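/- **Theorem.** Fix a first-order signature $\Sigma$ with finitely many function symbols $f$, each with a fixed arity. Given a finite set $V$ of variables and a program $s$ over $\Sigma$ and $V$, one can decide in $\mathsf{PSPACE}$ (space polynomial in the length of the input, which consists of a list of the variables in $V$, each variable name being a word over $\{0,1\}$, and of the text of $s$) whether $s$ is coherent. Here programs are given by $$s ::= \mathsf{skip} \mid x:=y \mid x:=f(\vec z) \mid \mathsf{assume}(c) \mid s;s \mid \mathsf{if}\ c\ \mathsf{then}\ s\ \mathsf{else}\ s \mid \mathsf{while}\ c\ s, \qquad c ::= x=y \mid x\neq y,$$ with $x,y\in V$ and $\vec z$ a tuple over $V$. An execution is a finite word of letters $x:=y$, $x:=f(\vec z)$, $\mathsf{assume}(c)$, and the set $\mathsf{Exec}(s)$ of executions of $s$ is given by $\mathsf{Exec}(\mathsf{skip})=\{\epsilon\}$, $\mathsf{Exec}(a)=\{a\}$ for an assignment or assume statement $a$, $\mathsf{Exec}(s_1;s_2)=\mathsf{Exec}(s_1)\cdot\mathsf{Exec}(s_2)$, $\mathsf{Exec}(\mathsf{if}\ c\ \mathsf{then}\ s_1\ \mathsf{else}\ s_2)=\mathsf{assume}(c)\cdot\mathsf{Exec}(s_1)\cup\mathsf{assume}(\neg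 c)\cdot\mathsf{Exec}(s_2)$, and $\mathsf{Exec}(\mathsf{while}\ c\ s)=[\mathsf{assume}(c)\cdot\mathsf{Exec}(s)]^*\cdot\mathsf{assume}(\neg c)$. For an execution $\rho$ and $x\in V$, let $\mathsf{Comp}(\rho,x)$ be the term over the constants $\hat v$ ($v\in V$, the initial values) that $x$ holds after $\rho$: $\mathsf{Comp}(\epsilon,x)=\hat x$; the letter $x:=y$ replaces the term of $x$ by that of $y$; the letter $x:=f(z_1,\dots,z_k)$ replaces the term of $x$ by $f(\mathsf{Comp}(\rho,z_1),\dots,\mathsf{Comp}(\rho,z_k))$; assumes change nothing. Let $\mathsf{Terms}(\rho)=\{\mathsf{Comp}(\rho',x) : \rho'\text{ a prefix of }\rho,\ x\in V\}$, let $\alpha(\rho)$ be the set of pairs $(\mathsf{Comp}(\sigma,x),\mathsf{Comp}(\sigma,y))$ with $\sigma\cdot\mathsf{assume}(x=y)$ a prefix of $\rho$, and let $\cong_{A}$ denote the congruence closure of a set $A$ of pairs of terms. A term $u$ is a superterm of $t$ modulo $\cong$ if there are $u'\cong u$ and $t'\cong t$ such that $t'$ is a subterm of $u'$. An execution $\rho$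 is *coherent* if * (memoizing) for every prefix $\sigma\cdot(x:=f(\vec z))$ of $\rho$, with $t=\mathsf{Comp}(\sigma\cdot(x:=f(\vec z)),x)$: if $t'\cong_{\alpha(\sigma)}t$ for some $t'\in\mathsf{Terms}(\sigma)$, then $\mathsf{Comp}(\sigma,y)\cong_{\alpha(\sigma)}t$ for some $y\in V$; and * (early assumes) for every prefix $\sigma\cdot\mathsf{assume}(x=y)$ of $\rho$: if $t'\in\mathsf{Terms}(\sigma)$ is a superterm of $\mathsf{Comp}(\sigma,x)$ or of $\mathsf{Comp}(\sigma,y)$ modulo $\cong_{\alpha(\sigma)}$, then $\mathsf{Comp}(\sigma,z)\cong_{\alpha(\sigma)}t'$ for some $z\in V$. The program $s$ is *coherent* if every $\rho\in\mathsf{Exec}(s)$ is coherent. -/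

import Mathlib

namespace UninterpretedProgram

/-! ### Programs and executions

`L` is a first-order signature and `V` a type of program variables. -/

/-- Conditions `x = y` and `x ≠ y`. -/
inductive Cond (V : Type) : Type
  | eq (x y : V) : Cond V
  | ne (x y : V) : Cond V

/-- The negation of a condition. -/
def Cond.neg {V : Type} : Cond V → Cond V
  | .eq x y => .ne x y
  | .ne x y => .eq x y

/-- Programs over the signature `L` with variables in `V`. -/
inductive Prog (L : FirstOrder.Language.{0, 0}) (V : Type) : Type
  | skip : Prog L V
  | copy (x y : V) : Prog L V
  | app {n : ℕ} (x : V) (f : L.Functions n) (z : Fin n → V) : Prog L V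
  | assume (c : Cond V) : Prog L V
  | seq (s₁ s₂ : Prog L V) : Prog L V
  | ite (c : Cond V) (s₁ s₂ : Prog L V) : Prog L V
  | while (c : Cond V) (s : Prog L V) : Prog L V

/-- The letters of executions: `x := y`, `x := f(z)`, `assume (x = y)`, `assume (x ≠ y)`. -/
inductive Letter (L : FirstOrder.Language.{0, 0}) (V : Type) : Type
  | copy (x y : V) : Letter L V
  | app {n : ℕ} (x : V) (f : L.Functions n) (z : Fin n → V) : Letter L V
  | assume (c : Cond V) : Letter L V

/-- Executions are finite words of letters. -/
abbrev Execution (L : FirstOrder.Language.{0, 0}) (V : Type) : Type := List (Letter L V)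

section

variable {L : FirstOrder.Language.{0, 0}} {V : Type}

open scoped Computability in
/-- The complete executions of a program, with the usual operations on formal languages:
sum is union, product is concatenation, `∗` is Kleene star. -/
def Prog.Exec : Prog L V → Language (Letter L V)
  | .skip => {[]}
  | .copy x y => {[.copy x y]}
  | .app x f z => {[.app x f z]}
  | .assume c => {[.assume c]}
  | .seq s₁ s₂ => s₁.Exec * s₂.Exec
  | .ite c s₁ s₂ => {[.assume c]} * s₁.Exec + {[.assume c.neg]} * s₂.Exec
  | .while c s => ({[.assume c]} * s.Exec)∗ * {[.assume c.neg]}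

/-! ### Terms computed by an execution

Terms are `L.Term V`; `FirstOrder.Language.Term.var x` is the constant denoting the initial
value of the variable `x`. -/

/-- The effect of a letter on the terms held by the variables. -/
def Letter.update [DecidableEq V] (v : V → L.Term V) : Letter L V → V → L.Term V
  | .copy x y => Function.update v x (v y)
  | .app x f z => Function.update v x (.func f fun i => v (z i))
  | .assume _ => v

/-- `comp ρ x` is the term held by `x` after the execution `ρ`. -/
def comp [DecidableEq V] (ρ : Execution L V) : V → L.Term V :=
  ρ.foldl Letter.update FirstOrder.Language.Term.var

/-- The terms computed by an execution. -/
def terms [DecidableEq V] (ρ : Execution L V) : Set (L.Term V) :=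
  {t | ∃ ρ', ρ' <+: ρ ∧ ∃ x, t = comp ρ' x}

/-- The equality assumes of an execution. -/
def eqAssumes [DecidableEq V] (ρ : Execution L V) : Set (L.Term V × L.Term V) :=
  {p | ∃ σ x y, σ ++ [.assume (.eq x y)] <+: ρ ∧ p = (comp σ x, comp σ y)}

/-- The congruence closure of a binary relation on terms. -/
inductive CongCl (A : Set (L.Term V × L.Term V)) : L.Term V → L.Term V → Prop
  | base {t u : L.Term V} : (t, u) ∈ A → CongCl A t u
  | refl (t : L.Term V) : CongCl A t t
  | symm {t u : L.Term V} : CongCl A t u → CongCl A u t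
  | trans {t u v : L.Term V} : CongCl A t u → CongCl A u v → CongCl A t v
  | congr {n : ℕ} (f : L.Functions n) {ts us : Fin n → L.Term V} :
      (∀ i, CongCl A (ts i) (us i)) → CongCl A (.func f ts) (.func f us)

/-- `Superterm u t`: the term `u` is a (not necessarily proper) superterm of `t`. -/
inductive Superterm : L.Term V → L.Term V → Prop
  | refl (t : L.Term V) : Superterm t t
  | func {n : ℕ} (f : L.Functions n) (us : Fin n → L.Term V) (i : Fin n) {t : L.Term V} :
      Superterm (us i) t → Superterm (.func f us) t

/-- `u` is a superterm of `t` modulo the congruence closure of `A`. -/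
def SupertermMod (A : Set (L.Term V × L.Term V)) (u t : L.Term V) : Prop :=
  ∃ u' t', CongCl A u' u ∧ CongCl A t' t ∧ Superterm u' t'

/-! ### Coherence -/

/-- Whenever an execution recomputes a term modulo the equalities assumed so far, some variable
currently holds that term. -/
def Memoizing [DecidableEq V] (ρ : Execution L V) : Prop :=
  ∀ (σ : Execution L V) (n : ℕ) (x : V) (f : L.Functions n) (z : Fin n → V),
    σ ++ [.app x f z] <+: ρ →
    (∃ t' ∈ terms σ, CongCl (eqAssumes σ) t' (comp (σ ++ [.app x f z]) x)) →
    ∃ y, CongCl (eqAssumes σ) (comp σ y) (comp (σ ++ [.app x f z]) x)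

/-- Whenever `x = y` is assumed, every computed superterm of the terms held by `x` and `y`,
modulo the equalities assumed so far, is currently held by some variable. -/
def EarlyAssumes [DecidableEq V] (ρ : Execution L V) : Prop :=
  ∀ (σ : Execution L V) (x y : V), σ ++ [.assume (.eq x y)] <+: ρ →
    ∀ t' ∈ terms σ,
      SupertermMod (eqAssumes σ) t' (comp σ x) ∨ SupertermMod (eqAssumes σ) t' (comp σ y) →
      ∃ z, CongCl (eqAssumes σ) (comp σ z) t'

/-- Coherent executions. -/
def CoherentExecution [DecidableEq V] (ρ : Execution L V) : Prop :=
  Memoizing ρ ∧ EarlyAssumes ρ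

/-- A program is coherent if all its executions are. -/
def Prog.Coherent [DecidableEq V] (s : Prog L V) : Prop :=
  ∀ ρ ∈ s.Exec, CoherentExecution ρ

end

/-! ### Programs as words over a finite alphabet -/

/-- The tokens by which programs are written down. Variable names are words over `{0, 1}`;
the function symbols of the (fixed) signature are single tokens. -/
inductive Token (L : FirstOrder.Language.{0, 0}) : Type
  | bit (b : Bool)
  | endName
  | endDecl
  | fn (f : Σ n, L.Functions n)
  | eq
  | ne
  | skip
  | assign
  | assume
  | seq
  | ite
  | while

section

variable {L : FirstOrder.Language.{0, 0}} {V : Type}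

/-- A variable name, followed by an end marker. -/
def encodeName (w : List Bool) : List (Token L) :=
  w.map Token.bit ++ [.endName]

/-- Conditions in prefix notation. -/
def Cond.encode (name : V → List Bool) : Cond V → List (Token L)
  | .eq x y => .eq :: (encodeName (name x) ++ encodeName (name y))
  | .ne x y => .ne :: (encodeName (name x) ++ encodeName (name y))

/-- Programs in prefix notation. -/
def Prog.encode (name : V → List Bool) : Prog L V → List (Token L)
  | .skip => [.skip]
  | .copy x y => .assign :: (encodeName (name x) ++ encodeName (name y))
  | .app x f z =>
      .assign :: (encodeName (name x) ++
        .fn ⟨_, f⟩ :: (List.ofFn fun i => encodeName (name (z i))).flatten)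
  | .assume c => .assume :: c.encode name
  | .seq s₁ s₂ => .seq :: (s₁.encode name ++ s₂.encode name)
  | .ite c s₁ s₂ => .ite :: (c.encode name ++ s₁.encode name ++ s₂.encode name)
  | .while c s => .while :: (c.encode name ++ s.encode name)

/-- A list `vs` of variable names followed by a program whose set of variables is
`{x | x ∈ vs}`. -/
def encodeInstance (vs : List (List Bool)) (s : Prog L {x // x ∈ vs}) : List (Token L) :=
  (vs.map encodeName).flatten ++ .endDecl :: s.encode Subtype.val

variable (L) in
/-- The decision problem "given a finite set of variables and a program over it, is the program
coherent?", for the signature `L`, as a formal language. -/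
def coherenceProblem : Language (Token L) :=
  {w | ∃ (vs : List (List Bool)) (s : Prog L {x // x ∈ vs}), w = encodeInstance vs s ∧ s.Coherent}

end

/-! ### Polynomial space -/

/-- The space used by a configuration of a multi-stack Turing machine: the total number of cells
on its stacks. -/
def cfgSpace (tm : Turing.FinTM2) (c : tm.Cfg) : ℕ :=
  ∑ k ∈ @Finset.univ tm.K tm.kFin, (c.stk k).length

/-- The formal languages over `A` decided by a deterministic Turing machine (finitely many stacks,
finite stack alphabets, finite control) in polynomial space: on every input the machine halts,
the control state in which it halts tells whether the input is in the language, and all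
configurations of the run have size at most a polynomial in the length of the input.
Finiteness of the stack alphabets is required explicitly because `Turing.FinTM2` itself only
demands it of the input stack. -/
def PSPACE (A : Type) : Set (Language A) :=
  {P | ∃ (tm : Turing.FinTM2) (inp : A ↪ tm.Γ tm.k₀) (acc : tm.σ → Bool) (p : Polynomial ℕ),
    (∀ k, Finite (tm.Γ k)) ∧
    ∀ w : List A,
      (∃ c : tm.Cfg, StateTransition.Reaches tm.step (Turing.initList tm (w.map inp)) c ∧
        c.l = none ∧ (acc c.var = true ↔ w ∈ P)) ∧
      ∀ c : tm.Cfg, StateTransition.Reaches tm.step (Turing.initList tm (w.map inp)) c →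
        cfgSpace tm c ≤ p.eval w.length}

end UninterpretedProgram

/-!
# Coherence of uninterpreted programs is decidable in polynomial space

Whether a coherent execution `σ` can be continued by a letter without violating coherence depends
only on a *summary* of `σ`: finitely many relations on the program variables, of a size that is
polynomial because the signature is fixed (`Summ`). They say which variables hold congruent terms,
which variables hold terms `f(…)` whose arguments are congruent to prescribed variables or to one
another, which terms `f(z)` have been computed, and for which variables a computed superterm has
been dropped. The effect of a letter on the summary can be computed from the summary alone
(`Closed.summ_copy`, `Closed.summ_fresh`, `Closed.summ_assume`): a copy redirects variables, a new
term is congruent to computed terms only if head symbols and arguments agree, and an assume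
`x = y` in an execution with early assumes identifies only computed terms that are still held, so
that the new congruence is the congruence closure of `x = y` on the variables (`Summ.eqv`).

Hence a program is incoherent if and only if, in the finite graph of configurations (position in
the program, violation flag, summary), the end of the program can be reached after a violation
(`not_coherent_iff`). Paths in the flow graph of the program are the executions (`mem_exec_iff`).

A configuration is a bit string of polynomial length, so reachability between configurations is in
polynomial space by Savitch's argument. To organize this, second-order formulas over words are
used (`Fml`): they speak about the input word, numbers below polynomial bounds and strings of
polynomial length, and have an alternating quantifier over all the bits of a string. They are
evaluated by stack programs in polynomial space (`Fml.run_code`), and these are compiled to Turing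
machines (`mem_PSPACE_of_code`). Least fixed points are definable by quantification over relations
(`PS.lfp`); this gives the parsing of the input (`PS.progAt`), its flow graph (`PS.fol`) and the
closure operations on summaries (`PSumm`). Reachability is definable by the alternating quantifier
(`PS.reflTransGen`): one player names midpoints, the other one selects halves. It remains to
express membership in the coherence problem by such a formula (`mem_coherenceProblem_iff`,
`coherenceProblem_mem_PSPACE`).
-/


namespace UninterpretedProgram

/-! ### Structured stack programs and their space usage -/

/-- Structured programs acting on a family of stacks indexed by `ℕ`, all over the alphabet `G`. -/
inductive Code (G : Type) : Type
  /-- do nothing -/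
  | skip : Code G
  /-- push onto stack `k'` a symbol computed from the top symbol of stack `k` -/
  | push (k k' : ℕ) (g : Option G → G) : Code G
  /-- pop stack `k` (no effect if it is empty) -/
  | pop (k : ℕ) : Code G
  /-- sequential composition -/
  | seq (a b : Code G) : Code G
  /-- test the top symbol of stack `k` -/
  | ite (k : ℕ) (p : Option G → Bool) (a b : Code G) : Code G
  /-- loop while the top symbol of stack `k` passes the test -/
  | loop (k : ℕ) (p : Option G → Bool) (a : Code G) : Code G

/-- The contents of all stacks. -/
abbrev Stacks (G : Type) : Type := ℕ → List G

namespace Code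

variable {G : Type}

/-- Big-step semantics in which no stack is allowed to grow beyond `B` cells. -/
inductive Run (B : ℕ) : Code G → Stacks G → Stacks G → Prop
  | skip (S : Stacks G) : Run B .skip S S
  | push (k k' : ℕ) (g : Option G → G) (S : Stacks G) (h : (S k').length + 1 ≤ B) :
      Run B (.push k k' g) S (Function.update S k' (g (S k).head? :: S k'))
  | pop (k : ℕ) (S : Stacks G) : Run B (.pop k) S (Function.update S k (S k).tail)
  | seq {a b : Code G} {S T U : Stacks G} : Run B a S T → Run B b T U → Run B (.seq a b) S U
  | ite_true {k : ℕ} {p : Option G → Bool} {a b : Code G} {S T : Stacks G} :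
      p (S k).head? = true → Run B a S T → Run B (.ite k p a b) S T
  | ite_false {k : ℕ} {p : Option G → Bool} {a b : Code G} {S T : Stacks G} :
      p (S k).head? = false → Run B b S T → Run B (.ite k p a b) S T
  | loop_true {k : ℕ} {p : Option G → Bool} {a : Code G} {S T U : Stacks G} :
      p (S k).head? = true → Run B a S T → Run B (.loop k p a) T U → Run B (.loop k p a) S U
  | loop_false {k : ℕ} {p : Option G → Bool} {a : Code G} {S : Stacks G} :
      p (S k).head? = false → Run B (.loop k p a) S S

/-- All stacks used by the program have an index at most `N`. -/
def Below (N : ℕ) : Code G → Prop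
  | .skip => True
  | .push k k' _ => k ≤ N ∧ k' ≤ N
  | .pop k => k ≤ N
  | .seq a b => a.Below N ∧ b.Below N
  | .ite k _ a b => k ≤ N ∧ a.Below N ∧ b.Below N
  | .loop k _ a => k ≤ N ∧ a.Below N

theorem Below.mono {N N' : ℕ} (h : N ≤ N') {c : Code G} (hc : c.Below N) : c.Below N' := by
  induction c with
  | skip => trivial
  | push k k' g => exact ⟨hc.1.trans h, hc.2.trans h⟩
  | pop k => exact le_trans hc h
  | seq a b iha ihb => exact ⟨iha hc.1, ihb hc.2⟩
  | ite k p a b iha ihb => exact ⟨hc.1.trans h, iha hc.2.1, ihb hc.2.2⟩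
  | loop k p a iha => exact ⟨hc.1.trans h, iha hc.2⟩

theorem exists_below (c : Code G) : ∃ N, c.Below N := by
  induction c with
  | skip => exact ⟨0, trivial⟩
  | push k k' g => exact ⟨max k k', le_max_left _ _, le_max_right _ _⟩
  | pop k => exact ⟨k, le_refl k⟩
  | seq a b iha ihb =>
    obtain ⟨⟨m, hm⟩, n, hn⟩ := And.intro iha ihb
    exact ⟨max m n, hm.mono (le_max_left _ _), hn.mono (le_max_right _ _)⟩
  | ite k p a b iha ihb =>
    obtain ⟨⟨m, hm⟩, n, hn⟩ := And.intro iha ihb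
    exact ⟨max k (max m n), le_max_left _ _, hm.mono (by omega), hn.mono (by omega)⟩
  | loop k p a iha =>
    obtain ⟨m, hm⟩ := iha
    exact ⟨max k m, le_max_left _ _, hm.mono (by omega)⟩

/-! ### Compilation to a Turing machine -/

/-- The control points inside a program. -/
inductive Lab {G : Type} : Code G → Type
  | skip : Lab .skip
  | push {k k' : ℕ} {g : Option G → G} : Lab (.push k k' g)
  | pop {k : ℕ} : Lab (.pop k)
  | fst {a b : Code G} : Lab a → Lab (.seq a b)
  | snd {a b : Code G} : Lab b → Lab (.seq a b)
  | test {k : ℕ} {p : Option G → Bool} {a b : Code G} : Lab (.ite k p a b)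
  | pos {k : ℕ} {p : Option G → Bool} {a b : Code G} : Lab a → Lab (.ite k p a b)
  | neg {k : ℕ} {p : Option G → Bool} {a b : Code G} : Lab b → Lab (.ite k p a b)
  | head {k : ℕ} {p : Option G → Bool} {a : Code G} : Lab (.loop k p a)
  | body {k : ℕ} {p : Option G → Bool} {a : Code G} : Lab a → Lab (.loop k p a)

instance finite_lab (c : Code G) : Finite c.Lab := by
  induction c with
  | skip => exact Finite.of_surjective (fun _ : Unit => Lab.skip) fun | .skip => ⟨(), rfl⟩
  | push k k' g => exact Finite.of_surjective (fun _ : Unit => Lab.push) fun | .push => ⟨(), rfl⟩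
  | pop k => exact Finite.of_surjective (fun _ : Unit => Lab.pop) fun | .pop => ⟨(), rfl⟩
  | seq a b iha ihb =>
    exact Finite.of_surjective (fun l : a.Lab ⊕ b.Lab => l.elim Lab.fst Lab.snd) fun
      | .fst l => ⟨.inl l, rfl⟩
      | .snd l => ⟨.inr l, rfl⟩
  | ite k p a b iha ihb =>
    exact Finite.of_surjective
      (fun l : Option (a.Lab ⊕ b.Lab) => l.elim Lab.test fun l => l.elim Lab.pos Lab.neg) fun
      | .test => ⟨none, rfl⟩
      | .pos l => ⟨some (.inl l), rfl⟩
      | .neg l => ⟨some (.inr l), rfl⟩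
  | loop k p a iha =>
    exact Finite.of_surjective (fun l : Option a.Lab => l.elim Lab.head Lab.body) fun
      | .head => ⟨none, rfl⟩
      | .body l => ⟨some l, rfl⟩

/-- The control point at which a program starts. -/
def entry : (c : Code G) → c.Lab
  | .skip => .skip
  | .push _ _ _ => .push
  | .pop _ => .pop
  | .seq a _ => .fst a.entry
  | .ite _ _ _ _ => .test
  | .loop _ _ _ => .head

/-- Index `k` as an index below `N + 1`, truncated if necessary. -/
def idx (N k : ℕ) : Fin (N + 1) := ⟨min k N, Nat.lt_succ_of_le (min_le_right k N)⟩

/-- Statements of the machines into which programs are compiled. The internal state is the symbol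
seen by the last look at a stack. -/
abbrev MStmt (G : Type) (N : ℕ) (Λ : Type) : Type :=
  Turing.TM2.Stmt (fun _ : Fin (N + 1) => G) Λ (Option G)

/-- The machine statement at a control point of a program; `e` embeds the control points into the
labels of the machine, and `nx` is the label at which the machine goes on afterwards. -/
def stmt (N : ℕ) {Λ : Type} : (c : Code G) → (c.Lab → Λ) → Λ → c.Lab → MStmt G N Λ
  | .skip, _, nx, _ => .goto fun _ => nx
  | .push k k' g, _, nx, _ =>
      .peek (idx N k) (fun _ o => o)
        (.push (idx N k') g (.goto fun _ => nx))
  | .pop k, _, nx, _ => .pop (idx N k) (fun v _ => v) (.goto fun _ => nx)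
  | .seq a b, e, _, .fst l => a.stmt N (fun l => e (.fst l)) (e (.snd b.entry)) l
  | .seq _ b, e, nx, .snd l => b.stmt N (fun l => e (.snd l)) nx l
  | .ite k p a b, e, _, .test =>
      .peek (idx N k) (fun _ o => o)
        (.branch p (.goto fun _ => e (.pos a.entry)) (.goto fun _ => e (.neg b.entry)))
  | .ite _ _ a _, e, nx, .pos l => a.stmt N (fun l => e (.pos l)) nx l
  | .ite _ _ _ b, e, nx, .neg l => b.stmt N (fun l => e (.neg l)) nx l
  | .loop k p a, e, nx, .head =>
      .peek (idx N k) (fun _ o => o)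
        (.branch p (.goto fun _ => e (.body a.entry)) (.goto fun _ => nx))
  | .loop _ _ a, e, _, .body l => a.stmt N (fun l => e (.body l)) (e .head) l

/-- Configurations of the compiled machines. -/
abbrev MCfg (G : Type) (N : ℕ) (Λ : Type) : Type :=
  Turing.TM2.Cfg (fun _ : Fin (N + 1) => G) Λ (Option G)

/-- One machine step into a configuration all of whose stacks have at most `B` cells. -/
def BStep {N B : ℕ} {Λ : Type} (M : Λ → MStmt G N Λ) (c c' : MCfg G N Λ) : Prop :=
  c' ∈ Turing.TM2.step M c ∧ ∀ k, (c'.stk k).length ≤ B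

theorem idx_val {N k : ℕ} (h : k ≤ N) : (idx N k).val = k := min_eq_left h

theorem update_restrict {N k : ℕ} (h : k ≤ N) (S : Stacks G) (l : List G) :
    Function.update (fun i : Fin (N + 1) => S i.val) (idx N k) l =
      fun i : Fin (N + 1) => Function.update S k l i.val := by
  funext i
  by_cases hi : i = idx N k
  · subst hi; simp [idx_val h]
  · have : i.val ≠ k := fun h' => hi (Fin.ext (by rw [idx_val h, h']))
    simp [hi, this]

theorem Run.bounded {B : ℕ} {c : Code G} {S T : Stacks G} (h : Run B c S T)
    (hS : ∀ k, (S k).length ≤ B) : ∀ k, (T k).length ≤ B := by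
  induction h with
  | skip | loop_false => exact hS
  | push k k' g S h =>
    intro i
    by_cases hi : i = k'
    · subst hi; simpa using h
    · simpa [hi] using hS i
  | pop k S =>
    intro i
    by_cases hi : i = k
    · subst hi; simpa using (Nat.sub_le _ _).trans (hS i)
    · simpa [hi] using hS i
  | seq _ _ ih1 ih2 => exact ih2 (ih1 hS)
  | ite_true _ _ ih => exact ih hS
  | ite_false _ _ ih => exact ih hS
  | loop_true _ _ _ ih1 ih2 => exact ih2 (ih1 hS)

/-- A compiled program runs from its entry to the label following it, transforms the stacks
as the program does, and respects the bound on the stacks. -/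
theorem Run.simulate {B N : ℕ} {Λ : Type} {M : Λ → MStmt G N Λ} {c : Code G} {S T : Stacks G}
    (h : Run B c S T) : c.Below N → (∀ k, (S k).length ≤ B) → ∀ (e : c.Lab → Λ) (nx : Λ),
    (∀ l, M (e l) = c.stmt N e nx l) → ∀ v, ∃ v',
      Relation.ReflTransGen (BStep (B := B) M) ⟨some (e c.entry), v, fun k => S k.val⟩
        ⟨some nx, v', fun k => T k.val⟩ := by
  induction h with
  | skip S =>
    intro _ hS e nx hM v
    refine ⟨v, .single ⟨?_, fun k => hS _⟩⟩
    simp [hM, stmt]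
  | push k k' g S h =>
    intro hN hS e nx hM v
    refine ⟨(S k).head?, .single ⟨?_, fun i => (Run.push k k' g S h).bounded hS _⟩⟩
    simp [hM, stmt, ← update_restrict hN.2, idx_val hN.1, idx_val hN.2]
  | pop k S =>
    intro hN hS e nx hM v
    refine ⟨v, .single ⟨?_, fun i => (Run.pop k S).bounded hS _⟩⟩
    simp [hM, stmt, ← update_restrict hN, idx_val hN]
  | seq h1 h2 ih1 ih2 =>
    intro hN hS e nx hM v
    obtain ⟨v1, r1⟩ := ih1 hN.1 hS (fun l => e (.fst l)) (e (.snd (entry _)))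
      (fun l => by rw [hM, stmt]) v
    obtain ⟨v2, r2⟩ := ih2 hN.2 (h1.bounded hS) (fun l => e (.snd l)) nx
      (fun l => by rw [hM, stmt]) v1
    exact ⟨v2, r1.trans r2⟩
  | @ite_true k p a b S T hp h1 ih1 =>
    intro hN hS e nx hM v
    obtain ⟨v1, r1⟩ := ih1 hN.2.1 hS (fun l => e (.pos l)) nx
      (fun l => by rw [hM, stmt]) (S k).head?
    refine ⟨v1, .head ⟨?_, fun k => hS _⟩ r1⟩
    simp [hM, stmt, entry, idx_val hN.1, hp]
  | @ite_false k p a b S T hp h1 ih1 =>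
    intro hN hS e nx hM v
    obtain ⟨v1, r1⟩ := ih1 hN.2.2 hS (fun l => e (.neg l)) nx
      (fun l => by rw [hM, stmt]) (S k).head?
    refine ⟨v1, .head ⟨?_, fun k => hS _⟩ r1⟩
    simp [hM, stmt, entry, idx_val hN.1, hp]
  | @loop_true k p a S T U hp h1 h2 ih1 ih2 =>
    intro hN hS e nx hM v
    obtain ⟨v1, r1⟩ := ih1 hN.2 hS (fun l => e (.body l)) (e .head)
      (fun l => by rw [hM, stmt]) (S k).head?
    obtain ⟨v2, r2⟩ := ih2 hN (h1.bounded hS) e nx hM v1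
    refine ⟨v2, .head ⟨?_, fun k => hS _⟩ (r1.trans r2)⟩
    simp [hM, stmt, entry, idx_val hN.1, hp]
  | @loop_false k p a S hp =>
    intro hN hS e nx hM v
    refine ⟨(S k).head?, .single ⟨?_, fun k => hS _⟩⟩
    simp [hM, stmt, entry, idx_val hN.1, hp]

/-- The machine of a program: run it, load the top symbol of stack `r` and halt. -/
noncomputable def machine [Fintype G] (c : Code G) (N r : ℕ) : Turing.FinTM2 :=
  letI : Fintype c.Lab := Fintype.ofFinite _
  { K := Fin (N + 1)
    k₀ := 0
    k₁ := 0
    Γ := fun _ => G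
    Λ := Option c.Lab
    main := some c.entry
    σ := Option G
    initialState := none
    m := fun l => match l with
      | none => .peek (idx N r) (fun _ o => o) .halt
      | some l => c.stmt N some none l }

end Code

/-- A run of a deterministic system that ends in a halting state and stays inside `P`
contains all reachable states, so that `P` holds of all of them. -/
theorem reaches_bounded {σ : Type} {f : σ → Option σ} {P : σ → Prop} {a b : σ}
    (h : Relation.ReflTransGen (fun c c' => c' ∈ f c ∧ P c') a b) (ha : P a) (hb : f b = none) :
    ∀ c, StateTransition.Reaches f a c → P c := by
  induction h using Relation.ReflTransGen.head_induction_on with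
  | refl =>
    intro c hc
    rcases Relation.ReflTransGen.cases_head hc with rfl | ⟨d, hd, _⟩
    · exact ha
    · rw [hb] at hd; simp at hd
  | head h1 _ ih =>
    intro c hc
    rcases Relation.ReflTransGen.cases_head hc with rfl | ⟨d, hd, hdc⟩
    · exact ha
    · obtain rfl := Option.mem_unique hd h1.1
      exact ih h1.2 c hdc

/-- Input symbols as symbols of the compiled machine. -/
def Code.inputSymbol {A : Type} [Fintype (A ⊕ Bool)] (c : Code (A ⊕ Bool)) (N r : ℕ) :
    A ↪ (c.machine N r).Γ (c.machine N r).k₀ :=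
  ⟨Sum.inl, Sum.inl_injective⟩

theorem Code.initList_machine {A : Type} [Fintype (A ⊕ Bool)] (c : Code (A ⊕ Bool)) (N r : ℕ)
    (w : List A) :
    Turing.initList (c.machine N r) (w.map (c.inputSymbol N r)) =
      (⟨some (some c.entry), none, fun k => (Function.update (fun _ => []) 0 (w.map Sum.inl) :
        Stacks (A ⊕ Bool)) k.val⟩ : MCfg (A ⊕ Bool) N (Option c.Lab)) := by
  unfold Turing.initList
  change (⟨_, _, _⟩ : MCfg (A ⊕ Bool) N (Option c.Lab)) = _
  congr 1
  funext (k : Fin (N + 1))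
  by_cases hk : k = 0
  · subst hk
    exact dif_pos rfl
  · have hk' : k.val ≠ 0 := fun h => hk (Fin.ext h)
    rw [Function.update_of_ne hk']
    exact dif_neg hk

open Code in
/-- A language recognized by a stack program within polynomially bounded stacks is in `PSPACE`.
Stack `0` initially holds the input, and stack `2` receives the answer. -/
theorem mem_PSPACE_of_code {A : Type} [Finite A] (P : Language A) (c : Code (A ⊕ Bool))
    (p : Polynomial ℕ)
    (h : ∀ w : List A, ∃ T : Stacks (A ⊕ Bool),
      Run (p.eval w.length) c (Function.update (fun _ => []) 0 (w.map Sum.inl)) T ∧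
      ((T 2).head? = some (Sum.inr true) ↔ w ∈ P) ∧ w.length ≤ p.eval w.length) :
    P ∈ PSPACE A := by
  classical
  have : Fintype A := Fintype.ofFinite A
  obtain ⟨N₀, hN₀⟩ := c.exists_below
  obtain ⟨N, hN⟩ : ∃ N, N = max N₀ 2 := ⟨_, rfl⟩
  have hb : c.Below N := hN₀.mono (by omega)
  refine ⟨c.machine N 2, c.inputSymbol N 2,
    fun v => decide ((show Option (A ⊕ Bool) from v) = some (Sum.inr true)),
    Polynomial.C (N + 1) * p, ?_, fun w => ?_⟩
  · intro k; exact inferInstanceAs (Finite (A ⊕ Bool))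
  obtain ⟨T, hrun, hT, hw⟩ := h w
  rw [c.initList_machine N 2 w]
  generalize hB : p.eval w.length = B at hrun hw
  generalize hS : (Function.update (fun _ => []) 0 (w.map Sum.inl) : Stacks (A ⊕ Bool)) = S
    at hrun ⊢
  have hSB : ∀ k, (S k).length ≤ B := by
    intro k
    subst hS
    by_cases hk : k = 0
    · subst hk; simpa using hw
    · simp [hk]
  obtain ⟨v, r⟩ := hrun.simulate (M := (c.machine N 2).m) hb hSB some none
    (fun l => rfl) none
  have r' : Relation.ReflTransGen (BStep (B := B) (c.machine N 2).m)
      (⟨some (some c.entry), none, fun k => S k.val⟩ : MCfg (A ⊕ Bool) N (Option c.Lab))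
      (⟨none, (T 2).head?, fun k => T k.val⟩ : MCfg (A ⊕ Bool) N (Option c.Lab)) := by
    refine r.tail ⟨?_, fun k => hrun.bounded hSB _⟩
    have h2 : T 2 = T (idx N 2).val := by rw [idx_val (by omega)]
    rw [h2]
    rfl
  refine ⟨⟨(⟨none, (T 2).head?, fun k => T k.val⟩ : MCfg (A ⊕ Bool) N (Option c.Lab)),
    Relation.ReflTransGen.mono (p := fun a b => b ∈ (c.machine N 2).step a)
      (fun _ _ h => h.1) _ _ r', rfl, ?_⟩, ?_⟩
  · simpa using hT
  · intro d hd
    have hd' := reaches_bounded (P := fun d : MCfg (A ⊕ Bool) N (Option c.Lab) =>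
      ∀ k, (d.stk k).length ≤ B) r' (fun k => hSB _) rfl d hd
    have : cfgSpace (c.machine N 2) d ≤ ∑ _k : Fin (N + 1), B :=
      Finset.sum_le_sum (fun k _ => hd' k)
    refine this.trans ?_
    simp [hB]

end UninterpretedProgram

namespace UninterpretedProgram

/-! ### Second-order formulas over words -/

/-- Terms denoting numbers, built from the lengths of registers and of the input word. They are
polynomials in these lengths. -/
inductive Trm : Type
  | var (x : ℕ)
  | len
  | zero
  | one
  | add (s t : Trm)
  | mul (s t : Trm)

/-- The value of a term for an input of length `n`. -/
def Trm.val (n : ℕ) (env : ℕ → List Bool) : Trm → ℕ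
  | .var x => (env x).length
  | .len => n
  | .zero => 0
  | .one => 1
  | .add s t => s.val n env + t.val n env
  | .mul s t => s.val n env * t.val n env

/-- The game on bit strings with pattern `r`: the bits of a string are chosen one after the other
and put in front of `s`, by the existential player where the pattern has `false` and by the
universal player where it has `true`; the existential player wins if `φ` holds of the result. -/
def Game (φ : List Bool → Prop) : List Bool → List Bool → Prop
  | [], s => φ s
  | true :: r, s => Game φ r (false :: s) ∧ Game φ r (true :: s)
  | false :: r, s => Game φ r (false :: s) ∨ Game φ r (true :: s)

/-- Formulas about a word over `A` and about registers that hold bit strings; a number is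
represented by a string of that length. -/
inductive Fml (A : Type) : Type
  /-- the letter at a position has a given property -/
  | letter (P : A → Bool) (t : Trm)
  /-- a bit of a register is `true` -/
  | bit (x : ℕ) (t : Trm)
  | lt (s t : Trm)
  | not (a : Fml A)
  | and (a b : Fml A)
  /-- quantification over the numbers below a bound -/
  | exNum (x : ℕ) (t : Trm) (a : Fml A)
  /-- quantification over the bit strings of a given length -/
  | exStr (x : ℕ) (t : Trm) (a : Fml A)
  /-- alternating quantification over the bits of register `x`, with the pattern in register `y` -/
  | game (x y : ℕ) (a : Fml A)
  /-- renaming of registers -/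
  | ren (f : ℕ → ℕ) (a : Fml A)

/-- Truth of a formula for the input `w` and the registers `env`. -/
def Fml.Eval {A : Type} (w : List A) : Fml A → (ℕ → List Bool) → Prop
  | .letter P t, env => ∃ a, w[t.val w.length env]? = some a ∧ P a = true
  | .bit x t, env => (env x)[t.val w.length env]? = some true
  | .lt s t, env => s.val w.length env < t.val w.length env
  | .not a, env => ¬ a.Eval w env
  | .and a b, env => a.Eval w env ∧ b.Eval w env
  | .exNum x t a, env =>
      ∃ v < t.val w.length env, a.Eval w (Function.update env x (List.replicate v false))
  | .exStr x t a, env =>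
      ∃ v : List Bool, v.length = t.val w.length env ∧ a.Eval w (Function.update env x v)
  | .game x y a, env => Game (fun v => a.Eval w (Function.update env x v)) (env y) []
  | .ren f a, env => a.Eval w fun x => env (f x)

theorem game_replicate_false (φ : List Bool → Prop) (m : ℕ) (s : List Bool) :
    Game φ (List.replicate m false) s ↔ ∃ v : List Bool, v.length = m ∧ φ (v ++ s) := by
  induction m generalizing s with
  | zero => simp [Game]
  | succ m ih =>
    simp only [List.replicate_succ, Game, ih]
    constructor
    · rintro (⟨v, hv, h⟩ | ⟨v, hv, h⟩)
      · exact ⟨v ++ [false], by simp [hv], by simpa using h⟩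
      · exact ⟨v ++ [true], by simp [hv], by simpa using h⟩
    · rintro ⟨v, hv, h⟩
      obtain rfl | ⟨u, b, rfl⟩ := v.eq_nil_or_concat
      · simp at hv
      · have hu : u.length = m := by simpa using hv
        cases b
        · exact .inl ⟨u, hu, by simpa using h⟩
        · exact .inr ⟨u, hu, by simpa using h⟩

theorem game_append (φ : List Bool → Prop) (p q s : List Bool) :
    Game φ (p ++ q) s ↔ Game (fun s' => Game φ q s') p s := by
  induction p generalizing s with
  | nil => rfl
  | cons b p ih => cases b <;> simp [Game, ih]

theorem game_congr {φ ψ : List Bool → Prop} (p s : List Bool)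
    (h : ∀ v : List Bool, v.length = p.length → (φ (v ++ s) ↔ ψ (v ++ s))) :
    Game φ p s ↔ Game ψ p s := by
  induction p generalizing s with
  | nil => simpa [Game] using h []
  | cons b p ih =>
    have h1 (c : Bool) : Game φ p (c :: s) ↔ Game ψ p (c :: s) :=
      ih _ fun v hv => by simpa using h (v ++ [c]) (by simpa using hv)
    cases b <;> simp [Game, h1]

/-! ### Evaluation of formulas by stack programs

Stack `0` holds the input, stack `2` receives truth values, stack `3` is used for scanning other
stacks, and the registers are kept on stacks from `4` on. -/

namespace Code

variable {A : Type}

/-- The alphabet of the evaluating programs. -/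
abbrev Sym (A : Type) : Type := A ⊕ Bool

/-- The symbol from which unary counters are made. -/
abbrev mk : Sym A := Sum.inr false

/-- The top symbol is the truth value `true`. -/
def isT : Option (Sym A) → Bool
  | some (Sum.inr true) => true
  | _ => false

/-- Transfer the top symbol of a nonempty stack. -/
def move (k k' : ℕ) : Code (Sym A) := .seq (.push k k' fun o => o.getD mk) (.pop k)

/-- Empty a stack. -/
def clear (k : ℕ) : Code (Sym A) := .loop k Option.isSome (.pop k)

/-- Put a copy of stack `k`, changed by `g`, on top of stack `k'`. -/
def copy (k k' : ℕ) (g : Option (Sym A) → Sym A) : Code (Sym A) :=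
  .seq (.loop k Option.isSome (move k 3))
    (.loop 3 Option.isSome (.seq (.push 3 k' g) (move 3 k)))

/-- Execute a program as often as the height of a counter. -/
def times (d : ℕ) (c : Code (Sym A)) : Code (Sym A) := .loop d Option.isSome (.seq (.pop d) c)

theorem Run.of_eq {G : Type} {B : ℕ} {c : Code G} {S T T' : Stacks G} (h : Run B c S T)
    (e : T = T') : Run B c S T' := e ▸ h

theorem run_move {B k k' : ℕ} (hk : k ≠ k') {S : Stacks (Sym A)} {a : Sym A} {l : List (Sym A)}
    (hS : S k = a :: l) (hB : (S k').length + 1 ≤ B) :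
    Run B (move k k') S (Function.update (Function.update S k l) k' (a :: S k')) := by
  refine (Run.seq (.push _ _ _ _ hB) (.pop _ _)).of_eq ?_
  rw [Function.update_comm hk]
  simp [hS, hk]

theorem run_clear {B k : ℕ} (S : Stacks (Sym A)) :
    Run B (clear k) S (Function.update S k []) := by
  generalize hl : S k = l
  induction l generalizing S with
  | nil => exact (Run.loop_false (by simp [hl])).of_eq (by rw [← hl, Function.update_eq_self])
  | cons a l ih =>
    refine .loop_true (by simp [hl]) (.pop _ _) ((ih _ (by simp [hl])).of_eq ?_)
    simp

theorem run_drain {B k k' : ℕ} (hk : k ≠ k') (l : List (Sym A)) (S : Stacks (Sym A))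
    (hS : S k = l) (hB : l.length + (S k').length ≤ B) :
    Run B (.loop k Option.isSome (move k k')) S
      (Function.update (Function.update S k []) k' (l.reverse ++ S k')) := by
  induction l generalizing S with
  | nil =>
    refine (Run.loop_false (by simp [hS])).of_eq ?_
    funext j
    by_cases h1 : j = k' <;> by_cases h2 : j = k <;> simp_all
  | cons a l ih =>
    simp only [List.length_cons] at hB
    refine .loop_true (by simp [hS]) (run_move hk hS (by omega)) ((ih _ ?_ ?_).of_eq ?_)
    · simp [hk]
    · simp; omega
    · funext j
      by_cases h1 : j = k' <;> by_cases h2 : j = k <;> simp_all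

theorem run_copy {B k k' : ℕ} (g : Option (Sym A) → Sym A) (hk : k ≠ k') (h3 : k ≠ 3) (h3' : k' ≠ 3)
    (S : Stacks (Sym A)) (hS : S 3 = []) (hB : (S k).length + (S k').length ≤ B) :
    Run B (copy k k' g) S (Function.update S k' ((S k).map (fun a => g (some a)) ++ S k')) := by
  have second : ∀ (m : List (Sym A)) (T : Stacks (Sym A)), T 3 = m →
      m.length + (T k).length ≤ B → m.length + (T k').length ≤ B →
      Run B (.loop 3 Option.isSome (.seq (.push 3 k' g) (move 3 k))) T
        (Function.update (Function.update (Function.update T 3 []) k (m.reverse ++ T k)) k'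
          ((m.map (fun a => g (some a))).reverse ++ T k')) := by
    intro m
    induction m with
    | nil =>
      intro T hT _ _
      refine (Run.loop_false (by simp [hT])).of_eq ?_
      funext j
      by_cases h1 : j = k' <;> by_cases h2 : j = k <;> by_cases h4 : j = 3 <;> simp_all
    | cons a m ih =>
      intro T hT hB1 hB2
      simp only [List.length_cons] at hB1 hB2
      refine .loop_true (by simp [hT]) (.seq (.push _ _ _ _ (by omega))
        (run_move h3.symm (a := a) (l := m) ?_ ?_)) ((ih _ ?_ ?_ ?_).of_eq ?_)
      · simp [h3'.symm, hT]
      · simp [hk]; omega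
      · simp [h3.symm]
      · simp [hk]; omega
      · simp [h3', hk.symm]; omega
      · funext j
        by_cases h1 : j = k' <;> by_cases h2 : j = k <;> by_cases h4 : j = 3 <;> simp_all
  refine (Run.seq (run_drain h3 _ S rfl (by rw [hS]; simp; omega))
    (second _ _ rfl ?_ ?_)).of_eq ?_
  · simp [hS, h3]; omega
  · simp [hS, h3', hk.symm]; omega
  · funext j
    by_cases h1 : j = k' <;> by_cases h2 : j = k <;> by_cases h4 : j = 3 <;> simp_all

theorem run_times {B d n : ℕ} {c : Code (Sym A)} (F : ℕ → Stacks (Sym A))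
    (h : ∀ i < n, Run B c (Function.update (F i) d (List.replicate (n - i - 1) mk))
      (Function.update (F (i + 1)) d (List.replicate (n - i - 1) mk))) :
    Run B (times d c) (Function.update (F 0) d (List.replicate n mk))
      (Function.update (F n) d []) := by
  have key : ∀ j ≤ n, Run B (times d c)
      (Function.update (F (n - j)) d (List.replicate j mk)) (Function.update (F n) d []) := by
    intro j
    induction j with
    | zero => intro _; exact .loop_false (by simp)
    | succ j ih =>
      intro hj
      have h1 := h (n - (j + 1)) (by omega)
      rw [show n - (n - (j + 1)) - 1 = j by omega, show n - (j + 1) + 1 = n - j by omega] at h1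
      exact .loop_true (by simp) (.seq (.pop _ _) (by simpa using h1)) (ih (by omega))
  simpa using key n le_rfl

end Code

end UninterpretedProgram

namespace UninterpretedProgram

/-- A polynomial bound for the value of a term, and of all numbers that come up in its evaluation,
in terms of a bound for the input and the registers. -/
noncomputable def Trm.bound : Trm → Polynomial ℕ
  | .var _ => Polynomial.X
  | .len => Polynomial.X
  | .zero => 0
  | .one => 1
  | .add s t => s.bound + t.bound
  | .mul s t => (s.bound + 1) * (t.bound + 1)

theorem Trm.val_le_bound {n m : ℕ} {env : ℕ → List Bool} (hn : n ≤ m)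
    (he : ∀ x, (env x).length ≤ m) (t : Trm) : t.val n env ≤ t.bound.eval m := by
  induction t with
  | var x => simpa [Trm.val, Trm.bound] using he x
  | len => simpa [Trm.val, Trm.bound] using hn
  | zero => simp [Trm.val]
  | one => simp [Trm.val, Trm.bound]
  | add s t ihs iht => simp [Trm.val, Trm.bound]; omega
  | mul s t ihs iht =>
    simp only [Trm.val, Trm.bound, Polynomial.eval_mul, Polynomial.eval_add, Polynomial.eval_one]
    exact Nat.mul_le_mul (by omega) (by omega)

namespace Code

variable {A : Type}

theorem Run.from_eq {G : Type} {B : ℕ} {c : Code G} {S S' T : Stacks G} (h : Run B c S T)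
    (e : S = S') : Run B c S' T := e ▸ h

/-- Add the value of a term to the counter on stack `k`; stacks from `e` on are free. -/
def evalTrm (ν : ℕ → ℕ) : Trm → ℕ → ℕ → Code (Sym A)
  | .var x, k, _ => copy (ν x) k fun _ => mk
  | .len, k, _ => copy 0 k fun _ => mk
  | .zero, _, _ => .skip
  | .one, k, _ => .push k k fun _ => mk
  | .add s t, k, e => .seq (evalTrm ν s k e) (evalTrm ν t k e)
  | .mul s t, k, e => .seq (evalTrm ν s e (e + 1)) (times e (evalTrm ν t k (e + 1)))

/-- The stacks hold the input and the registers, the register `x` on stack `ν x`, below stack `d`.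
Stack `1` is available for registers that are always empty. -/
structure Reads (w : List A) (env : ℕ → List Bool) (ν : ℕ → ℕ) (d : ℕ) (S : Stacks (Sym A)) :
    Prop where
  four_le : 4 ≤ d
  input : S 0 = w.map Sum.inl
  scan : S 3 = []
  place : ∀ x, ν x = 1 ∨ 4 ≤ ν x
  place_lt : ∀ x, ν x < d
  reg : ∀ x, S (ν x) = (env x).map Sum.inr

theorem Reads.update {w : List A} {env : ℕ → List Bool} {ν : ℕ → ℕ} {d : ℕ}
    {S : Stacks (Sym A)} (h : Reads w env ν d S) {k : ℕ} (hk : k = 2 ∨ d ≤ k)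
    (l : List (Sym A)) : Reads w env ν d (Function.update S k l) := by
  have h4 := h.four_le
  refine ⟨by omega, ?_, ?_, h.place, h.place_lt, fun x => ?_⟩
  · rw [Function.update_of_ne (by omega), h.input]
  · rw [Function.update_of_ne (by omega), h.scan]
  · have := h.place x
    have := h.place_lt x
    rw [Function.update_of_ne (by omega), h.reg]

theorem Reads.mono {w : List A} {env : ℕ → List Bool} {ν : ℕ → ℕ} {d d' : ℕ}
    {S : Stacks (Sym A)} (h : Reads w env ν d S) (hd : d ≤ d') : Reads w env ν d' S :=
  ⟨h.four_le.trans hd, h.input, h.scan, h.place, fun x => (h.place_lt x).trans_le hd, h.reg⟩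

/-- Store a new register on a free stack. -/
theorem Reads.bind {w : List A} {env : ℕ → List Bool} {ν : ℕ → ℕ} {d d' : ℕ}
    {S : Stacks (Sym A)} (h : Reads w env ν d S) {k : ℕ} (hk : d ≤ k) (hd : k < d') (x : ℕ)
    (v : List Bool) (hv : S k = v.map Sum.inr) :
    Reads w (Function.update env x v) (Function.update ν x k) d' S := by
  have h4 := h.four_le
  have h' := h.mono (d' := d') (by omega)
  refine ⟨h'.four_le, h'.input, h'.scan, fun y => ?_, fun y => ?_, fun y => ?_⟩ <;>
    by_cases hy : y = x
  · subst hy; simp; omega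
  · simpa [hy] using h.place y
  · subst hy; simpa using hd
  · simpa [hy] using h'.place_lt y
  · subst hy; simpa using hv
  · simpa [hy] using h'.reg y

theorem run_evalTrm {w : List A} {env : ℕ → List Bool} {ν : ℕ → ℕ} {m B d : ℕ}
    (hw : w.length ≤ m) (he : ∀ x, (env x).length ≤ m) (t : Trm) :
    ∀ (k e : ℕ) (S : Stacks (Sym A)), Reads w env ν d S → d ≤ k → k < e →
    (∀ j, e ≤ j → S j = []) → (∀ j, (S j).length ≤ B) → (S k).length + t.bound.eval m ≤ B →
    Run B (evalTrm ν t k e) S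
      (Function.update S k (List.replicate (t.val w.length env) mk ++ S k)) := by
  induction t with
  | var x =>
    intro k e S hS hdk hke hf hB hk
    have h1 := hS.place x
    have h2 := hS.place_lt x
    have h4 := hS.four_le
    have h6 := he x
    simp only [Trm.bound, Polynomial.eval_X] at hk
    refine (run_copy _ (by omega) (by omega) (by omega) S hS.scan ?_).of_eq ?_
    · rw [hS.reg, List.length_map]; omega
    · simp [hS.reg, Trm.val, Function.comp_def]
  | len =>
    intro k e S hS hdk hke hf hB hk
    have h4 := hS.four_le
    simp only [Trm.bound, Polynomial.eval_X] at hk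
    refine (run_copy _ (by omega) (by omega) (by omega) S hS.scan ?_).of_eq ?_
    · rw [hS.input, List.length_map]; omega
    · simp [hS.input, Trm.val, Function.comp_def]
  | zero =>
    intro k e S hS hdk hke hf hB hk
    exact (Run.skip S).of_eq (by simp [Trm.val])
  | one =>
    intro k e S hS hdk hke hf hB hk
    simp only [Trm.bound, Polynomial.eval_one] at hk
    exact (Run.push _ _ _ _ (by omega)).of_eq (by simp [Trm.val])
  | add s t ihs iht =>
    intro k e S hS hdk hke hf hB hk
    simp only [Trm.bound, Polynomial.eval_add] at hk
    have hv := Trm.val_le_bound hw he s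
    have r1 := ihs k e S hS hdk hke hf hB (by omega)
    have r2 := iht k e _ (hS.update (.inr hdk) _) hdk hke
      (fun j hj => by rw [Function.update_of_ne (by omega), hf j hj])
      (r1.bounded hB) (by simp; omega)
    refine (r1.seq r2).of_eq ?_
    simp [Trm.val, ← List.append_assoc, add_comm]
  | mul s t ihs iht =>
    intro k e S hS hdk hke hf hB hk
    simp only [Trm.bound, Polynomial.eval_add, Polynomial.eval_mul, Polynomial.eval_one] at hk
    have hv := Trm.val_le_bound hw he s
    have hv' := Trm.val_le_bound hw he t
    generalize hn : s.val w.length env = n at *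
    generalize hn' : t.val w.length env = n' at *
    generalize s.bound.eval m = b at *
    generalize t.bound.eval m = b' at *
    have hbb : b + b' + b * b' + 1 = (b + 1) * (b' + 1) := by ring
    have r1 := ihs e (e + 1) S hS (by omega) (by omega) (fun j hj => hf j (by omega)) hB
      (by simp [hf e le_rfl]; omega)
    have r2 := run_times (B := B) (d := e) (n := n) (c := evalTrm ν t k (e + 1))
      (fun i => Function.update S k (List.replicate (i * n') mk ++ S k)) (fun i hi => ?_)
    · refine (r1.seq (r2.from_eq ?_)).of_eq ?_
      · simp [hf e le_rfl]
      · rw [Function.update_comm (by omega : k ≠ e)]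
        simp [Trm.val, hn, hn', ← hf e le_rfl]
    · have hi' : (i + 1) * b' ≤ b * b' := Nat.mul_le_mul_right _ (by omega)
      have hi2 : i * n' ≤ i * b' := Nat.mul_le_mul_left _ hv'
      have hi3 : (i + 1) * b' = i * b' + b' := by ring
      refine (iht k (e + 1) _ ?_ hdk (by omega) (fun j hj => ?_) (fun j => ?_) ?_).of_eq ?_
      · exact (hS.update (.inr hdk) _).update (.inr (by omega)) _
      · rw [Function.update_of_ne (by omega), Function.update_of_ne (by omega), hf j (by omega)]
      · by_cases hj : j = e
        · subst hj; simp; omega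
        · by_cases hj' : j = k
          · subst hj'; simp [hj]; omega
          · simpa [hj, hj'] using hB j
      · rw [Function.update_of_ne (by omega)]; simp; omega
      · have e1 : (i + 1) * n' = n' + i * n' := by ring
        have e2 : k ≠ e := by omega
        rw [e1, ← List.replicate_append_replicate, List.append_assoc]
        funext j
        by_cases j1 : j = k <;> by_cases j2 : j = e <;> simp_all

/-- Report whether the symbol at the position given by the counter `d` on stack `k` passes the
test `p`. -/
def look (k : ℕ) (p : Option (Sym A) → Bool) (d : ℕ) : Code (Sym A) :=
  .seq (times d (.ite k Option.isSome (move k 3) .skip))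
    (.seq (.push k 2 fun o => Sum.inr (p o)) (.loop 3 Option.isSome (move 3 k)))

theorem run_look {B k d n : ℕ} (p : Option (Sym A) → Bool) (S : Stacks (Sym A)) (hk2 : k ≠ 2)
    (hk3 : k ≠ 3) (hkd : k ≠ d) (hd : 4 ≤ d) (h3 : S 3 = []) (hd0 : S d = List.replicate n mk)
    (hk : (S k).length ≤ B) (h2 : (S 2).length + 1 ≤ B) :
    Run B (look k p d) S
      (Function.update (Function.update S d []) 2 (Sum.inr (p (S k)[n]?) :: S 2)) := by
  have r1 := run_times (B := B) (d := d) (n := n)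
    (c := .ite k Option.isSome (move k 3) .skip)
    (fun i => Function.update (Function.update S k ((S k).drop i)) 3 ((S k).take i).reverse)
    (fun i hi => ?_)
  · refine .seq (r1.from_eq ?_) (.seq (.push _ _ _ _ ?_) ((run_drain hk3.symm _ _ rfl ?_).of_eq ?_))
    · rw [← hd0]
      simp
      rw [← h3, Function.update_eq_self, Function.update_eq_self]
    · have e1 : (2 : ℕ) ≠ d := by omega
      simpa [e1, hk2.symm] using h2
    · have e1 : (3 : ℕ) ≠ d := by omega
      simp [e1, hkd, hk3, hk2]; omega
    · funext j
      have e1 : 3 ≠ d := by omega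
      have e2 : (2 : ℕ) ≠ d := by omega
      by_cases j2 : j = 2 <;> by_cases j3 : j = 3 <;> by_cases jk : j = k <;>
        by_cases jd : j = d <;>
        simp_all [Function.update_apply]
  · rcases hl : (S k).drop i with _ | ⟨a, l⟩
    · refine (Run.ite_false (by simp [hkd, hk3]) (.skip _)).of_eq ?_
      have hle : (S k).length ≤ i := List.drop_eq_nil_iff.1 hl
      rw [List.drop_of_length_le (by omega), List.take_of_length_le hle,
        List.take_of_length_le (by omega)]
    · have hlt : i < (S k).length := by
        by_contra h
        simp [List.drop_of_length_le (not_lt.1 h)] at hl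
      rw [List.drop_eq_getElem_cons hlt] at hl
      obtain ⟨ha, hl'⟩ := List.cons.inj hl
      refine (Run.ite_true (by simp [hkd, hk3])
        (run_move hk3 (a := a) (l := l) (by simp [hkd, hk3]) ?_)).of_eq ?_
      · rw [Function.update_of_ne (by omega), Function.update_self]
        simp; omega
      · rw [List.take_add_one, List.getElem?_eq_getElem hlt, ha, hl']
        funext j
        have e1 : 3 ≠ d := by omega
        by_cases j3 : j = 3 <;> by_cases jk : j = k <;> by_cases jd : j = d <;>
          simp_all [Function.update_apply]

/-- Negate the truth value on top of stack `2`. -/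
def negTop : Code (Sym A) :=
  .ite 2 isT (.seq (.pop 2) (.push 2 2 fun _ => Sum.inr false))
    (.seq (.pop 2) (.push 2 2 fun _ => Sum.inr true))

/-- Replace the two truth values on top of stack `2` by their conjunction. -/
def andTop : Code (Sym A) :=
  .ite 2 isT (.pop 2) (.seq (.pop 2) (.seq (.pop 2) (.push 2 2 fun _ => Sum.inr false)))

/-- Replace the two truth values on top of stack `2` by their disjunction. -/
def orTop : Code (Sym A) :=
  .ite 2 isT (.seq (.pop 2) (.seq (.pop 2) (.push 2 2 fun _ => Sum.inr true))) (.pop 2)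

theorem run_negTop {B : ℕ} {S : Stacks (Sym A)} {b : Bool} {l : List (Sym A)}
    (h : S 2 = Sum.inr b :: l) (hB : (S 2).length ≤ B) :
    Run B negTop S (Function.update S 2 (Sum.inr (!b) :: l)) := by
  cases b
  · exact (Run.ite_false (by simp [h, isT])
      (.seq (.pop 2 _) (.push _ _ _ _ (by simpa [h] using hB)))).of_eq (by simp [h])
  · exact (Run.ite_true (by simp [h, isT])
      (.seq (.pop 2 _) (.push _ _ _ _ (by simpa [h] using hB)))).of_eq (by simp [h])

theorem run_andTop {B : ℕ} {S : Stacks (Sym A)} {b c : Bool} {l : List (Sym A)}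
    (h : S 2 = Sum.inr b :: Sum.inr c :: l) (hB : (S 2).length ≤ B) :
    Run B andTop S (Function.update S 2 (Sum.inr (b && c) :: l)) := by
  cases b
  · exact (Run.ite_false (by simp [h, isT])
      (.seq (.pop 2 _) (.seq (.pop 2 _) (.push _ _ _ _ (by simp [h] at hB ⊢; omega))))).of_eq
        (by simp [h])
  · exact (Run.ite_true (by simp [h, isT]) (.pop 2 _)).of_eq (by simp [h])

theorem run_orTop {B : ℕ} {S : Stacks (Sym A)} {b c : Bool} {l : List (Sym A)}
    (h : S 2 = Sum.inr b :: Sum.inr c :: l) (hB : (S 2).length ≤ B) :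
    Run B orTop S (Function.update S 2 (Sum.inr (b || c) :: l)) := by
  cases b
  · exact (Run.ite_false (by simp [h, isT]) (.pop 2 _)).of_eq (by simp [h])
  · exact (Run.ite_true (by simp [h, isT])
      (.seq (.pop 2 _) (.seq (.pop 2 _) (.push _ _ _ _ (by simp [h] at hB ⊢; omega))))).of_eq
        (by simp [h])

theorem run_loop_of_steps {B k : ℕ} {c : Code (Sym A)} {S T : Stacks (Sym A)}
    (h : Relation.ReflTransGen (fun S T => (S k).head?.isSome = true ∧ Run B c S T) S T)
    (hT : (T k).head?.isSome = false) : Run B (.loop k Option.isSome c) S T := by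
  induction h using Relation.ReflTransGen.head_induction_on with
  | refl => exact .loop_false hT
  | head h1 _ ih => exact .loop_true h1.1 h1.2 ih

/-! ### Alternating quantification by depth-first search

Four stacks are used: `d` holds the bits chosen so far, `d + 1` the part of the pattern for which
bits are to be chosen, `d + 2` the other part of the pattern, reversed, and `d + 3` tells whether
the search descends (`true`) or has come back with a value on stack `2` (`false`). -/

/-- Turn the last chosen bit from `false` to `true` and descend again. -/
def gameFlip (d : ℕ) : Code (Sym A) :=
  .seq (.pop d) (.seq (.push d d fun _ => Sum.inr true)
    (.seq (.pop 2) (.seq (.pop (d + 3)) (.push d (d + 3) fun _ => Sum.inr true))))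

/-- Give up the last chosen bit and keep the value. -/
def gameUp (d : ℕ) : Code (Sym A) := .seq (.pop d) (move (d + 2) (d + 1))

/-- One step of the search, in which `c` evaluates complete choices. -/
def gameStep (c : Code (Sym A)) (d : ℕ) : Code (Sym A) :=
  .ite (d + 3) isT
    (.ite (d + 1) Option.isSome
      (.seq (move (d + 1) (d + 2)) (.push d d fun _ => Sum.inr false))
      (.seq c (.seq (.pop (d + 3)) (.push d (d + 3) fun _ => Sum.inr false))))
    (.ite (d + 2) Option.isSome
      (.ite d isT (gameUp d)
        (.ite (d + 2) isT
          (.ite 2 isT (gameFlip d) (gameUp d))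
          (.ite 2 isT (gameUp d) (gameFlip d))))
      (.pop (d + 3)))

/-- Evaluate the game with the pattern on stack `d + 1`. -/
def gameCode (c : Code (Sym A)) (d : ℕ) : Code (Sym A) :=
  .seq (.push d (d + 3) fun _ => Sum.inr true)
    (.seq (.loop (d + 3) Option.isSome (gameStep c d)) (clear (d + 1)))

/-- The stacks `S` with new contents of the stacks used by the search. -/
def gameStacks (S : Stacks (Sym A)) (d : ℕ) (x y y' : List Bool) (o r : List (Sym A)) :
    Stacks (Sym A) :=
  Function.update (Function.update (Function.update (Function.update (Function.update S d
    (x.map Sum.inr)) (d + 1) (y.map Sum.inr)) (d + 2) (y'.map Sum.inr)) (d + 3) o) 2 r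

section

variable {S : Stacks (Sym A)} {d : ℕ} {x y y' : List Bool} {o r : List (Sym A)}

theorem gameStacks_x (hd : 4 ≤ d) : gameStacks S d x y y' o r d = x.map Sum.inr := by
  have : d ≠ 2 := by omega
  simp [gameStacks, this]

theorem gameStacks_y (hd : 4 ≤ d) : gameStacks S d x y y' o r (d + 1) = y.map Sum.inr := by
  have : d + 1 ≠ 2 := by omega
  simp [gameStacks, this]

theorem gameStacks_y' (hd : 4 ≤ d) : gameStacks S d x y y' o r (d + 2) = y'.map Sum.inr := by
  have : d ≠ 0 := by omega
  simp [gameStacks, this]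

theorem gameStacks_o : gameStacks S d x y y' o r (d + 3) = o := by
  simp [gameStacks]

theorem gameStacks_r : gameStacks S d x y y' o r 2 = r := by
  simp [gameStacks]

theorem update_x (hd : 4 ≤ d) {l : List (Sym A)} {x' : List Bool} (hl : l = x'.map Sum.inr) :
    Function.update (gameStacks S d x y y' o r) d l = gameStacks S d x' y y' o r := by
  subst hl
  funext j
  have : d ≠ 2 := by omega
  simp only [gameStacks, Function.update_apply]
  split_ifs <;> first | rfl | omega

theorem update_y (hd : 4 ≤ d) {l : List (Sym A)} {x' : List Bool} (hl : l = x'.map Sum.inr) :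
    Function.update (gameStacks S d x y y' o r) (d + 1) l = gameStacks S d x x' y' o r := by
  subst hl
  funext j
  simp only [gameStacks, Function.update_apply]
  split_ifs <;> first | rfl | omega

theorem update_y' (hd : 4 ≤ d) {l : List (Sym A)} {x' : List Bool} (hl : l = x'.map Sum.inr) :
    Function.update (gameStacks S d x y y' o r) (d + 2) l = gameStacks S d x y x' o r := by
  subst hl
  funext j
  simp only [gameStacks, Function.update_apply]
  split_ifs <;> first | rfl | omega

theorem update_o (l : List (Sym A)) :
    Function.update (gameStacks S d x y y' o r) (d + 3) l = gameStacks S d x y y' l r := by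
  funext j
  simp only [gameStacks, Function.update_apply]
  split_ifs <;> first | rfl | omega

theorem update_r (l : List (Sym A)) :
    Function.update (gameStacks S d x y y' o r) 2 l = gameStacks S d x y y' o l := by
  simp [gameStacks]

end

theorem run_gameFlip {B d : ℕ} (hd : 4 ≤ d) {S : Stacks (Sym A)} {x y y' : List Bool} {b v : Bool}
    {o : Sym A} {r : List (Sym A)} (hx : x.length + 1 ≤ B) (hB : 1 ≤ B) :
    Run B (gameFlip d) (gameStacks S d (b :: x) y y' [o] (Sum.inr v :: r))
      (gameStacks S d (true :: x) y y' [Sum.inr true] r) := by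
  refine (Run.seq (.pop _ _) (.seq (.push _ _ _ _ ?_) (.seq (.pop _ _)
    (.seq (.pop _ _) (.push _ _ _ _ ?_))))).of_eq ?_
  · rw [update_x (x' := x) hd (by simp [gameStacks_x hd]), gameStacks_x hd]
    simpa using hx
  · rw [update_x (x' := x) hd (by simp [gameStacks_x hd]),
      update_x (x' := true :: x) hd (by simp [gameStacks_x hd]), update_r, update_o, gameStacks_o,
      gameStacks_o]
    simpa using hB
  · rw [update_x (x' := x) hd (by simp [gameStacks_x hd]),
      update_x (x' := true :: x) hd (by simp [gameStacks_x hd]), update_r, update_o, update_o]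
    simp [gameStacks_r, gameStacks_o]

theorem run_gameUp {B d : ℕ} (hd : 4 ≤ d) {S : Stacks (Sym A)} {x y y' : List Bool} {b c : Bool}
    {o r : List (Sym A)} (hy : y.length + 1 ≤ B) :
    Run B (gameUp d) (gameStacks S d (b :: x) y (c :: y') o r)
      (gameStacks S d x (c :: y) y' o r) := by
  have h1 := Run.pop (B := B) d (gameStacks S d (b :: x) y (c :: y') o r)
  rw [update_x (x' := x) hd (by simp [gameStacks_x hd])] at h1
  have h2 := run_move (B := B) (k := d + 2) (k' := d + 1) (by omega)
    (S := gameStacks S d x y (c :: y') o r) (a := Sum.inr c) (l := y'.map Sum.inr)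
    (by simp [gameStacks_y' hd]) (by simpa [gameStacks_y hd] using hy)
  rw [update_y' hd rfl, update_y (x' := c :: y) hd (by simp [gameStacks_y hd])] at h2
  exact h1.seq h2

open Classical in
/-- The depth-first search computes the value of the game. -/
theorem gameStep_reaches {B d : ℕ} (hd : 4 ≤ d) {S : Stacks (Sym A)} {c : Code (Sym A)}
    {φ : List Bool → Prop} {r : List (Sym A)} (y : List Bool) :
    ∀ x y' : List Bool, x.length + y.length ≤ B → y.length + y'.length ≤ B → 1 ≤ B →
    (∀ v p : List Bool, v.length = x.length + y.length → p = y.reverse ++ y' →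
      Run B c (gameStacks S d v [] p [Sum.inr true] r)
        (gameStacks S d v [] p [Sum.inr true] (Sum.inr (decide (φ v)) :: r))) →
    Relation.ReflTransGen (fun S T => (S (d + 3)).head?.isSome = true ∧ Run B (gameStep c d) S T)
      (gameStacks S d x y y' [Sum.inr true] r)
      (gameStacks S d x y y' [Sum.inr false] (Sum.inr (decide (Game φ y x)) :: r)) := by
  induction y with
  | nil =>
    intro x y' _ _ hB hc
    refine .single ⟨by simp [gameStacks_o], .ite_true (by simp [gameStacks_o, isT])
      (.ite_false (by simp [gameStacks_y hd]) ((Run.seq (hc x y' (by simp) (by simp))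
        (.seq (.pop _ _) (.push _ _ _ _ ?_))).of_eq ?_))⟩
    · simpa [update_o, gameStacks_o] using hB
    · simp only [update_o, gameStacks_o, List.tail_cons]
      rfl
  | cons b y ih =>
    intro x y' hx hy hB hc
    simp only [List.length_cons] at hx hy
    have ih' (e : Bool) := ih (e :: x) (b :: y') (by simp; omega) (by simp; omega) hB
      (fun v p hv hp => hc v p (by simp at hv ⊢; omega) (by simpa using hp))
    have down : Relation.ReflTransGen
        (fun S T => (S (d + 3)).head?.isSome = true ∧ Run B (gameStep c d) S T)
        (gameStacks S d x (b :: y) y' [Sum.inr true] r)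
        (gameStacks S d (false :: x) y (b :: y') [Sum.inr true] r) := by
      refine .single ⟨by simp [gameStacks_o], .ite_true (by simp [gameStacks_o, isT])
        (.ite_true (by simp [gameStacks_y hd]) ?_)⟩
      have h1 := run_move (B := B) (k := d + 1) (k' := d + 2) (by omega)
        (S := gameStacks S d x (b :: y) y' [Sum.inr true] r) (a := Sum.inr b) (l := y.map Sum.inr)
        (by simp [gameStacks_y hd]) (by simp [gameStacks_y' hd]; omega)
      rw [update_y hd rfl, update_y' (x' := b :: y') hd (by simp [gameStacks_y' hd])] at h1
      refine h1.seq ((Run.push _ _ _ _ ?_).of_eq ?_)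
      · simp [gameStacks_x hd]; omega
      · rw [update_x (x' := false :: x) hd (by simp [gameStacks_x hd])]
    have up (e : Bool) (v : Bool) (h : e = true ∨ v ≠ b) : Relation.ReflTransGen
        (fun S T => (S (d + 3)).head?.isSome = true ∧ Run B (gameStep c d) S T)
        (gameStacks S d (e :: x) y (b :: y') [Sum.inr false] (Sum.inr v :: r))
        (gameStacks S d x (b :: y) y' [Sum.inr false] (Sum.inr v :: r)) := by
      refine .single ⟨by simp [gameStacks_o], .ite_false (by simp [gameStacks_o, isT])
        (.ite_true (by simp [gameStacks_y' hd]) ?_)⟩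
      have hu := run_gameUp (B := B) hd (S := S) (x := x) (y := y) (y' := y') (b := e) (c := b)
        (o := [Sum.inr false]) (r := Sum.inr v :: r) (by omega)
      cases e
      · refine .ite_false (by simp [gameStacks_x hd, isT]) ?_
        cases b <;> cases v <;> simp at h
        · exact .ite_false (by simp [gameStacks_y' hd, isT])
            (.ite_true (by simp [gameStacks_r, isT]) hu)
        · exact .ite_true (by simp [gameStacks_y' hd, isT])
            (.ite_false (by simp [gameStacks_r, isT]) hu)
      · exact .ite_true (by simp [gameStacks_x hd, isT]) hu
    have flip : Relation.ReflTransGen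
        (fun S T => (S (d + 3)).head?.isSome = true ∧ Run B (gameStep c d) S T)
        (gameStacks S d (false :: x) y (b :: y') [Sum.inr false] (Sum.inr b :: r))
        (gameStacks S d (true :: x) y (b :: y') [Sum.inr true] r) := by
      refine .single ⟨by simp [gameStacks_o], .ite_false (by simp [gameStacks_o, isT])
        (.ite_true (by simp [gameStacks_y' hd]) (.ite_false (by simp [gameStacks_x hd, isT]) ?_))⟩
      have hu := run_gameFlip (B := B) hd (S := S) (x := x) (y := y) (y' := b :: y') (b := false)
        (v := b) (o := Sum.inr false) (r := r) (by omega) hB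
      cases b
      · exact .ite_false (by simp [gameStacks_y' hd, isT])
          (.ite_false (by simp [gameStacks_r, isT]) hu)
      · exact .ite_true (by simp [gameStacks_y' hd, isT])
          (.ite_true (by simp [gameStacks_r, isT]) hu)
    refine down.trans ((ih' false).trans ?_)
    by_cases hv : decide (Game φ y (false :: x)) = b
    · rw [hv]
      refine flip.trans ((ih' true).trans ((up _ _ (.inl rfl)).trans ?_))
      have : decide (Game φ y (true :: x)) = decide (Game φ (b :: y) x) := by
        cases b <;> simp_all [Game]
      rw [this]
    · refine (up _ _ (.inr hv)).trans ?_
      have : decide (Game φ y (false :: x)) = decide (Game φ (b :: y) x) := by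
        cases b <;> simp_all [Game]
      rw [this]

open Classical in
theorem run_gameCode {B d : ℕ} (hd : 4 ≤ d) {S : Stacks (Sym A)} {c : Code (Sym A)}
    {φ : List Bool → Prop} {r : List (Sym A)} (y : List Bool) (hy : y.length ≤ B) (hB : 1 ≤ B)
    (hc : ∀ v p : List Bool, v.length = y.length → p.length = y.length →
      Run B c (gameStacks S d v [] p [Sum.inr true] r)
        (gameStacks S d v [] p [Sum.inr true] (Sum.inr (decide (φ v)) :: r))) :
    Run B (gameCode c d) (gameStacks S d [] y [] [] r)
      (gameStacks S d [] [] [] [] (Sum.inr (decide (Game φ y [])) :: r)) := by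
  have h := gameStep_reaches (B := B) hd (S := S) (c := c) (φ := φ) (r := r) y [] []
    (by simpa using hy) (by simpa using hy) hB (fun v p hv hp => hc v p (by simpa using hv)
      (by simp [hp]))
  have h' := h.tail (b := gameStacks S d [] y [] [Sum.inr false]
      (Sum.inr (decide (Game φ y [])) :: r))
    (c := gameStacks S d [] y [] [] (Sum.inr (decide (Game φ y [])) :: r))
    ⟨by simp [gameStacks_o], .ite_false (by simp [gameStacks_o, isT])
      (.ite_false (by simp [gameStacks_y' hd]) ((Run.pop _ _).of_eq (by
        simp [update_o, gameStacks_o])))⟩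
  refine Run.seq ((Run.push _ _ _ _ (by simpa [gameStacks_o] using hB)).of_eq ?_)
    (.seq (run_loop_of_steps h' (by simp [gameStacks_o])) ((run_clear _).of_eq ?_))
  · simp [gameStacks_o, update_o]
  · rw [update_y (x' := []) hd (by simp)]

end Code

end UninterpretedProgram

namespace UninterpretedProgram

open Code

variable {A : Type}

/-- The program evaluating a formula: it puts the truth value on top of stack `2`. The register `x`
is on stack `ν x`, and the stacks from `d` on are free. -/
def Fml.code : Fml A → (ℕ → ℕ) → ℕ → Code (Sym A)
  | .letter P t, ν, d =>
      .seq (evalTrm ν t d (d + 1)) (look 0 (fun o => match o with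
        | some (Sum.inl a) => P a
        | _ => false) d)
  | .bit x t, ν, d => .seq (evalTrm ν t d (d + 1)) (look (ν x) isT d)
  | .lt s t, ν, d =>
      .seq (evalTrm ν s d (d + 2)) (.seq (evalTrm ν t (d + 1) (d + 2))
        (.seq (times d (.pop (d + 1))) (.seq (.push (d + 1) 2 fun o => Sum.inr o.isSome)
          (clear (d + 1)))))
  | .not a, ν, d => .seq (a.code ν d) negTop
  | .and a b, ν, d => .seq (a.code ν d) (.seq (b.code ν d) andTop)
  | .exNum x t a, ν, d =>
      .seq (evalTrm ν t d (d + 2)) (.seq (.push 2 2 fun _ => Sum.inr false)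
        (.seq (times d (.seq (a.code (Function.update ν x (d + 1)) (d + 2))
          (.seq orTop (.push d (d + 1) fun _ => mk)))) (clear (d + 1))))
  | .exStr x t a, ν, d =>
      .seq (evalTrm ν t (d + 1) (d + 4)) (gameCode (a.code (Function.update ν x d) (d + 4)) d)
  | .game x y a, ν, d =>
      .seq (copy (ν y) (d + 1) fun o => o.getD mk)
        (gameCode (a.code (Function.update ν x d) (d + 4)) d)
  | .ren f a, ν, d => a.code (fun x => ν (f x)) d

open Polynomial in
/-- A polynomial bound for the space needed to evaluate a formula. -/
noncomputable def Fml.bound : Fml A → Polynomial ℕ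
  | .letter _ t => t.bound + X + 1
  | .bit _ t => t.bound + X + 1
  | .lt s t => s.bound + t.bound + X + 1
  | .not a => a.bound + X + 1
  | .and a b => a.bound + b.bound.comp (X + 1) + X + 2
  | .exNum _ t a => a.bound.comp (X + t.bound + 2) + t.bound + X + 3
  | .exStr _ t a => a.bound.comp (X + t.bound + 2) + t.bound + X + 3
  | .game _ _ a => a.bound.comp (X + X + 2) + X + X + 3
  | .ren _ a => a.bound

theorem gameStacks_eq {S : Stacks (Sym A)} {d : ℕ} (hf : ∀ j, d ≤ j → S j = []) (y : List Bool)
    (r : List (Sym A)) :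
    gameStacks S d [] y [] [] r =
      Function.update (Function.update S (d + 1) (y.map Sum.inr)) 2 r := by
  have h0 := hf d le_rfl
  have h2 := hf (d + 2) (by omega)
  have h3 := hf (d + 3) (by omega)
  funext j
  simp only [gameStacks, Function.update_apply]
  split_ifs <;> simp_all

open Classical in
theorem run_code_game {w : List A} {a : Fml A} {x : ℕ} {ν : ℕ → ℕ} {d : ℕ} {env : ℕ → List Bool}
    {S : Stacks (Sym A)} {m B n : ℕ} {y : List Bool}
    (ih : ∀ (ν : ℕ → ℕ) (d : ℕ) (env : ℕ → List Bool) (S : Stacks (Sym A)) (m B : ℕ),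
      Reads w env ν d S → (∀ j, d ≤ j → S j = []) → w.length ≤ m → (∀ x, (env x).length ≤ m) →
      (∀ j, (S j).length ≤ m) → a.bound.eval m ≤ B →
      Run B (a.code ν d) S (Function.update S 2 (Sum.inr (decide (a.Eval w env)) :: S 2)))
    (hS : Reads w env ν d S) (hf : ∀ j, d ≤ j → S j = []) (hw : w.length ≤ m)
    (he : ∀ x, (env x).length ≤ m) (hm : ∀ j, (S j).length ≤ m) (hy : y.length ≤ n)
    (hB : a.bound.eval (m + n + 2) ≤ B) (hB' : m + n + 2 ≤ B) :
    Run B (gameCode (a.code (Function.update ν x d) (d + 4)) d)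
      (Function.update S (d + 1) (y.map Sum.inr))
      (Function.update S 2 (Sum.inr (decide (Game (fun v => a.Eval w (Function.update env x v))
        y [])) :: S 2)) := by
  have h4 := hS.four_le
  refine ((run_gameCode (S := S) (r := S 2)
    (φ := fun v => a.Eval w (Function.update env x v)) h4 y (by omega) (by omega) (fun v p hv hp =>
    (ih (Function.update ν x d) (d + 4) (Function.update env x v) _ (m + n + 2) B ?_ ?_ (by omega)
      ?_ ?_ hB).of_eq ?_)).from_eq ?_).of_eq ?_
  · refine Reads.bind (d := d) ?_ le_rfl (by omega) _ _ (gameStacks_x h4)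
    exact ((((hS.update (.inr le_rfl) _).update (.inr (by omega)) _).update
      (.inr (by omega)) _).update (.inr (by omega)) _).update (.inl rfl) _
  · intro j hj
    have := hf j (by omega)
    simp only [gameStacks, Function.update_apply]
    split_ifs <;> omega
  · intro z
    by_cases hz : z = x
    · subst hz; simp; omega
    · simpa [hz] using (he z).trans (by omega)
  · intro j
    have := hm j
    have := hm 2
    simp only [gameStacks, Function.update_apply]
    split_ifs <;> simp <;> omega
  · rw [update_r, gameStacks_r]
  · rw [gameStacks_eq hf]
    have : S 2 = Function.update S (d + 1) (y.map Sum.inr) 2 := by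
      rw [Function.update_of_ne (by omega)]
    rw [this, Function.update_eq_self]
  · rw [gameStacks_eq hf]
    have := hf (d + 1) (by omega)
    rw [List.map_nil, ← this, Function.update_eq_self]

open Classical in
theorem Fml.run_code (w : List A) (φ : Fml A) :
    ∀ (ν : ℕ → ℕ) (d : ℕ) (env : ℕ → List Bool) (S : Stacks (Sym A)) (m B : ℕ),
    Reads w env ν d S → (∀ j, d ≤ j → S j = []) → w.length ≤ m → (∀ x, (env x).length ≤ m) →
    (∀ j, (S j).length ≤ m) → φ.bound.eval m ≤ B →
    Run B (φ.code ν d) S (Function.update S 2 (Sum.inr (decide (φ.Eval w env)) :: S 2)) := by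
  induction φ with
  | letter P t =>
    intro ν d env S m B hS hf hw he hm hB
    simp only [Fml.bound, Polynomial.eval_add, Polynomial.eval_X, Polynomial.eval_one] at hB
    have h4 := hS.four_le
    have e1 : (3 : ℕ) ≠ d := by omega
    have e2 : (2 : ℕ) ≠ d := by omega
    have e3 : (0 : ℕ) ≠ d := by omega
    have r1 := run_evalTrm (B := B) hw he t d (d + 1) S hS le_rfl (by omega)
      (fun j hj => hf j (by omega)) (fun j => (hm j).trans (by omega))
      (by simp [hf d le_rfl]; omega)
    have h0 := hm 0
    have h2 := hm 2
    refine r1.seq ((run_look _ _ (by omega) (by omega) e3 h4 (by simp [e1, hS.scan])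
      (by simp [hf d le_rfl]; rfl) (by simp [e3]; omega) (by simp [e2]; omega)).of_eq ?_)
    have : Function.update S d [] = S := by rw [← hf d le_rfl, Function.update_eq_self]
    simp only [Function.update_idem, this, Function.update_of_ne e2, Function.update_of_ne e3,
      hS.input, List.getElem?_map]
    congr 3
    rw [Bool.eq_iff_iff, decide_eq_true_iff]
    simp only [Fml.Eval]
    rcases hl : w[t.val w.length env]? with _ | a <;> simp
  | bit x t =>
    intro ν d env S m B hS hf hw he hm hB
    simp only [Fml.bound, Polynomial.eval_add, Polynomial.eval_X, Polynomial.eval_one] at hB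
    have h4 := hS.four_le
    have hx := hS.place x
    have hx' := hS.place_lt x
    have e1 : (3 : ℕ) ≠ d := by omega
    have e2 : (2 : ℕ) ≠ d := by omega
    have e3 : ν x ≠ d := by omega
    have r1 := run_evalTrm (B := B) hw he t d (d + 1) S hS le_rfl (by omega)
      (fun j hj => hf j (by omega)) (fun j => (hm j).trans (by omega))
      (by simp [hf d le_rfl]; omega)
    have h0 := hm (ν x)
    have h2 := hm 2
    refine r1.seq ((run_look _ _ (by omega) (by omega) e3 h4 (by simp [e1, hS.scan])
      (by simp [hf d le_rfl]; rfl) (by simp [e3]; omega) (by simp [e2]; omega)).of_eq ?_)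
    have : Function.update S d [] = S := by rw [← hf d le_rfl, Function.update_eq_self]
    simp only [Function.update_idem, this, Function.update_of_ne e2, Function.update_of_ne e3,
      hS.reg, List.getElem?_map]
    congr 3
    rw [Bool.eq_iff_iff, decide_eq_true_iff]
    simp only [Fml.Eval]
    rcases hl : (env x)[t.val w.length env]? with _ | (_ | _) <;> simp [isT]
  | lt s t =>
    intro ν d env S m B hS hf hw he hm hB
    simp only [Fml.bound, Polynomial.eval_add, Polynomial.eval_X, Polynomial.eval_one] at hB
    have h4 := hS.four_le
    have h2 := hm 2
    have r1 := run_evalTrm (B := B) hw he s d (d + 2) S hS le_rfl (by omega)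
      (fun j hj => hf j (by omega)) (fun j => (hm j).trans (by omega))
      (by simp [hf d le_rfl]; omega)
    have r2 := run_evalTrm (B := B) hw he t (d + 1) (d + 2) _ (hS.update (.inr le_rfl) _)
      (by omega) (by omega) (fun j hj => by
        rw [Function.update_of_ne (by omega), hf j (by omega)]) (r1.bounded fun j => (hm j).trans
          (by omega)) (by simp [hf (d + 1) (by omega)]; omega)
    have r3 := run_times (B := B) (d := d) (n := s.val w.length env) (c := .pop (d + 1))
      (fun i => Function.update S (d + 1) (List.replicate (t.val w.length env - i) mk))
      (fun i hi => (Run.pop _ _).of_eq (by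
        funext j
        by_cases j1 : j = d <;> by_cases j2 : j = d + 1 <;> simp_all [Nat.sub_sub]))
    refine r1.seq (r2.seq ((r3.from_eq ?_).seq ((Run.push _ _ _ _ ?_).seq
      ((run_clear _).of_eq ?_))))
    · funext j
      by_cases j1 : j = d <;> by_cases j2 : j = d + 1 <;> simp_all
    · rw [Function.update_of_ne (by omega), Function.update_of_ne (by omega)]
      omega
    · have e1 : 2 ≠ d := by omega
      have e2 : 2 ≠ d + 1 := by omega
      have : (List.replicate (t.val w.length env - s.val w.length env) (mk : Sym A)).head?.isSome
          = decide (s.val w.length env < t.val w.length env) := by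
        by_cases h : s.val w.length env < t.val w.length env
        · simp [h]; omega
        · simp [h, Nat.sub_eq_zero_of_le (not_lt.1 h)]
      funext j
      by_cases j1 : j = d <;> by_cases j2 : j = d + 1 <;> by_cases j3 : j = 2 <;>
        simp_all [Fml.Eval]
      congr
  | not a ih =>
    intro ν d env S m B hS hf hw he hm hB
    simp only [Fml.bound, Polynomial.eval_add, Polynomial.eval_X, Polynomial.eval_one] at hB
    have h2 := hm 2
    refine (ih ν d env S m B hS hf hw he hm (by omega)).seq
      ((run_negTop (l := S 2) (b := decide (a.Eval w env)) (by simp) (by simp; omega)).of_eq ?_)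
    have : decide ((Fml.not a).Eval w env) = !decide (a.Eval w env) := by
      rw [Bool.eq_iff_iff, Bool.not_eq_true']
      simp only [decide_eq_true_iff, decide_eq_false_iff_not]
      rfl
    rw [this, Function.update_idem]
  | and a b iha ihb =>
    intro ν d env S m B hS hf hw he hm hB
    simp only [Fml.bound, Polynomial.eval_add, Polynomial.eval_X, Polynomial.eval_one,
      Polynomial.eval_comp, Polynomial.eval_ofNat] at hB
    have h4 := hS.four_le
    have h2 := hm 2
    refine (iha ν d env S m B hS hf hw he hm (by omega)).seq
      ((ihb ν d env _ (m + 1) B (hS.update (.inl rfl) _) (fun j hj => ?_) (by omega)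
        (fun x => (he x).trans (by omega)) (fun j => ?_) (by omega)).seq
        ((run_andTop (l := S 2) (b := decide (b.Eval w env))
          (c := decide (a.Eval w env)) (by simp) (by simp; omega)).of_eq ?_))
    · rw [Function.update_of_ne (by omega), hf j hj]
    · by_cases hj : j = 2
      · subst hj; simpa using h2
      · simpa [hj] using (hm j).trans (by omega)
    · have : decide ((Fml.and a b).Eval w env)
          = (decide (b.Eval w env) && decide (a.Eval w env)) := by
        rw [Bool.eq_iff_iff, Bool.and_eq_true]
        simp only [decide_eq_true_iff]
        exact and_comm
      rw [this, Function.update_idem, Function.update_idem]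
  | exNum x t a ih =>
    intro ν d env S m B hS hf hw he hm hB
    simp only [Fml.bound, Polynomial.eval_add, Polynomial.eval_X,
      Polynomial.eval_comp, Polynomial.eval_ofNat] at hB
    have h4 := hS.four_le
    have h2 := hm 2
    have hv := Trm.val_le_bound hw he t
    have e1 : (2 : ℕ) ≠ d := by omega
    have e2 : (2 : ℕ) ≠ d + 1 := by omega
    have r1 := run_evalTrm (B := B) hw he t d (d + 2) S hS le_rfl (by omega)
      (fun j hj => hf j (by omega)) (fun j => (hm j).trans (by omega))
      (by simp [hf d le_rfl]; omega)
    generalize hn : t.val w.length env = n at *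
    have r2 := run_times (B := B) (d := d) (n := n)
      (c := .seq (a.code (Function.update ν x (d + 1)) (d + 2))
          (.seq orTop (.push d (d + 1) fun _ => mk)))
      (fun i => Function.update (Function.update S (d + 1) (List.replicate i mk)) 2
        (Sum.inr (decide (∃ v < i, a.Eval w (Function.update env x (List.replicate v false)))) ::
          S 2)) (fun i hi => ?_)
    · refine r1.seq ((Run.push _ _ _ _ ?_).seq ((r2.from_eq ?_).seq ((run_clear _).of_eq ?_)))
      · rw [Function.update_of_ne (by omega)]; omega
      · have := hf (d + 1) (by omega)
        have := hf d le_rfl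
        funext j
        by_cases j1 : j = d <;> by_cases j2 : j = d + 1 <;> by_cases j3 : j = 2 <;> simp_all
      · have := hf (d + 1) (by omega)
        have := hf d le_rfl
        funext j
        by_cases j1 : j = d <;> by_cases j2 : j = d + 1 <;> by_cases j3 : j = 2 <;>
          simp_all [Fml.Eval]
    · generalize hb : decide (∃ v < i, a.Eval w (Function.update env x (List.replicate v false)))
        = b
      have hT : (∀ j, (Function.update (Function.update (Function.update S (d + 1)
          (List.replicate i (mk : Sym A))) 2 (Sum.inr b :: S 2)) d
          (List.replicate (n - i - 1) mk) j).length ≤ m + t.bound.eval m + 2) := by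
        intro j
        have := hm j
        by_cases j1 : j = d
        · subst j1; simp; omega
        by_cases j2 : j = 2
        · subst j2; simp [e1]; omega
        by_cases j3 : j = d + 1
        · subst j3; simp [j2]; omega
        · simp [j2, j3, j1]; omega
      refine (ih (Function.update ν x (d + 1)) (d + 2)
        (Function.update env x (List.replicate i false)) _ (m + t.bound.eval m + 2) B ?_ ?_
        (by omega) (fun y => ?_) hT (by omega)).seq
        ((run_orTop (l := S 2) (b := decide (a.Eval w (Function.update env x
          (List.replicate i false)))) (c := b) (by simp [e1]) ?_).seq
          ((Run.push _ _ _ _ ?_).of_eq ?_))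
      · refine Reads.bind (d := d) ?_ (k := d + 1) (by omega) (by omega) _ _ ?_
        · exact (((hS.update (.inr (by omega)) _).update (.inl rfl) _).update (.inr le_rfl) _)
        · rw [Function.update_of_ne (by omega), Function.update_of_ne (by omega),
            Function.update_self]
          simp
      · intro j hj
        rw [Function.update_of_ne (by omega), Function.update_of_ne (by omega),
          Function.update_of_ne (by omega), hf j (by omega)]
      · by_cases hy : y = x
        · subst hy; simp; omega
        · simpa [hy] using (he y).trans (by omega)
      · simp [e1]; omega
      · rw [Function.update_of_ne e2.symm, Function.update_of_ne e2.symm,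
          Function.update_of_ne (by omega), Function.update_of_ne e2.symm, Function.update_self]
        simp; omega
      · have hb' : decide (∃ v < i + 1, a.Eval w (Function.update env x (List.replicate v false)))
            = (decide (a.Eval w (Function.update env x (List.replicate i false))) || b) := by
          rw [← hb, ← Bool.decide_or]
          congr 1
          simp only [Nat.lt_succ_iff_lt_or_eq, or_and_right, exists_or, exists_eq_left, eq_iff_iff]
          exact or_comm
        rw [hb']
        funext j
        by_cases j1 : j = d <;> by_cases j2 : j = d + 1 <;> by_cases j3 : j = 2 <;>
          simp_all [List.replicate_succ]
  | exStr x t a ih =>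
    intro ν d env S m B hS hf hw he hm hB
    simp only [Fml.bound, Polynomial.eval_add, Polynomial.eval_X,
      Polynomial.eval_comp, Polynomial.eval_ofNat] at hB
    have hv := Trm.val_le_bound hw he t
    have r1 := run_evalTrm (B := B) hw he t (d + 1) (d + 4) S hS (by omega) (by omega)
      (fun j hj => hf j (by omega)) (fun j => (hm j).trans (by omega))
      (by simp [hf (d + 1) (by omega)]; omega)
    have r2 := run_code_game (x := x) ih hS hf hw he hm
      (y := List.replicate (t.val w.length env) false) (n := t.bound.eval m) (B := B) (by simpa)
      (by omega) (by omega)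
    refine (r1.seq (r2.from_eq ?_)).of_eq ?_
    · simp [hf (d + 1) (by omega)]
    · have : decide ((Fml.exStr x t a).Eval w env) =
          decide (Game (fun v => a.Eval w (Function.update env x v))
            (List.replicate (t.val w.length env) false) []) := by
        rw [Bool.eq_iff_iff, decide_eq_true_iff, decide_eq_true_iff, game_replicate_false]
        simp [Fml.Eval]
      rw [this]
  | game x y a ih =>
    intro ν d env S m B hS hf hw he hm hB
    simp only [Fml.bound, Polynomial.eval_add, Polynomial.eval_X,
      Polynomial.eval_comp, Polynomial.eval_ofNat] at hB
    have h4 := hS.four_le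
    have h1 := hS.place y
    have h2 := hS.place_lt y
    have hv := he y
    have r1 := run_copy (B := B) (k := ν y) (k' := d + 1) (fun o => o.getD mk) (by omega)
      (by omega) (by omega) S hS.scan (by simp [hf (d + 1) (by omega), hS.reg]; omega)
    have r2 := run_code_game (x := x) ih hS hf hw he hm (y := env y) (n := m) (B := B) hv
      (by omega) (by omega)
    refine (r1.seq (r2.from_eq ?_)).of_eq rfl
    simp [hf (d + 1) (by omega), hS.reg, Function.comp_def]
  | ren f a ih =>
    intro ν d env S m B hS hf hw he hm hB
    exact ih (fun x => ν (f x)) d (fun x => env (f x)) S m B ⟨hS.four_le, hS.input, hS.scan,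
      fun x => hS.place _, fun x => hS.place_lt _, fun x => hS.reg _⟩ hf hw (fun x => he _) hm hB

open Classical in
/-- The languages defined by second-order formulas are in `PSPACE`. -/
theorem mem_PSPACE_of_fml [Finite A] (P : Language A) (φ : Fml A)
    (h : ∀ w, w ∈ P ↔ φ.Eval w fun _ => []) : P ∈ PSPACE A := by
  refine mem_PSPACE_of_code P (φ.code (fun _ => 1) 4) (φ.bound + Polynomial.X) fun w => ?_
  refine ⟨_, φ.run_code w (fun _ => 1) 4 (fun _ => []) _ w.length _ ⟨le_rfl, ?_, ?_, ?_, ?_, ?_⟩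
    (fun j hj => ?_) le_rfl (fun _ => Nat.zero_le _) (fun j => ?_) ?_, ?_, ?_⟩
  · simp
  · simp
  · simp
  · simp
  · simp
  · rw [Function.update_of_ne (by omega)]
  · by_cases hj : j = 0
    · subst hj; simp
    · simp [hj]
  · simp
  · simp [h]
  · simp

end UninterpretedProgram

namespace UninterpretedProgram

/-! ### Definable predicates -/

/-- Families of types, indexed by the input word, whose elements are stored in registers. -/
class Reg {A : Type} (τ : List A → Type) where
  /-- the number of registers for an element -/
  width : ℕ
  /-- the contents of these registers -/
  enc : ∀ w, τ w → ℕ → List Bool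

/-- Families of types, indexed by the input word, whose elements are the contents of finitely many
registers. -/
class Ctx {A : Type} (Γ : List A → Type) where
  /-- the number of registers -/
  size : ℕ
  /-- the contents of the registers -/
  val : ∀ w, Γ w → ℕ → List Bool

section

variable {A : Type}

instance : Reg fun _ : List A => ℕ := ⟨1, fun _ n _ => List.replicate n false⟩

instance : Reg fun _ : List A => List Bool := ⟨1, fun _ x _ => x⟩

instance : Reg fun w : List A => Fin w.length := ⟨1, fun _ n _ => List.replicate n false⟩

instance (n : ℕ) : Reg fun w : List A => Fin n → Fin w.length :=
  ⟨n, fun _ z i => if h : i < n then List.replicate (z ⟨i, h⟩) false else []⟩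

instance : Ctx fun _ : List A => Unit := ⟨0, fun _ _ _ => []⟩

variable {Γ Δ τ : List A → Type} [Ctx Γ] [Ctx Δ] [Reg τ]

instance : Ctx fun w => Γ w × τ w :=
  ⟨Ctx.size Γ + Reg.width τ,
    fun w p i => if i < Ctx.size Γ then Ctx.val w p.1 i else Reg.enc w p.2 (i - Ctx.size Γ)⟩

/-- The registers hold the data of the context `a`. -/
def Agrees {w : List A} (a : Γ w) (env : ℕ → List Bool) : Prop :=
  ∀ i < Ctx.size Γ, env i = Ctx.val w a i

/-- Number-valued functions denoted by a term. -/
def PT (f : ∀ w, Γ w → ℕ) : Prop :=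
  ∃ t : Trm, ∀ w (a : Γ w) env, Agrees a env → t.val w.length env = f w a

/-- Predicates defined by a formula. -/
def PS (R : ∀ w, Γ w → Prop) : Prop :=
  ∃ φ : Fml A, ∀ w (a : Γ w) env, Agrees a env → (φ.Eval w env ↔ R w a)

/-- Functions whose value can be read off from some of the registers. -/
def RegOf (g : ∀ w, Γ w → τ w) : Prop :=
  ∃ ρ : ℕ → ℕ, ∀ w (a : Γ w) env, Agrees a env →
    ∀ i < Reg.width τ, env (ρ i) = Reg.enc w (g w a) i

/-- Maps of contexts that only select registers. -/
def RegMap (f : ∀ w, Γ w → Δ w) : Prop :=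
  ∃ ρ : ℕ → ℕ, ∀ w (a : Γ w) env, Agrees a env → Agrees (f w a) fun i => env (ρ i)

variable {w : List A}

theorem Agrees.fst {p : Γ w × τ w} {env : ℕ → List Bool}
    (h : Agrees (Γ := fun w => Γ w × τ w) p env) : Agrees p.1 env := by
  intro i hi
  have := h i (Nat.lt_add_right _ hi)
  simpa [Ctx.val, hi] using this

theorem Agrees.snd {p : Γ w × τ w} {env : ℕ → List Bool}
    (h : Agrees (Γ := fun w => Γ w × τ w) p env) (i : ℕ)
    (hi : i < Reg.width τ) : env (Ctx.size Γ + i) = Reg.enc w p.2 i := by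
  have := h (Ctx.size Γ + i) (Nat.add_lt_add_left hi _)
  simpa [Ctx.val] using this

theorem Agrees.prod {a : Γ w} {v : τ w} {env : ℕ → List Bool} (h : Agrees a env)
    (h' : ∀ i < Reg.width τ, env (Ctx.size Γ + i) = Reg.enc w v i) :
    Agrees (Γ := fun w => Γ w × τ w) (a, v) env := by
  intro i hi
  by_cases hia : i < Ctx.size Γ
  · simpa [Ctx.val, hia] using h i hia
  · have hi' : i < Ctx.size Γ + Reg.width τ := hi
    have := h' (i - Ctx.size Γ) (by omega)
    rw [show Ctx.size Γ + (i - Ctx.size Γ) = i by omega] at this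
    simpa [Ctx.val, hia] using this

/-- A new value can be stored in the next register. -/
theorem Agrees.update {a : Γ w} {env : ℕ → List Bool} (h : Agrees a env) (l : List Bool) :
    Agrees a (Function.update env (Ctx.size Γ) l) := by
  intro i hi
  rw [Function.update_of_ne (by omega), h i hi]

theorem Agrees.push {a : Γ w} {v : τ w} {env : ℕ → List Bool} {l : List Bool} (h : Agrees a env)
    (h1 : Reg.width τ = 1) (hl : l = Reg.enc w v 0) :
    Agrees (Γ := fun w => Γ w × τ w) (a, v) (Function.update env (Ctx.size Γ) l) := by
  refine (h.update l).prod fun i hi => ?_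
  obtain rfl : i = 0 := by omega
  simp [hl]

theorem RegOf.snd : RegOf fun w (p : Γ w × τ w) => p.2 :=
  ⟨fun i => Ctx.size Γ + i, fun _ _ _ h i hi => h.snd i hi⟩

theorem RegOf.fst {σ : List A → Type} [Reg σ] {g : ∀ w, Γ w → τ w} (h : RegOf g) :
    RegOf fun w (p : Γ w × σ w) => g w p.1 := by
  obtain ⟨ρ, h⟩ := h
  exact ⟨ρ, fun _ _ _ hp => h _ _ _ hp.fst⟩

theorem RegOf.tuple {n : ℕ} {g : ∀ w, Γ w → Fin n → Fin w.length}
    (h : ∀ i, RegOf (τ := fun w => Fin w.length) fun w a => g w a i) :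
    RegOf (τ := fun w => Fin n → Fin w.length) g := by
  choose ρ h using h
  refine ⟨fun i => if hi : i < n then ρ ⟨i, hi⟩ 0 else 0, fun w a env ha i (hi : i < n) => ?_⟩
  simp only [hi, dif_pos]
  rw [h ⟨i, hi⟩ w a env ha 0 Nat.one_pos]
  simp [Reg.enc, hi]

theorem RegOf.app {n : ℕ} {g : ∀ w, Γ w → Fin n → Fin w.length}
    (h : RegOf (τ := fun w => Fin n → Fin w.length) g) (i : Fin n) :
    RegOf (τ := fun w => Fin w.length) fun w a => g w a i := by
  obtain ⟨ρ, h⟩ := h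
  refine ⟨fun _ => ρ i, fun w a env ha j hj => ?_⟩
  rw [h w a env ha i i.isLt]
  simp [Reg.enc]

theorem RegMap.id : RegMap fun w (a : Γ w) => a := ⟨fun i => i, fun _ _ _ h => h⟩

theorem RegMap.fst {f : ∀ w, Γ w → Δ w} (h : RegMap f) :
    RegMap fun w (p : Γ w × τ w) => f w p.1 := by
  obtain ⟨ρ, h⟩ := h
  exact ⟨ρ, fun _ _ _ hp => h _ _ _ hp.fst⟩

theorem RegMap.prod {f : ∀ w, Γ w → Δ w} (hf : RegMap f) {g : ∀ w, Γ w → τ w} (hg : RegOf g) :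
    RegMap (Δ := fun w => Δ w × τ w) fun w a => (f w a, g w a) := by
  obtain ⟨ρ, hf⟩ := hf
  obtain ⟨ρ', hg⟩ := hg
  refine ⟨fun i => if i < Ctx.size Δ then ρ i else ρ' (i - Ctx.size Δ),
    fun w a env h => Agrees.prod (fun i hi => ?_) (fun i hi => ?_)⟩
  · simpa [hi] using hf w a env h i hi
  · simpa using hg w a env h i hi

theorem PS.comp {f : ∀ w, Γ w → Δ w} {R : ∀ w, Δ w → Prop} (hR : PS R) (hf : RegMap f) :
    PS fun w a => R w (f w a) := by
  obtain ⟨ρ, hf⟩ := hf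
  obtain ⟨φ, hφ⟩ := hR
  exact ⟨.ren ρ φ, fun w a env h => hφ _ _ _ (hf w a env h)⟩

theorem PS.fst {R : ∀ w, Γ w → Prop} (h : PS R) : PS fun w (p : Γ w × τ w) => R w p.1 :=
  h.comp RegMap.id.fst

theorem PS.congr {R R' : ∀ w, Γ w → Prop} (h : PS R) (h' : ∀ w a, R' w a ↔ R w a) : PS R' := by
  obtain ⟨φ, hφ⟩ := h
  exact ⟨φ, fun w a env ha => (hφ w a env ha).trans (h' w a).symm⟩

/-! #### Terms -/

theorem PT.fst {f : ∀ w, Γ w → ℕ} (h : PT f) : PT fun w (p : Γ w × τ w) => f w p.1 := by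
  obtain ⟨t, h⟩ := h
  exact ⟨t, fun _ _ _ hp => h _ _ _ hp.fst⟩

theorem PT.snd : PT fun w (p : Γ w × ℕ) => p.2 :=
  ⟨.var (Ctx.size Γ), fun w p env hp => by
    have := hp.snd (τ := fun _ => ℕ) 0 Nat.one_pos
    simp only [Nat.add_zero] at this
    rw [Trm.val, this]
    exact List.length_replicate⟩

/-- A position of the input word as a number. -/
theorem RegOf.num {g : ∀ w, Γ w → Fin w.length} (h : RegOf (τ := fun w => Fin w.length) g) :
    PT fun w a => (g w a : ℕ) := by
  obtain ⟨ρ, h⟩ := h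
  refine ⟨.var (ρ 0), fun w a env ha => ?_⟩
  rw [Trm.val, h w a env ha 0 Nat.one_pos]
  exact List.length_replicate

theorem PT.len : PT fun w (_ : Γ w) => w.length := ⟨.len, fun _ _ _ _ => rfl⟩

theorem PT.add {f g : ∀ w, Γ w → ℕ} (hf : PT f) (hg : PT g) : PT fun w a => f w a + g w a := by
  obtain ⟨s, hs⟩ := hf
  obtain ⟨t, ht⟩ := hg
  exact ⟨.add s t, fun w a env h => by rw [Trm.val, hs w a env h, ht w a env h]⟩

theorem PT.mul {f g : ∀ w, Γ w → ℕ} (hf : PT f) (hg : PT g) : PT fun w a => f w a * g w a := by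
  obtain ⟨s, hs⟩ := hf
  obtain ⟨t, ht⟩ := hg
  exact ⟨.mul s t, fun w a env h => by rw [Trm.val, hs w a env h, ht w a env h]⟩

theorem PT.const (c : ℕ) : PT fun w (_ : Γ w) => c := by
  induction c with
  | zero => exact ⟨.zero, fun _ _ _ _ => rfl⟩
  | succ c ih => exact ih.add ⟨.one, fun _ _ _ _ => rfl⟩

theorem PT.pow {f : ∀ w, Γ w → ℕ} (hf : PT f) (c : ℕ) : PT fun w a => f w a ^ c := by
  induction c with
  | zero => exact PT.const 1
  | succ c ih => simpa only [pow_succ] using ih.mul hf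

theorem PT.sum {n : ℕ} {f : Fin n → ∀ w, Γ w → ℕ} (hf : ∀ i, PT (f i)) :
    PT fun w a => ∑ i, f i w a := by
  induction n with
  | zero => simpa using PT.const 0
  | succ n ih => simpa only [Fin.sum_univ_succ] using (hf 0).add (ih fun i => hf i.succ)

/-! #### Boolean combinations and quantifiers -/

theorem PS.lt {f g : ∀ w, Γ w → ℕ} (hf : PT f) (hg : PT g) : PS fun w a => f w a < g w a := by
  obtain ⟨s, hs⟩ := hf
  obtain ⟨t, ht⟩ := hg
  exact ⟨.lt s t, fun w a env h => by rw [Fml.Eval, hs w a env h, ht w a env h]⟩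

theorem PS.not {R : ∀ w, Γ w → Prop} (h : PS R) : PS fun w a => ¬ R w a := by
  obtain ⟨φ, hφ⟩ := h
  exact ⟨.not φ, fun w a env ha => not_congr (hφ w a env ha)⟩

theorem PS.and {R R' : ∀ w, Γ w → Prop} (h : PS R) (h' : PS R') :
    PS fun w a => R w a ∧ R' w a := by
  obtain ⟨φ, hφ⟩ := h
  obtain ⟨ψ, hψ⟩ := h'
  exact ⟨.and φ ψ, fun w a env ha => and_congr (hφ w a env ha) (hψ w a env ha)⟩

theorem PS.or {R R' : ∀ w, Γ w → Prop} (h : PS R) (h' : PS R') : PS fun w a => R w a ∨ R' w a :=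
  (h.not.and h'.not).not.congr fun w a => by tauto

theorem PS.imp {R R' : ∀ w, Γ w → Prop} (h : PS R) (h' : PS R') : PS fun w a => R w a → R' w a :=
  (h.and h'.not).not.congr fun w a => by tauto

theorem PS.iff {R R' : ∀ w, Γ w → Prop} (h : PS R) (h' : PS R') :
    PS fun w a => (R w a ↔ R' w a) :=
  ((h.imp h').and (h'.imp h)).congr fun w a => by tauto

theorem PS.const (p : Prop) : PS fun w (_ : Γ w) => p := by
  by_cases hp : p
  · exact (PS.lt (PT.const 0) (PT.const 1)).congr fun w a => by simp [hp]
  · exact (PS.lt (PT.const 0) (PT.const 0)).congr fun w a => by simp [hp]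

theorem PS.le {f g : ∀ w, Γ w → ℕ} (hf : PT f) (hg : PT g) : PS fun w a => f w a ≤ g w a :=
  (PS.lt hg hf).not.congr fun _ _ => by omega

theorem PS.eq {f g : ∀ w, Γ w → ℕ} (hf : PT f) (hg : PT g) : PS fun w a => f w a = g w a :=
  ((PS.le hf hg).and (PS.le hg hf)).congr fun _ _ => by omega

theorem PS.eqFin {f g : ∀ w, Γ w → Fin w.length} (hf : RegOf (τ := fun w => Fin w.length) f)
    (hg : RegOf (τ := fun w => Fin w.length) g) : PS fun w a => f w a = g w a :=
  (PS.eq hf.num hg.num).congr fun _ _ => Fin.ext_iff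

theorem PS.finite_ex {ι : Type} [Finite ι] {R : ι → ∀ w, Γ w → Prop} (h : ∀ i, PS (R i)) :
    PS fun w a => ∃ i, R i w a := by
  classical
  have := Fintype.ofFinite ι
  have key : ∀ s : Finset ι, PS fun w a => ∃ i ∈ s, R i w a := by
    intro s
    induction s using Finset.induction_on with
    | empty => exact (PS.const False).congr fun w a => by simp
    | insert i s _ ih => exact ((h i).or ih).congr fun w a => by simp
  exact (key Finset.univ).congr fun w a => by simp

theorem PS.finite_all {ι : Type} [Finite ι] {R : ι → ∀ w, Γ w → Prop} (h : ∀ i, PS (R i)) :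
    PS fun w a => ∀ i, R i w a :=
  (PS.finite_ex fun i => (h i).not).not.congr fun w a => by simp

open Classical in
theorem PS.letter {f : ∀ w, Γ w → ℕ} (hf : PT f) (P : A → Prop) :
    PS fun w a => ∃ x, w[f w a]? = some x ∧ P x := by
  obtain ⟨t, ht⟩ := hf
  exact ⟨.letter (fun x => decide (P x)) t, fun w a env h => by simp [Fml.Eval, ht w a env h]⟩

theorem PS.letter_eq {f : ∀ w, Γ w → ℕ} (hf : PT f) (x : A) :
    PS fun w a => w[f w a]? = some x :=
  (PS.letter hf fun y => y = x).congr fun w a => by simp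

/-- The bit of a string at a position. -/
def BitAt (x : List Bool) (n : ℕ) : Prop := x[n]? = some true

theorem PS.bit {x : ∀ w, Γ w → List Bool} (hx : RegOf (τ := fun _ => List Bool) x)
    {f : ∀ w, Γ w → ℕ} (hf : PT f) : PS fun w a => BitAt (x w a) (f w a) := by
  obtain ⟨ρ, h⟩ := hx
  obtain ⟨t, ht⟩ := hf
  refine ⟨.bit (ρ 0) t, fun w a env ha => ?_⟩
  rw [Fml.Eval, h w a env ha 0 Nat.one_pos, ht w a env ha]
  rfl

theorem PT.length {x : ∀ w, Γ w → List Bool} (hx : RegOf (τ := fun _ => List Bool) x) :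
    PT fun w a => (x w a).length := by
  obtain ⟨ρ, h⟩ := hx
  refine ⟨.var (ρ 0), fun w a env ha => ?_⟩
  rw [Trm.val, h w a env ha 0 Nat.one_pos]
  rfl

theorem PS.exNum {t : ∀ w, Γ w → ℕ} (ht : PT t) {R : ∀ w, Γ w → ℕ → Prop}
    (h : PS fun w (p : Γ w × ℕ) => R w p.1 p.2) : PS fun w a => ∃ v, v < t w a ∧ R w a v := by
  obtain ⟨s, hs⟩ := ht
  obtain ⟨φ, hφ⟩ := h
  refine ⟨.exNum (Ctx.size Γ) s φ, fun w a env ha => ?_⟩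
  rw [Fml.Eval, hs w a env ha]
  exact exists_congr fun v => and_congr Iff.rfl
    (hφ w (a, v) _ (ha.push (τ := fun _ => ℕ) rfl rfl))

theorem PS.allNum {t : ∀ w, Γ w → ℕ} (ht : PT t) {R : ∀ w, Γ w → ℕ → Prop}
    (h : PS fun w (p : Γ w × ℕ) => R w p.1 p.2) : PS fun w a => ∀ v, v < t w a → R w a v :=
  (PS.exNum ht (R := fun w a v => ¬ R w a v) h.not).not.congr fun w a => by simp

theorem PS.exFin {R : ∀ w, Γ w → Fin w.length → Prop}
    (h : PS fun w (p : Γ w × Fin w.length) => R w p.1 p.2) : PS fun w a => ∃ v, R w a v := by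
  obtain ⟨φ, hφ⟩ := h
  refine ⟨.exNum (Ctx.size Γ) .len φ, fun w a env ha => ?_⟩
  refine Iff.trans (exists_congr fun v => ?_) Fin.exists_iff.symm
  rw [← exists_prop]
  exact exists_congr fun hv => hφ w (a, ⟨v, hv⟩) _ (ha.push (τ := fun w => Fin w.length) rfl rfl)

theorem PS.allFin {R : ∀ w, Γ w → Fin w.length → Prop}
    (h : PS fun w (p : Γ w × Fin w.length) => R w p.1 p.2) : PS fun w a => ∀ v, R w a v :=
  (PS.exFin (R := fun w a v => ¬ R w a v) h.not).not.congr fun w a => by simp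

theorem PS.exStr {t : ∀ w, Γ w → ℕ} (ht : PT t) {R : ∀ w, Γ w → List Bool → Prop}
    (h : PS fun w (p : Γ w × List Bool) => R w p.1 p.2) :
    PS fun w a => ∃ v : List Bool, v.length = t w a ∧ R w a v := by
  obtain ⟨s, hs⟩ := ht
  obtain ⟨φ, hφ⟩ := h
  refine ⟨.exStr (Ctx.size Γ) s φ, fun w a env ha => ?_⟩
  rw [Fml.Eval, hs w a env ha]
  exact exists_congr fun v => and_congr Iff.rfl
    (hφ w (a, v) _ (ha.push (τ := fun _ => List Bool) rfl rfl))

theorem PS.game {x : ∀ w, Γ w → List Bool} (hx : RegOf (τ := fun _ => List Bool) x)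
    {R : ∀ w, Γ w → List Bool → Prop}
    (h : PS fun w (p : Γ w × List Bool) => R w p.1 p.2) :
    PS fun w a => Game (R w a) (x w a) [] := by
  obtain ⟨ρ, hx⟩ := hx
  obtain ⟨φ, hφ⟩ := h
  refine ⟨.game (Ctx.size Γ) (ρ 0) φ, fun w a env ha => ?_⟩
  rw [Fml.Eval, hx w a env ha 0 Nat.one_pos]
  exact game_congr _ _ fun v _ => hφ w (a, v ++ []) _ (ha.push (τ := fun _ => List Bool) rfl rfl)

theorem PS.exTuple {n : ℕ} {R : ∀ w, Γ w → (Fin n → Fin w.length) → Prop}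
    (h : PS fun w (p : Γ w × (Fin n → Fin w.length)) => R w p.1 p.2) :
    PS fun w a => ∃ z, R w a z := by
  induction n generalizing Γ with
  | zero =>
    refine PS.congr (h.comp (RegMap.prod (τ := fun w => Fin 0 → Fin w.length) RegMap.id
      (g := fun _ _ => Fin.elim0) ⟨fun i => i, fun _ _ _ _ i hi => absurd hi (Nat.not_lt_zero i)⟩))
      fun w a => ⟨?_, fun h => ⟨_, h⟩⟩
    rintro ⟨z, h⟩
    rwa [← Subsingleton.elim z (Fin.elim0 : Fin 0 → Fin w.length)]
  | succ n ih =>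
    have h1 := ih (Γ := fun w => Γ w × Fin w.length)
      (R := fun w p z => R w p.1 (Fin.cons p.2 z))
      (h.comp (RegMap.id.fst.fst.prod (τ := fun w => Fin (n + 1) → Fin w.length)
        (RegOf.tuple fun i => by
          refine Fin.cases ?_ (fun i => ?_) i
          · exact (RegOf.snd (τ := fun w => Fin w.length)).fst
          · exact (RegOf.snd (τ := fun w => Fin n → Fin w.length)).app i)))
    refine (PS.exFin (R := fun w a v => ∃ z : Fin n → Fin w.length, R w a (Fin.cons v z))
      h1).congr fun w a => ?_
    constructor
    · rintro ⟨z, h⟩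
      exact ⟨z 0, Fin.tail z, by rwa [Fin.cons_self_tail]⟩
    · rintro ⟨v, z, h⟩
      exact ⟨_, h⟩

theorem PS.allTuple {n : ℕ} {R : ∀ w, Γ w → (Fin n → Fin w.length) → Prop}
    (h : PS fun w (p : Γ w × (Fin n → Fin w.length)) => R w p.1 p.2) :
    PS fun w a => ∀ z, R w a z :=
  (PS.exTuple (R := fun w a v => ¬ R w a v) h.not).not.congr fun w a => by simp

end

theorem bits_ext {x y : List Bool} (h : x.length = y.length)
    (h' : ∀ k < y.length, (BitAt x k ↔ BitAt y k)) : x = y := by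
  refine List.ext_getElem h fun i h1 h2 => ?_
  have := h' i h2
  rw [BitAt, BitAt, List.getElem?_eq_getElem h1, List.getElem?_eq_getElem h2,
    Option.some_inj, Option.some_inj] at this
  exact Bool.eq_iff_iff.2 this

open Classical in
/-- The string of a given length with given bits. -/
noncomputable def bitString (n : ℕ) (P : ℕ → Prop) : List Bool :=
  List.ofFn fun i : Fin n => decide (P i)

theorem length_bitString (n : ℕ) (P : ℕ → Prop) : (bitString n P).length = n := by
  simp [bitString]

theorem bitAt_bitString {n k : ℕ} {P : ℕ → Prop} : BitAt (bitString n P) k ↔ k < n ∧ P k := by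
  by_cases hk : k < n
  · simp [BitAt, bitString, hk]
  · simp [BitAt, bitString, hk]

theorem bitString_bitAt (x : List Bool) : bitString x.length (BitAt x) = x :=
  bits_ext (length_bitString _ _) fun k hk => by simp [bitAt_bitString, hk]

/-- Substitution of a string whose bits are definable. -/
theorem PS.substStr {A : Type} {Γ : List A → Type} [Ctx Γ] {t : ∀ w, Γ w → ℕ} (ht : PT t)
    {P : ∀ w, Γ w → ℕ → Prop}
    (hP : PS fun w (p : Γ w × ℕ) => P w p.1 p.2) {R : ∀ w, Γ w → List Bool → Prop}
    (h : PS fun w (p : Γ w × List Bool) => R w p.1 p.2) :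
    PS fun w a => R w a (bitString (t w a) (P w a)) := by
  refine (PS.exStr ht (R := fun w a v => (∀ k, k < t w a → (BitAt v k ↔ P w a k)) ∧ R w a v)
    ((PS.allNum ht.fst (PS.iff
      (PS.bit (RegOf.snd (τ := fun _ => List Bool)).fst PT.snd)
      (hP.comp (RegMap.id.fst.fst.prod RegOf.snd)))).and h)).congr fun w a => ?_
  constructor
  · exact fun h => ⟨_, length_bitString _ _, fun k hk => by simp [bitAt_bitString, hk], h⟩
  · rintro ⟨v, hv, h1, h2⟩
    have : v = bitString (t w a) (P w a) := bits_ext (by rw [hv, length_bitString]) fun k hk => by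
      rw [length_bitString] at hk
      simp [bitAt_bitString, hk, h1]
    rwa [← this]

/-- Languages defined by a formula are in `PSPACE`. -/
theorem mem_PSPACE_of_PS {A : Type} [Finite A] {P : Language A}
    (h : PS fun (w : List A) (_ : Unit) => w ∈ P) : P ∈ PSPACE A := by
  obtain ⟨φ, hφ⟩ := h
  exact mem_PSPACE_of_fml P φ fun w =>
    (hφ w () _ fun i hi => absurd hi (Nat.not_lt_zero i)).symm

end UninterpretedProgram

namespace UninterpretedProgram

/-! ### Reachability in polynomial space -/

/-- Paths of a given length. -/
def Steps {α : Type} (r : α → α → Prop) : ℕ → α → α → Prop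
  | 0, x, y => x = y
  | n + 1, x, y => ∃ z, r x z ∧ Steps r n z y

theorem Steps.add {α : Type} {r : α → α → Prop} {m n : ℕ} {x y : α} :
    Steps r (m + n) x y ↔ ∃ z, Steps r m x z ∧ Steps r n z y := by
  induction m generalizing x with
  | zero => simp [Steps]
  | succ m ih =>
    rw [Nat.succ_add]
    simp only [Steps, ih]
    exact ⟨fun ⟨z, h, z', h1, h2⟩ => ⟨z', ⟨z, h, h1⟩, h2⟩, fun ⟨z', ⟨z, h, h1⟩, h2⟩ =>
      ⟨z, h, z', h1, h2⟩⟩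

theorem Steps.reflTransGen {α : Type} {r : α → α → Prop} {n : ℕ} {x y : α} (h : Steps r n x y) :
    Relation.ReflTransGen r x y := by
  induction n generalizing x with
  | zero => cases h; exact .refl
  | succ n ih => obtain ⟨z, h, h'⟩ := h; exact .head h (ih h')

/-- A path can be shortened so that it does not return to its starting point. -/
theorem exists_path_not_return {α : Type} {r : α → α → Prop} {x y : α}
    (h : Relation.ReflTransGen r x y) :
    x = y ∨ ∃ x', r x x' ∧ x' ≠ x ∧
      Relation.ReflTransGen (fun a b => r a b ∧ a ≠ x ∧ b ≠ x) x' y := by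
  induction h with
  | refl => exact Or.inl rfl
  | @tail y y' _ hr ih =>
    by_cases hy' : y' = x
    · exact Or.inl hy'.symm
    by_cases hy : y = x
    · subst hy
      exact Or.inr ⟨y', hr, hy', .refl⟩
    · rcases ih with rfl | ⟨x', h1, h2, h3⟩
      · exact absurd rfl hy
      · exact Or.inr ⟨x', h1, h2, h3.tail ⟨hr, hy, hy'⟩⟩

theorem exists_steps_le_card {α : Type} [DecidableEq α] {r : α → α → Prop} (s : Finset α) {x y : α}
    (hx : x ∈ s) (hr : ∀ a b, r a b → b ∈ s) (h : Relation.ReflTransGen r x y) :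
    ∃ n ≤ s.card, Steps r n x y := by
  induction hn : s.card generalizing s r x with
  | zero => simp [Finset.card_eq_zero.1 hn] at hx
  | succ k ih =>
    rcases exists_path_not_return h with rfl | ⟨x', h1, h2, h3⟩
    · exact ⟨0, Nat.zero_le _, rfl⟩
    · obtain ⟨n, hnk, h⟩ := ih (s.erase x) (Finset.mem_erase.2 ⟨h2, hr _ _ h1⟩)
        (fun a b h => Finset.mem_erase.2 ⟨h.2.2, hr _ _ h.1⟩) h3
        (by rw [Finset.card_erase_of_mem hx, hn, Nat.add_sub_cancel])
      have hmono : ∀ n z, Steps (fun a b => r a b ∧ a ≠ x ∧ b ≠ x) n z y → Steps r n z y := by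
        intro n
        induction n with
        | zero => exact fun z h => h
        | succ n ih => exact fun z ⟨z', h, h'⟩ => ⟨z', h.1, ih z' h'⟩
      exact ⟨n + 1, Nat.succ_le_succ hnk, x', h1, hmono n x' h⟩

/-- `Doubling r m t x y`: one can get from `x` to `y` in at most `2 ^ t` steps, where midpoints
are strings of length `m`. -/
def Doubling (r : List Bool → List Bool → Prop) (m : ℕ) :
    ℕ → List Bool → List Bool → Prop
  | 0, x, y => x = y ∨ r x y
  | t + 1, x, y => ∃ z, z.length = m ∧ Doubling r m t x z ∧ Doubling r m t z y

theorem doubling_iff {r : List Bool → List Bool → Prop} {m t : ℕ} {x y : List Bool}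
    (hr : ∀ x y, r x y → y.length = m) (hx : x.length = m) :
    Doubling r m t x y ↔ ∃ n ≤ 2 ^ t, Steps r n x y := by
  have hl : ∀ n x y, x.length = m → Steps r n x y → y.length = m := by
    intro n
    induction n with
    | zero => rintro x y h rfl; exact h
    | succ n ih => rintro x y h ⟨z, h1, h2⟩; exact ih z y (hr _ _ h1) h2
  induction t generalizing x y with
  | zero =>
    constructor
    · rintro (rfl | h)
      · exact ⟨0, Nat.zero_le _, rfl⟩
      · exact ⟨1, le_refl _, y, h, rfl⟩
    · rintro ⟨n, hn, h⟩
      rcases n with _ | _ | n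
      · exact Or.inl h
      · obtain ⟨z, h, rfl⟩ := h
        exact Or.inr h
      · simp at hn
  | succ t ih =>
    have h2 : 2 ^ (t + 1) = 2 ^ t + 2 ^ t := by rw [pow_succ]; omega
    constructor
    · rintro ⟨z, hz, h, h'⟩
      obtain ⟨n, hn, h⟩ := (ih hx).1 h
      obtain ⟨n', hn', h'⟩ := (ih hz).1 h'
      exact ⟨n + n', by omega, Steps.add.2 ⟨z, h, h'⟩⟩
    · rintro ⟨n, hn, h⟩
      obtain ⟨a, b, rfl, ha, hb⟩ : ∃ a b, n = a + b ∧ a ≤ 2 ^ t ∧ b ≤ 2 ^ t :=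
        ⟨n / 2, n - n / 2, by omega, by omega, by omega⟩
      obtain ⟨z, h, h'⟩ := Steps.add.1 h
      have hz := hl a x z hx h
      exact ⟨z, hz, (ih hx).2 ⟨a, ha, h⟩, (ih hz).2 ⟨b, hb, h'⟩⟩

theorem reflTransGen_iff_doubling {r : List Bool → List Bool → Prop} {m : ℕ} {x y : List Bool}
    (hr : ∀ x y, r x y → y.length = m) (hx : x.length = m) :
    Relation.ReflTransGen r x y ↔ Doubling r m m x y := by
  rw [doubling_iff hr hx]
  refine ⟨fun h => ?_, fun ⟨n, _, h⟩ => h.reflTransGen⟩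
  let s : Finset (List Bool) := (Finset.univ : Finset (List.Vector Bool m)).image fun v => v.1
  have hs : ∀ z : List Bool, z.length = m → z ∈ s := fun z hz =>
    Finset.mem_image.2 ⟨⟨z, hz⟩, Finset.mem_univ _, rfl⟩
  obtain ⟨n, hn, h⟩ := exists_steps_le_card s (hs x hx) (fun a b h => hs b (hr a b h)) h
  refine ⟨n, hn.trans (Finset.card_image_le.trans ?_), h⟩
  rw [Finset.card_univ, card_vector, Fintype.card_bool]

/-- The quantifier prefix of the recursion of `Doubling`: a midpoint is chosen, then one of the two
halves of the path. -/
def doublingPattern (m : ℕ) : ℕ → List Bool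
  | 0 => []
  | t + 1 => (List.replicate m false ++ [true]) ++ doublingPattern m t

theorem length_doublingPattern (m t : ℕ) : (doublingPattern m t).length = t * (m + 1) := by
  induction t with
  | zero => simp [doublingPattern]
  | succ t ih => simp [doublingPattern, ih]; ring

theorem bitAt_doublingPattern {m t k : ℕ} :
    BitAt (doublingPattern m t) k ↔ ∃ s < t, k = s * (m + 1) + m := by
  induction t generalizing k with
  | zero => simp [doublingPattern, BitAt]
  | succ t ih =>
    rw [doublingPattern, BitAt]
    rcases lt_or_ge k (m + 1) with hk | hk
    · rw [List.getElem?_append_left (by simpa using hk)]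
      constructor
      · intro h
        rcases Nat.lt_succ_iff_lt_or_eq.1 hk with hk | rfl
        · rw [List.getElem?_append_left (by simpa using hk)] at h
          simp [hk] at h
        · exact ⟨0, Nat.succ_pos _, by simp⟩
      · rintro ⟨s, hs, rfl⟩
        rcases s with _ | s
        · simp
        · rw [Nat.succ_mul] at hk
          omega
    · rw [List.getElem?_append_right (by simpa using hk)]
      simp only [List.length_append, List.length_replicate, List.length_singleton]
      refine ih.trans ⟨?_, ?_⟩
      · rintro ⟨s, hs, h⟩
        exact ⟨s + 1, by omega, by rw [Nat.succ_mul]; omega⟩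
      · rintro ⟨s, hs, h⟩
        rcases s with _ | s
        · simp at h
          omega
        · rw [Nat.succ_mul] at h
          exact ⟨s, by omega, by omega⟩

/-- The midpoint chosen at level `t`, in the string of all choices. -/
noncomputable def midpoint (m : ℕ) (v : List Bool) (t : ℕ) : List Bool :=
  bitString m fun k => BitAt v (t * (m + 1) + 1 + k)

open Classical in
/-- An endpoint of the path that remains after `t` levels, the original one being `x`:
`c t` says that this endpoint was replaced by the midpoint at level `t`. Level `0` is the last. -/
noncomputable def endpoint (m : ℕ) (v : List Bool) (c : ℕ → Prop) : ℕ → List Bool → List Bool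
  | 0, x => x
  | t + 1, x => endpoint m v c t (if c t then midpoint m v t else x)

/-- The bits of `endpoint`, without recursion: the last replacement counts. -/
def EndpointBit (m : ℕ) (v : List Bool) (c : ℕ → Prop) (t : ℕ) (x : List Bool) (k : ℕ) : Prop :=
  (∃ s, s < t ∧ c s ∧ (∀ s', s' < s → ¬ c s') ∧ BitAt v (s * (m + 1) + 1 + k)) ∨
    ((∀ s, s < t → ¬ c s) ∧ BitAt x k)

theorem endpoint_eq {m : ℕ} {v : List Bool} {c : ℕ → Prop} {t : ℕ} {x : List Bool}
    (hx : x.length = m) : endpoint m v c t x = bitString m (EndpointBit m v c t x) := by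
  induction t generalizing x with
  | zero =>
    rw [show EndpointBit m v c 0 x = BitAt x by funext k; simp [EndpointBit]]
    subst hx
    exact (bitString_bitAt x).symm
  | succ t ih =>
    rw [endpoint, ih (by split_ifs <;> simp [midpoint, length_bitString, hx])]
    refine bits_ext (by simp only [length_bitString]) fun k hk => ?_
    rw [length_bitString] at hk
    simp only [bitAt_bitString, EndpointBit, hk, true_and]
    by_cases hc : c t
    · simp only [hc, if_true, midpoint, bitAt_bitString, hk, true_and]
      constructor
      · rintro (⟨s, hs, h⟩ | ⟨h, h'⟩)
        · exact Or.inl ⟨s, by omega, h⟩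
        · exact Or.inl ⟨t, by omega, hc, h, h'⟩
      · rintro (⟨s, hs, h1, h2, h3⟩ | ⟨h, _⟩)
        · rcases Nat.lt_succ_iff_lt_or_eq.1 hs with hs | rfl
          · exact Or.inl ⟨s, hs, h1, h2, h3⟩
          · exact Or.inr ⟨h2, h3⟩
        · exact absurd hc (h t (Nat.lt_succ_self t))
    · simp only [hc, if_false]
      refine or_congr ⟨?_, ?_⟩ (and_congr_left fun _ => ⟨?_, ?_⟩)
      · rintro ⟨s, hs, h⟩
        exact ⟨s, by omega, h⟩
      · rintro ⟨s, hs, h1, h2⟩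
        rcases Nat.lt_succ_iff_lt_or_eq.1 hs with hs | rfl
        · exact ⟨s, hs, h1, h2⟩
        · exact absurd h1 hc
      · intro h s hs
        rcases Nat.lt_succ_iff_lt_or_eq.1 hs with hs | rfl
        · exact h s hs
        · exact hc
      · exact fun h s hs => h s (by omega)

theorem game_doubling {r : List Bool → List Bool → Prop} {m t : ℕ} {x y s : List Bool} :
    Game (fun v => endpoint m v (fun s => BitAt v (s * (m + 1))) t x =
        endpoint m v (fun s => ¬ BitAt v (s * (m + 1))) t y ∨
      r (endpoint m v (fun s => BitAt v (s * (m + 1))) t x)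
        (endpoint m v (fun s => ¬ BitAt v (s * (m + 1))) t y)) (doublingPattern m t) s ↔
    Doubling r m t x y := by
  induction t generalizing x y s with
  | zero => rfl
  | succ t ih =>
    rw [doublingPattern, game_append, game_append, game_replicate_false, Doubling]
    refine exists_congr fun z => and_congr_right fun hz => ?_
    have key : ∀ b v : List Bool, ∀ c : Bool, v.length = t * (m + 1) →
        (BitAt (v ++ c :: (z ++ b)) (t * (m + 1)) ↔ c = true) ∧
        midpoint m (v ++ c :: (z ++ b)) t = z := by
      intro b v c hv
      constructor
      · rw [BitAt, ← hv]
        simp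
      · rw [midpoint]
        refine bits_ext (by rw [length_bitString, hz]) fun k hk => ?_
        rw [bitAt_bitString, BitAt, List.getElem?_append_right (by omega),
          show t * (m + 1) + 1 + k - v.length = k + 1 by omega, List.getElem?_cons_succ,
          List.getElem?_append_left hk]
        exact and_iff_right (hz ▸ hk)
    rw [← ih (s := false :: (z ++ s)), ← ih (s := true :: (z ++ s))]
    have h1 := fun v hv => key s v true hv
    have h0 := fun v hv => key s v false hv
    simp only [Game]
    refine and_congr (game_congr _ _ fun v hv => ?_) (game_congr _ _ fun v hv => ?_)
    all_goals
      rw [length_doublingPattern] at hv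
      simp only [endpoint, h0 v hv, h1 v hv]
      simp

section

variable {A : Type} {Γ : List A → Type} [Ctx Γ]

theorem PS.endpoint {m : ∀ w, Γ w → ℕ} (hm : PT m) {v x : ∀ w, Γ w → List Bool}
    (hv : RegOf (τ := fun _ => List Bool) v) (hx : RegOf (τ := fun _ => List Bool) x)
    {c : ∀ w, Γ w → ℕ → Prop} (hc : PS fun w (p : Γ w × ℕ) => c w p.1 p.2) :
    PS fun w (p : Γ w × ℕ) =>
      EndpointBit (m w p.1) (v w p.1) (c w p.1) (m w p.1) (x w p.1) p.2 := by
  have hc1 := hc.comp (RegMap.id.fst.fst.prod (RegOf.snd (τ := fun _ => ℕ))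
    (Γ := fun w => (Γ w × ℕ) × ℕ))
  have hc2 := hc.comp (RegMap.id.fst.fst.fst.prod (RegOf.snd (τ := fun _ => ℕ))
    (Γ := fun w => ((Γ w × ℕ) × ℕ) × ℕ))
  exact .or (.exNum hm.fst (.and hc1 (.and (.allNum PT.snd hc2.not)
    (.bit hv.fst.fst (((PT.snd.mul (hm.fst.fst.add (.const 1))).add (.const 1)).add PT.snd.fst)))))
    (.and (.allNum hm.fst hc1.not) (.bit hx.fst PT.snd))

/-- Reachability between strings of polynomial length is definable: the game of `Doubling` needs
only polynomially many quantifiers. -/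
theorem PS.reflTransGen {m : ∀ w, Γ w → ℕ} (hm : PT m)
    {R : ∀ w, Γ w → List Bool → List Bool → Prop}
    (hR : PS fun w (p : (Γ w × List Bool) × List Bool) => R w p.1.1 p.1.2 p.2) :
    PS fun w (p : (Γ w × List Bool) × List Bool) => p.1.2.length = m w p.1.1 ∧
      p.2.length = m w p.1.1 ∧ Relation.ReflTransGen
        (fun x y => R w p.1.1 x y ∧ x.length = m w p.1.1 ∧ y.length = m w p.1.1) p.1.2 p.2 := by
  have hl : PS fun w (p : (Γ w × List Bool) × List Bool) =>
      p.1.2.length = m w p.1.1 ∧ p.2.length = m w p.1.1 :=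
    .and (.eq (.length (RegOf.snd.fst (τ := fun _ => List Bool))) hm.fst.fst)
      (.eq (.length (RegOf.snd (τ := fun _ => List Bool))) hm.fst.fst)
  have hr : PS fun w (p : (Γ w × List Bool) × List Bool) => p.1.2 = p.2 ∨
      (R w p.1.1 p.1.2 p.2 ∧ p.1.2.length = m w p.1.1 ∧ p.2.length = m w p.1.1) := by
    refine .or (PS.congr (.and (.eq (.length RegOf.snd.fst) (.length RegOf.snd))
      (PS.allNum (.length RegOf.snd)
        (R := fun w p k => BitAt p.1.2 k ↔ BitAt p.2 k) (.iff (.bit RegOf.snd.fst.fst PT.snd)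
        (.bit RegOf.snd.fst PT.snd)))) fun w p => ?_) (.and hR hl)
    exact ⟨fun h => h ▸ ⟨rfl, fun _ _ => Iff.rfl⟩, fun h => bits_ext h.1 h.2⟩
  have hlevel : PS fun w (p : ((((Γ w × List Bool) × List Bool) × List Bool) × List Bool) × ℕ) =>
      BitAt p.1.2 (p.2 * (m w p.1.1.1.1.1 + 1)) :=
    .bit RegOf.snd.fst (PT.snd.mul (hm.fst.fst.fst.fst.fst.add (.const 1)))
  let Q : ∀ w, Γ w → List Bool → List Bool → Prop := fun w a x y =>
    x = y ∨ (R w a x y ∧ x.length = m w a ∧ y.length = m w a)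
  have hr1 : PS fun w (p : (((((Γ w × List Bool) × List Bool) × List Bool) × List Bool) ×
      List Bool) × List Bool) => Q w p.1.1.1.1.1.1 p.1.2 p.2 :=
    hr.comp ((RegMap.id.fst.fst.fst.fst.fst.fst.prod RegOf.snd.fst).prod RegOf.snd)
  have hr2 := PS.substStr hm.fst.fst.fst.fst.fst
    (P := fun w (p : ((((Γ w × List Bool) × List Bool) × List Bool) × List Bool) × List Bool) =>
      EndpointBit (m w p.1.1.1.1.1) p.1.2 (fun s => ¬ BitAt p.1.2 (s * (m w p.1.1.1.1.1 + 1)))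
        (m w p.1.1.1.1.1) p.1.1.1.2)
    ((PS.endpoint hm.fst.fst.fst.fst RegOf.snd RegOf.snd.fst.fst
      (c := fun w (p : (((Γ w × List Bool) × List Bool) × List Bool) × List Bool) s =>
        ¬ BitAt p.2 (s * (m w p.1.1.1.1 + 1))) hlevel.not).comp
      (RegMap.id.fst.fst.prod RegOf.snd))
    (R := fun w (p : ((((Γ w × List Bool) × List Bool) × List Bool) × List Bool) × List Bool) y =>
      Q w p.1.1.1.1.1 p.2 y) hr1
  have hr3 := PS.substStr hm.fst.fst.fst.fst
    (P := fun w (p : (((Γ w × List Bool) × List Bool) × List Bool) × List Bool) =>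
      EndpointBit (m w p.1.1.1.1) p.2 (fun s => BitAt p.2 (s * (m w p.1.1.1.1 + 1)))
        (m w p.1.1.1.1) p.1.1.1.2)
    (PS.endpoint hm.fst.fst.fst.fst RegOf.snd RegOf.snd.fst.fst.fst
      (c := fun w (p : (((Γ w × List Bool) × List Bool) × List Bool) × List Bool) s =>
        BitAt p.2 (s * (m w p.1.1.1.1 + 1))) hlevel)
    (R := fun w (p : (((Γ w × List Bool) × List Bool) × List Bool) × List Bool) x =>
      Q w p.1.1.1.1 x (bitString (m w p.1.1.1.1) (EndpointBit (m w p.1.1.1.1) p.2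
        (fun s => ¬ BitAt p.2 (s * (m w p.1.1.1.1 + 1))) (m w p.1.1.1.1) p.1.1.2))) hr2
  have hg := PS.game (RegOf.snd (τ := fun _ => List Bool))
    (R := fun w (p : ((Γ w × List Bool) × List Bool) × List Bool) v =>
      Q w p.1.1.1 (bitString (m w p.1.1.1) (EndpointBit (m w p.1.1.1) v
        (fun s => BitAt v (s * (m w p.1.1.1 + 1))) (m w p.1.1.1) p.1.1.2))
      (bitString (m w p.1.1.1) (EndpointBit (m w p.1.1.1) v
        (fun s => ¬ BitAt v (s * (m w p.1.1.1 + 1))) (m w p.1.1.1) p.1.2))) hr3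
  have hex := PS.exStr (hm.fst.fst.mul (hm.fst.fst.add (.const 1)))
    (R := fun w (p : (Γ w × List Bool) × List Bool) v => (∀ k, k < v.length →
      (BitAt v k ↔ ∃ s, s < m w p.1.1 ∧ k = s * (m w p.1.1 + 1) + m w p.1.1)) ∧
      Game (fun v =>
        Q w p.1.1 (bitString (m w p.1.1) (EndpointBit (m w p.1.1) v
          (fun s => BitAt v (s * (m w p.1.1 + 1))) (m w p.1.1) p.1.2))
        (bitString (m w p.1.1) (EndpointBit (m w p.1.1) v
          (fun s => ¬ BitAt v (s * (m w p.1.1 + 1))) (m w p.1.1) p.2))) v [])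
    (.and (.allNum (.length RegOf.snd) (.iff (.bit RegOf.snd.fst PT.snd)
      (.exNum hm.fst.fst.fst.fst (.eq PT.snd.fst
        ((PT.snd.mul (hm.fst.fst.fst.fst.fst.add (.const 1))).add hm.fst.fst.fst.fst.fst))))) hg)
  refine PS.congr (.and hl hex) fun w p => ?_
  rw [← and_assoc]
  refine and_congr_right fun ⟨h1, h2⟩ => ?_
  rw [reflTransGen_iff_doubling (fun _ _ h => h.2.2) h1, ← game_doubling (s := [])]
  simp only [endpoint_eq h1, endpoint_eq h2]
  constructor
  · refine fun h => ⟨doublingPattern _ _, length_doublingPattern _ _, fun k hk => ?_, h⟩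
    exact bitAt_doublingPattern
  · rintro ⟨v, hv, h3, h⟩
    have : v = doublingPattern (m w p.1.1) (m w p.1.1) :=
      bits_ext (by rw [hv, length_doublingPattern]) fun k hk =>
        (h3 k (by rwa [hv, ← length_doublingPattern])).trans bitAt_doublingPattern.symm
    rw [this] at h
    exact h

end

end UninterpretedProgram

namespace UninterpretedProgram

/-! ### Finite relational structures -/

/-- Relational structures on `Fin n`, with relation symbols `T` of arities `ar`. -/
def St {T : Type} (ar : T → ℕ) (n : ℕ) : Type := ∀ t, (Fin (ar t) → Fin n) → Prop

section

variable {T : Type} [Finite T] (ar : T → ℕ) (n : ℕ)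

/-- The number of bits of a relational structure. -/
noncomputable def stSize : ℕ := ∑ i, n ^ ar ((Finite.equivFin T).symm i)

/-- The place of an atomic statement in the string for a relational structure. -/
noncomputable def stAddr : (Σ t, Fin (ar t) → Fin n) ≃ Fin (stSize ar n) :=
  (Equiv.sigmaCongrRight fun _ => finFunctionFinEquiv).trans
    ((Equiv.sigmaCongrLeft' (Finite.equivFin T)).trans finSigmaFinEquiv)

variable {ar n}

theorem stAddr_apply (t : T) (z : Fin (ar t) → Fin n) : (stAddr ar n ⟨t, z⟩ : ℕ) =
    (∑ i : Fin (Finite.equivFin T t), n ^ ar ((Finite.equivFin T).symm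
      (Fin.castLE (Finite.equivFin T t).2.le i))) + ∑ i, (z i : ℕ) * n ^ (i : ℕ) := by
  have h : ∀ (s : Fin (Nat.card T)) (x : Fin (n ^ ar ((Finite.equivFin T).symm s))) (t : T)
      (y : Fin (n ^ ar t)), (⟨s, x⟩ : Σ s, Fin (n ^ ar ((Finite.equivFin T).symm s))) =
        Equiv.sigmaCongrLeft' (β := fun t => Fin (n ^ ar t)) (Finite.equivFin T) ⟨t, y⟩ →
      s = Finite.equivFin T t ∧ (x : ℕ) = y := by
    intro s x t y h
    rw [← Equiv.symm_apply_eq] at h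
    simp only [Equiv.sigmaCongrLeft', Equiv.symm_symm, Equiv.sigmaCongrLeft_apply] at h
    obtain ⟨h1, h2⟩ := Sigma.mk.inj_iff.1 h
    subst h1
    exact ⟨by simp, by rw [eq_of_heq h2]⟩
  change (finSigmaFinEquiv (Equiv.sigmaCongrLeft' (β := fun t => Fin (n ^ ar t))
    (Finite.equivFin T) ⟨t, finFunctionFinEquiv z⟩) : ℕ) = _
  generalize hq : Equiv.sigmaCongrLeft' (β := fun t => Fin (n ^ ar t))
    (Finite.equivFin T) ⟨t, finFunctionFinEquiv z⟩ = q
  obtain ⟨s, x⟩ := q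
  obtain ⟨rfl, hx⟩ := h s x t _ hq.symm
  rw [finSigmaFinEquiv_apply, hx, finFunctionFinEquiv_apply]

/-- The string for a relational structure. -/
noncomputable def St.enc (S : St ar n) : List Bool :=
  bitString (stSize ar n) fun k => ∃ x, (stAddr ar n x : ℕ) = k ∧ S x.1 x.2

variable (ar n) in
/-- The relational structure stored in a string. -/
def St.dec (x : List Bool) : St ar n := fun t z => BitAt x (stAddr ar n ⟨t, z⟩)

theorem St.bitAt_enc (S : St ar n) (t : T) (z : Fin (ar t) → Fin n) :
    BitAt S.enc (stAddr ar n ⟨t, z⟩) ↔ S t z := by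
  rw [St.enc, bitAt_bitString, and_iff_right (Fin.is_lt _)]
  constructor
  · rintro ⟨x, hx, h⟩
    rwa [(stAddr ar n).injective (Fin.ext hx)] at h
  · exact fun h => ⟨_, rfl, h⟩

theorem St.length_enc (S : St ar n) : S.enc.length = stSize ar n := length_bitString _ _

theorem St.dec_enc (S : St ar n) : St.dec ar n S.enc = S := by
  funext t z
  exact propext (S.bitAt_enc t z)

theorem St.enc_dec {x : List Bool} (hx : x.length = stSize ar n) : (St.dec ar n x).enc = x := by
  refine bits_ext (by rw [length_enc, hx]) fun k hk => ?_
  rw [hx] at hk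
  obtain ⟨⟨t, z⟩, h⟩ := (stAddr ar n).surjective ⟨k, hk⟩
  rw [show k = (stAddr ar n ⟨t, z⟩ : ℕ) by rw [h], St.bitAt_enc]
  rfl

variable {A : Type} {Γ : List A → Type} [Ctx Γ]

noncomputable instance (ar : T → ℕ) : Reg fun w : List A => St ar w.length :=
  ⟨1, fun _ S _ => S.enc⟩

theorem PT.stSize (ar : T → ℕ) : PT fun w (_ : Γ w) => stSize ar w.length :=
  .sum fun _ => PT.len.pow _

theorem RegOf.enc {S : ∀ w, Γ w → St ar w.length} (hS : RegOf (τ := fun w => St ar w.length) S) :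
    RegOf (τ := fun _ => List Bool) fun w a => (S w a).enc := by
  obtain ⟨ρ, h⟩ := hS
  exact ⟨ρ, fun w a env ha i hi => h w a env ha i hi⟩

theorem PS.rel {S : ∀ w, Γ w → St ar w.length} (hS : RegOf (τ := fun w => St ar w.length) S) (t : T)
    {z : ∀ w, Γ w → Fin (ar t) → Fin w.length}
    (hz : RegOf (τ := fun w => Fin (ar t) → Fin w.length) z) :
    PS fun w a => S w a t (z w a) := by
  have h2 : PT fun w a => (stAddr ar w.length ⟨t, z w a⟩ : ℕ) := by
    simp only [stAddr_apply]
    exact (PT.sum fun _ => PT.len.pow _).add (.sum fun i => (hz.app i).num.mul (PT.len.pow _))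
  exact (PS.bit hS.enc h2).congr fun w a => (St.bitAt_enc _ _ _).symm

theorem PS.ofStr {R : ∀ w, Γ w → St ar w.length → Prop}
    (h : PS fun w (p : Γ w × St ar w.length) => R w p.1 p.2) :
    PS fun w (p : Γ w × List Bool) => p.2.length = UninterpretedProgram.stSize ar w.length ∧
      R w p.1 (St.dec ar w.length p.2) := by
  obtain ⟨φ, hφ⟩ := (PS.eq (PT.length (RegOf.snd (Γ := Γ) (τ := fun _ => List Bool)))
    (PT.stSize ar))
  obtain ⟨ψ, hψ⟩ := h
  refine ⟨.and φ ψ, fun w p env hp => ?_⟩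
  rw [Fml.Eval, hφ w p env hp]
  refine and_congr_right fun hl => hψ w (p.1, St.dec ar w.length p.2) env
    (hp.fst.prod fun i hi => ?_)
  exact (hp.snd i hi).trans (St.enc_dec hl).symm

theorem PS.exSt {R : ∀ w, Γ w → St ar w.length → Prop}
    (h : PS fun w (p : Γ w × St ar w.length) => R w p.1 p.2) : PS fun w a => ∃ S, R w a S := by
  refine (PS.exStr (PT.stSize ar) (R := fun w a x =>
    x.length = UninterpretedProgram.stSize ar w.length ∧
      R w a (St.dec ar w.length x)) h.ofStr).congr fun w a => ?_
  constructor
  · rintro ⟨S, h⟩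
    exact ⟨S.enc, S.length_enc, S.length_enc, S.dec_enc.symm ▸ h⟩
  · rintro ⟨_, _, _, h⟩
    exact ⟨_, h⟩

theorem PS.allSt {R : ∀ w, Γ w → St ar w.length → Prop}
    (h : PS fun w (p : Γ w × St ar w.length) => R w p.1 p.2) : PS fun w a => ∀ S, R w a S :=
  (PS.exSt (R := fun w a S => ¬ R w a S) h.not).not.congr fun w a => by simp

/-- Reachability between relational structures is definable. -/
theorem PS.reachSt {R : ∀ w, Γ w → St ar w.length → St ar w.length → Prop}
    (hR : PS fun w (p : (Γ w × St ar w.length) × St ar w.length) => R w p.1.1 p.1.2 p.2) :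
    PS fun w (p : (Γ w × St ar w.length) × St ar w.length) =>
      Relation.ReflTransGen (R w p.1.1) p.1.2 p.2 := by
  have h1 := PS.ofStr (Γ := fun w => Γ w × St ar w.length) (R := fun w p S => R w p.1 p.2 S) hR
  have h2 := (PS.ofStr (Γ := fun w => Γ w × List Bool) (R := fun w p S =>
    p.2.length = UninterpretedProgram.stSize ar w.length ∧
      R w p.1 S (St.dec ar w.length p.2))
    (h1.comp ((RegMap.id.fst.fst.prod RegOf.snd).prod RegOf.snd.fst))).comp
      ((RegMap.id.fst.fst.prod RegOf.snd).prod RegOf.snd.fst)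
  have h3 := PS.reflTransGen (PT.stSize ar) (R := fun w a x y =>
    x.length = UninterpretedProgram.stSize ar w.length ∧
      y.length = UninterpretedProgram.stSize ar w.length ∧
      R w a (St.dec ar w.length x) (St.dec ar w.length y)) h2
  have h4 := h3.comp (Γ := fun w => (Γ w × St ar w.length) × St ar w.length)
    ((RegMap.id.fst.fst.prod (RegOf.enc RegOf.snd.fst)).prod (RegOf.enc RegOf.snd))
  refine h4.congr fun w p => ?_
  simp only [St.length_enc, true_and]
  constructor
  · obtain ⟨⟨a, S⟩, S'⟩ := p
    intro h
    change Relation.ReflTransGen _ S S' at h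
    induction h with
    | refl => exact .refl
    | tail _ h ih =>
      exact ih.tail (by simpa only [St.length_enc, St.dec_enc, true_and, and_true] using h)
  · intro h
    obtain ⟨⟨a, S⟩, S'⟩ := p
    have : ∀ x, Relation.ReflTransGen (fun x y =>
        (x.length = UninterpretedProgram.stSize ar w.length ∧
          y.length = UninterpretedProgram.stSize ar w.length ∧
          R w a (St.dec ar w.length x) (St.dec ar w.length y)) ∧
        x.length = UninterpretedProgram.stSize ar w.length ∧
        y.length = UninterpretedProgram.stSize ar w.length) S.enc x →
        Relation.ReflTransGen (R w a) S (St.dec ar w.length x) := by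
      intro x h
      induction h with
      | refl => rw [St.dec_enc]
      | tail _ h ih => exact ih.tail h.1.2.2
    simpa only [St.dec_enc] using this _ h

end

/-- The least binary relation closed under the rules `Φ`. -/
def Lfp {I : Type} (Φ : (I → I → Prop) → I → I → Prop) (i j : I) : Prop :=
  ∀ X : I → I → Prop, (∀ i j, Φ X i j → X i j) → X i j

section

variable {A : Type} {Γ : List A → Type} [Ctx Γ]

/-- The arity of the single symbol of a structure that consists of a binary relation. -/
def binary : Unit → ℕ := fun _ => 2

theorem RegOf.pair {f g : ∀ w, Γ w → Fin w.length} (hf : RegOf (τ := fun w => Fin w.length) f)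
    (hg : RegOf (τ := fun w => Fin w.length) g) :
    RegOf (τ := fun w => Fin 2 → Fin w.length) fun w a => ![f w a, g w a] :=
  .tuple fun i => by
    match i with
    | 0 => exact hf
    | 1 => exact hg

theorem PS.lfp {Φ : ∀ w, Γ w → (Fin w.length → Fin w.length → Prop) →
      Fin w.length → Fin w.length → Prop}
    (h : PS fun w (p : ((Γ w × St binary w.length) × Fin w.length) × Fin w.length) =>
      Φ w p.1.1.1 (fun i j => p.1.1.2 () ![i, j]) p.1.2 p.2) :
    PS fun w (p : (Γ w × Fin w.length) × Fin w.length) => Lfp (Φ w p.1.1) p.1.2 p.2 := by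
  have h1 := h.comp (Γ := fun w => ((((Γ w × Fin w.length) × Fin w.length) × St binary w.length) ×
      Fin w.length) × Fin w.length)
    (((RegMap.id.fst.fst.fst.fst.fst.prod RegOf.snd.fst.fst).prod RegOf.snd.fst).prod RegOf.snd)
  refine PS.congr (.allSt (ar := binary)
    (R := fun w (p : (Γ w × Fin w.length) × Fin w.length) S =>
      (∀ i j, Φ w p.1.1 (fun i j => S () ![i, j]) i j → S () ![i, j]) → S () ![p.1.2, p.2])
    (.imp (.allFin (.allFin (.imp h1 (.rel RegOf.snd.fst.fst () (RegOf.snd.fst.pair RegOf.snd)))))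
      (.rel RegOf.snd () (RegOf.snd.fst.fst.pair RegOf.snd.fst)))) fun w p => ?_
  constructor
  · exact fun h S hS => h _ hS
  · intro h X hX
    exact h (fun _ (z : Fin 2 → Fin w.length) => X (z 0) (z 1)) hX

theorem lfp_iff_reflTransGen {I : Type} {r : I → I → Prop} {i j : I} :
    Lfp (fun X i j => i = j ∨ ∃ k, X i k ∧ r k j) i j ↔ Relation.ReflTransGen r i j := by
  constructor
  · refine fun h => h _ ?_
    rintro i j (rfl | ⟨k, h, h'⟩)
    · exact .refl
    · exact h.tail h'
  · intro h X hX
    induction h with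
    | refl => exact hX _ _ (Or.inl rfl)
    | tail _ h ih => exact hX _ _ (Or.inr ⟨_, ih, h⟩)

theorem PS.rtc {r : ∀ w, Γ w → Fin w.length → Fin w.length → Prop}
    (h : PS fun w (p : (Γ w × Fin w.length) × Fin w.length) => r w p.1.1 p.1.2 p.2) :
    PS fun w (p : (Γ w × Fin w.length) × Fin w.length) =>
      Relation.ReflTransGen (r w p.1.1) p.1.2 p.2 := by
  have h1 := h.comp
    (Γ := fun w => (((Γ w × St binary w.length) × Fin w.length) × Fin w.length) × Fin w.length)
    ((RegMap.id.fst.fst.fst.fst.prod RegOf.snd).prod RegOf.snd.fst)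
  exact (PS.lfp (Φ := fun w a X i j => i = j ∨ ∃ k, X i k ∧ r w a k j)
    (.or (.eqFin RegOf.snd.fst RegOf.snd) (.exFin
      (.and (.rel RegOf.snd.fst.fst.fst () (RegOf.snd.fst.fst.pair RegOf.snd)) h1)))).congr
    fun w p => lfp_iff_reflTransGen.symm

end

end UninterpretedProgram

namespace UninterpretedProgram

/-! ### Congruence closures -/

section

variable {L : FirstOrder.Language.{0, 0}} {V : Type}

open FirstOrder.Language (Term)
open FirstOrder.Language.Term (func)

theorem CongCl.mono {A A' : Set (L.Term V × L.Term V)} (h : A ⊆ A') {t u : L.Term V}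
    (htu : CongCl A t u) : CongCl A' t u := by
  induction htu with
  | base h' => exact .base (h h')
  | refl t => exact .refl t
  | symm _ ih => exact .symm ih
  | trans _ _ ih ih' => exact .trans ih ih'
  | congr f _ ih => exact .congr f ih

/-- Terms that are equal, or have the same head symbol and congruent arguments. -/
def HeadCong (A : Set (L.Term V × L.Term V)) (t u : L.Term V) : Prop :=
  t = u ∨ ∃ (n : ℕ) (f : L.Functions n) (ts us : Fin n → L.Term V),
    t = func f ts ∧ u = func f us ∧ ∀ i, CongCl A (ts i) (us i)

variable {A : Set (L.Term V × L.Term V)} {Tm : Set (L.Term V)}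

theorem HeadCong.symm {t u : L.Term V} (h : HeadCong A t u) : HeadCong A u t := by
  rcases h with rfl | ⟨n, f, ts, us, rfl, rfl, h⟩
  · exact Or.inl rfl
  · exact Or.inr ⟨n, f, us, ts, rfl, rfl, fun i => (h i).symm⟩

theorem HeadCong.trans {t u v : L.Term V} (h : HeadCong A t u) (h' : HeadCong A u v) :
    HeadCong A t v := by
  rcases h with rfl | ⟨n, f, ts, us, rfl, rfl, h⟩
  · exact h'
  · rcases h' with rfl | ⟨n', f', ts', us', h1, rfl, h'⟩
    · exact Or.inr ⟨n, f, ts, us, rfl, rfl, h⟩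
    · cases h1
      exact Or.inr ⟨n, f, ts, us', rfl, rfl, fun i => (h i).trans (h' i)⟩

theorem HeadCong.congCl {t u : L.Term V} (h : HeadCong A t u) : CongCl A t u := by
  rcases h with rfl | ⟨n, f, ts, us, rfl, rfl, h⟩
  · exact .refl _
  · exact .congr f h

/-- A set of terms that contains the terms of `A` and is closed under subterms. -/
structure Closed (A : Set (L.Term V × L.Term V)) (Tm : Set (L.Term V)) : Prop where
  left : ∀ {t u}, (t, u) ∈ A → t ∈ Tm
  right : ∀ {t u}, (t, u) ∈ A → u ∈ Tm
  arg : ∀ {n : ℕ} {f : L.Functions n} {ts : Fin n → L.Term V}, func f ts ∈ Tm → ∀ i, ts i ∈ Tm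

/-- Congruences that are not obtained from congruences of the arguments go through terms of `A`. -/
theorem Closed.headCong_or (hc : Closed A Tm) {t u : L.Term V} (h : CongCl A t u) :
    HeadCong A t u ∨ (∃ m ∈ Tm, HeadCong A t m) ∧ ∃ m ∈ Tm, HeadCong A u m := by
  induction h with
  | base h => exact Or.inr ⟨⟨_, hc.left h, Or.inl rfl⟩, _, hc.right h, Or.inl rfl⟩
  | refl t => exact Or.inl (Or.inl rfl)
  | symm _ ih => exact ih.imp HeadCong.symm And.symm
  | trans _ _ ih ih' =>
    rcases ih with h | ⟨h1, m, hm, h2⟩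
    · rcases ih' with h' | ⟨⟨m, hm, h1⟩, h2⟩
      · exact Or.inl (h.trans h')
      · exact Or.inr ⟨⟨m, hm, h.trans h1⟩, h2⟩
    · rcases ih' with h' | ⟨_, h3⟩
      · exact Or.inr ⟨h1, m, hm, h'.symm.trans h2⟩
      · exact Or.inr ⟨h1, h3⟩
  | congr f h _ => exact Or.inl (Or.inr ⟨_, f, _, _, rfl, rfl, h⟩)

/-- A term congruent to a computed term has the same head symbol as some computed term with
congruent arguments. -/
theorem Closed.exists_func (hc : Closed A Tm) {m : L.Term V} (hm : m ∈ Tm) {n : ℕ}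
    {f : L.Functions n} {ts : Fin n → L.Term V} (h : CongCl A m (func f ts)) :
    ∃ ms, func f ms ∈ Tm ∧ ∀ i, CongCl A (ms i) (ts i) := by
  have : ∃ m ∈ Tm, HeadCong A (func f ts) m := by
    rcases hc.headCong_or h with h | ⟨_, h⟩
    · exact ⟨m, hm, h.symm⟩
    · exact h
  obtain ⟨m, hm, rfl | ⟨_, _, _, us, h1, rfl, h⟩⟩ := this
  · exact ⟨ts, hm, fun i => .refl _⟩
  · cases h1
    exact ⟨us, hm, fun i => (h i).symm⟩

/-- `Sup A u t`: modulo `A`, the term `t` is reached from `u` by passing to arguments. -/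
def Sup (A : Set (L.Term V × L.Term V)) : L.Term V → L.Term V → Prop :=
  Relation.ReflTransGen fun u t => CongCl A u t ∨
    ∃ (n : ℕ) (f : L.Functions n) (ts : Fin n → L.Term V) (i : Fin n),
      CongCl A u (func f ts) ∧ CongCl A (ts i) t

theorem Sup.of_congCl {u t : L.Term V} (h : CongCl A u t) : Sup A u t := .single (Or.inl h)

theorem Sup.of_arg {n : ℕ} {f : L.Functions n} {ts : Fin n → L.Term V} {u t : L.Term V} (i : Fin n)
    (h : CongCl A u (func f ts)) (h' : CongCl A (ts i) t) : Sup A u t :=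
  .single (Or.inr ⟨_, f, ts, i, h, h'⟩)

theorem Sup.trans {u t s : L.Term V} (h : Sup A u t) (h' : Sup A t s) : Sup A u s :=
  Relation.ReflTransGen.trans h h'

theorem Sup.mono {A' : Set (L.Term V × L.Term V)} (hA : A ⊆ A') {u t : L.Term V} (h : Sup A u t) :
    Sup A' u t := by
  induction h with
  | refl => exact .refl
  | tail _ h ih =>
    refine ih.trans ?_
    rcases h with h | ⟨n, f, ts, i, h, h'⟩
    · exact .of_congCl (h.mono hA)
    · exact .of_arg i (h.mono hA) (h'.mono hA)

theorem sup_iff_supertermMod {u t : L.Term V} : Sup A u t ↔ SupertermMod A u t := by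
  constructor
  · intro h
    induction h using Relation.ReflTransGen.head_induction_on with
    | refl => exact ⟨t, t, .refl t, .refl t, .refl t⟩
    | head h _ ih =>
      obtain ⟨u', t', hu, ht, hs⟩ := ih
      rcases h with h | ⟨n, f, ts, i, h, h'⟩
      · exact ⟨u', t', hu.trans h.symm, ht, hs⟩
      · refine ⟨func f (Function.update ts i u'), t', ?_, ht, ?_⟩
        · refine .trans (.congr f fun j => ?_) h.symm
          by_cases hj : j = i
          · subst hj
            rw [Function.update_self]
            exact hu.trans h'.symm
          · rw [Function.update_of_ne hj]
            exact .refl _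
        · exact .func f _ i (by rwa [Function.update_self])
  · rintro ⟨u', t', hu, ht, hs⟩
    have : Sup A u' t' := by
      clear hu ht
      induction hs with
      | refl => exact .refl
      | func f us i _ ih => exact .trans (.of_arg i (.refl _) (.refl _)) ih
    exact (Sup.of_congCl hu.symm).trans (this.trans (.of_congCl ht))

/-! ### Summaries of executions -/

/-- The information about an execution on which its coherent continuations depend. The type `I`
names the program variables. -/
@[ext] structure Summ (L : FirstOrder.Language.{0, 0}) (I : Type) where
  /-- two variables hold congruent terms -/
  E : I → I → Prop
  /-- two variables `a`, `b` hold terms with head symbol `f` whose arguments are pairwise congruent,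
  except that the arguments selected by the mask are those held by variables `u` and `v` -/
  K : ∀ f : Σ n, L.Functions n, (Fin f.1 → Bool) → (Fin f.1 → I) → (Fin f.1 → I) → I → I → Prop
  /-- the term `f(z)` has been computed -/
  C : ∀ f : Σ n, L.Functions n, (Fin f.1 → I) → Prop
  /-- a superterm of the term held by the variable has been computed and is not held any more -/
  D : I → Prop

variable {I : Type}

/-- The summary for assumed equalities `A`, computed terms `Tm` and the terms `h` that are held. -/
def summ (A : Set (L.Term V × L.Term V)) (Tm : Set (L.Term V)) (h : I → L.Term V) : Summ L I where
  E i j := CongCl A (h i) (h j)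
  K f M u v a b := ∃ t t' : Fin f.1 → L.Term V,
    CongCl A (h a) (func f.2 t) ∧ CongCl A (h b) (func f.2 t') ∧ ∀ i,
      (M i = true → CongCl A (t i) (h (u i)) ∧ CongCl A (t' i) (h (v i))) ∧
      (M i = false → CongCl A (t i) (t' i))
  C f z := ∃ m ∈ Tm, CongCl A m (func f.2 fun i => h (z i))
  D v := ∃ m ∈ Tm, Sup A m (h v) ∧ ∀ z, ¬ CongCl A m (h z)

namespace Summ

/-- `y` holds the term `f(z)`. -/
def Holds (S : Summ L I) (f : Σ n, L.Functions n) (z : Fin f.1 → I) (y : I) : Prop :=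
  S.K f (fun _ => true) z z y y

/-- The term held by `v` is congruent to, or an argument of, the one held by `u`. -/
def Child (S : Summ L I) (u v : I) : Prop :=
  S.E u v ∨ ∃ (f : Σ n, L.Functions n) (i : Fin f.1),
    S.K f (fun j => decide (j = i)) (fun _ => v) (fun _ => v) u u

/-- The summary after the term held by `y` is stored in the variables `X`. -/
def copy (S : Summ L I) (s : I → I) : Summ L I where
  E i j := S.E (s i) (s j)
  K f M u v a b := S.K f M (fun i => s (u i)) (fun i => s (v i)) (s a) (s b)
  C f z := S.C f fun i => s (z i)
  D v := S.D (s v) ∨ ∃ u, Relation.ReflTransGen S.Child u (s v) ∧ ∀ z, ¬ S.E u (s z)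

/-- The summary after a new term `g(z)` is stored in the variables `X`. -/
def fresh (S : Summ L I) (X : I → Prop) (g : Σ n, L.Functions n) (z : Fin g.1 → I) : Summ L I where
  E i j := (X i ∧ X j) ∨ (¬ X i ∧ ¬ X j ∧ S.E i j)
  K f M u v a b := (∀ i, M i = true → ¬ X (u i) ∧ ¬ X (v i)) ∧
    ((¬ X a ∧ ¬ X b ∧ S.K f M u v a b) ∨
     ∃ e : f = g,
      (X a ∧ ¬ X b ∧ (∀ i, M i = true → S.E (z (e ▸ i)) (u i)) ∧
        S.Holds f (fun i => if M i = true then v i else z (e ▸ i)) b) ∨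
      (¬ X a ∧ X b ∧ (∀ i, M i = true → S.E (z (e ▸ i)) (v i)) ∧
        S.Holds f (fun i => if M i = true then u i else z (e ▸ i)) a) ∨
      (X a ∧ X b ∧ ∀ i, M i = true → S.E (z (e ▸ i)) (u i) ∧ S.E (z (e ▸ i)) (v i)))
  C f y := (∀ i, ¬ X (y i)) ∧ (S.C f y ∨ ∃ e : f = g, ∀ i, S.E (z (e ▸ i)) (y i))
  D v := ¬ X v ∧ (S.D v ∨ ∃ u, Relation.ReflTransGen S.Child u v ∧ ∀ z, ¬ X z → ¬ S.E u z)

/-- The equalities between variables after `x = y` is assumed. -/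
def eqv (S : Summ L I) (x y : I) : I → I → Prop :=
  Lfp fun X i j => S.E i j ∨ (i = x ∧ j = y) ∨ X j i ∨ (∃ k, X i k ∧ X k j) ∨
    ∃ f M, ∃ u v, S.K f M u v i j ∧ ∀ k, M k = true → X (u k) (v k)

/-- The summary after `x = y` is assumed. -/
def assume (S : Summ L I) (x y : I) : Summ L I where
  E := S.eqv x y
  K f M u v a b := ∃ M', ∃ u' v', ∃ a' b', S.K f M' u' v' a' b' ∧
    S.eqv x y a a' ∧ S.eqv x y b b' ∧ ∀ i,
      (M i = true → M' i = true ∧ S.eqv x y (u i) (u' i) ∧ S.eqv x y (v i) (v' i)) ∧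
      (M i = false → M' i = true → S.eqv x y (u' i) (v' i))
  C f z := ∃ z', S.C f z' ∧ ∀ i, S.eqv x y (z i) (z' i)
  D v := ∃ u, S.D u ∧ Relation.ReflTransGen (fun i j => S.Child i j ∨ S.eqv x y i j) u v

end Summ

/-! #### Superterms and the variables holding them -/

variable {h : I → L.Term V}

theorem holds_iff {f : Σ n, L.Functions n} {z : Fin f.1 → I} {y : I} :
    (summ A Tm h).Holds f z y ↔ CongCl A (h y) (func f.2 fun i => h (z i)) := by
  constructor
  · rintro ⟨t, _, h1, _, h2⟩
    exact h1.trans (.congr _ fun i => ((h2 i).1 rfl).1)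
  · exact fun h1 => ⟨_, _, h1, h1, fun i => ⟨fun _ => ⟨.refl _, .refl _⟩, fun _ => .refl _⟩⟩

theorem child_iff {u v : I} : (summ A Tm h).Child u v ↔ CongCl A (h u) (h v) ∨
    ∃ (n : ℕ) (f : L.Functions n) (ts : Fin n → L.Term V) (i : Fin n),
      CongCl A (h u) (func f ts) ∧ CongCl A (ts i) (h v) := by
  refine or_congr Iff.rfl ⟨?_, ?_⟩
  · rintro ⟨⟨n, f⟩, i, t, _, h1, _, h2⟩
    exact ⟨n, f, t, i, h1, ((h2 i).1 (decide_eq_true rfl)).1⟩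
  · rintro ⟨n, f, ts, i, h1, h2⟩
    refine ⟨⟨n, f⟩, i, ts, ts, h1, h1, fun j => ⟨fun hj => ?_, fun _ => .refl _⟩⟩
    obtain rfl := of_decide_eq_true hj
    exact ⟨h2, h2⟩

theorem Sup.of_child {u v : I} (huv : (summ A Tm h).Child u v) : Sup A (h u) (h v) :=
  .single (child_iff.1 huv)

theorem Sup.of_rtc_child {u v : I}
    (huv : Relation.ReflTransGen (summ A Tm h).Child u v) : Sup A (h u) (h v) := by
  induction huv with
  | refl => exact .refl
  | tail _ h' ih => exact ih.trans (.of_child h')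

/-- A chain of superterms either consists of terms that are held, or contains a computed term that
is not held. -/
theorem Closed.sup_cases (hc : Closed A Tm) {v : I} {t : L.Term V} (ht : Sup A t (h v))
    {m : L.Term V} (hm : m ∈ Tm) (hmt : CongCl A m t) :
    (summ A Tm h).D v ∨
      ∃ u, CongCl A m (h u) ∧ Relation.ReflTransGen (summ A Tm h).Child u v := by
  induction ht using Relation.ReflTransGen.head_induction_on generalizing m with
  | refl => exact Or.inr ⟨v, hmt, .refl⟩
  | @head t t' h1 h2 ih =>
    rcases h1 with h1 | ⟨n, f, ts, i, h1, h1'⟩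
    · exact ih hm (hmt.trans h1)
    · obtain ⟨ms, hms, hms'⟩ := hc.exists_func hm (hmt.trans h1)
      rcases ih (hc.arg hms i) ((hms' i).trans h1') with h3 | ⟨u, h3, h4⟩
      · exact Or.inl h3
      · by_cases hu : ∃ u, CongCl A m (h u)
        · obtain ⟨u', hu'⟩ := hu
          exact Or.inr ⟨u', hu', .head (child_iff.2 (Or.inr ⟨n, f, ts, i,
            hu'.symm.trans (hmt.trans h1), (hms' i).symm.trans h3⟩)) h4⟩
        · refine Or.inl ⟨m, hm, ?_, not_exists.1 hu⟩
          exact (Sup.of_congCl hmt).trans (.head (Or.inr ⟨n, f, ts, i, h1, h1'⟩) h2)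

/-- The terms above the one held by `v` that are not held by the variables in the range of `s`. -/
theorem Closed.exists_sup_iff (hc : Closed A Tm) (hh : ∀ i, h i ∈ Tm) {v : I} {P : I → Prop} :
    (∃ m ∈ Tm, Sup A m (h v) ∧ ∀ z, P z → ¬ CongCl A m (h z)) ↔
      (summ A Tm h).D v ∨ ∃ u, Relation.ReflTransGen (summ A Tm h).Child u v ∧
        ∀ z, P z → ¬ (summ A Tm h).E u z := by
  constructor
  · rintro ⟨m, hm, h1, h2⟩
    rcases hc.sup_cases h1 hm (.refl m) with h3 | ⟨u, h3, h4⟩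
    · exact Or.inl h3
    · exact Or.inr ⟨u, h4, fun z hz h5 => h2 z hz (h3.trans h5)⟩
  · rintro (⟨m, hm, h1, h2⟩ | ⟨u, h1, h2⟩)
    · exact ⟨m, hm, h1, fun z _ => h2 z⟩
    · exact ⟨h u, hh u, .of_rtc_child h1, h2⟩

/-! #### Assignments of terms that are already held -/

theorem Closed.summ_copy (hc : Closed A Tm) (hh : ∀ i, h i ∈ Tm) {Tm' : Set (L.Term V)}
    {h' : I → L.Term V} {s : I → I} (hs : ∀ i, CongCl A (h' i) (h (s i))) (hT : Tm ⊆ Tm')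
    (hT' : ∀ m ∈ Tm', ∃ m' ∈ Tm, CongCl A m m') :
    summ A Tm' h' = (summ A Tm h).copy s := by
  have hex : ∀ {P : L.Term V → Prop}, (∀ m m', CongCl A m m' → P m → P m') →
      ((∃ m ∈ Tm', P m) ↔ ∃ m ∈ Tm, P m) := by
    intro P hP
    constructor
    · rintro ⟨m, hm, h⟩
      obtain ⟨m', hm', h'⟩ := hT' m hm
      exact ⟨m', hm', hP _ _ h' h⟩
    · rintro ⟨m, hm, h⟩
      exact ⟨m, hT hm, h⟩
  have hl : ∀ {t i}, CongCl A t (h' i) ↔ CongCl A t (h (s i)) := fun {t i} =>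
    ⟨fun h => h.trans (hs i), fun h => h.trans (hs i).symm⟩
  have hr : ∀ {t i}, CongCl A (h' i) t ↔ CongCl A (h (s i)) t := fun {t i} =>
    ⟨fun h => (hs i).symm.trans h, fun h => (hs i).trans h⟩
  ext
  · simp only [summ, Summ.copy, hl, hr]
  · simp only [summ, Summ.copy, hl, hr]
  · rename_i f z
    simp only [summ, Summ.copy]
    rw [hex fun m m' h1 h2 => h1.symm.trans h2]
    refine exists_congr fun m => and_congr_right fun _ => ?_
    have : CongCl A (func f.2 fun i => h' (z i)) (func f.2 fun i => h (s (z i))) :=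
      .congr _ fun i => hs _
    exact ⟨fun h => h.trans this, fun h => h.trans this.symm⟩
  · rename_i v
    have := hc.exists_sup_iff (h := h) hh (v := s v) (P := fun z => z ∈ Set.range s)
    simp only [Set.forall_mem_range] at this
    refine Iff.trans ?_ this
    rw [← hex fun m m' h1 h2 => ⟨(Sup.of_congCl h1.symm).trans h2.1, fun z h3 =>
      h2.2 z (h1.trans h3)⟩]
    refine exists_congr fun m => and_congr_right fun _ => and_congr ⟨fun h => ?_, fun h => ?_⟩ ?_
    · exact h.trans (.of_congCl (hs v))
    · exact h.trans (.of_congCl (hs v).symm)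
    · simp only [hl]

end

end UninterpretedProgram

namespace UninterpretedProgram

/-! #### Assignments of new terms -/

section

variable {L : FirstOrder.Language.{0, 0}} {V I : Type}

open FirstOrder.Language (Term)
open FirstOrder.Language.Term (func)

variable {A : Set (L.Term V × L.Term V)} {Tm : Set (L.Term V)} {h : I → L.Term V}

/-- A term not congruent to any computed term is congruent only to terms with the same head symbol
and congruent arguments. -/
theorem Closed.new_term (hc : Closed A Tm) {t u : L.Term V}
    (hn : ∀ m ∈ Tm, ¬ CongCl A m t) (htu : CongCl A t u) : HeadCong A t u := by
  rcases hc.headCong_or htu with h1 | ⟨⟨m, hm, h1⟩, _⟩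
  · exact h1
  · exact absurd h1.congCl.symm (hn m hm)

theorem Closed.new_func (hc : Closed A Tm) {f g : Σ n, L.Functions n} {us : Fin g.1 → L.Term V}
    (hn : ∀ m ∈ Tm, ¬ CongCl A m (func g.2 us)) {ts : Fin f.1 → L.Term V}
    (h3 : CongCl A (func g.2 us) (func f.2 ts)) :
    ∃ e : f = g, ∀ i, CongCl A (ts i) (us (e ▸ i)) := by
  obtain ⟨k, f⟩ := f
  obtain ⟨n, g⟩ := g
  simp only at us ts hn h3
  rcases hc.new_term hn h3 with h4 | ⟨_, _, us, us', h4, h5, h6⟩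
  · cases h4
    exact ⟨rfl, fun i => .refl _⟩
  · cases h4
    cases h5
    exact ⟨rfl, fun i => (h6 i).symm⟩

theorem Closed.summ_fresh (hc : Closed A Tm) (hh : ∀ i, h i ∈ Tm) {X : I → Prop}
    (hX : ∃ i, X i) {g : Σ n, L.Functions n} {z : Fin g.1 → I} {h' : I → L.Term V}
    (hn : ¬ (summ A Tm h).C g z) (h1 : ∀ i, X i → h' i = func g.2 fun i => h (z i))
    (h2 : ∀ i, ¬ X i → h' i = h i) :
    summ A (insert (func g.2 fun i => h (z i)) Tm) h' = (summ A Tm h).fresh X g z := by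
  set t : L.Term V := func g.2 fun i => h (z i) with ht
  have hn : ∀ m ∈ Tm, ¬ CongCl A m t := fun m hm h3 => hn ⟨m, hm, h3⟩
  have hinv : ∀ {f : Σ n, L.Functions n} {ts : Fin f.1 → L.Term V}, CongCl A t (func f.2 ts) →
      ∃ e : f = g, ∀ i, CongCl A (ts i) (h (z (e ▸ i))) := hc.new_func hn
  have hX' : ∀ {i}, X i → CongCl A (h' i) t := fun {i} hi => by rw [h1 i hi]; exact .refl _
  -- arguments of a term congruent to a computed or the new term are not new
  have harg : ∀ {f : Σ n, L.Functions n} {ts : Fin f.1 → L.Term V} {i j},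
      CongCl A (h' j) (func f.2 ts) → ¬ CongCl A (ts i) t := by
    intro f ts i j h3 h4
    by_cases hj : X j
    · rw [h1 j hj] at h3
      obtain ⟨e, h5⟩ := hinv h3
      exact hn _ (hh _) ((h5 i).symm.trans h4)
    · rw [h2 j hj] at h3
      obtain ⟨ms, h5, h6⟩ := hc.exists_func (hh j) h3
      exact hn _ (hc.arg h5 i) ((h6 i).trans h4)
  ext
  · rename_i i j
    simp only [summ, Summ.fresh]
    by_cases hi : X i <;> by_cases hj : X j <;> simp only [hi, hj, not_true, not_false_iff,
      true_and, false_and, and_true, and_false, or_false, false_or, iff_true, iff_false]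
    · rw [h1 i hi, h1 j hj]; exact .refl _
    · rw [h1 i hi, h2 j hj]; exact fun h3 => hn _ (hh j) h3.symm
    · rw [h2 i hi, h1 j hj]; exact fun h3 => hn _ (hh i) h3
    · rw [h2 i hi, h2 j hj]
  · rename_i f M u v a b
    constructor
    · rintro ⟨t1, t2, h3, h4, h5⟩
      have hu : ∀ i, M i = true → ¬ X (u i) := fun i hi hx =>
        harg h3 (h1 _ hx ▸ ((h5 i).1 hi).1)
      have hv : ∀ i, M i = true → ¬ X (v i) := fun i hi hx =>
        harg h4 (h1 _ hx ▸ ((h5 i).1 hi).2)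
      refine ⟨fun i hi => ⟨hu i hi, hv i hi⟩, ?_⟩
      replace h5 : ∀ i, (M i = true → CongCl A (t1 i) (h (u i)) ∧ CongCl A (t2 i) (h (v i))) ∧
          (M i = false → CongCl A (t1 i) (t2 i)) := fun i =>
        ⟨fun hi => h2 _ (hu i hi) ▸ h2 _ (hv i hi) ▸ (h5 i).1 hi, (h5 i).2⟩
      by_cases ha : X a
      · refine Or.inr ?_
        rw [h1 a ha] at h3
        obtain ⟨e, h6⟩ := hinv h3
        cases e
        refine ⟨rfl, ?_⟩
        by_cases hb : X b
        · rw [h1 b hb] at h4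
          obtain ⟨_, h7⟩ := hinv h4
          exact Or.inr (Or.inr ⟨ha, hb, fun i hi =>
            ⟨(h6 i).symm.trans ((h5 i).1 hi).1, (h7 i).symm.trans ((h5 i).1 hi).2⟩⟩)
        · rw [h2 b hb] at h4
          refine Or.inl ⟨ha, hb, fun i hi => (h6 i).symm.trans ((h5 i).1 hi).1, ?_⟩
          refine holds_iff.2 (h4.trans (.congr _ fun i => ?_))
          rcases hi : M i with _ | _
          · simpa using ((h5 i).2 hi).symm.trans (h6 i)
          · simpa using ((h5 i).1 hi).2
      · rw [h2 a ha] at h3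
        by_cases hb : X b
        · refine Or.inr ?_
          rw [h1 b hb] at h4
          obtain ⟨e, h6⟩ := hinv h4
          cases e
          refine ⟨rfl, Or.inr (Or.inl ⟨ha, hb, fun i hi => (h6 i).symm.trans ((h5 i).1 hi).2, ?_⟩)⟩
          refine holds_iff.2 (h3.trans (.congr _ fun i => ?_))
          rcases hi : M i with _ | _
          · simpa using ((h5 i).2 hi).trans (h6 i)
          · simpa using ((h5 i).1 hi).1
        · rw [h2 b hb] at h4
          exact Or.inl ⟨ha, hb, t1, t2, h3, h4, h5⟩
    · rintro ⟨h3, h4⟩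
      have hu : ∀ {i}, M i = true → h' (u i) = h (u i) := fun {i} hi => h2 _ (h3 i hi).1
      have hv : ∀ {i}, M i = true → h' (v i) = h (v i) := fun {i} hi => h2 _ (h3 i hi).2
      rcases h4 with ⟨ha, hb, t1, t2, h4, h5, h6⟩ | ⟨e, h4⟩
      · refine ⟨t1, t2, h2 a ha ▸ h4, h2 b hb ▸ h5, fun i => ⟨fun hi => ?_, (h6 i).2⟩⟩
        rw [hu hi, hv hi]
        exact (h6 i).1 hi
      · cases e
        rcases h4 with ⟨ha, hb, h4, h5⟩ | ⟨ha, hb, h4, h5⟩ | ⟨ha, hb, h4⟩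
        · refine ⟨_, _, hX' ha, h2 b hb ▸ holds_iff.1 h5, fun i => ⟨fun hi => ?_,
            fun hi => ?_⟩⟩
          · rw [hu hi, hv hi]
            exact ⟨h4 i hi, by simpa [hi] using .refl _⟩
          · simpa [hi] using .refl _
        · refine ⟨_, _, h2 a ha ▸ holds_iff.1 h5, hX' hb, fun i => ⟨fun hi => ?_,
            fun hi => ?_⟩⟩
          · rw [hu hi, hv hi]
            exact ⟨by simpa [hi] using .refl _, h4 i hi⟩
          · simpa [hi] using .refl _
        · refine ⟨_, _, hX' ha, hX' hb, fun i => ⟨fun hi => ?_,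
            fun hi => .refl _⟩⟩
          rw [hu hi, hv hi]
          exact h4 i hi
  · rename_i f y
    constructor
    · rintro ⟨m, hm, h3⟩
      have hy : ∀ i, ¬ X (y i) := by
        intro i hi
        rcases Set.mem_insert_iff.1 hm with rfl | hm
        · obtain ⟨e, h5⟩ := hinv h3
          exact hn _ (hh _) ((h5 i).symm.trans (h1 _ hi ▸ .refl _))
        · obtain ⟨ms, h5, h6⟩ := hc.exists_func hm h3
          exact hn _ (hc.arg h5 i) ((h6 i).trans (h1 _ hi ▸ .refl _))
      refine ⟨hy, ?_⟩
      have : (fun i => h' (y i)) = fun i => h (y i) := funext fun i => h2 _ (hy i)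
      simp only [this] at h3
      rcases Set.mem_insert_iff.1 hm with rfl | hm
      · obtain ⟨e, h5⟩ := hinv h3
        exact Or.inr ⟨e, fun i => (h5 i).symm⟩
      · exact Or.inl ⟨m, hm, h3⟩
    · rintro ⟨hy, h3⟩
      have : (fun i => h' (y i)) = fun i => h (y i) := funext fun i => h2 _ (hy i)
      simp only [summ, this]
      rcases h3 with ⟨m, hm, h3⟩ | ⟨e, h3⟩
      · exact ⟨m, Set.mem_insert_of_mem _ hm, h3⟩
      · cases e
        exact ⟨t, Set.mem_insert _ _, .congr _ h3⟩
  · rename_i v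
    have hsup : ∀ {m u}, Sup A m u → m ∈ Tm → ∃ m' ∈ Tm, CongCl A m' u := by
      intro m u h3 hm
      induction h3 with
      | refl => exact ⟨m, hm, .refl _⟩
      | tail _ h3 ih =>
        obtain ⟨m', hm', h4⟩ := ih
        rcases h3 with h3 | ⟨_, f, ts, i, h3, h5⟩
        · exact ⟨m', hm', h4.trans h3⟩
        · obtain ⟨ms, h6, h7⟩ := hc.exists_func hm' (h4.trans h3)
          exact ⟨_, hc.arg h6 i, (h7 i).trans h5⟩
    have key : (summ A (insert t Tm) h').D v ↔
        ¬ X v ∧ ∃ m ∈ Tm, Sup A m (h v) ∧ ∀ z, ¬ X z → ¬ CongCl A m (h z) := by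
      constructor
      · rintro ⟨m, hm, h3, h4⟩
        have hm : m ∈ Tm := by
          rcases Set.mem_insert_iff.1 hm with rfl | hm
          · obtain ⟨i, hi⟩ := hX
            exact absurd (h1 i hi ▸ .refl _) (h4 i)
          · exact hm
        have hv : ¬ X v := by
          intro hv
          obtain ⟨m', hm', h5⟩ := hsup (h1 v hv ▸ h3) hm
          exact hn _ hm' h5
        exact ⟨hv, m, hm, h2 v hv ▸ h3, fun z hz => h2 z hz ▸ h4 z⟩
      · rintro ⟨hv, m, hm, h3, h4⟩
        refine ⟨m, Set.mem_insert_of_mem _ hm, (h2 v hv).symm ▸ h3, fun z => ?_⟩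
        by_cases hz : X z
        · rw [h1 z hz]
          exact hn m hm
        · rw [h2 z hz]
          exact h4 z hz
    rw [key, hc.exists_sup_iff hh]
    rfl

end

end UninterpretedProgram

namespace UninterpretedProgram

/-! #### Assumed equalities -/

section

variable {L : FirstOrder.Language.{0, 0}} {V I : Type}

open FirstOrder.Language (Term)
open FirstOrder.Language.Term (func var)

theorem Lfp.minimal {Φ : (I → I → Prop) → I → I → Prop} {X : I → I → Prop}
    (hX : ∀ i j, Φ X i j → X i j) {i j : I} (h : Lfp Φ i j) : X i j := h X hX

theorem Lfp.closed {Φ : (I → I → Prop) → I → I → Prop}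
    (hΦ : ∀ X Y : I → I → Prop, (∀ i j, X i j → Y i j) → ∀ i j, Φ X i j → Φ Y i j) {i j : I}
    (h : Φ (Lfp Φ) i j) : Lfp Φ i j := fun X hX =>
  hX _ _ (hΦ _ _ (fun _ _ h => h X hX) _ _ h)

namespace Summ

variable {S : Summ L I} {x y : I}

theorem eqv_closed {i j : I} (h : S.E i j ∨ (i = x ∧ j = y) ∨ S.eqv x y j i ∨
    (∃ k, S.eqv x y i k ∧ S.eqv x y k j) ∨
    ∃ f M, ∃ u v, S.K f M u v i j ∧ ∀ k, M k = true → S.eqv x y (u k) (v k)) : S.eqv x y i j := by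
  refine Lfp.closed ?_ h
  intro X Y hXY i j h
  rcases h with h | h | h | ⟨k, h, h'⟩ | ⟨f, M, u, v, h, h'⟩
  · exact Or.inl h
  · exact Or.inr (Or.inl h)
  · exact Or.inr (Or.inr (Or.inl (hXY _ _ h)))
  · exact Or.inr (Or.inr (Or.inr (Or.inl ⟨k, hXY _ _ h, hXY _ _ h'⟩)))
  · exact Or.inr (Or.inr (Or.inr (Or.inr ⟨f, M, u, v, h, fun k hk => hXY _ _ (h' k hk)⟩)))

theorem eqv_of_E {i j : I} (h : S.E i j) : S.eqv x y i j := eqv_closed (Or.inl h)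

theorem eqv_symm {i j : I} (h : S.eqv x y i j) : S.eqv x y j i :=
  eqv_closed (Or.inr (Or.inr (Or.inl h)))

theorem eqv_trans {i j k : I} (h : S.eqv x y i j) (h' : S.eqv x y j k) : S.eqv x y i k :=
  eqv_closed (Or.inr (Or.inr (Or.inr (Or.inl ⟨j, h, h'⟩))))

end Summ

variable {A : Set (L.Term V × L.Term V)} {Tm : Set (L.Term V)} {h : I → L.Term V} {x y : I}

/-- Computed terms that are congruent after `x = y` is assumed: they were congruent before, or
both are held by variables. -/
def Joined (A : Set (L.Term V × L.Term V)) (Tm : Set (L.Term V)) (h : I → L.Term V) (x y : I)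
    (t u : L.Term V) : Prop :=
  CongCl A t u ∨ ∃ i j, CongCl A t (h i) ∧ CongCl A u (h j) ∧ (summ A Tm h).eqv x y i j

theorem Joined.symm {t u : L.Term V} (htu : Joined A Tm h x y t u) : Joined A Tm h x y u t := by
  rcases htu with h1 | ⟨i, j, h1, h2, h3⟩
  · exact Or.inl h1.symm
  · exact Or.inr ⟨j, i, h2, h1, Summ.eqv_symm h3⟩

theorem Joined.trans {t u v : L.Term V} (htu : Joined A Tm h x y t u)
    (huv : Joined A Tm h x y u v) : Joined A Tm h x y t v := by
  rcases htu with h1 | ⟨i, j, h1, h2, h3⟩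
  · rcases huv with h4 | ⟨i', j', h4, h5, h6⟩
    · exact Or.inl (h1.trans h4)
    · exact Or.inr ⟨i', j', h1.trans h4, h5, h6⟩
  · rcases huv with h4 | ⟨i', j', h4, h5, h6⟩
    · exact Or.inr ⟨i, j, h1, h4.symm.trans h2, h3⟩
    · exact Or.inr ⟨i, j', h1, h5,
        Summ.eqv_trans h3 (Summ.eqv_trans (Summ.eqv_of_E (h2.symm.trans h4)) h6)⟩

theorem Joined.right_eqv {t : L.Term V} {i : I} (ht : Joined A Tm h x y t (h i)) :
    CongCl A t (h i) ∨ ∃ j, CongCl A t (h j) ∧ (summ A Tm h).eqv x y j i := by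
  rcases ht with h1 | ⟨i', j', h1, h2, h3⟩
  · exact Or.inl h1
  · exact Or.inr ⟨i', h1, Summ.eqv_trans h3 (Summ.eqv_of_E h2.symm)⟩

theorem Joined.exists_eqv {t : L.Term V} {i : I} (ht : Joined A Tm h x y t (h i)) :
    ∃ j, CongCl A t (h j) ∧ (summ A Tm h).eqv x y i j := by
  rcases ht.right_eqv with h1 | ⟨j, h1, h2⟩
  · exact ⟨i, h1, Summ.eqv_of_E (.refl _)⟩
  · exact ⟨j, h1, Summ.eqv_symm h2⟩

/-- New equalities only arise between superterms of `x` and `y`. -/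
theorem eqv_cases {i j : I} (hij : (summ A Tm h).eqv x y i j) : CongCl A (h i) (h j) ∨
    (Sup A (h i) (h x) ∨ Sup A (h i) (h y)) ∧ (Sup A (h j) (h x) ∨ Sup A (h j) (h y)) := by
  refine Lfp.minimal (X := fun i j => CongCl A (h i) (h j) ∨
    (Sup A (h i) (h x) ∨ Sup A (h i) (h y)) ∧ (Sup A (h j) (h x) ∨ Sup A (h j) (h y))) ?_ hij
  intro i j hij
  have hup : ∀ {t u}, Sup A t u → Sup A u (h x) ∨ Sup A u (h y) → Sup A t (h x) ∨ Sup A t (h y) :=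
    fun h1 h2 => h2.imp h1.trans h1.trans
  rcases hij with h1 | ⟨rfl, rfl⟩ | h1 | ⟨k, h1, h2⟩ | ⟨f, M, u, v, ⟨t, t', h1, h2, h3⟩, h4⟩
  · exact Or.inl h1
  · exact Or.inr ⟨Or.inl .refl, Or.inr .refl⟩
  · exact h1.imp CongCl.symm And.symm
  · rcases h1 with h1 | ⟨h1, h3⟩ <;> rcases h2 with h2 | ⟨h2, h4⟩
    · exact Or.inl (h1.trans h2)
    · exact Or.inr ⟨hup (.of_congCl h1) h2, h4⟩
    · exact Or.inr ⟨h1, hup (.of_congCl h2.symm) h3⟩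
    · exact Or.inr ⟨h1, h4⟩
  · by_cases h5 : ∀ k, M k = true → CongCl A (h (u k)) (h (v k))
    · refine Or.inl (h1.trans (.trans (.congr _ fun k => ?_) h2.symm))
      rcases hk : M k with _ | _
      · exact (h3 k).2 hk
      · exact ((h3 k).1 hk).1.trans ((h5 k hk).trans ((h3 k).1 hk).2.symm)
    · push Not at h5
      obtain ⟨k, hk, h5⟩ := h5
      obtain ⟨h6, h7⟩ := (h4 k hk).resolve_left h5
      exact Or.inr ⟨hup (.of_arg k h1 ((h3 k).1 hk).1) h6, hup (.of_arg k h2 ((h3 k).1 hk).2) h7⟩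

/-- All computed superterms of `x` and `y` are held. -/
def EarlyAt (A : Set (L.Term V × L.Term V)) (Tm : Set (L.Term V)) (h : I → L.Term V) (x y : I) :
    Prop := ¬ (summ A Tm h).D x ∧ ¬ (summ A Tm h).D y

theorem EarlyAt.held (he : EarlyAt A Tm h x y) {m : L.Term V} (hm : m ∈ Tm)
    (hs : Sup A m (h x) ∨ Sup A m (h y)) : ∃ z, CongCl A m (h z) := by
  by_contra hn
  push Not at hn
  exact hs.elim (fun hs => he.1 ⟨m, hm, hs, hn⟩) fun hs => he.2 ⟨m, hm, hs, hn⟩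

/-- `Joined` is compatible with function symbols, since the computed superterms of `x` and `y`
are still held. -/
theorem Joined.func (he : EarlyAt A Tm h x y) {n : ℕ} {f : L.Functions n}
    {ms ms' : Fin n → L.Term V} (hm : func f ms ∈ Tm) (hm' : func f ms' ∈ Tm)
    (hj : ∀ i, Joined A Tm h x y (ms i) (ms' i)) :
    Joined A Tm h x y (func f ms) (func f ms') := by
  classical
  by_cases hall : ∀ i, CongCl A (ms i) (ms' i)
  · exact Or.inl (.congr f hall)
  have h1 : ∀ i, ∃ u v, ¬ CongCl A (ms i) (ms' i) →
      CongCl A (ms i) (h u) ∧ CongCl A (ms' i) (h v) ∧ (summ A Tm h).eqv x y u v := by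
    intro i
    rcases hj i with h1 | ⟨u, v, h1⟩
    · exact ⟨x, x, fun h2 => absurd h1 h2⟩
    · exact ⟨u, v, fun _ => h1⟩
  choose u v h1 using h1
  push Not at hall
  obtain ⟨i, hi⟩ := hall
  obtain ⟨h2, h3, h4⟩ := h1 i hi
  obtain ⟨h5, h6⟩ := (eqv_cases h4).resolve_left fun h5 => hi (h2.trans (h5.trans h3.symm))
  obtain ⟨a, ha⟩ := he.held hm (h5.imp (Sup.trans (.of_arg i (.refl _) h2))
    (Sup.trans (.of_arg i (.refl _) h2)))
  obtain ⟨b, hb⟩ := he.held hm' (h6.imp (Sup.trans (.of_arg i (.refl _) h3))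
    (Sup.trans (.of_arg i (.refl _) h3)))
  refine Or.inr ⟨a, b, ha, hb, Summ.eqv_closed (Or.inr (Or.inr (Or.inr (Or.inr
    ⟨⟨n, f⟩, fun i => decide (¬ CongCl A (ms i) (ms' i)), u, v,
      ⟨ms, ms', ha.symm, hb.symm, fun i => ⟨fun hi => ?_, fun hi => ?_⟩⟩, fun i hi => ?_⟩))))⟩
  · have := h1 i (of_decide_eq_true hi)
    exact ⟨this.1, this.2.1⟩
  · exact not_not.1 (of_decide_eq_false hi)
  · exact (h1 i (of_decide_eq_true hi)).2.2

/-- `Evaluates t m`: evaluating `t` from the bottom up in the set `Tm` of computed terms, modulo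
`Joined`, yields `m`. -/
inductive Evaluates (A : Set (L.Term V × L.Term V)) (Tm : Set (L.Term V)) (h : I → L.Term V)
    (x y : I) : L.Term V → L.Term V → Prop
  | var {a : V} {m : L.Term V} : var a ∈ Tm → Joined A Tm h x y (var a) m →
      Evaluates A Tm h x y (var a) m
  | func {n : ℕ} {f : L.Functions n} {ts ms : Fin n → L.Term V} {m : L.Term V} :
      (∀ i, Evaluates A Tm h x y (ts i) (ms i)) → func f ms ∈ Tm →
      Joined A Tm h x y (func f ms) m → Evaluates A Tm h x y (func f ts) m

theorem Evaluates.joined {t m m' : L.Term V} (ht : Evaluates A Tm h x y t m)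
    (hm : Joined A Tm h x y m m') : Evaluates A Tm h x y t m' := by
  cases ht with
  | var h1 h2 => exact .var h1 (h2.trans hm)
  | func h1 h2 h3 => exact .func h1 h2 (h3.trans hm)

theorem Evaluates.unique (he : EarlyAt A Tm h x y) {t m m' : L.Term V}
    (h1 : Evaluates A Tm h x y t m) (h2 : Evaluates A Tm h x y t m') :
    Joined A Tm h x y m m' := by
  induction h1 generalizing m' with
  | var _ h4 =>
    cases h2 with
    | var _ h6 => exact h4.symm.trans h6
  | func h3 h4 h5 ih =>
    cases h2 with
    | func h6 h7 h8 => exact h5.symm.trans ((Joined.func he h4 h7 fun i => ih i (h6 i)).trans h8)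

theorem Closed.evaluates_self (hc : Closed A Tm) {t : L.Term V} (ht : t ∈ Tm) :
    Evaluates A Tm h x y t t := by
  induction t with
  | var a => exact .var ht (Or.inl (.refl _))
  | func f ts ih => exact .func (fun i => ih i (hc.arg ht i)) ht (Or.inl (.refl _))

/-- Terms with joined values, or with the same head symbol and related arguments. -/
inductive EvalCong (A : Set (L.Term V × L.Term V)) (Tm : Set (L.Term V)) (h : I → L.Term V)
    (x y : I) : L.Term V → L.Term V → Prop
  | eval {t u m : L.Term V} : Evaluates A Tm h x y t m → Evaluates A Tm h x y u m →
      EvalCong A Tm h x y t u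
  | var (a : V) : EvalCong A Tm h x y (var a) (var a)
  | func {n : ℕ} (f : L.Functions n) {ts us : Fin n → L.Term V} :
      (∀ i, EvalCong A Tm h x y (ts i) (us i)) → EvalCong A Tm h x y (func f ts) (func f us)

theorem EvalCong.refl (t : L.Term V) : EvalCong A Tm h x y t t := by
  induction t with
  | var a => exact .var a
  | func f ts ih => exact .func f ih

theorem EvalCong.symm {t u : L.Term V} (htu : EvalCong A Tm h x y t u) :
    EvalCong A Tm h x y u t := by
  induction htu with
  | eval h1 h2 => exact .eval h2 h1
  | var a => exact .var a
  | func f _ ih => exact .func f ih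

theorem EvalCong.evaluates (he : EarlyAt A Tm h x y) {t u m : L.Term V}
    (htu : EvalCong A Tm h x y t u) (ht : Evaluates A Tm h x y t m) :
    Evaluates A Tm h x y u m := by
  induction htu generalizing m with
  | eval h1 h2 => exact h2.joined (h1.unique he ht)
  | var a => exact ht
  | func f _ ih =>
    cases ht with
    | func h1 h2 h3 => exact .func (fun i => ih i (h1 i)) h2 h3

theorem EvalCong.trans (he : EarlyAt A Tm h x y) {t u v : L.Term V}
    (htu : EvalCong A Tm h x y t u) (huv : EvalCong A Tm h x y u v) :
    EvalCong A Tm h x y t v := by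
  induction htu generalizing v with
  | eval h1 h2 => exact .eval h1 (huv.evaluates he h2)
  | var a => exact huv
  | func f h1 ih =>
    cases huv with
    | eval h2 h3 => exact .eval ((EvalCong.func f h1).symm.evaluates he h2) h3
    | func _ h2 => exact .func f fun i => ih i (h2 i)

/-- Computed terms that become congruent when `x = y` is assumed are joined. -/
theorem Closed.joined_of_congCl (hc : Closed A Tm) (hh : ∀ i, h i ∈ Tm)
    (he : EarlyAt A Tm h x y) {m m' : L.Term V} (hm : m ∈ Tm) (hm' : m' ∈ Tm)
    (hmm : CongCl (insert (h x, h y) A) m m') : Joined A Tm h x y m m' := by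
  have key : ∀ {t u}, CongCl (insert (h x, h y) A) t u → EvalCong A Tm h x y t u := by
    intro t u htu
    induction htu with
    | base h1 =>
      rcases Set.mem_insert_iff.1 h1 with h1 | h1
      · obtain ⟨rfl, rfl⟩ := Prod.mk.inj h1
        exact .eval (hc.evaluates_self (hh x)) ((hc.evaluates_self (hh y)).joined
          (Or.inr ⟨y, x, .refl _, .refl _,
            Summ.eqv_symm (Summ.eqv_closed (Or.inr (Or.inl ⟨rfl, rfl⟩)))⟩))
      · exact .eval (hc.evaluates_self (hc.left h1)) ((hc.evaluates_self (hc.right h1)).joined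
          (Or.inl (.symm (.base h1))))
    | refl t => exact .refl t
    | symm _ ih => exact ih.symm
    | trans _ _ ih ih' => exact ih.trans he ih'
    | congr f _ ih => exact .func f ih
  exact ((key hmm).evaluates he (hc.evaluates_self hm)).unique he (hc.evaluates_self hm')

theorem congCl_of_eqv {i j : I} (hij : (summ A Tm h).eqv x y i j) :
    CongCl (insert (h x, h y) A) (h i) (h j) := by
  refine Lfp.minimal (X := fun i j => CongCl (insert (h x, h y) A) (h i) (h j)) ?_ hij
  have hA := Set.subset_insert (h x, h y) A
  intro i j hij
  rcases hij with h1 | ⟨rfl, rfl⟩ | h1 | ⟨k, h1, h2⟩ | ⟨f, M, u, v, ⟨t, t', h1, h2, h3⟩, h4⟩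
  · exact h1.mono hA
  · exact .base (Set.mem_insert _ _)
  · exact h1.symm
  · exact h1.trans h2
  · refine (h1.mono hA).trans (.trans (.congr _ fun k => ?_) (h2.mono hA).symm)
    rcases hk : M k with _ | _
    · exact ((h3 k).2 hk).mono hA
    · exact (((h3 k).1 hk).1.mono hA).trans ((h4 k hk).trans (((h3 k).1 hk).2.mono hA).symm)

theorem Closed.insert (hc : Closed A Tm) (hh : ∀ i, h i ∈ Tm) :
    Closed (Insert.insert (h x, h y) A) Tm where
  left h1 := by
    rcases Set.mem_insert_iff.1 h1 with h1 | h1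
    · rw [(Prod.mk.inj h1).1]
      exact hh x
    · exact hc.left h1
  right h1 := by
    rcases Set.mem_insert_iff.1 h1 with h1 | h1
    · rw [(Prod.mk.inj h1).2]
      exact hh y
    · exact hc.right h1
  arg := hc.arg

theorem Closed.summ_assume (hc : Closed A Tm) (hh : ∀ i, h i ∈ Tm) (he : EarlyAt A Tm h x y) :
    summ (Insert.insert (h x, h y) A) Tm h = (summ A Tm h).assume x y := by
  have hA := Set.subset_insert (h x, h y) A
  have hc' := hc.insert hh (x := x) (y := y)
  have hj : ∀ {m m'}, m ∈ Tm → m' ∈ Tm → CongCl (Insert.insert (h x, h y) A) m m' →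
      Joined A Tm h x y m m' := fun hm hm' => hc.joined_of_congCl hh he hm hm'
  have hE : ∀ i j, CongCl (Insert.insert (h x, h y) A) (h i) (h j) ↔ (summ A Tm h).eqv x y i j := by
    intro i j
    refine ⟨fun h1 => ?_, congCl_of_eqv⟩
    obtain ⟨k, h2, h3⟩ := (hj (hh i) (hh j) h1).exists_eqv
    exact Summ.eqv_symm (Summ.eqv_trans h3 (Summ.eqv_of_E h2.symm))
  ext
  · exact hE _ _
  · rename_i f M u v a b
    constructor
    · rintro ⟨t, t', h1, h2, h3⟩
      obtain ⟨ms, hms, h4⟩ := hc'.exists_func (hh a) h1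
      obtain ⟨ms', hms', h5⟩ := hc'.exists_func (hh b) h2
      obtain ⟨a', ha', haa'⟩ :=
        (hj hms (hh a) (.trans (.congr _ h4) h1.symm)).exists_eqv
      obtain ⟨b', hb', hbb'⟩ :=
        (hj hms' (hh b) (.trans (.congr _ h5) h2.symm)).exists_eqv
      -- the mask selects the arguments that are congruent to the terms of given variables
      have h6 : ∀ i, ∃ c : Bool, ∃ u' v',
          (c = true → CongCl A (ms i) (h u') ∧ CongCl A (ms' i) (h v')) ∧
          (c = false → CongCl A (ms i) (ms' i)) ∧
          (M i = true →
            c = true ∧ (summ A Tm h).eqv x y (u i) u' ∧ (summ A Tm h).eqv x y (v i) v') ∧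
          (M i = false → c = true → (summ A Tm h).eqv x y u' v') := by
        intro i
        rcases hi : M i with _ | _
        · rcases hj (hc.arg hms i) (hc.arg hms' i)
            ((h4 i).trans (((h3 i).2 hi).trans (h5 i).symm)) with h7 | ⟨u', v', h7, h8, h9⟩
          · exact ⟨false, a, a, by simp [h7]⟩
          · exact ⟨true, u', v', by simp [h7, h8, h9]⟩
        · obtain ⟨u', h7, h8⟩ := (hj (hc.arg hms i) (hh (u i))
            ((h4 i).trans ((h3 i).1 hi).1)).exists_eqv
          obtain ⟨v', h9, h10⟩ := (hj (hc.arg hms' i) (hh (v i))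
            ((h5 i).trans ((h3 i).1 hi).2)).exists_eqv
          exact ⟨true, u', v', by simp [h7, h8, h9, h10]⟩
      choose M' u' v' h6 using h6
      exact ⟨M', u', v', a', b', ⟨ms, ms', ha'.symm, hb'.symm, fun i => ⟨(h6 i).1, (h6 i).2.1⟩⟩,
        haa', hbb', fun i => (h6 i).2.2⟩
    · rintro ⟨M', u', v', a', b', ⟨t, t', h1, h2, h3⟩, h4, h5, h6⟩
      refine ⟨t, t', ((hE _ _).2 h4).trans (h1.mono hA), ((hE _ _).2 h5).trans (h2.mono hA),
        fun i => ⟨fun hi => ?_, fun hi => ?_⟩⟩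
      · obtain ⟨h7, h8, h9⟩ := (h6 i).1 hi
        obtain ⟨h10, h11⟩ := (h3 i).1 h7
        exact ⟨(h10.mono hA).trans ((hE _ _).2 h8).symm, (h11.mono hA).trans ((hE _ _).2 h9).symm⟩
      · rcases hi' : M' i with _ | _
        · exact ((h3 i).2 hi').mono hA
        · obtain ⟨h10, h11⟩ := (h3 i).1 hi'
          exact (h10.mono hA).trans (((hE _ _).2 ((h6 i).2 hi hi')).trans (h11.mono hA).symm)
  · rename_i f z
    constructor
    · rintro ⟨m, hm, h1⟩
      obtain ⟨ms, hms, h2⟩ := hc'.exists_func hm h1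
      choose z' h3 h4 using fun i => (hj (hc.arg hms i) (hh (z i)) (h2 i)).exists_eqv
      exact ⟨z', ⟨_, hms, .congr _ h3⟩, h4⟩
    · rintro ⟨z', ⟨m, hm, h1⟩, h2⟩
      exact ⟨m, hm, (h1.mono hA).trans (.congr _ fun i => ((hE _ _).2 (h2 i)).symm)⟩
  · rename_i v
    constructor
    · rintro ⟨m, hm, h1, h2⟩
      have key : ∀ t, Sup (Insert.insert (h x, h y) A) t (h v) → ∀ m ∈ Tm,
          CongCl (Insert.insert (h x, h y) A) m t → ((summ A Tm h).assume x y).D v ∨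
          ∃ u, CongCl A m (h u) ∧ Relation.ReflTransGen
            (fun i j => (summ A Tm h).Child i j ∨ (summ A Tm h).eqv x y i j) u v := by
        intro t ht
        induction ht using Relation.ReflTransGen.head_induction_on with
        | refl =>
          intro m hm hmt
          obtain ⟨u, h3, h4⟩ := (hj hm (hh v) hmt).exists_eqv
          exact Or.inr ⟨u, h3, .single (Or.inr (Summ.eqv_symm h4))⟩
        | @head t t' h3 _ ih =>
          intro m hm hmt
          rcases h3 with h3 | ⟨n, f, ts, i, h3, h4⟩
          · exact ih m hm (hmt.trans h3)
          · obtain ⟨ms, hms, h5⟩ := hc'.exists_func hm (hmt.trans h3)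
            rcases ih _ (hc.arg hms i) ((h5 i).trans h4) with h6 | ⟨u, h6, h7⟩
            · exact Or.inl h6
            · by_cases ha : ∃ a, CongCl A (func f ms) (h a)
              · obtain ⟨a, ha⟩ := ha
                have hau : (summ A Tm h).Child a u :=
                  child_iff.2 (Or.inr ⟨n, f, ms, i, ha.symm, h6⟩)
                have hma : Joined A Tm h x y m (h a) :=
                  (hj hm hms (hmt.trans (h3.trans (.congr _ fun i => (h5 i).symm)))).trans
                    (Or.inl ha)
                obtain ⟨a', h8, h9⟩ := hma.exists_eqv
                exact Or.inr ⟨a', h8, .head (Or.inr (Summ.eqv_symm h9)) (.head (Or.inl hau) h7)⟩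
              · exact Or.inl ⟨u, ⟨_, hms, .of_arg i (.refl _) h6, not_exists.1 ha⟩, h7⟩
      rcases key m h1 m hm (.refl m) with h3 | ⟨u, h3, _⟩
      · exact h3
      · exact absurd (h3.mono hA) (h2 u)
    · rintro ⟨u, ⟨m, hm, h1, h2⟩, h3⟩
      refine ⟨m, hm, (h1.mono hA).trans ?_, fun z hz => ?_⟩
      · clear h1 h2
        induction h3 with
        | refl => exact .refl
        | tail _ h3 ih =>
          refine ih.trans ?_
          rcases h3 with h3 | h3
          · exact (Sup.of_child h3).mono hA
          · exact .of_congCl ((hE _ _).2 h3)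
      · obtain ⟨z', hz', _⟩ := (hj hm (hh z) hz).exists_eqv
        exact h2 z' hz'

end

end UninterpretedProgram

namespace UninterpretedProgram

/-! ### Summaries along executions -/

section

variable {L : FirstOrder.Language.{0, 0}} {V I : Type}

open FirstOrder.Language.Term (func var)

/-- Renaming of variables in conditions. -/
def Cond.map (φ : I → V) : Cond I → Cond V
  | .eq x y => .eq (φ x) (φ y)
  | .ne x y => .ne (φ x) (φ y)

/-- Renaming of variables in letters. -/
def Letter.map (φ : I → V) : Letter L I → Letter L V
  | .copy x y => .copy (φ x) (φ y)
  | .app x f z => .app (φ x) f fun i => φ (z i)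
  | .assume c => .assume (c.map φ)

variable [DecidableEq V]

theorem comp_concat (σ : Execution L V) (a : Letter L V) : comp (σ ++ [a]) = a.update (comp σ) := by
  simp [comp]

theorem mem_terms_concat {σ : Execution L V} {a : Letter L V} {t : L.Term V} :
    t ∈ terms (σ ++ [a]) ↔ t ∈ terms σ ∨ ∃ x, t = comp (σ ++ [a]) x := by
  constructor
  · rintro ⟨ρ, hρ, x, rfl⟩
    rcases List.prefix_concat_iff.1 hρ with rfl | hρ
    · exact Or.inr ⟨x, rfl⟩
    · exact Or.inl ⟨ρ, hρ, x, rfl⟩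
  · rintro (⟨ρ, hρ, h⟩ | h)
    · exact ⟨ρ, hρ.trans (List.prefix_append _ _), h⟩
    · exact ⟨_, List.prefix_rfl, h⟩

theorem comp_mem_terms (σ : Execution L V) (x : V) : comp σ x ∈ terms σ :=
  ⟨σ, List.prefix_rfl, x, rfl⟩

theorem mem_eqAssumes_concat {σ : Execution L V} {a : Letter L V} {p : L.Term V × L.Term V} :
    p ∈ eqAssumes (σ ++ [a]) ↔ p ∈ eqAssumes σ ∨
      ∃ x y, a = .assume (.eq x y) ∧ p = (comp σ x, comp σ y) := by
  constructor
  · rintro ⟨ρ, x, y, hρ, rfl⟩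
    rcases List.prefix_concat_iff.1 hρ with h | h
    · obtain ⟨rfl, h1⟩ := List.append_inj' h rfl
      exact Or.inr ⟨x, y, (List.singleton_inj.1 h1).symm, rfl⟩
    · exact Or.inl ⟨ρ, x, y, h, rfl⟩
  · rintro (⟨ρ, x, y, hρ, h⟩ | ⟨x, y, rfl, h⟩)
    · exact ⟨ρ, x, y, hρ.trans (List.prefix_append _ _), h⟩
    · exact ⟨σ, x, y, List.prefix_rfl, h⟩

theorem eqAssumes_eq {σ : Execution L V} {x y : V} :
    eqAssumes (σ ++ [.assume (.eq x y)]) = insert (comp σ x, comp σ y) (eqAssumes σ) := by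
  ext p
  rw [mem_eqAssumes_concat, Set.mem_insert_iff, or_comm]
  refine or_congr ⟨?_, fun h => ⟨x, y, rfl, h⟩⟩ Iff.rfl
  rintro ⟨x', y', h, rfl⟩
  cases h
  rfl

theorem eqAssumes_of_ne {σ : Execution L V} {a : Letter L V}
    (ha : ∀ x y, a ≠ .assume (.eq x y)) : eqAssumes (σ ++ [a]) = eqAssumes σ := by
  ext p
  rw [mem_eqAssumes_concat]
  exact or_iff_left fun ⟨x, y, h, _⟩ => ha x y h

theorem closed_terms (σ : Execution L V) : Closed (eqAssumes σ) (terms σ) := by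
  refine ⟨?_, ?_, ?_⟩
  · rintro _ _ ⟨ρ, x, y, hρ, h⟩
    rw [(Prod.mk.inj h).1]
    exact ⟨ρ, (List.prefix_append _ _).trans hρ, x, rfl⟩
  · rintro _ _ ⟨ρ, x, y, hρ, h⟩
    rw [(Prod.mk.inj h).2]
    exact ⟨ρ, (List.prefix_append _ _).trans hρ, y, rfl⟩
  · intro n f ts h i
    induction σ using List.reverseRecOn with
    | nil =>
      obtain ⟨ρ, hρ, x, h⟩ := h
      rw [List.prefix_nil.1 hρ] at h
      simp [comp] at h
    | append_singleton σ a ih =>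
      rcases mem_terms_concat.1 h with h | ⟨x, h⟩
      · exact mem_terms_concat.2 (Or.inl (ih h))
      · refine mem_terms_concat.2 (Or.inl ?_)
        rw [comp_concat] at h
        have hold : ∀ x, func f ts = comp σ x → ts i ∈ terms σ :=
          fun x h => ih (h ▸ comp_mem_terms σ x)
        cases a with
        | copy y z =>
          by_cases hx : x = y
          · rw [hx, Letter.update, Function.update_self] at h
            exact hold _ h
          · rw [Letter.update, Function.update_of_ne hx] at h
            exact hold _ h
        | app y g z =>
          by_cases hx : x = y
          · rw [hx, Letter.update, Function.update_self] at h
            cases h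
            exact comp_mem_terms _ _
          · rw [Letter.update, Function.update_of_ne hx] at h
            exact hold _ h
        | assume c => exact hold _ h

/-- The letter `a` makes the coherent execution `σ` incoherent. -/
def Violates (σ : Execution L V) : Letter L V → Prop
  | .app x f z => (∃ t' ∈ terms σ, CongCl (eqAssumes σ) t' (comp (σ ++ [.app x f z]) x)) ∧
      ¬ ∃ y, CongCl (eqAssumes σ) (comp σ y) (comp (σ ++ [.app x f z]) x)
  | .assume (.eq x y) => ∃ t' ∈ terms σ,
      (SupertermMod (eqAssumes σ) t' (comp σ x) ∨ SupertermMod (eqAssumes σ) t' (comp σ y)) ∧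
      ¬ ∃ z, CongCl (eqAssumes σ) (comp σ z) t'
  | _ => False

theorem coherentExecution_iff {ρ : Execution L V} :
    CoherentExecution ρ ↔ ∀ σ a, σ ++ [a] <+: ρ → ¬ Violates σ a := by
  constructor
  · rintro ⟨hm, he⟩ σ a hσ ha
    match a, ha with
    | .app x f z, ha => exact ha.2 (hm σ _ x f z hσ ha.1)
    | .assume (.eq x y), ⟨t, ht, h, h'⟩ => exact h' (he σ x y hσ t ht h)
  · refine fun h => ⟨fun σ n x f z hσ ht => ?_, fun σ x y hσ t ht hs => ?_⟩
    · by_contra hn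
      exact h σ _ hσ ⟨ht, hn⟩
    · by_contra hn
      exact h σ _ hσ ⟨t, ht, hs, hn⟩

/-- The summary of an execution, where `nm i` is the variable named by `i`. -/
def summOf (nm : I → V) (ρ : Execution L V) : Summ L I :=
  summ (eqAssumes ρ) (terms ρ) fun i => comp ρ (nm i)

/-- The summary of the empty execution; `N i j` says that `i` and `j` name the same variable. -/
def Summ.init (N : I → I → Prop) : Summ L I where
  E := N
  K _ _ _ _ _ _ := False
  C _ _ := False
  D _ := False

/-- The letter `a` leads to a violation of coherence. -/
def Summ.Bad (S : Summ L I) : Letter L I → Prop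
  | .app _ f z => S.C ⟨_, f⟩ z ∧ ∀ y, ¬ S.Holds ⟨_, f⟩ z y
  | .assume (.eq x y) => S.D x ∨ S.D y
  | _ => False

open Classical in
/-- Redirect the names of the variable named by `x` to `y`. -/
noncomputable def redirect (N : I → I → Prop) (x y i : I) : I := if N i x then y else i

/-- `S'` is the summary after the letter `a`, if that does not lead to a violation of coherence;
`N i j` says that `i` and `j` name the same variable. -/
def Summ.Next (N : I → I → Prop) (S : Summ L I) (a : Letter L I) (S' : Summ L I) : Prop :=
  match a with
  | .copy x y => S' = S.copy (redirect N x y)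
  | .app x f z => (∃ y, S.Holds ⟨_, f⟩ z y ∧ S' = S.copy (redirect N x y)) ∨
      (¬ S.C ⟨_, f⟩ z ∧ S' = S.fresh (fun i => N i x) ⟨_, f⟩ z)
  | .assume (.eq x y) => S' = S.assume x y
  | .assume (.ne _ _) => S' = S

variable {nm : I → V}

omit [DecidableEq V] in
theorem congCl_empty {t u : L.Term V} : CongCl ∅ t u ↔ t = u := by
  constructor
  · intro h
    induction h with
    | base h => exact absurd h (Set.notMem_empty _)
    | refl => rfl
    | symm _ ih => exact ih.symm
    | trans _ _ ih ih' => exact ih.trans ih'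
    | congr f _ ih => exact congrArg _ (funext ih)
  · rintro rfl
    exact .refl _

theorem summOf_nil (hnm : Function.Surjective nm) :
    summOf (L := L) nm [] = Summ.init fun i j => nm i = nm j := by
  have h1 : eqAssumes ([] : Execution L V) = ∅ := by
    ext p
    simp [eqAssumes]
  have h2 : ∀ t ∈ terms ([] : Execution L V), ∃ x, t = var x := by
    rintro t ⟨ρ, hρ, x, rfl⟩
    rw [List.prefix_nil.1 hρ]
    exact ⟨x, rfl⟩
  have h3 : (fun i => comp ([] : Execution L V) (nm i)) = fun i => var (nm i) := rfl
  rw [summOf, h1, h3]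
  ext
  · simp [summ, Summ.init, congCl_empty]
  · simp [summ, Summ.init, congCl_empty]
  · rename_i f z
    refine iff_of_false ?_ id
    rintro ⟨m, hm, h⟩
    obtain ⟨x, rfl⟩ := h2 m hm
    exact absurd (congCl_empty.1 h) (by simp)
  · refine iff_of_false ?_ id
    rintro ⟨m, hm, _, h⟩
    obtain ⟨x, rfl⟩ := h2 m hm
    obtain ⟨i, rfl⟩ := hnm x
    exact h i (.refl _)

theorem violates_iff (hnm : Function.Surjective nm) (σ : Execution L V) (a : Letter L I) :
    Violates σ (a.map nm) ↔ (summOf nm σ).Bad a := by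
  match a with
  | .copy x y => exact Iff.rfl
  | .app x f z =>
    simp only [Letter.map, Violates, comp_concat, Letter.update, Function.update_self]
    refine and_congr Iff.rfl ?_
    rw [not_exists, hnm.forall]
    exact forall_congr' fun y => not_congr
      (holds_iff (A := eqAssumes σ) (Tm := terms σ) (h := fun i => comp σ (nm i))
        (f := ⟨_, f⟩)).symm
  | .assume (.eq x y) =>
    simp only [Letter.map, Cond.map, Violates, ← sup_iff_supertermMod, hnm.exists, not_exists]
    constructor
    · rintro ⟨t, ht, h1 | h1, h2⟩
      · exact Or.inl ⟨t, ht, h1, fun z h => h2 z h.symm⟩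
      · exact Or.inr ⟨t, ht, h1, fun z h => h2 z h.symm⟩
    · rintro (⟨t, ht, h1, h2⟩ | ⟨t, ht, h1, h2⟩)
      · exact ⟨t, ht, Or.inl h1, fun z h => h2 z h.symm⟩
      · exact ⟨t, ht, Or.inr h1, fun z h => h2 z h.symm⟩
  | .assume (.ne x y) => exact Iff.rfl

theorem summOf_copy {σ : Execution L V} {a : Letter L V} {x y : I} {t : L.Term V}
    (ha : ∀ x y, a ≠ .assume (.eq x y)) (hup : comp (σ ++ [a]) = Function.update (comp σ) (nm x) t)
    (ht : CongCl (eqAssumes σ) t (comp σ (nm y))) :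
    summOf nm (σ ++ [a]) = (summOf nm σ).copy (redirect (fun i j => nm i = nm j) x y) := by
  rw [summOf, summOf, eqAssumes_of_ne ha]
  refine (closed_terms σ).summ_copy (fun i => comp_mem_terms σ _) ?_ ?_ ?_
  · intro i
    rw [hup, redirect]
    by_cases hi : nm i = nm x
    · rwa [if_pos hi, hi, Function.update_self]
    · rw [if_neg hi, Function.update_of_ne hi]
      exact .refl _
  · exact fun t ht => mem_terms_concat.2 (Or.inl ht)
  · intro m hm
    rcases mem_terms_concat.1 hm with hm | ⟨v, rfl⟩
    · exact ⟨m, hm, .refl _⟩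
    · rw [hup]
      by_cases hv : v = nm x
      · subst hv
        exact ⟨_, comp_mem_terms σ (nm y), by rwa [Function.update_self]⟩
      · exact ⟨_, comp_mem_terms σ v, by rw [Function.update_of_ne hv]; exact .refl _⟩

theorem next_iff (σ : Execution L V) {a : Letter L I}
    (ha : ¬ (summOf nm σ).Bad a) {S' : Summ L I} :
    (summOf nm σ).Next (fun i j => nm i = nm j) a S' ↔ S' = summOf nm (σ ++ [a.map nm]) := by
  have hc := closed_terms σ
  have hh : ∀ i, comp σ (nm i) ∈ terms σ := fun i => comp_mem_terms σ _
  match a with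
  | .copy x y =>
    rw [Summ.Next, summOf_copy (y := y) (by simp [Letter.map]) (comp_concat _ _) (.refl _)]
  | .app x f z =>
    have hcopy : ∀ y, (summOf nm σ).Holds ⟨_, f⟩ z y →
        summOf nm (σ ++ [Letter.map nm (.app x f z)]) =
          (summOf nm σ).copy (redirect (fun i j => nm i = nm j) x y) := fun y hy =>
      summOf_copy (by simp [Letter.map]) (comp_concat _ _) (holds_iff.1 hy).symm
    have hfresh : ¬ (summOf nm σ).C ⟨_, f⟩ z →
        summOf nm (σ ++ [Letter.map nm (.app x f z)]) =
          (summOf nm σ).fresh (fun i => nm i = nm x) ⟨_, f⟩ z := by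
      intro hn
      rw [summOf, summOf, eqAssumes_of_ne (by simp [Letter.map])]
      refine Eq.trans ?_ (hc.summ_fresh
        (h' := fun i => comp (σ ++ [Letter.map nm (.app x f z)]) (nm i))
        (X := fun i => nm i = nm x) hh ⟨x, rfl⟩ hn ?_ ?_)
      · congr 1
        ext t
        rw [mem_terms_concat, Set.mem_insert_iff, comp_concat, Letter.map, Letter.update]
        constructor
        · rintro (h | ⟨v, rfl⟩)
          · exact Or.inr h
          · by_cases hv : v = nm x
            · rw [hv, Function.update_self]
              exact Or.inl rfl
            · rw [Function.update_of_ne hv]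
              exact Or.inr (comp_mem_terms _ _)
        · rintro (rfl | h)
          · exact Or.inr ⟨nm x, by rw [Function.update_self]⟩
          · exact Or.inl h
      · intro i hi
        rw [comp_concat, Letter.map, Letter.update, hi, Function.update_self]
      · intro i hi
        rw [comp_concat, Letter.map, Letter.update, Function.update_of_ne hi]
    constructor
    · rintro (⟨y, hy, rfl⟩ | ⟨hn, rfl⟩)
      · exact (hcopy y hy).symm
      · exact (hfresh hn).symm
    · rintro rfl
      by_cases hn : (summOf nm σ).C ⟨_, f⟩ z
      · have : ∃ y, (summOf nm σ).Holds ⟨_, f⟩ z y := by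
          by_contra hy
          exact ha ⟨hn, not_exists.1 hy⟩
        obtain ⟨y, hy⟩ := this
        exact Or.inl ⟨y, hy, hcopy y hy⟩
      · exact Or.inr ⟨hn, hfresh hn⟩
  | .assume (.eq x y) =>
    have hT : terms (σ ++ [Letter.map nm (.assume (.eq x y))]) = terms σ := by
      ext t
      rw [mem_terms_concat, comp_concat]
      exact or_iff_left_of_imp fun ⟨v, hv⟩ => hv ▸ comp_mem_terms _ _
    rw [Summ.Next, summOf, summOf, hT, comp_concat]
    simp only [Letter.map, Cond.map, Letter.update, eqAssumes_eq]
    rw [hc.summ_assume hh (not_or.1 ha)]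
  | .assume (.ne x y) =>
    have hT : terms (σ ++ [Letter.map nm (.assume (.ne x y))]) = terms σ := by
      ext t
      rw [mem_terms_concat, comp_concat]
      exact or_iff_left_of_imp fun ⟨v, hv⟩ => hv ▸ comp_mem_terms _ _
    rw [Summ.Next, summOf, summOf, hT, comp_concat,
      eqAssumes_of_ne (by simp [Letter.map, Cond.map])]
    rfl

end

end UninterpretedProgram

namespace UninterpretedProgram

/-! ### Control flow -/

section

variable {L : FirstOrder.Language.{0, 0}} {V : Type}

/-- The length of the text of a program. -/
def Prog.len (name : V → List Bool) (s : Prog L V) : ℕ := (s.encode name).length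

/-- The length of the text of a condition. -/
def Cond.len (L : FirstOrder.Language.{0, 0}) (name : V → List Bool) (c : Cond V) : ℕ :=
  (c.encode (L := L) name).length

variable (name : V → List Bool)

/-- `Occ name s₀ i₀ k₀ s i k`: if the text of `s₀` starts at position `i₀` and control is passed
to position `k₀` after `s₀`, then `s` is a subprogram that starts at `i`, and control is passed to
position `k` after `s`. -/
inductive Occ (s₀ : Prog L V) (i₀ k₀ : ℕ) : Prog L V → ℕ → ℕ → Prop
  | root : Occ s₀ i₀ k₀ s₀ i₀ k₀
  | seq_left {s₁ s₂ : Prog L V} {i k : ℕ} : Occ s₀ i₀ k₀ (.seq s₁ s₂) i k →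
      Occ s₀ i₀ k₀ s₁ (i + 1) (i + 1 + s₁.len name)
  | seq_right {s₁ s₂ : Prog L V} {i k : ℕ} : Occ s₀ i₀ k₀ (.seq s₁ s₂) i k →
      Occ s₀ i₀ k₀ s₂ (i + 1 + s₁.len name) k
  | ite_left {c : Cond V} {s₁ s₂ : Prog L V} {i k : ℕ} : Occ s₀ i₀ k₀ (.ite c s₁ s₂) i k →
      Occ s₀ i₀ k₀ s₁ (i + 1 + c.len L name) k
  | ite_right {c : Cond V} {s₁ s₂ : Prog L V} {i k : ℕ} : Occ s₀ i₀ k₀ (.ite c s₁ s₂) i k →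
      Occ s₀ i₀ k₀ s₂ (i + 1 + c.len L name + s₁.len name) k
  | body {c : Cond V} {s : Prog L V} {i k : ℕ} : Occ s₀ i₀ k₀ (.while c s) i k →
      Occ s₀ i₀ k₀ s (i + 1 + c.len L name) i

variable {name}

theorem len_seq {s₁ s₂ : Prog L V} : (Prog.seq s₁ s₂).len name = s₁.len name + s₂.len name + 1 := by
  simp [Prog.len, Prog.encode]

theorem len_ite {c : Cond V} {s₁ s₂ : Prog L V} :
    (Prog.ite c s₁ s₂).len name = c.len L name + s₁.len name + s₂.len name + 1 := by
  simp [Prog.len, Prog.encode, Cond.len]; omega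

theorem len_while {c : Cond V} {s : Prog L V} :
    (Prog.while c s).len name = c.len L name + s.len name + 1 := by
  simp [Prog.len, Prog.encode, Cond.len]

theorem Prog.len_pos (s : Prog L V) : 0 < s.len name := by
  cases s <;> simp [Prog.len, Prog.encode]

theorem Occ.range {s₀ s : Prog L V} {i₀ k₀ i k : ℕ} (h : Occ name s₀ i₀ k₀ s i k) :
    i₀ ≤ i ∧ i + s.len name ≤ i₀ + s₀.len name := by
  induction h with
  | root => simp
  | seq_left _ ih => rw [len_seq] at ih; omega
  | seq_right _ ih => rw [len_seq] at ih; omega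
  | ite_left _ ih => rw [len_ite] at ih; omega
  | ite_right _ ih => rw [len_ite] at ih; omega
  | body _ ih => rw [len_while] at ih; omega

theorem Occ.cases_seq {s₁ s₂ s : Prog L V} {i₀ k₀ i k : ℕ}
    (h : Occ name (.seq s₁ s₂) i₀ k₀ s i k) : (s = .seq s₁ s₂ ∧ i = i₀ ∧ k = k₀) ∨
      Occ name s₁ (i₀ + 1) (i₀ + 1 + s₁.len name) s i k ∨
      Occ name s₂ (i₀ + 1 + s₁.len name) k₀ s i k := by
  induction h with
  | root => exact Or.inl ⟨rfl, rfl, rfl⟩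
  | seq_left _ ih =>
    rcases ih with ⟨h, rfl, rfl⟩ | h | h
    · cases h; exact Or.inr (Or.inl .root)
    · exact Or.inr (Or.inl h.seq_left)
    · exact Or.inr (Or.inr h.seq_left)
  | seq_right _ ih =>
    rcases ih with ⟨h, rfl, rfl⟩ | h | h
    · cases h; exact Or.inr (Or.inr .root)
    · exact Or.inr (Or.inl h.seq_right)
    · exact Or.inr (Or.inr h.seq_right)
  | ite_left _ ih => exact Or.inr ((ih.resolve_left (by simp)).imp Occ.ite_left Occ.ite_left)
  | ite_right _ ih => exact Or.inr ((ih.resolve_left (by simp)).imp Occ.ite_right Occ.ite_right)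
  | body _ ih => exact Or.inr ((ih.resolve_left (by simp)).imp Occ.body Occ.body)

theorem Occ.cases_ite {c : Cond V} {s₁ s₂ s : Prog L V} {i₀ k₀ i k : ℕ}
    (h : Occ name (.ite c s₁ s₂) i₀ k₀ s i k) : (s = .ite c s₁ s₂ ∧ i = i₀ ∧ k = k₀) ∨
      Occ name s₁ (i₀ + 1 + c.len L name) k₀ s i k ∨
      Occ name s₂ (i₀ + 1 + c.len L name + s₁.len name) k₀ s i k := by
  induction h with
  | root => exact Or.inl ⟨rfl, rfl, rfl⟩
  | seq_left _ ih => exact Or.inr ((ih.resolve_left (by simp)).imp Occ.seq_left Occ.seq_left)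
  | seq_right _ ih => exact Or.inr ((ih.resolve_left (by simp)).imp Occ.seq_right Occ.seq_right)
  | ite_left _ ih =>
    rcases ih with ⟨h, rfl, rfl⟩ | h | h
    · cases h; exact Or.inr (Or.inl .root)
    · exact Or.inr (Or.inl h.ite_left)
    · exact Or.inr (Or.inr h.ite_left)
  | ite_right _ ih =>
    rcases ih with ⟨h, rfl, rfl⟩ | h | h
    · cases h; exact Or.inr (Or.inr .root)
    · exact Or.inr (Or.inl h.ite_right)
    · exact Or.inr (Or.inr h.ite_right)
  | body _ ih => exact Or.inr ((ih.resolve_left (by simp)).imp Occ.body Occ.body)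

theorem Occ.cases_while {c : Cond V} {s₁ s : Prog L V} {i₀ k₀ i k : ℕ}
    (h : Occ name (.while c s₁) i₀ k₀ s i k) : (s = .while c s₁ ∧ i = i₀ ∧ k = k₀) ∨
      Occ name s₁ (i₀ + 1 + c.len L name) i₀ s i k := by
  induction h with
  | root => exact Or.inl ⟨rfl, rfl, rfl⟩
  | seq_left _ ih => exact Or.inr (ih.resolve_left (by simp)).seq_left
  | seq_right _ ih => exact Or.inr (ih.resolve_left (by simp)).seq_right
  | ite_left _ ih => exact Or.inr (ih.resolve_left (by simp)).ite_left
  | ite_right _ ih => exact Or.inr (ih.resolve_left (by simp)).ite_right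
  | body _ ih =>
    rcases ih with ⟨h, rfl, rfl⟩ | h
    · cases h; exact Or.inr .root
    · exact Or.inr h.body

theorem Occ.eq_root {s₀ s : Prog L V} {i₀ k₀ i k : ℕ} (h : Occ name s₀ i₀ k₀ s i k)
    (h0 : ∀ s₁ s₂, s₀ ≠ .seq s₁ s₂) (h1 : ∀ c s₁ s₂, s₀ ≠ .ite c s₁ s₂)
    (h2 : ∀ c s₁, s₀ ≠ .while c s₁) : s = s₀ ∧ i = i₀ ∧ k = k₀ := by
  induction h with
  | root => exact ⟨rfl, rfl, rfl⟩
  | seq_left _ ih => exact absurd ih.1.symm (h0 _ _)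
  | seq_right _ ih => exact absurd ih.1.symm (h0 _ _)
  | ite_left _ ih => exact absurd ih.1.symm (h1 _ _ _)
  | ite_right _ ih => exact absurd ih.1.symm (h1 _ _ _)
  | body _ ih => exact absurd ih.1.symm (h2 _ _)

/-- At most one subprogram starts at a position. -/
theorem Occ.unique {s₀ s s' : Prog L V} {i₀ k₀ i k k' : ℕ} (h : Occ name s₀ i₀ k₀ s i k)
    (h' : Occ name s₀ i₀ k₀ s' i k') : s = s' ∧ k = k' := by
  have hroot : ∀ {s₀ : Prog L V} {i₀ k₀ : ℕ}, (∀ s₁ s₂, s₀ ≠ .seq s₁ s₂) →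
      (∀ c s₁ s₂, s₀ ≠ .ite c s₁ s₂) → (∀ c s₁, s₀ ≠ .while c s₁) →
      Occ name s₀ i₀ k₀ s i k → Occ name s₀ i₀ k₀ s' i k' → s = s' ∧ k = k' := by
    intro s₀ i₀ k₀ h0 h1 h2 h h'
    have e := h.eq_root h0 h1 h2
    have e' := h'.eq_root h0 h1 h2
    exact ⟨e.1.trans e'.1.symm, e.2.2.trans e'.2.2.symm⟩
  induction s₀ generalizing i₀ k₀ with
  | skip => exact hroot (by simp) (by simp) (by simp) h h'
  | copy x y => exact hroot (by simp) (by simp) (by simp) h h'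
  | app x f z => exact hroot (by simp) (by simp) (by simp) h h'
  | assume c => exact hroot (by simp) (by simp) (by simp) h h'
  | seq s₁ s₂ ih₁ ih₂ =>
    have hp := Prog.len_pos (name := name) s
    have hp' := Prog.len_pos (name := name) s'
    rcases h.cases_seq with ⟨e, h1, e1⟩ | h1 | h1 <;>
      rcases h'.cases_seq with ⟨e', h2, e2⟩ | h2 | h2
    · exact ⟨e.trans e'.symm, e1.trans e2.symm⟩
    · have := h2.range; omega
    · have := h2.range; omega
    · have := h1.range; omega
    · exact ih₁ h1 h2
    · have := h1.range; have := h2.range; omega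
    · have := h1.range; omega
    · have := h1.range; have := h2.range; omega
    · exact ih₂ h1 h2
  | ite c s₁ s₂ ih₁ ih₂ =>
    have hp := Prog.len_pos (name := name) s
    have hp' := Prog.len_pos (name := name) s'
    rcases h.cases_ite with ⟨e, h1, e1⟩ | h1 | h1 <;>
      rcases h'.cases_ite with ⟨e', h2, e2⟩ | h2 | h2
    · exact ⟨e.trans e'.symm, e1.trans e2.symm⟩
    · have := h2.range; omega
    · have := h2.range; omega
    · have := h1.range; omega
    · exact ih₁ h1 h2
    · have := h1.range; have := h2.range; omega
    · have := h1.range; omega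
    · have := h1.range; have := h2.range; omega
    · exact ih₂ h1 h2
  | _ c s₁ ih =>
    rcases h.cases_while with ⟨e, h1, e1⟩ | h1 <;>
      rcases h'.cases_while with ⟨e', h2, e2⟩ | h2
    · exact ⟨e.trans e'.symm, e1.trans e2.symm⟩
    · have := h2.range; omega
    · have := h1.range; omega
    · exact ih h1 h2

variable (name) in
/-- The transitions of the flow graph: from a position, the letter (if any) leads to the next
position. -/
inductive Edge (s₀ : Prog L V) (i₀ k₀ : ℕ) : ℕ → Option (Letter L V) → ℕ → Prop
  | skip {i k : ℕ} : Occ name s₀ i₀ k₀ .skip i k → Edge s₀ i₀ k₀ i none k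
  | copy {x y : V} {i k : ℕ} : Occ name s₀ i₀ k₀ (.copy x y) i k →
      Edge s₀ i₀ k₀ i (some (.copy x y)) k
  | app {n : ℕ} {x : V} {f : L.Functions n} {z : Fin n → V} {i k : ℕ} :
      Occ name s₀ i₀ k₀ (.app x f z) i k → Edge s₀ i₀ k₀ i (some (.app x f z)) k
  | assume {c : Cond V} {i k : ℕ} : Occ name s₀ i₀ k₀ (.assume c) i k →
      Edge s₀ i₀ k₀ i (some (.assume c)) k
  | seq {s₁ s₂ : Prog L V} {i k : ℕ} : Occ name s₀ i₀ k₀ (.seq s₁ s₂) i k →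
      Edge s₀ i₀ k₀ i none (i + 1)
  | ite_left {c : Cond V} {s₁ s₂ : Prog L V} {i k : ℕ} : Occ name s₀ i₀ k₀ (.ite c s₁ s₂) i k →
      Edge s₀ i₀ k₀ i (some (.assume c)) (i + 1 + c.len L name)
  | ite_right {c : Cond V} {s₁ s₂ : Prog L V} {i k : ℕ} : Occ name s₀ i₀ k₀ (.ite c s₁ s₂) i k →
      Edge s₀ i₀ k₀ i (some (.assume c.neg)) (i + 1 + c.len L name + s₁.len name)
  | enter {c : Cond V} {s : Prog L V} {i k : ℕ} : Occ name s₀ i₀ k₀ (.while c s) i k →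
      Edge s₀ i₀ k₀ i (some (.assume c)) (i + 1 + c.len L name)
  | exit {c : Cond V} {s : Prog L V} {i k : ℕ} : Occ name s₀ i₀ k₀ (.while c s) i k →
      Edge s₀ i₀ k₀ i (some (.assume c.neg)) k

/-- `Path R n i ρ j`: a path with `n` edges from `i` to `j` whose letters spell `ρ`. -/
def Path (R : ℕ → Option (Letter L V) → ℕ → Prop) : ℕ → ℕ → Execution L V → ℕ → Prop
  | 0, i, ρ, j => i = j ∧ ρ = []
  | n + 1, i, ρ, j => ∃ a i' ρ', R i a i' ∧ ρ = a.toList ++ ρ' ∧ Path R n i' ρ' j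

variable {R : ℕ → Option (Letter L V) → ℕ → Prop}

theorem Path.trans {m n i j k : ℕ} {ρ ρ' : Execution L V} (h : Path R m i ρ j)
    (h' : Path R n j ρ' k) : Path R (m + n) i (ρ ++ ρ') k := by
  induction m generalizing i ρ with
  | zero =>
    obtain ⟨rfl, rfl⟩ := h
    simpa using h'
  | succ m ih =>
    obtain ⟨a, i', ρ1, h1, rfl, h2⟩ := h
    rw [Nat.succ_add]
    exact ⟨a, i', ρ1 ++ ρ', h1, by rw [List.append_assoc], ih h2⟩

theorem Path.single {i j : ℕ} {a : Option (Letter L V)} (h : R i a j) : Path R 1 i a.toList j :=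
  ⟨a, j, [], h, (List.append_nil _).symm, rfl, rfl⟩

open scoped Computability

variable {s₀ s : Prog L V} {i₀ k₀ i k : ℕ}

theorem Occ.exists_path (h : Occ name s₀ i₀ k₀ s i k) {ρ : Execution L V} (hρ : ρ ∈ s.Exec) :
    ∃ n, Path (Edge name s₀ i₀ k₀) n i ρ k := by
  induction s generalizing i k ρ with
  | skip =>
    cases hρ
    exact ⟨1, Path.single (Edge.skip h)⟩
  | copy x y =>
    cases hρ
    exact ⟨1, Path.single (Edge.copy h)⟩
  | app x f z =>
    cases hρ
    exact ⟨1, Path.single (Edge.app h)⟩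
  | assume c =>
    cases hρ
    exact ⟨1, Path.single (Edge.assume h)⟩
  | seq s₁ s₂ ih₁ ih₂ =>
    obtain ⟨ρ₁, h₁, ρ₂, h₂, rfl⟩ := Language.mem_mul.1 hρ
    obtain ⟨n₁, h₁⟩ := ih₁ h.seq_left h₁
    obtain ⟨n₂, h₂⟩ := ih₂ h.seq_right h₂
    exact ⟨_, (Path.single (.seq h)).trans (h₁.trans h₂)⟩
  | ite c s₁ s₂ ih₁ ih₂ =>
    rcases (Language.mem_add _ _ _).1 hρ with hρ | hρ
    · obtain ⟨ρ₁, rfl, ρ₂, h₂, rfl⟩ := Language.mem_mul.1 hρ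
      obtain ⟨n, h₂⟩ := ih₁ h.ite_left h₂
      exact ⟨_, (Path.single (.ite_left h)).trans h₂⟩
    · obtain ⟨ρ₁, rfl, ρ₂, h₂, rfl⟩ := Language.mem_mul.1 hρ
      obtain ⟨n, h₂⟩ := ih₂ h.ite_right h₂
      exact ⟨_, (Path.single (.ite_right h)).trans h₂⟩
  | _ c s ih =>
    obtain ⟨ρ₁, h₁, ρ₂, rfl, rfl⟩ := Language.mem_mul.1 hρ
    obtain ⟨l, rfl, hl⟩ := Language.mem_kstar.1 h₁
    have hloop : ∃ n, Path (Edge name s₀ i₀ k₀) n i l.flatten i := by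
      clear hρ h₁
      induction l with
      | nil => exact ⟨0, rfl, rfl⟩
      | cons ρ l ihl =>
        obtain ⟨n, hn⟩ := ihl fun y hy => hl y (List.mem_cons_of_mem _ hy)
        obtain ⟨ρ₁, rfl, ρ₂, h₂, rfl⟩ := Language.mem_mul.1 (hl ρ List.mem_cons_self)
        obtain ⟨n', h₂⟩ := ih h.body h₂
        exact ⟨_, ((Path.single (.enter h)).trans h₂).trans hn⟩
    obtain ⟨n, hn⟩ := hloop
    exact ⟨_, hn.trans (Path.single (Edge.exit h))⟩

/-- A path from the start of a subprogram to the end begins with an execution of the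
subprogram. -/
theorem Occ.split_path (hk : k₀ < i₀) {n : ℕ} (h : Occ name s₀ i₀ k₀ s i k) {ρ : Execution L V}
    (hp : Path (Edge name s₀ i₀ k₀) n i ρ k₀) : ∃ m < n, ∃ ρ₁ ρ₂, ρ = ρ₁ ++ ρ₂ ∧ ρ₁ ∈ s.Exec ∧
      Path (Edge name s₀ i₀ k₀) m k ρ₂ k₀ := by
  induction n using Nat.strong_induction_on generalizing s i k ρ with
  | _ n ih =>
    rcases n with _ | n
    · obtain ⟨rfl, -⟩ := hp
      have := h.range
      omega
    obtain ⟨a, i', ρ', he, rfl, hp⟩ := hp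
    have hn := Nat.lt_succ_self n
    cases he with
    | skip h' =>
      obtain ⟨rfl, rfl⟩ := h.unique h'
      exact ⟨n, hn, [], ρ', rfl, rfl, hp⟩
    | copy h' =>
      obtain ⟨rfl, rfl⟩ := h.unique h'
      exact ⟨n, hn, _, ρ', rfl, rfl, hp⟩
    | app h' =>
      obtain ⟨rfl, rfl⟩ := h.unique h'
      exact ⟨n, hn, _, ρ', rfl, rfl, hp⟩
    | assume h' =>
      obtain ⟨rfl, rfl⟩ := h.unique h'
      exact ⟨n, hn, _, ρ', rfl, rfl, hp⟩
    | seq h' =>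
      obtain ⟨rfl, rfl⟩ := h.unique h'
      obtain ⟨m, hm, ρ₁, ρ₂, rfl, h1, hp⟩ := ih n hn h.seq_left hp
      obtain ⟨m', hm', ρ₃, ρ₄, rfl, h2, hp⟩ := ih m (by omega) h.seq_right hp
      exact ⟨m', by omega, ρ₁ ++ ρ₃, ρ₄, by simp, Language.mem_mul.2 ⟨_, h1, _, h2, rfl⟩, hp⟩
    | ite_left h' =>
      obtain ⟨rfl, rfl⟩ := h.unique h'
      obtain ⟨m, hm, ρ₁, ρ₂, rfl, h1, hp⟩ := ih n hn h.ite_left hp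
      exact ⟨m, by omega, _ :: ρ₁, ρ₂, rfl, (Language.mem_add _ _ _).2
        (Or.inl (Language.mem_mul.2 ⟨_, rfl, _, h1, rfl⟩)), hp⟩
    | ite_right h' =>
      obtain ⟨rfl, rfl⟩ := h.unique h'
      obtain ⟨m, hm, ρ₁, ρ₂, rfl, h1, hp⟩ := ih n hn h.ite_right hp
      exact ⟨m, by omega, _ :: ρ₁, ρ₂, rfl, (Language.mem_add _ _ _).2
        (Or.inr (Language.mem_mul.2 ⟨_, rfl, _, h1, rfl⟩)), hp⟩
    | @enter c s _ _ h' =>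
      obtain ⟨rfl, rfl⟩ := h.unique h'
      obtain ⟨m, hm, ρ₁, ρ₂, rfl, h1, hp⟩ := ih n hn h.body hp
      obtain ⟨m', hm', ρ₃, ρ₄, rfl, h2, hp⟩ := ih m (by omega) h hp
      refine ⟨m', by omega, (.assume c :: ρ₁) ++ ρ₃, ρ₄, by simp, ?_, hp⟩
      obtain ⟨ρ₅, h5, ρ₆, h6, rfl⟩ := Language.mem_mul.1 h2
      obtain ⟨l, rfl, hl⟩ := Language.mem_kstar.1 h5
      refine Language.mem_mul.2 ⟨_, Language.mem_kstar.2 ⟨(.assume c :: ρ₁) :: l, rfl, ?_⟩,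
        ρ₆, h6, by simp⟩
      intro y hy
      rcases List.mem_cons.1 hy with rfl | hy
      · exact Language.mem_mul.2 ⟨_, rfl, _, h1, rfl⟩
      · exact hl y hy
    | exit h' =>
      obtain ⟨rfl, rfl⟩ := h.unique h'
      exact ⟨n, hn, _, ρ', rfl, Language.mem_mul.2
        ⟨[], Language.nil_mem_kstar _, _, rfl, rfl⟩, hp⟩

theorem Edge.source {a : Option (Letter L V)} {j : ℕ} (h : Edge name s₀ i₀ k₀ i a j) :
    ∃ s k, Occ name s₀ i₀ k₀ s i k := by
  cases h <;> exact ⟨_, _, ‹_›⟩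

/-- The executions of a program are spelled by the paths through its flow graph. -/
theorem mem_exec_iff (hk : k₀ < i₀) {ρ : Execution L V} :
    ρ ∈ s₀.Exec ↔ ∃ n, Path (Edge name s₀ i₀ k₀) n i₀ ρ k₀ := by
  refine ⟨Occ.root.exists_path, fun ⟨n, hp⟩ => ?_⟩
  obtain ⟨m, -, ρ₁, ρ₂, rfl, h, hp⟩ := Occ.root.split_path hk hp
  rcases m with _ | m
  · obtain ⟨-, rfl⟩ := hp
    rwa [List.append_nil]
  · obtain ⟨a, i', ρ', he, -⟩ := hp
    obtain ⟨s, k, h⟩ := he.source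
    have := h.range
    omega

/-! ### Configurations -/

/-- Configurations of the machine that follows an execution and maintains its summary: a position
in the program, whether coherence has been violated, and the summary. -/
structure Config (L : FirstOrder.Language.{0, 0}) (I : Type) where
  /-- the position -/
  pos : I
  /-- whether coherence has been violated -/
  bad : Prop
  /-- the summary -/
  S : Summ L I

/-- The effect of an edge of the flow graph. After a violation the summary is arbitrary. -/
def Trans {I : Type} (N : I → I → Prop) (b : Prop) (S : Summ L I) (a : Option (Letter L I))
    (b' : Prop) (S' : Summ L I) : Prop :=
  (b ∧ b') ∨ (¬ b ∧ match a with
    | none => ¬ b' ∧ S' = S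
    | some a => (S.Bad a ∧ b') ∨ (¬ S.Bad a ∧ ¬ b' ∧ S.Next N a S'))

/-- The transitions between configurations, for names `nm` of variables. -/
def CStep {m : ℕ} (R : ℕ → Option (Letter L V) → ℕ → Prop) (nm : Fin m → V)
    (c c' : Config L (Fin m)) : Prop :=
  ∃ a : Option (Letter L (Fin m)), R c.pos (a.map (Letter.map nm)) c'.pos ∧
    Trans (fun i j => nm i = nm j) c.bad c.S a c'.bad c'.S

theorem Letter.map_surjective {I : Type} {nm : I → V} (hnm : Function.Surjective nm) :
    Function.Surjective (Letter.map (L := L) nm) := by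
  have hcond : Function.Surjective (Cond.map nm) := by
    rintro (⟨x, y⟩ | ⟨x, y⟩)
    · obtain ⟨⟨x, rfl⟩, y, rfl⟩ := hnm x, hnm y
      exact ⟨.eq x y, rfl⟩
    · obtain ⟨⟨x, rfl⟩, y, rfl⟩ := hnm x, hnm y
      exact ⟨.ne x y, rfl⟩
  rintro (⟨x, y⟩ | ⟨x, f, z⟩ | c)
  · obtain ⟨⟨x, rfl⟩, y, rfl⟩ := hnm x, hnm y
    exact ⟨.copy x y, rfl⟩
  · obtain ⟨x, rfl⟩ := hnm x
    choose z' hz using fun i => hnm (z i)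
    obtain rfl : (fun i => nm (z' i)) = z := funext hz
    exact ⟨.app x f z', rfl⟩
  · obtain ⟨c, rfl⟩ := hcond c
    exact ⟨.assume c, rfl⟩

theorem coherentExecution_concat [DecidableEq V] {σ : Execution L V} {a : Letter L V} :
    CoherentExecution (σ ++ [a]) ↔ CoherentExecution σ ∧ ¬ Violates σ a := by
  rw [coherentExecution_iff, coherentExecution_iff]
  constructor
  · exact fun h => ⟨fun σ' a' h' => h σ' a' (h'.trans (List.prefix_append _ _)),
      h σ a List.prefix_rfl⟩
  · rintro ⟨h, h'⟩ σ' a' hσ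
    rcases List.prefix_concat_iff.1 hσ with h1 | h1
    · obtain ⟨rfl, h2⟩ := List.append_inj' h1 rfl
      rwa [List.singleton_inj.1 h2]
    · exact h σ' a' h1

theorem coherentExecution_nil [DecidableEq V] : CoherentExecution ([] : Execution L V) :=
  coherentExecution_iff.2 fun σ a h => absurd (List.prefix_nil.1 h) (by simp)

theorem CoherentExecution.of_append [DecidableEq V] {σ τ : Execution L V}
    (h : CoherentExecution (σ ++ τ)) : CoherentExecution σ := by
  rw [coherentExecution_iff] at h ⊢
  exact fun σ' a h' => h σ' a (h'.trans (List.prefix_append _ _))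

variable {m : ℕ} {nm : Fin m → V}

theorem reaches_of_bad (hnm : Function.Surjective nm)
    (hR : ∀ i a j, R i a j → j < m) {n : ℕ} {i j : Fin m} {ρ : Execution L V}
    (hp : Path R n i ρ j) (S : Summ L (Fin m)) :
    Relation.ReflTransGen (CStep R nm) ⟨i, True, S⟩ ⟨j, True, S⟩ := by
  induction n generalizing i ρ with
  | zero =>
    obtain rfl := Fin.ext hp.1
    exact .refl
  | succ n ih =>
    obtain ⟨a, i', ρ', h, rfl, hp⟩ := hp
    have ha : ∃ a', a = Option.map (Letter.map nm) a' := by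
      cases a with
      | none => exact ⟨none, rfl⟩
      | some a =>
        obtain ⟨a, rfl⟩ := Letter.map_surjective hnm a
        exact ⟨some a, rfl⟩
    obtain ⟨a, rfl⟩ := ha
    exact .head (b := ⟨⟨i', hR _ _ _ h⟩, True, S⟩) ⟨a, h, Or.inl ⟨trivial, trivial⟩⟩
      (ih (i := ⟨i', hR _ _ _ h⟩) hp)

theorem reaches_of_violation [DecidableEq V] (hnm : Function.Surjective nm)
    (hR : ∀ i a j, R i a j → j < m) {n : ℕ} {i j : Fin m} {σ ρ : Execution L V}
    (hp : Path R n i ρ j) (hσ : CoherentExecution σ) (hρ : ¬ CoherentExecution (σ ++ ρ)) :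
    ∃ S, Relation.ReflTransGen (CStep R nm) ⟨i, False, summOf nm σ⟩ ⟨j, True, S⟩ := by
  induction n generalizing i σ ρ with
  | zero =>
    obtain ⟨-, rfl⟩ := hp
    rw [List.append_nil] at hρ
    exact absurd hσ hρ
  | succ n ih =>
    obtain ⟨a, i', ρ', h, rfl, hp⟩ := hp
    have hi' := hR _ _ _ h
    cases a with
    | none =>
      obtain ⟨S, hS⟩ := ih (i := ⟨i', hi'⟩) hp hσ hρ
      exact ⟨S, .head (show CStep R nm _ ⟨⟨i', hi'⟩, False, summOf nm σ⟩ from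
        ⟨none, h, Or.inr ⟨id, id, rfl⟩⟩) hS⟩
    | some a =>
      obtain ⟨a, rfl⟩ := Letter.map_surjective hnm a
      by_cases hv : Violates σ (a.map nm)
      · exact ⟨_, .head (show CStep R nm _ ⟨⟨i', hi'⟩, True, summOf nm σ⟩ from
          ⟨some a, h, Or.inr ⟨id, Or.inl ⟨(violates_iff hnm σ a).1 hv, trivial⟩⟩⟩)
          (reaches_of_bad (i := ⟨i', hi'⟩) hnm hR hp (summOf nm σ))⟩
      · rw [← List.append_assoc] at hρ
        obtain ⟨S, hS⟩ := ih (i := ⟨i', hi'⟩) hp (coherentExecution_concat.2 ⟨hσ, hv⟩) hρ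
        have hv' := fun h => hv ((violates_iff hnm σ a).2 h)
        exact ⟨S, .head (show CStep R nm _ ⟨⟨i', hi'⟩, False, summOf nm (σ ++ [a.map nm])⟩ from
          ⟨some a, h, Or.inr ⟨id, Or.inr ⟨hv', id, (next_iff σ hv').2 rfl⟩⟩⟩) hS⟩

theorem path_of_reaches [DecidableEq V] (hnm : Function.Surjective nm) {i : Fin m}
    {c : Config L (Fin m)}
    (h : Relation.ReflTransGen (CStep R nm) ⟨i, False, summOf nm []⟩ c) :
    ∃ n ρ, Path R n i ρ c.pos ∧ ((c.bad ∧ ¬ CoherentExecution ρ) ∨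
      (¬ c.bad ∧ CoherentExecution ρ ∧ c.S = summOf nm ρ)) := by
  induction h with
  | refl => exact ⟨0, [], ⟨rfl, rfl⟩, Or.inr ⟨id, coherentExecution_nil, rfl⟩⟩
  | @tail c c' _ h ih =>
    obtain ⟨n, ρ, hp, h1⟩ := ih
    obtain ⟨a, ha, ht⟩ := h
    refine ⟨n + 1, _, hp.trans (Path.single ha), ?_⟩
    rcases h1 with ⟨hb, h1⟩ | ⟨hb, h1, h2⟩
    · exact Or.inl ⟨(ht.resolve_right fun h => h.1 hb).2, fun h => h1 h.of_append⟩
    · obtain ⟨-, ht⟩ := ht.resolve_left fun h => hb h.1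
      cases a with
      | none => exact Or.inr ⟨ht.1, by simpa using h1, by simpa [h2] using ht.2⟩
      | some a =>
        rw [h2] at ht
        rcases ht with ⟨h3, h4⟩ | ⟨h3, h4, h5⟩
        · exact Or.inl ⟨h4, fun h => (coherentExecution_concat.1 h).2 ((violates_iff hnm ρ a).2 h3)⟩
        · exact Or.inr ⟨h4,
            coherentExecution_concat.2 ⟨h1, fun h => h3 ((violates_iff hnm ρ a).1 h)⟩,
            (next_iff ρ h3).1 h5⟩

/-- A program is incoherent if and only if the machine that maintains summaries can reach the end
of the program after a violation of coherence. -/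
theorem not_coherent_iff [DecidableEq V] (hnm : Function.Surjective nm) {i j : Fin m}
    (hij : (j : ℕ) < i) (hR : ∀ p a q, Edge name s₀ i j p a q → q < m) :
    ¬ s₀.Coherent ↔ ∃ S, Relation.ReflTransGen (CStep (Edge name s₀ i j) nm)
      ⟨i, False, Summ.init fun i j => nm i = nm j⟩ ⟨j, True, S⟩ := by
  rw [← summOf_nil hnm]
  constructor
  · intro h
    simp only [Prog.Coherent, not_forall] at h
    obtain ⟨ρ, hρ, h⟩ := h
    obtain ⟨n, hp⟩ := (mem_exec_iff (name := name) hij).1 hρ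
    exact reaches_of_violation hnm hR hp coherentExecution_nil h
  · rintro ⟨S, hS⟩ h
    obtain ⟨n, ρ, hp, h1⟩ := path_of_reaches hnm hS
    have := h ρ ((mem_exec_iff hij).2 ⟨n, hp⟩)
    exact h1.elim (fun h1 => h1.2 this) fun h1 => h1.1 trivial

end

end UninterpretedProgram

namespace UninterpretedProgram

/-! ### Reading programs -/

section

variable {α : Type}

/-- The word `l` is written in `w` from position `i` on. -/
def Spells (w : List α) (i : ℕ) (l : List α) : Prop := l <+: w.drop i

theorem spells_nil {w : List α} {i : ℕ} : Spells w i [] := List.nil_prefix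

theorem spells_cons {w : List α} {i : ℕ} {a : α} {l : List α} :
    Spells w i (a :: l) ↔ w[i]? = some a ∧ Spells w (i + 1) l := by
  rw [Spells, Spells]
  rcases lt_or_ge i w.length with h | h
  · rw [List.drop_eq_getElem_cons h, List.cons_prefix_cons, List.getElem?_eq_getElem h,
      Option.some_inj, eq_comm]
  · simp [List.drop_eq_nil_of_le h, h]

theorem spells_append {w : List α} {i : ℕ} {l l' : List α} :
    Spells w i (l ++ l') ↔ Spells w i l ∧ Spells w (i + l.length) l' := by
  induction l generalizing i with
  | nil => simp [spells_nil]
  | cons a l ih =>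
    rw [List.cons_append, spells_cons, spells_cons, ih, and_assoc, List.length_cons,
      show i + 1 + l.length = i + (l.length + 1) by omega]

theorem Spells.length_le {w : List α} {i : ℕ} {l : List α} (h : Spells w i l) (hl : l ≠ []) :
    i + l.length ≤ w.length := by
  have h1 := List.IsPrefix.length_le h
  have h2 := List.length_pos_iff.2 hl
  rw [List.length_drop] at h1
  omega

end

section

variable {L : FirstOrder.Language.{0, 0}} {V : Type} {w : List (Token L)}

/-- The name at the beginning of a list of tokens. -/
def readName : List (Token L) → List Bool
  | .bit b :: l => b :: readName l
  | _ => []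

theorem readName_encodeName (x : List Bool) (l : List (Token L)) :
    readName (encodeName x ++ l) = x := by
  induction x with
  | nil => rfl
  | cons b x ih => simpa [encodeName, readName] using ih

theorem Spells.readName {i : ℕ} {x : List Bool} (h : Spells w i (encodeName x)) :
    UninterpretedProgram.readName (w.drop i) = x := by
  obtain ⟨l, h⟩ := h
  rw [← h, readName_encodeName]

theorem length_encodeName (x : List Bool) : (encodeName (L := L) x).length = x.length + 1 := by
  simp [encodeName]

theorem Spells.name_unique {i : ℕ} {x y : List Bool} (h : Spells w i (encodeName x))
    (h' : Spells w i (encodeName y)) : x = y := h.readName.symm.trans h'.readName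

/-- A name starts with a bit or the end marker. -/
theorem Spells.name_ne {i : ℕ} {x : List Bool} (h : Spells w i (encodeName x)) {a : Token L}
    (ha : w[i]? = some a) : (∃ b, a = .bit b) ∨ a = .endName := by
  cases x with
  | nil =>
    rw [encodeName, List.map_nil, List.nil_append, spells_cons, ha] at h
    exact Or.inr (Option.some_inj.1 h.1)
  | cons b x =>
    rw [encodeName, List.map_cons, List.cons_append, spells_cons, ha] at h
    exact Or.inl ⟨b, Option.some_inj.1 h.1⟩

variable {name : V → List Bool}

/-- The texts of the arguments of a function symbol. -/
def encodeArgs (name : V → List Bool) {k : ℕ} (z : Fin k → V) : List (Token L) :=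
  (List.ofFn fun i => encodeName (name (z i))).flatten

theorem encodeArgs_succ {k : ℕ} (z : Fin (k + 1) → V) : encodeArgs (L := L) name z =
    encodeName (name (z 0)) ++ encodeArgs name fun i => z i.succ := by
  simp [encodeArgs, List.ofFn_succ]

theorem Spells.args_unique (hname : Function.Injective name) {k i : ℕ} {z z' : Fin k → V}
    (h : Spells w i (encodeArgs name z)) (h' : Spells w i (encodeArgs name z')) : z = z' := by
  induction k generalizing i with
  | zero => exact Subsingleton.elim _ _
  | succ k ih =>
    rw [encodeArgs_succ, spells_append] at h h'
    have h0 := h.1.name_unique h'.1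
    rw [h0] at h
    have hs := ih h.2 h'.2
    funext j
    refine Fin.cases (hname h0) (fun j => ?_) j
    exact congrFun hs j

theorem spells_cond {i : ℕ} {c : Cond V} : Spells w i (c.encode name) ↔ ∃ x y,
    ((c = .eq x y ∧ w[i]? = some .eq) ∨ (c = .ne x y ∧ w[i]? = some .ne)) ∧
    Spells w (i + 1) (encodeName (name x)) ∧
    Spells w (i + 1 + (encodeName (L := L) (name x)).length) (encodeName (name y)) := by
  cases c with
  | eq x y =>
    rw [Cond.encode, spells_cons, spells_append]
    constructor
    · exact fun h => ⟨x, y, Or.inl ⟨rfl, h.1⟩, h.2⟩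
    · rintro ⟨x', y', ⟨h, h1⟩ | ⟨h, -⟩, h2⟩
      · cases h; exact ⟨h1, h2⟩
      · cases h
  | ne x y =>
    rw [Cond.encode, spells_cons, spells_append]
    constructor
    · exact fun h => ⟨x, y, Or.inr ⟨rfl, h.1⟩, h.2⟩
    · rintro ⟨x', y', ⟨h, -⟩ | ⟨h, h1⟩, h2⟩
      · cases h
      · cases h; exact ⟨h1, h2⟩

theorem Spells.cond_unique (hname : Function.Injective name) {i : ℕ} {c c' : Cond V}
    (h : Spells w i (c.encode name)) (h' : Spells w i (c'.encode name)) : c = c' := by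
  obtain ⟨x, y, h1, h2, h3⟩ := spells_cond.1 h
  obtain ⟨x', y', h1', h2', h3'⟩ := spells_cond.1 h'
  have hx := h2.name_unique h2'
  rw [hx] at h3
  obtain rfl := hname hx
  obtain rfl := hname (h3.name_unique h3')
  rcases h1 with ⟨rfl, h1⟩ | ⟨rfl, h1⟩ <;> rcases h1' with ⟨rfl, h1'⟩ | ⟨rfl, h1'⟩
  · rfl
  · rw [h1] at h1'; cases h1'
  · rw [h1] at h1'; cases h1'
  · rfl

/-- Program texts are prefix-free. -/
theorem Spells.prog_unique (hname : Function.Injective name) {i : ℕ} {s s' : Prog L V}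
    (h : Spells w i (s.encode name)) (h' : Spells w i (s'.encode name)) : s = s' := by
  induction s generalizing i s' with
  | skip =>
    cases s' <;> simp only [Prog.encode, spells_cons] at h h' <;>
      first | rfl | (have e := h.1.symm.trans h'.1; cases e)
  | copy x y =>
    cases s' <;> simp only [Prog.encode, spells_cons, spells_append] at h h' <;>
      try (have e := h.1.symm.trans h'.1; cases e; done)
    · have hx := h.2.1.name_unique h'.2.1
      rw [hx] at h
      rw [hname hx, hname (h.2.2.name_unique h'.2.2)]
    · have hx := h.2.1.name_unique h'.2.1
      rw [hx] at h
      rcases h.2.2.name_ne h'.2.2.1 with ⟨b, h1⟩ | h1 <;> cases h1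
  | app x f z =>
    cases s' <;> simp only [Prog.encode, spells_cons, spells_append] at h h' <;>
      try (have e := h.1.symm.trans h'.1; cases e; done)
    · have hx := h.2.1.name_unique h'.2.1
      rw [hx] at h
      rcases h'.2.2.name_ne h.2.2.1 with ⟨b, h1⟩ | h1 <;> cases h1
    · have hx := h.2.1.name_unique h'.2.1
      rw [hx] at h
      have hf := h.2.2.1.symm.trans h'.2.2.1
      cases hf
      rw [hname hx, Spells.args_unique hname h.2.2.2 h'.2.2.2]
  | assume c =>
    cases s' <;> simp only [Prog.encode, spells_cons] at h h' <;>
      try (have e := h.1.symm.trans h'.1; cases e; done)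
    rw [h.2.cond_unique hname h'.2]
  | seq s₁ s₂ ih₁ ih₂ =>
    cases s' <;> simp only [Prog.encode, spells_cons, spells_append] at h h' <;>
      try (have e := h.1.symm.trans h'.1; cases e; done)
    have h1 := ih₁ h.2.1 h'.2.1
    rw [h1] at h
    rw [h1, ih₂ h.2.2 h'.2.2]
  | ite c s₁ s₂ ih₁ ih₂ =>
    cases s' <;> simp only [Prog.encode, spells_cons, spells_append] at h h' <;>
      try (have e := h.1.symm.trans h'.1; cases e; done)
    have h0 := h.2.1.1.cond_unique hname h'.2.1.1
    rw [h0] at h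
    have h1 := ih₁ h.2.1.2 h'.2.1.2
    rw [h1] at h
    rw [h0, h1, ih₂ h.2.2 h'.2.2]
  | _ c s ih =>
    cases s' <;> simp only [Prog.encode, spells_cons, spells_append] at h h' <;>
      try (have e := h.1.symm.trans h'.1; cases e; done)
    have h0 := h.2.1.cond_unique hname h'.2.1
    rw [h0] at h
    rw [h0, ih h.2.2 h'.2.2]

end

end UninterpretedProgram

namespace UninterpretedProgram

/-! ### Programs as a least fixed point -/

section

variable {L : FirstOrder.Language.{0, 0}} {V : Type} {w : List (Token L)} {name : V → List Bool}

/-- The number of tokens for a name. -/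
def nlen (name : V → List Bool) (v : V) : ℕ := (name v).length + 1

/-- The number of tokens for the arguments of a function symbol. -/
def alen (L : FirstOrder.Language.{0, 0}) (name : V → List Bool) {k : ℕ} (z : Fin k → V) : ℕ :=
  (encodeArgs (L := L) name z).length

/-- The equality or disequality of two variables. -/
def condOf (b : Bool) (x y : V) : Cond V := if b then .eq x y else .ne x y

/-- The token for equality or disequality. -/
def condTok (L : FirstOrder.Language.{0, 0}) (b : Bool) : Token L := if b then .eq else .ne

theorem exists_condOf (c : Cond V) : ∃ b x y, c = condOf b x y := by
  cases c with
  | eq x y => exact ⟨true, x, y, rfl⟩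
  | ne x y => exact ⟨false, x, y, rfl⟩

theorem length_name {v : V} : (encodeName (L := L) (name v)).length = nlen name v :=
  length_encodeName _

theorem spells_condOf {i : ℕ} {b : Bool} {x y : V} :
    Spells w i ((condOf b x y).encode name) ↔ w[i]? = some (condTok L b) ∧
      Spells w (i + 1) (encodeName (name x)) ∧
      Spells w (i + 1 + nlen name x) (encodeName (name y)) := by
  cases b <;> simp [condOf, condTok, Cond.encode, spells_cons, spells_append, length_name]

theorem len_condOf {b : Bool} {x y : V} :
    (condOf b x y).len L name = nlen name x + nlen name y + 1 := by
  cases b <;> simp [condOf, Cond.len, Cond.encode, length_name]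

theorem spells_skip {i : ℕ} :
    Spells w i (Prog.skip.encode (V := V) name) ↔ w[i]? = some .skip := by
  simp [Prog.encode, spells_cons, spells_nil]

theorem spells_copy {i : ℕ} {x y : V} : Spells w i ((Prog.copy x y).encode name) ↔
    w[i]? = some .assign ∧ Spells w (i + 1) (encodeName (name x)) ∧
      Spells w (i + 1 + nlen name x) (encodeName (name y)) := by
  simp [Prog.encode, spells_cons, spells_append, length_name]

theorem spells_app {i n : ℕ} {x : V} {f : L.Functions n} {z : Fin n → V} :
    Spells w i ((Prog.app x f z).encode name) ↔
    w[i]? = some .assign ∧ Spells w (i + 1) (encodeName (name x)) ∧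
      w[i + 1 + nlen name x]? = some (.fn ⟨n, f⟩) ∧
      Spells w (i + 1 + nlen name x + 1) (encodeArgs name z) := by
  simp [Prog.encode, spells_cons, spells_append, length_name, encodeArgs]

theorem spells_assume {i : ℕ} {c : Cond V} : Spells w i ((Prog.assume c).encode name) ↔
    w[i]? = some .assume ∧ Spells w (i + 1) (c.encode name) := by
  simp [Prog.encode, spells_cons]

theorem spells_seq {i : ℕ} {s₁ s₂ : Prog L V} : Spells w i ((Prog.seq s₁ s₂).encode name) ↔
    w[i]? = some .seq ∧ Spells w (i + 1) (s₁.encode name) ∧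
      Spells w (i + 1 + s₁.len name) (s₂.encode name) := by
  simp [Prog.encode, spells_cons, spells_append, Prog.len]

theorem spells_ite {i : ℕ} {c : Cond V} {s₁ s₂ : Prog L V} :
    Spells w i ((Prog.ite c s₁ s₂).encode name) ↔
    w[i]? = some .ite ∧ Spells w (i + 1) (c.encode name) ∧
      Spells w (i + 1 + c.len L name) (s₁.encode name) ∧
      Spells w (i + 1 + c.len L name + s₁.len name) (s₂.encode name) := by
  simp [Prog.encode, spells_cons, spells_append, Prog.len, Cond.len, Nat.add_assoc]

theorem spells_while {i : ℕ} {c : Cond V} {s : Prog L V} :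
    Spells w i ((Prog.while c s).encode name) ↔
    w[i]? = some .while ∧ Spells w (i + 1) (c.encode name) ∧
      Spells w (i + 1 + c.len L name) (s.encode name) := by
  simp [Prog.encode, spells_cons, spells_append, Cond.len]

theorem len_skip : (Prog.skip : Prog L V).len name = 1 := rfl

theorem len_copy {x y : V} :
    (Prog.copy x y : Prog L V).len name = nlen name x + nlen name y + 1 := by
  simp [Prog.len, Prog.encode, length_name]

theorem len_app {n : ℕ} {x : V} {f : L.Functions n} {z : Fin n → V} :
    (Prog.app x f z).len name = nlen name x + alen L name z + 2 := by
  rw [Prog.len, Prog.encode, alen, encodeArgs]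
  simp only [List.length_cons, List.length_append, length_name]
  omega

theorem len_assume {c : Cond V} : (Prog.assume c : Prog L V).len name = c.len L name + 1 := by
  simp [Prog.len, Prog.encode, Cond.len]

theorem Spells.name_lt {i : ℕ} {v : V} (h : Spells w i (encodeName (name v))) :
    i + nlen name v ≤ w.length := by
  have := h.length_le (by simp [encodeName])
  rwa [length_name] at this

theorem Spells.prog_lt {i : ℕ} {s : Prog L V} (h : Spells w i (s.encode name)) :
    i + s.len name ≤ w.length :=
  h.length_le (List.length_pos_iff.1 (Prog.len_pos (name := name) s))

/-- `VarsAt VA k z i j`: names for the variables `z` are written after position `i`, up to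
position `j`. -/
def VarsAt {m : ℕ} (VA : ℕ → Fin m → ℕ → Prop) : (k : ℕ) → (Fin k → Fin m) → ℕ → ℕ → Prop
  | 0, _, i, j => i = j
  | k + 1, z, i, j => ∃ e : Fin m, VA (i + 1) (z 0) e ∧ VarsAt VA k (fun i => z i.succ) e j

/-- A condition with variables `x` and `y` is written between the positions `i` and `j`. -/
def CondAt (w : List (Token L)) (VA : ℕ → Fin w.length → ℕ → Prop) (b : Bool) (i : ℕ)
    (x y : Fin w.length) (j : ℕ) : Prop :=
  w[i]? = some (condTok L b) ∧ ∃ e : Fin w.length, VA (i + 1) x e ∧ VA (e + 1) y j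

/-- One level of the recursive definition of programs: a program is written between the positions
`i` and `j`, both inclusive, if this holds with `X` for its parts. `VA i x e` says that a name for
the variable `x` is written between `i` and `e`. -/
def ProgRule (w : List (Token L)) (VA : ℕ → Fin w.length → ℕ → Prop)
    (X : Fin w.length → Fin w.length → Prop) (i j : Fin w.length) : Prop :=
  (w[(i : ℕ)]? = some .skip ∧ j = i) ∨
  (w[(i : ℕ)]? = some .assign ∧ ∃ x y e : Fin w.length, VA (i + 1) x e ∧ VA (e + 1) y j) ∨
  (w[(i : ℕ)]? = some .assign ∧ ∃ f : Σ n, L.Functions n, ∃ x : Fin w.length,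
    ∃ z : Fin f.1 → Fin w.length, ∃ e : Fin w.length, VA (i + 1) x e ∧
    w[(e + 1 : ℕ)]? = some (.fn f) ∧ VarsAt VA f.1 z (e + 1) j) ∨
  (w[(i : ℕ)]? = some .assume ∧ ∃ b, ∃ x y : Fin w.length, CondAt w VA b (i + 1) x y j) ∨
  (w[(i : ℕ)]? = some .seq ∧ ∃ i₁ e₁ i₂ : Fin w.length, (i₁ : ℕ) = i + 1 ∧ X i₁ e₁ ∧
    (i₂ : ℕ) = e₁ + 1 ∧ X i₂ j) ∨
  (w[(i : ℕ)]? = some .ite ∧ ∃ b, ∃ x y e i₁ e₁ i₂ : Fin w.length, CondAt w VA b (i + 1) x y e ∧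
    (i₁ : ℕ) = e + 1 ∧ X i₁ e₁ ∧ (i₂ : ℕ) = e₁ + 1 ∧ X i₂ j) ∨
  (w[(i : ℕ)]? = some .while ∧ ∃ b, ∃ x y e i₁ : Fin w.length, CondAt w VA b (i + 1) x y e ∧
    (i₁ : ℕ) = e + 1 ∧ X i₁ j)

theorem progRule_mono {VA : ℕ → Fin w.length → ℕ → Prop} (X Y : Fin w.length → Fin w.length → Prop)
    (hXY : ∀ i j, X i j → Y i j) (i j : Fin w.length) (h : ProgRule w VA X i j) :
    ProgRule w VA Y i j := by
  rcases h with h | h | h | h | ⟨h0, i₁, e₁, i₂, h1, h2, h3, h4⟩ |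
    ⟨h0, b, x, y, e, i₁, e₁, i₂, h, h1, h2, h3, h4⟩ | ⟨h0, b, x, y, e, i₁, h, h1, h2⟩
  · exact Or.inl h
  · exact Or.inr (Or.inl h)
  · exact Or.inr (Or.inr (Or.inl h))
  · exact Or.inr (Or.inr (Or.inr (Or.inl h)))
  · exact Or.inr (Or.inr (Or.inr (Or.inr (Or.inl
      ⟨h0, i₁, e₁, i₂, h1, hXY _ _ h2, h3, hXY _ _ h4⟩))))
  · exact Or.inr (Or.inr (Or.inr (Or.inr (Or.inr (Or.inl
      ⟨h0, b, x, y, e, i₁, e₁, i₂, h, h1, hXY _ _ h2, h3, hXY _ _ h4⟩)))))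
  · exact Or.inr (Or.inr (Or.inr (Or.inr (Or.inr (Or.inr
      ⟨h0, b, x, y, e, i₁, h, h1, hXY _ _ h2⟩)))))

/-- A program is written between two positions, both inclusive. -/
def ProgAt (w : List (Token L)) (VA : ℕ → Fin w.length → ℕ → Prop) :
    Fin w.length → Fin w.length → Prop := Lfp (ProgRule w VA)

variable {VA : ℕ → Fin w.length → ℕ → Prop} {T : Fin w.length → V → Prop}

/-- `VA i x e` says that the name of the variable that `T` assigns to `x` is written between the
positions `i` and `e`. -/
def ReadsVars (w : List (Token L)) (name : V → List Bool) (VA : ℕ → Fin w.length → ℕ → Prop)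
    (T : Fin w.length → V → Prop) : Prop :=
  (∀ v, ∃ x, T x v) ∧ ∀ i x e, VA i x e ↔ ∃ v, T x v ∧ Spells w i (encodeName (name v)) ∧
    e + 1 = i + nlen name v

theorem ReadsVars.varsAt_iff (hV : ReadsVars w name VA T) {k : ℕ} {z : Fin k → Fin w.length}
    {i j : ℕ} : VarsAt VA k z i j ↔ ∃ z' : Fin k → V, (∀ i, T (z i) (z' i)) ∧
      Spells w (i + 1) (encodeArgs name z') ∧ j = i + alen L name z' := by
  induction k generalizing i j with
  | zero =>
    constructor
    · rintro rfl
      exact ⟨Fin.elim0, fun i => i.elim0, spells_nil, rfl⟩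
    · rintro ⟨z', -, -, h⟩
      exact h.symm
  | succ k ih =>
    simp only [VarsAt, hV.2, ih]
    constructor
    · rintro ⟨e, ⟨v, h1, h2, h3⟩, z', h4, h5, h6⟩
      refine ⟨Fin.cons v z', Fin.cases h1 h4, ?_, ?_⟩
      · rw [encodeArgs_succ, spells_append, length_name]
        rw [h3] at h5
        exact ⟨h2, h5⟩
      · rw [alen, encodeArgs_succ, List.length_append, length_name]
        change j = i + (nlen name v + (encodeArgs (L := L) name z').length)
        rw [alen] at h6
        omega
    · rintro ⟨z', h1, h2, h3⟩
      rw [encodeArgs_succ, spells_append, length_name] at h2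
      rw [alen, encodeArgs_succ, List.length_append, length_name] at h3
      have hlt := h2.1.name_lt
      have hpos : nlen name (z' 0) = (name (z' 0)).length + 1 := rfl
      refine ⟨⟨i + nlen name (z' 0), by omega⟩, ⟨z' 0, h1 0, h2.1, by simp only; omega⟩,
        fun i => z' i.succ, fun i => h1 _, ?_, ?_⟩
      · convert h2.2 using 1
        simp only; omega
      · change j = i + nlen name (z' 0) + (encodeArgs (L := L) name fun i => z' i.succ).length
        omega

theorem ReadsVars.condAt_iff (hV : ReadsVars w name VA T) {b : Bool} {x y : Fin w.length}
    {i j : ℕ} : CondAt w VA b i x y j ↔ ∃ v v', T x v ∧ T y v' ∧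
      Spells w i ((condOf b v v').encode name) ∧ j + 1 = i + (condOf b v v').len L name := by
  simp only [CondAt, hV.2, spells_condOf, len_condOf]
  constructor
  · rintro ⟨h, e, ⟨v, h1, h2, h3⟩, v', h4, h5, h6⟩
    rw [h3] at h5
    exact ⟨v, v', h1, h4, ⟨h, h2, h5⟩, by omega⟩
  · rintro ⟨v, v', h1, h4, ⟨h, h2, h5⟩, h6⟩
    have hlt := h2.name_lt
    have hpos : nlen name v = (name v).length + 1 := rfl
    refine ⟨h, ⟨i + nlen name v, by omega⟩, ⟨v, h1, h2, by simp only; omega⟩, v', h4, ?_, ?_⟩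
    · convert h5 using 1
      simp only; omega
    · simp only; omega

theorem Spells.cond_lt {i : ℕ} {c : Cond V} (h : Spells w i (c.encode name)) :
    i + c.len L name ≤ w.length :=
  h.length_le (by cases c <;> simp [Cond.encode])

theorem Cond.len_pos (c : Cond V) : 0 < c.len L name := by
  cases c <;> simp [Cond.len, Cond.encode]

/-- The recursive definition `ProgAt` describes the texts of programs. -/
theorem ReadsVars.progAt_iff (hV : ReadsVars w name VA T) {i j : Fin w.length} :
    ProgAt w VA i j ↔
      ∃ s : Prog L V, Spells w i (s.encode name) ∧ (j + 1 : ℕ) = i + s.len name := by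
  constructor
  · refine fun h => Lfp.minimal (X := fun i j : Fin w.length =>
      ∃ s : Prog L V, Spells w i (s.encode name) ∧ (j + 1 : ℕ) = i + s.len name) ?_ h
    intro i j h
    rcases h with ⟨h0, rfl⟩ | ⟨h0, x, y, e, h1, h2⟩ | ⟨h0, f, x, z, e, h1, h2, h3⟩ |
      ⟨h0, b, x, y, h1⟩ | ⟨h0, i₁, e₁, i₂, h1, ⟨s₁, h2, h2'⟩, h3, s₂, h4, h4'⟩ |
      ⟨h0, b, x, y, e, i₁, e₁, i₂, h, h1, ⟨s₁, h2, h2'⟩, h3, s₂, h4, h4'⟩ |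
      ⟨h0, b, x, y, e, i₁, h, h1, s₁, h2, h2'⟩
    · exact ⟨.skip, spells_skip.2 h0, rfl⟩
    · obtain ⟨v, -, h1, h3⟩ := (hV.2 _ _ _).1 h1
      obtain ⟨v', -, h2, h4⟩ := (hV.2 _ _ _).1 h2
      rw [h3] at h2
      exact ⟨.copy v v', spells_copy.2 ⟨h0, h1, h2⟩, by rw [len_copy]; omega⟩
    · obtain ⟨v, -, h1, h4⟩ := (hV.2 _ _ _).1 h1
      obtain ⟨z', -, h3, h5⟩ := hV.varsAt_iff.1 h3
      rw [h4] at h2 h3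
      exact ⟨.app v f.2 z', spells_app.2 ⟨h0, h1, h2, h3⟩, by rw [len_app]; omega⟩
    · obtain ⟨v, v', -, -, h1, h2⟩ := hV.condAt_iff.1 h1
      exact ⟨.assume _, spells_assume.2 ⟨h0, h1⟩, by rw [len_assume]; omega⟩
    · rw [h1] at h2 h2'
      rw [h3, h2'] at h4
      exact ⟨.seq s₁ s₂, spells_seq.2 ⟨h0, h2, h4⟩, by rw [len_seq]; omega⟩
    · obtain ⟨v, v', -, -, h, h5⟩ := hV.condAt_iff.1 h
      rw [h1, h5] at h2 h2'
      rw [h3, h2'] at h4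
      exact ⟨.ite _ s₁ s₂, spells_ite.2 ⟨h0, h, h2, h4⟩, by rw [len_ite]; omega⟩
    · obtain ⟨v, v', -, -, h, h5⟩ := hV.condAt_iff.1 h
      rw [h1, h5] at h2 h2'
      exact ⟨.while _ s₁, spells_while.2 ⟨h0, h, h2⟩, by rw [len_while]; omega⟩
  · rintro ⟨s, hs, hj⟩
    induction s generalizing i j with
    | skip =>
      rw [len_skip] at hj
      exact Lfp.closed progRule_mono (Or.inl ⟨spells_skip.1 hs, Fin.ext (by omega)⟩)
    | copy x y =>
      obtain ⟨h0, h1, h2⟩ := spells_copy.1 hs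
      obtain ⟨x', hx⟩ := hV.1 x
      obtain ⟨y', hy⟩ := hV.1 y
      rw [len_copy] at hj
      have hlt := h1.name_lt
      refine Lfp.closed progRule_mono (Or.inr (Or.inl ⟨h0, x', y', ⟨i + nlen name x, by omega⟩,
        (hV.2 _ _ _).2 ⟨x, hx, h1, by simp only; omega⟩,
        (hV.2 _ _ _).2 ⟨y, hy, ?_, by simp only; omega⟩⟩))
      convert h2 using 1
      simp only; omega
    | app x f z =>
      obtain ⟨h0, h1, h2, h3⟩ := spells_app.1 hs
      obtain ⟨x', hx⟩ := hV.1 x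
      choose z' hz using fun i => hV.1 (z i)
      rw [len_app] at hj
      have hlt := h1.name_lt
      refine Lfp.closed progRule_mono (Or.inr (Or.inr (Or.inl ⟨h0, ⟨_, f⟩, x', z',
        ⟨i + nlen name x, by omega⟩, (hV.2 _ _ _).2 ⟨x, hx, h1, by simp only; omega⟩, ?_,
        hV.varsAt_iff.2 ⟨z, hz, ?_, by simp only; omega⟩⟩)))
      · rw [← h2]
        simp only
        congr 1
        omega
      · convert h3 using 1
        simp only; omega
    | assume c =>
      obtain ⟨h0, h1⟩ := spells_assume.1 hs
      rw [len_assume] at hj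
      obtain ⟨b, x, y, rfl⟩ := exists_condOf c
      obtain ⟨x', hx⟩ := hV.1 x
      obtain ⟨y', hy⟩ := hV.1 y
      exact Lfp.closed progRule_mono (Or.inr (Or.inr (Or.inr (Or.inl ⟨h0, b, x', y',
        hV.condAt_iff.2 ⟨x, y, hx, hy, h1, by omega⟩⟩))))
    | seq s₁ s₂ ih₁ ih₂ =>
      obtain ⟨h0, h1, h2⟩ := spells_seq.1 hs
      rw [len_seq] at hj
      have hp₁ := Prog.len_pos (name := name) s₁
      have hp₂ := Prog.len_pos (name := name) s₂
      have hlt := h2.prog_lt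
      exact Lfp.closed progRule_mono (Or.inr (Or.inr (Or.inr (Or.inr (Or.inl ⟨h0,
        ⟨i + 1, by omega⟩, ⟨i + s₁.len name, by omega⟩, ⟨i + 1 + s₁.len name, by omega⟩, rfl,
        ih₁ h1 (by simp only; omega), by simp only; omega, ih₂ h2 (by simp only; omega)⟩)))))
    | ite c s₁ s₂ ih₁ ih₂ =>
      obtain ⟨h0, h3, h1, h2⟩ := spells_ite.1 hs
      rw [len_ite] at hj
      have hp₁ := Prog.len_pos (name := name) s₁
      have hp₂ := Prog.len_pos (name := name) s₂
      have hlt := h2.prog_lt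
      obtain ⟨b, x, y, rfl⟩ := exists_condOf c
      obtain ⟨x', hx⟩ := hV.1 x
      obtain ⟨y', hy⟩ := hV.1 y
      exact Lfp.closed progRule_mono (Or.inr (Or.inr (Or.inr (Or.inr (Or.inr (Or.inl ⟨h0, b, x', y',
        ⟨i + (condOf b x y).len L name, by omega⟩,
        ⟨i + 1 + (condOf b x y).len L name, by omega⟩,
        ⟨i + (condOf b x y).len L name + s₁.len name, by omega⟩,
        ⟨i + 1 + (condOf b x y).len L name + s₁.len name, by omega⟩,
        hV.condAt_iff.2 ⟨x, y, hx, hy, h3, by simp only; omega⟩, by simp only; omega,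
        ih₁ h1 (by simp only; omega), by simp only; omega, ih₂ h2 (by simp only; omega)⟩))))))
    | _ c s ih =>
      obtain ⟨h0, h3, h1⟩ := spells_while.1 hs
      rw [len_while] at hj
      have hp := Prog.len_pos (name := name) s
      have hlt := h1.prog_lt
      obtain ⟨b, x, y, rfl⟩ := exists_condOf c
      obtain ⟨x', hx⟩ := hV.1 x
      obtain ⟨y', hy⟩ := hV.1 y
      exact Lfp.closed progRule_mono (Or.inr (Or.inr (Or.inr (Or.inr (Or.inr (Or.inr ⟨h0, b, x', y',
        ⟨i + (condOf b x y).len L name, by omega⟩,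
        ⟨i + 1 + (condOf b x y).len L name, by omega⟩,
        hV.condAt_iff.2 ⟨x, y, hx, hy, h3, by simp only; omega⟩, by simp only; omega,
        ih h1 (by simp only; omega)⟩))))))

end

end UninterpretedProgram

namespace UninterpretedProgram

/-! ### The flow graph as a least fixed point -/

section

variable {L : FirstOrder.Language.{0, 0}} {V : Type} {w : List (Token L)} {name : V → List Bool}

theorem Spells.eq_skip {i : ℕ} {s : Prog L V} (h : Spells w i (s.encode name))
    (h0 : w[i]? = some .skip) : s = .skip := by
  cases s <;> simp [Prog.encode, spells_cons, h0] at h ⊢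

theorem Spells.eq_assume {i : ℕ} {s : Prog L V} (h : Spells w i (s.encode name))
    (h0 : w[i]? = some .assume) : ∃ c, s = .assume c := by
  cases s <;> simp [Prog.encode, spells_cons, h0] at h ⊢

theorem Spells.eq_seq {i : ℕ} {s : Prog L V} (h : Spells w i (s.encode name))
    (h0 : w[i]? = some .seq) : ∃ s₁ s₂, s = .seq s₁ s₂ := by
  cases s <;> simp [Prog.encode, spells_cons, h0] at h ⊢

theorem Spells.eq_ite {i : ℕ} {s : Prog L V} (h : Spells w i (s.encode name))
    (h0 : w[i]? = some .ite) : ∃ c s₁ s₂, s = .ite c s₁ s₂ := by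
  cases s <;> simp [Prog.encode, spells_cons, h0] at h ⊢

theorem Spells.eq_while {i : ℕ} {s : Prog L V} (h : Spells w i (s.encode name))
    (h0 : w[i]? = some .while) : ∃ c s₁, s = .while c s₁ := by
  cases s <;> simp [Prog.encode, spells_cons, h0] at h ⊢

theorem Occ.spells {s₀ s : Prog L V} {i₀ k₀ i k : ℕ} (hs₀ : Spells w i₀ (s₀.encode name))
    (h : Occ name s₀ i₀ k₀ s i k) : Spells w i (s.encode name) := by
  induction h with
  | root => exact hs₀
  | seq_left _ ih => exact (spells_seq.1 ih).2.1
  | seq_right _ ih => exact (spells_seq.1 ih).2.2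
  | ite_left _ ih => exact (spells_ite.1 ih).2.2.1
  | ite_right _ ih => exact (spells_ite.1 ih).2.2.2
  | body _ ih => exact (spells_while.1 ih).2.2

theorem Occ.lt_length {s₀ s : Prog L V} {i₀ k₀ i k : ℕ} (hs₀ : Spells w i₀ (s₀.encode name))
    (h : Occ name s₀ i₀ k₀ s i k) : i < w.length := by
  have := (h.spells hs₀).prog_lt
  have := Prog.len_pos (name := name) s
  omega

theorem Occ.next_lt_length {s₀ s : Prog L V} {i₀ k₀ i k : ℕ}
    (hs₀ : Spells w i₀ (s₀.encode name)) (hk : k₀ < w.length) (h : Occ name s₀ i₀ k₀ s i k) :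
    k < w.length := by
  induction h with
  | root => exact hk
  | seq_left h => exact h.seq_right.lt_length hs₀
  | seq_right _ ih => exact ih
  | ite_left _ ih => exact ih
  | ite_right _ ih => exact ih
  | body h => exact h.lt_length hs₀

/-- One level of the recursive definition of the position `k` that follows the subprogram at
position `i`, in a program whose text follows position `d`, where control ends at `d`. -/
def FolRule (w : List (Token L)) (VA : ℕ → Fin w.length → ℕ → Prop) (d : Fin w.length)
    (X : Fin w.length → Fin w.length → Prop) (i k : Fin w.length) : Prop :=
  ((i : ℕ) = d + 1 ∧ k = d) ∨
  (∃ p q e : Fin w.length, w[(p : ℕ)]? = some .seq ∧ X p q ∧ (i : ℕ) = p + 1 ∧ ProgAt w VA i e ∧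
    (k : ℕ) = e + 1) ∨
  (∃ p i₁ e : Fin w.length, w[(p : ℕ)]? = some .seq ∧ X p k ∧ (i₁ : ℕ) = p + 1 ∧
    ProgAt w VA i₁ e ∧ (i : ℕ) = e + 1) ∨
  (∃ p : Fin w.length, ∃ b, ∃ x y e : Fin w.length, w[(p : ℕ)]? = some .ite ∧ X p k ∧
    CondAt w VA b (p + 1) x y e ∧ (i : ℕ) = e + 1) ∨
  (∃ p : Fin w.length, ∃ b, ∃ x y e i₁ e₁ : Fin w.length, w[(p : ℕ)]? = some .ite ∧ X p k ∧
    CondAt w VA b (p + 1) x y e ∧ (i₁ : ℕ) = e + 1 ∧ ProgAt w VA i₁ e₁ ∧ (i : ℕ) = e₁ + 1) ∨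
  (∃ q : Fin w.length, ∃ b, ∃ x y e : Fin w.length, w[(k : ℕ)]? = some .while ∧ X k q ∧
    CondAt w VA b (k + 1) x y e ∧ (i : ℕ) = e + 1)

theorem folRule_mono {VA : ℕ → Fin w.length → ℕ → Prop} {d : Fin w.length}
    (X Y : Fin w.length → Fin w.length → Prop) (hXY : ∀ i j, X i j → Y i j) (i k : Fin w.length)
    (h : FolRule w VA d X i k) : FolRule w VA d Y i k := by
  rcases h with h | ⟨p, q, e, h1, h2, h3⟩ | ⟨p, i₁, e, h1, h2, h3⟩ | ⟨p, b, x, y, e, h1, h2, h3⟩ |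
    ⟨p, b, x, y, e, i₁, e₁, h1, h2, h3⟩ | ⟨q, b, x, y, e, h1, h2, h3⟩
  · exact Or.inl h
  · exact Or.inr (Or.inl ⟨p, q, e, h1, hXY _ _ h2, h3⟩)
  · exact Or.inr (Or.inr (Or.inl ⟨p, i₁, e, h1, hXY _ _ h2, h3⟩))
  · exact Or.inr (Or.inr (Or.inr (Or.inl ⟨p, b, x, y, e, h1, hXY _ _ h2, h3⟩)))
  · exact Or.inr (Or.inr (Or.inr (Or.inr (Or.inl ⟨p, b, x, y, e, i₁, e₁, h1, hXY _ _ h2, h3⟩))))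
  · exact Or.inr (Or.inr (Or.inr (Or.inr (Or.inr ⟨q, b, x, y, e, h1, hXY _ _ h2, h3⟩))))

/-- Control is passed to `k` after the subprogram at `i`. -/
def Fol (w : List (Token L)) (VA : ℕ → Fin w.length → ℕ → Prop) (d : Fin w.length) :
    Fin w.length → Fin w.length → Prop := Lfp (FolRule w VA d)

variable {VA : ℕ → Fin w.length → ℕ → Prop} {d : Fin w.length} {T : Fin w.length → V → Prop}
  {s₀ : Prog L V}

theorem ReadsVars.exists_condAt (hV : ReadsVars w name VA T) {i : ℕ} {c : Cond V}
    (h : Spells w i (c.encode name)) : ∃ b, ∃ x y e : Fin w.length, CondAt w VA b i x y e ∧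
      (e + 1 : ℕ) = i + c.len L name := by
  obtain ⟨b, v, v', rfl⟩ := exists_condOf c
  obtain ⟨x, hx⟩ := hV.1 v
  obtain ⟨y, hy⟩ := hV.1 v'
  have h1 := h.cond_lt
  have h2 := Cond.len_pos (L := L) (name := name) (condOf b v v')
  have h3 : i + (condOf b v v').len L name - 1 + 1 = i + (condOf b v v').len L name := by omega
  exact ⟨b, x, y, ⟨i + (condOf b v v').len L name - 1, by omega⟩,
    hV.condAt_iff.2 ⟨v, v', hx, hy, h, h3⟩, h3⟩

theorem ReadsVars.exists_progAt (hV : ReadsVars w name VA T) {i : Fin w.length} {s : Prog L V}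
    (h : Spells w i (s.encode name)) : ∃ e : Fin w.length, ProgAt w VA i e ∧
      (e + 1 : ℕ) = i + s.len name := by
  have h1 := h.prog_lt
  have h2 := Prog.len_pos (name := name) s
  have h3 : i + s.len name - 1 + 1 = i + s.len name := by omega
  exact ⟨⟨i + s.len name - 1, by omega⟩, hV.progAt_iff.2 ⟨s, h, h3⟩, h3⟩

variable (hname : Function.Injective name)
include hname

theorem ReadsVars.condAt_len (hV : ReadsVars w name VA T) {i j : ℕ} {b : Bool}
    {x y : Fin w.length} {c : Cond V} (h : Spells w i (c.encode name))
    (h' : CondAt w VA b i x y j) : j + 1 = i + c.len L name := by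
  obtain ⟨v, v', -, -, h1, h2⟩ := hV.condAt_iff.1 h'
  rw [h.cond_unique hname h1, h2]

theorem ReadsVars.progAt_len (hV : ReadsVars w name VA T) {i j : Fin w.length} {s : Prog L V}
    (h : Spells w i (s.encode name)) (h' : ProgAt w VA i j) : (j + 1 : ℕ) = i + s.len name := by
  obtain ⟨s', h1, h2⟩ := hV.progAt_iff.1 h'
  rw [h.prog_unique hname h1, h2]

/-- The recursive definition `Fol` describes the occurrences of subprograms. -/
theorem ReadsVars.fol_iff (hV : ReadsVars w name VA T) (hs₀ : Spells w (d + 1) (s₀.encode name))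
    {i k : Fin w.length} : Fol w VA d i k ↔ ∃ s, Occ name s₀ (d + 1) d s i k := by
  constructor
  · refine fun h => Lfp.minimal
      (X := fun i k : Fin w.length => ∃ s, Occ name s₀ (d + 1) d s i k) ?_ h
    intro i k h
    rcases h with ⟨h1, rfl⟩ | ⟨p, q, e, h1, ⟨s, h2⟩, h3, h4, h5⟩ |
      ⟨p, i₁, e, h1, ⟨s, h2⟩, h3, h4, h5⟩ | ⟨p, b, x, y, e, h1, ⟨s, h2⟩, h3, h4⟩ |
      ⟨p, b, x, y, e, i₁, e₁, h1, ⟨s, h2⟩, h3, h4, h5, h6⟩ | ⟨q, b, x, y, e, h1, ⟨s, h2⟩, h3, h4⟩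
    · exact ⟨s₀, h1 ▸ .root⟩
    · obtain ⟨s₁, s₂, rfl⟩ := (h2.spells hs₀).eq_seq h1
      have h6 := hV.progAt_len hname (h3.symm ▸ h2.seq_left.spells hs₀) h4
      have := h2.seq_left
      rw [← h3, ← h6, ← h5] at this
      exact ⟨_, this⟩
    · obtain ⟨s₁, s₂, rfl⟩ := (h2.spells hs₀).eq_seq h1
      have h6 := hV.progAt_len hname (h3.symm ▸ h2.seq_left.spells hs₀) h4
      have := h2.seq_right
      rw [← h3, ← h6, ← h5] at this
      exact ⟨_, this⟩
    · obtain ⟨c, s₁, s₂, rfl⟩ := (h2.spells hs₀).eq_ite h1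
      have h6 := hV.condAt_len hname (spells_ite.1 (h2.spells hs₀)).2.1 h3
      have := h2.ite_left
      rw [← h6, ← h4] at this
      exact ⟨_, this⟩
    · obtain ⟨c, s₁, s₂, rfl⟩ := (h2.spells hs₀).eq_ite h1
      have h7 := hV.condAt_len hname (spells_ite.1 (h2.spells hs₀)).2.1 h3
      have h8 := h2.ite_left.spells hs₀
      have := h2.ite_right
      rw [← h7, ← h4] at this h8
      rw [← hV.progAt_len hname h8 h5, ← h6] at this
      exact ⟨_, this⟩
    · obtain ⟨c, s₁, rfl⟩ := (h2.spells hs₀).eq_while h1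
      have h6 := hV.condAt_len hname (spells_while.1 (h2.spells hs₀)).2.1 h3
      have := h2.body
      rw [← h6, ← h4] at this
      exact ⟨_, this⟩
  · rintro ⟨s, h⟩
    have key : ∀ {s i k}, Occ name s₀ (d + 1) d s i k → ∀ i' k' : Fin w.length, (i' : ℕ) = i →
        (k' : ℕ) = k → Fol w VA d i' k' := by
      clear h
      intro s i k h
      induction h with
      | root =>
        exact fun i' k' hi hk => Lfp.closed folRule_mono (Or.inl ⟨hi, Fin.ext hk⟩)
      | @seq_left s₁ s₂ i k h ih =>
        intro i' k' hi hk
        obtain ⟨e, h1, h2⟩ := hV.exists_progAt (i := i') (hi ▸ h.seq_left.spells hs₀)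
        exact Lfp.closed folRule_mono (Or.inr (Or.inl ⟨⟨i, h.lt_length hs₀⟩,
          ⟨k, h.next_lt_length hs₀ d.2⟩, e, (spells_seq.1 (h.spells hs₀)).1, ih _ _ rfl rfl, hi, h1,
          by rw [hk, h2, hi]⟩))
      | @seq_right s₁ s₂ i k h ih =>
        intro i' k' hi hk
        obtain ⟨e, h1, h2⟩ := hV.exists_progAt (i := ⟨i + 1, h.seq_left.lt_length hs₀⟩)
          (h.seq_left.spells hs₀)
        exact Lfp.closed folRule_mono (Or.inr (Or.inr (Or.inl ⟨⟨i, h.lt_length hs₀⟩, _, e,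
          (spells_seq.1 (h.spells hs₀)).1, ih _ _ rfl hk, rfl, h1, by rw [hi, h2]⟩)))
      | @ite_left c s₁ s₂ i k h ih =>
        intro i' k' hi hk
        obtain ⟨b, x, y, e, h1, h2⟩ := hV.exists_condAt (spells_ite.1 (h.spells hs₀)).2.1
        exact Lfp.closed folRule_mono (Or.inr (Or.inr (Or.inr (Or.inl ⟨⟨i, h.lt_length hs₀⟩, b, x,
          y, e, (spells_ite.1 (h.spells hs₀)).1, ih _ _ rfl hk, h1, by rw [hi, h2]⟩))))
      | @ite_right c s₁ s₂ i k h ih =>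
        intro i' k' hi hk
        obtain ⟨b, x, y, e, h1, h2⟩ := hV.exists_condAt (spells_ite.1 (h.spells hs₀)).2.1
        obtain ⟨e₁, h3, h4⟩ := hV.exists_progAt
          (i := ⟨i + 1 + c.len L name, h.ite_left.lt_length hs₀⟩) (h.ite_left.spells hs₀)
        exact Lfp.closed folRule_mono (Or.inr (Or.inr (Or.inr (Or.inr (Or.inl ⟨⟨i, h.lt_length hs₀⟩,
          b, x, y, e, _, e₁, (spells_ite.1 (h.spells hs₀)).1, ih _ _ rfl hk, h1, h2.symm, h3,
          by rw [hi, h4]⟩)))))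
      | @body c s₁ i k h ih =>
        intro i' k' hi hk
        obtain ⟨b, x, y, e, h1, h2⟩ := hV.exists_condAt (spells_while.1 (h.spells hs₀)).2.1
        rw [← hk] at h1 h2
        exact Lfp.closed folRule_mono (Or.inr (Or.inr (Or.inr (Or.inr (Or.inr
          ⟨⟨k, h.next_lt_length hs₀ d.2⟩, b, x, y, e, hk ▸ (spells_while.1 (h.spells hs₀)).1,
          ih _ _ hk rfl, h1, by rw [hi, h2, hk]⟩)))))
    exact key h i k rfl rfl

omit hname

/-- The edges of the flow graph that are labelled with an assume. -/
def AssumeEdgeAt (w : List (Token L)) (VA : ℕ → Fin w.length → ℕ → Prop) (d : Fin w.length)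
    (i : Fin w.length) (b : Bool) (x y j : Fin w.length) : Prop :=
  (w[(i : ℕ)]? = some .assume ∧ Fol w VA d i j ∧ ∃ e : Fin w.length, CondAt w VA b (i + 1) x y e) ∨
  ((w[(i : ℕ)]? = some .ite ∨ w[(i : ℕ)]? = some .while) ∧ (∃ k, Fol w VA d i k) ∧
    ∃ e : Fin w.length, CondAt w VA b (i + 1) x y e ∧ (j : ℕ) = e + 1) ∨
  (w[(i : ℕ)]? = some .ite ∧ (∃ k, Fol w VA d i k) ∧ ∃ e i₁ e₁ : Fin w.length,
    CondAt w VA (!b) (i + 1) x y e ∧ (i₁ : ℕ) = e + 1 ∧ ProgAt w VA i₁ e₁ ∧ (j : ℕ) = e₁ + 1) ∨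
  (w[(i : ℕ)]? = some .while ∧ Fol w VA d i j ∧
    ∃ e : Fin w.length, CondAt w VA (!b) (i + 1) x y e)

/-- The edges of the flow graph, read off the text of the program. -/
def EdgeAt (w : List (Token L)) (VA : ℕ → Fin w.length → ℕ → Prop) (d : Fin w.length)
    (i : Fin w.length) (a : Option (Letter L (Fin w.length))) (j : Fin w.length) : Prop :=
  match a with
  | none => (w[(i : ℕ)]? = some .skip ∧ Fol w VA d i j) ∨
      (w[(i : ℕ)]? = some .seq ∧ (∃ k, Fol w VA d i k) ∧ (j : ℕ) = i + 1)
  | some (.copy x y) => w[(i : ℕ)]? = some .assign ∧ Fol w VA d i j ∧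
      ∃ e e' : Fin w.length, VA (i + 1) x e ∧ VA (e + 1) y e'
  | some (.app x f z) => w[(i : ℕ)]? = some .assign ∧ Fol w VA d i j ∧
      ∃ e e' : Fin w.length, VA (i + 1) x e ∧ w[(e + 1 : ℕ)]? = some (.fn ⟨_, f⟩) ∧
        VarsAt VA _ z (e + 1) e'
  | some (.assume (.eq x y)) => AssumeEdgeAt w VA d i true x y j
  | some (.assume (.ne x y)) => AssumeEdgeAt w VA d i false x y j

theorem edge_assume_iff {i₀ k₀ i j : ℕ} {c : Cond V} :
    Edge name s₀ i₀ k₀ i (some (.assume c)) j ↔ Occ name s₀ i₀ k₀ (.assume c) i j ∨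
      (∃ s₁ s₂ k, Occ name s₀ i₀ k₀ (.ite c s₁ s₂) i k ∧ j = i + 1 + c.len L name) ∨
      (∃ s₁ k, Occ name s₀ i₀ k₀ (.while c s₁) i k ∧ j = i + 1 + c.len L name) ∨
      (∃ c' s₁ s₂ k, c = c'.neg ∧ Occ name s₀ i₀ k₀ (.ite c' s₁ s₂) i k ∧
        j = i + 1 + c'.len L name + s₁.len name) ∨
      (∃ c' s₁, c = c'.neg ∧ Occ name s₀ i₀ k₀ (.while c' s₁) i j) := by
  constructor
  · intro h
    cases h with
    | assume h => exact Or.inl h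
    | ite_left h => exact Or.inr (Or.inl ⟨_, _, _, h, rfl⟩)
    | enter h => exact Or.inr (Or.inr (Or.inl ⟨_, _, h, rfl⟩))
    | ite_right h => exact Or.inr (Or.inr (Or.inr (Or.inl ⟨_, _, _, _, rfl, h, rfl⟩)))
    | exit h => exact Or.inr (Or.inr (Or.inr (Or.inr ⟨_, _, rfl, h⟩)))
  · rintro (h | ⟨_, _, _, h, rfl⟩ | ⟨_, _, h, rfl⟩ | ⟨_, _, _, _, rfl, h, rfl⟩ | ⟨_, _, rfl, h⟩)
    exacts [.assume h, .ite_left h, .enter h, .ite_right h, .exit h]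

variable {nm : Fin w.length → V}

include hname

theorem ReadsVars.assumeEdgeAt_iff (hV : ReadsVars w name VA fun x v => nm x = v)
    (hs₀ : Spells w (d + 1) (s₀.encode name)) {i j x y : Fin w.length} {b : Bool} :
    AssumeEdgeAt w VA d i b x y j ↔
      Edge name s₀ (d + 1) d i (some (.assume (condOf b (nm x) (nm y)))) j := by
  have hcond : ∀ {b : Bool} {k : ℕ} {c : Cond V} {e : ℕ}, Spells w k (c.encode name) →
      CondAt w VA b k x y e → c = condOf b (nm x) (nm y) := by
    intro b k c e h h'
    obtain ⟨_, _, rfl, rfl, h1, h2⟩ := hV.condAt_iff.1 h'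
    exact h.cond_unique hname h1
  have hcond' : ∀ {b : Bool} {k : ℕ}, Spells w k ((condOf b (nm x) (nm y)).encode name) →
      ∃ e : Fin w.length, CondAt w VA b k x y e ∧
        (e + 1 : ℕ) = k + (condOf b (nm x) (nm y)).len L name := by
    intro b k h
    have h1 := h.cond_lt
    have h2 := Cond.len_pos (L := L) (name := name) (condOf b (nm x) (nm y))
    have h3 : k + (condOf b (nm x) (nm y)).len L name - 1 + 1 =
      k + (condOf b (nm x) (nm y)).len L name := by omega
    exact ⟨⟨k + (condOf b (nm x) (nm y)).len L name - 1, by omega⟩,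
      hV.condAt_iff.2 ⟨_, _, rfl, rfl, h, h3⟩, h3⟩
  have hneg : ∀ {c : Cond V}, condOf b (nm x) (nm y) = c.neg ↔ c = condOf (!b) (nm x) (nm y) := by
    intro c
    cases b <;> cases c <;> simp [condOf, Cond.neg, eq_comm]
  have hfol : ∀ {i k}, Fol w VA d i k ↔ ∃ s, Occ name s₀ (d + 1) d s i k := hV.fol_iff hname hs₀
  rw [edge_assume_iff]
  constructor
  · rintro (⟨h1, h2, e, h3⟩ | ⟨h1 | h1, ⟨k, h2⟩, e, h3, h4⟩ |
      ⟨h1, ⟨k, h2⟩, e, i₁, e₁, h3, h4, h5, h6⟩ | ⟨h1, h2, e, h3⟩)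
    · obtain ⟨s, h2⟩ := hfol.1 h2
      obtain ⟨c, rfl⟩ := (h2.spells hs₀).eq_assume h1
      exact Or.inl (hcond (spells_assume.1 (h2.spells hs₀)).2 h3 ▸ h2)
    · obtain ⟨s, h2⟩ := hfol.1 h2
      obtain ⟨c, s₁, s₂, rfl⟩ := (h2.spells hs₀).eq_ite h1
      have h5 := (spells_ite.1 (h2.spells hs₀)).2.1
      obtain rfl := hcond h5 h3
      exact Or.inr (Or.inl ⟨s₁, s₂, k, h2, h4.trans (hV.condAt_len hname h5 h3)⟩)
    · obtain ⟨s, h2⟩ := hfol.1 h2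
      obtain ⟨c, s₁, rfl⟩ := (h2.spells hs₀).eq_while h1
      have h5 := (spells_while.1 (h2.spells hs₀)).2.1
      obtain rfl := hcond h5 h3
      exact Or.inr (Or.inr (Or.inl ⟨s₁, k, h2, h4.trans (hV.condAt_len hname h5 h3)⟩))
    · obtain ⟨s, h2⟩ := hfol.1 h2
      obtain ⟨c, s₁, s₂, rfl⟩ := (h2.spells hs₀).eq_ite h1
      have h7 := (spells_ite.1 (h2.spells hs₀)).2.1
      obtain rfl := hcond h7 h3
      have h8 := hV.condAt_len hname h7 h3
      have h9 := h2.ite_left.spells hs₀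
      rw [← h8, ← h4] at h9
      refine Or.inr (Or.inr (Or.inr (Or.inl ⟨_, s₁, s₂, k, hneg.2 rfl, h2, ?_⟩)))
      rw [h6, hV.progAt_len hname h9 h5, h4, h8]
    · obtain ⟨s, h2⟩ := hfol.1 h2
      obtain ⟨c, s₁, rfl⟩ := (h2.spells hs₀).eq_while h1
      obtain rfl := hcond (spells_while.1 (h2.spells hs₀)).2.1 h3
      exact Or.inr (Or.inr (Or.inr (Or.inr ⟨_, s₁, hneg.2 rfl, h2⟩)))
  · rintro (h | ⟨s₁, s₂, k, h, hj⟩ | ⟨s₁, k, h, hj⟩ | ⟨c, s₁, s₂, k, hc, h, hj⟩ | ⟨c, s₁, hc, h⟩)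
    · obtain ⟨h1, h2⟩ := spells_assume.1 (h.spells hs₀)
      obtain ⟨e, h3, -⟩ := hcond' h2
      exact Or.inl ⟨h1, hfol.2 ⟨_, h⟩, e, h3⟩
    · obtain ⟨h1, h2, -⟩ := spells_ite.1 (h.spells hs₀)
      obtain ⟨e, h3, h4⟩ := hcond' h2
      exact Or.inr (Or.inl ⟨Or.inl h1, ⟨⟨k, h.next_lt_length hs₀ d.2⟩, hfol.2 ⟨_, h⟩⟩, e, h3,
        hj.trans h4.symm⟩)
    · obtain ⟨h1, h2, -⟩ := spells_while.1 (h.spells hs₀)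
      obtain ⟨e, h3, h4⟩ := hcond' h2
      exact Or.inr (Or.inl ⟨Or.inr h1, ⟨⟨k, h.next_lt_length hs₀ d.2⟩, hfol.2 ⟨_, h⟩⟩, e, h3,
        hj.trans h4.symm⟩)
    · obtain rfl := hneg.1 hc
      obtain ⟨h1, h2, -⟩ := spells_ite.1 (h.spells hs₀)
      obtain ⟨e, h3, h4⟩ := hcond' h2
      obtain ⟨e₁, h5, h6⟩ := hV.exists_progAt (i := ⟨_, h.ite_left.lt_length hs₀⟩)
        (h.ite_left.spells hs₀)
      exact Or.inr (Or.inr (Or.inl ⟨h1, ⟨⟨k, h.next_lt_length hs₀ d.2⟩, hfol.2 ⟨_, h⟩⟩, e, _, e₁,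
        h3, h4.symm, h5, hj.trans h6.symm⟩))
    · obtain rfl := hneg.1 hc
      obtain ⟨h1, h2, -⟩ := spells_while.1 (h.spells hs₀)
      obtain ⟨e, h3, h4⟩ := hcond' h2
      exact Or.inr (Or.inr (Or.inr ⟨h1, hfol.2 ⟨_, h⟩, e, h3⟩))

theorem ReadsVars.edgeAt_iff (hV : ReadsVars w name VA fun x v => nm x = v)
    (hs₀ : Spells w (d + 1) (s₀.encode name)) {i j : Fin w.length}
    {a : Option (Letter L (Fin w.length))} :
    EdgeAt w VA d i a j ↔ Edge name s₀ (d + 1) d i (a.map (Letter.map nm)) j := by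
  have hfol : ∀ {i k}, Fol w VA d i k ↔ ∃ s, Occ name s₀ (d + 1) d s i k := hV.fol_iff hname hs₀
  match a with
  | none =>
    constructor
    · rintro (⟨h1, h2⟩ | ⟨h1, ⟨k, h2⟩, h3⟩)
      · obtain ⟨s, h2⟩ := hfol.1 h2
        obtain rfl := (h2.spells hs₀).eq_skip h1
        exact .skip h2
      · obtain ⟨s, h2⟩ := hfol.1 h2
        obtain ⟨s₁, s₂, rfl⟩ := (h2.spells hs₀).eq_seq h1
        rw [h3]
        exact .seq h2
    · intro h
      generalize hj : (j : ℕ) = j' at h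
      cases h with
      | skip h =>
        exact Or.inl ⟨spells_skip.1 (h.spells hs₀), hfol.2 ⟨_, hj ▸ h⟩⟩
      | seq h =>
        exact Or.inr ⟨(spells_seq.1 (h.spells hs₀)).1,
          ⟨⟨_, h.next_lt_length hs₀ d.2⟩, hfol.2 ⟨_, h⟩⟩, hj⟩
  | some (.copy x y) =>
    constructor
    · rintro ⟨h1, h2, e, e', h3, h4⟩
      obtain ⟨s, h2⟩ := hfol.1 h2
      obtain ⟨_, rfl, h5, h6⟩ := (hV.2 _ _ _).1 h3
      obtain ⟨_, rfl, h7, h8⟩ := (hV.2 _ _ _).1 h4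
      rw [h6] at h7
      obtain rfl := (h2.spells hs₀).prog_unique hname (spells_copy.2 ⟨h1, h5, h7⟩)
      exact .copy h2
    · intro h
      cases h with
      | copy h =>
        obtain ⟨h1, h2, h3⟩ := spells_copy.1 (h.spells hs₀)
        have h4 := h3.name_lt
        have h6 : i + 1 + nlen name (nm x) = i + nlen name (nm x) + 1 := by omega
        rw [h6] at h3
        have hy : 0 < nlen name (nm y) := Nat.succ_pos _
        exact ⟨h1, hfol.2 ⟨_, h⟩, ⟨i + nlen name (nm x), by omega⟩,
          ⟨i + nlen name (nm x) + nlen name (nm y), by omega⟩,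
          (hV.2 _ _ _).2 ⟨_, rfl, h2, h6.symm⟩, (hV.2 _ _ _).2 ⟨_, rfl, h3, by simp only; omega⟩⟩
  | some (.app x f z) =>
    constructor
    · rintro ⟨h1, h2, e, e', h3, h4, h5⟩
      obtain ⟨s, h2⟩ := hfol.1 h2
      obtain ⟨_, rfl, h6, h7⟩ := (hV.2 _ _ _).1 h3
      obtain ⟨z', h8, h9, -⟩ := hV.varsAt_iff.1 h5
      obtain rfl : (fun i => nm (z i)) = z' := funext h8
      rw [h7] at h4 h9
      obtain rfl := (h2.spells hs₀).prog_unique hname (spells_app.2 ⟨h1, h6, h4, h9⟩)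
      exact .app h2
    · intro h
      cases h with
      | app h =>
        obtain ⟨h1, h2, h3, h4⟩ := spells_app.1 (h.spells hs₀)
        have h5 := (h.spells hs₀).prog_lt
        have h6 : i + 1 + nlen name (nm x) = i + nlen name (nm x) + 1 := by omega
        rw [len_app] at h5
        rw [h6] at h3 h4
        exact ⟨h1, hfol.2 ⟨_, h⟩, ⟨i + nlen name (nm x), by omega⟩,
          ⟨i + nlen name (nm x) + 1 + alen L name fun i => nm (z i), by omega⟩,
          (hV.2 _ _ _).2 ⟨_, rfl, h2, h6.symm⟩, h3, hV.varsAt_iff.2 ⟨_, fun _ => rfl, h4, rfl⟩⟩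
  | some (.assume (.eq x y)) => exact hV.assumeEdgeAt_iff hname hs₀
  | some (.assume (.ne x y)) => exact hV.assumeEdgeAt_iff hname hs₀

end

end UninterpretedProgram

namespace UninterpretedProgram

/-! ### Declarations and names of variables -/

section

variable {L : FirstOrder.Language.{0, 0}} {w : List (Token L)}

/-- The tokens from which lists of names are made. -/
def IsNameToken (t : Token L) : Prop := (∃ b, t = .bit b) ∨ t = .endName

theorem exists_names_iff {l : List (Token L)} : (∃ vs : List (List Bool),
    l = (vs.map encodeName).flatten) ↔ (∀ t ∈ l, IsNameToken t) ∧
      ∀ k, k + 1 = l.length → l[k]? = some .endName := by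
  constructor
  · rintro ⟨vs, rfl⟩
    induction vs with
    | nil => simp
    | cons v vs ih =>
      rw [List.map_cons, List.flatten_cons]
      refine ⟨fun t ht => ?_, fun k hk => ?_⟩
      · rcases List.mem_append.1 ht with ht | ht
        · rcases List.mem_append.1 ht with ht | ht
          · obtain ⟨b, -, rfl⟩ := List.mem_map.1 ht
            exact Or.inl ⟨b, rfl⟩
          · exact Or.inr (List.mem_singleton.1 ht)
        · exact ih.1 t ht
      · rw [List.length_append, length_encodeName] at hk
        rcases Nat.eq_zero_or_pos ((vs.map (encodeName (L := L))).flatten).length with h0 | h0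
        · obtain rfl : k = v.length := by omega
          rw [List.length_eq_zero_iff.1 h0, List.append_nil, encodeName]
          simp
        · rw [List.getElem?_append_right (by rw [length_encodeName]; omega), length_encodeName]
          exact ih.2 _ (by omega)
  · rintro ⟨h, h'⟩
    induction l with
    | nil => exact ⟨[], rfl⟩
    | cons t l ih =>
      have hl : ∀ k, k + 1 = l.length → l[k]? = some .endName := fun k hk => by
        simpa using h' (k + 1) (by rw [List.length_cons, hk])
      obtain ⟨vs, rfl⟩ := ih (fun t ht => h t (List.mem_cons_of_mem _ ht)) hl
      rcases h t List.mem_cons_self with ⟨b, rfl⟩ | rfl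
      · cases vs with
        | nil =>
          have := h' 0 (by simp)
          simp at this
        | cons v vs => exact ⟨(b :: v) :: vs, by simp [encodeName]⟩
      · exact ⟨[] :: vs, by simp [encodeName]⟩

/-- The declarations end at position `d`. -/
def HeaderAt (w : List (Token L)) (d : Fin w.length) : Prop :=
  w[(d : ℕ)]? = some .endDecl ∧
  (∀ k : Fin w.length, (k : ℕ) < d → ∃ t, w[(k : ℕ)]? = some t ∧ IsNameToken t) ∧
  ∀ k : Fin w.length, (k + 1 : ℕ) = d → w[(k : ℕ)]? = some .endName

theorem drop_succ_of_eq {α : Type} {l l₁ l₂ : List α} {a : α} {k : ℕ} (h : l = l₁ ++ a :: l₂)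
    (hk : k = l₁.length) : l.drop (k + 1) = l₂ := by
  subst h hk
  simp

theorem headerAt_iff {d : Fin w.length} : HeaderAt w d ↔ ∃ vs : List (List Bool),
    w = (vs.map encodeName).flatten ++ .endDecl :: w.drop (d + 1) ∧
      (d : ℕ) = ((vs.map (encodeName (L := L))).flatten).length := by
  have hd := d.2
  have htake : (w.take d).length = d := by simp
  constructor
  · rintro ⟨h1, h2, h3⟩
    obtain ⟨vs, hvs⟩ := exists_names_iff (l := w.take d).2 (by
      refine ⟨fun t ht => ?_, fun k hk => ?_⟩
      · obtain ⟨k, hk, rfl⟩ := List.getElem_of_mem ht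
        rw [htake] at hk
        obtain ⟨t, h4, h5⟩ := h2 ⟨k, by omega⟩ hk
        rw [List.getElem?_eq_getElem (show k < w.length by omega)] at h4
        rw [List.getElem_take, Option.some_inj.1 h4]
        exact h5
      · rw [htake] at hk
        rw [List.getElem?_take_of_lt (by omega)]
        exact h3 ⟨k, by omega⟩ hk)
    refine ⟨vs, ?_, by rw [← hvs, htake]⟩
    rw [← hvs]
    rw [List.getElem?_eq_getElem hd, Option.some_inj] at h1
    rw [← h1, List.getElem_cons_drop, List.take_append_drop]
  · rintro ⟨vs, h1, h2⟩
    obtain ⟨h3, h4⟩ := exists_names_iff.1 ⟨vs, rfl⟩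
    have h5 : ∀ k : ℕ, w[k]? = _ := fun k => congrArg (fun l : List (Token L) => l[k]?) h1
    refine ⟨?_, fun k hk => ?_, fun k hk => ?_⟩
    · rw [h5, List.getElem?_append_right h2.ge, h2]
      simp
    · rw [h5, List.getElem?_append_left (by omega), List.getElem?_eq_getElem (by omega)]
      exact ⟨_, rfl, h3 _ (List.getElem_mem _)⟩
    · rw [h5, List.getElem?_append_left (by omega)]
      exact h4 _ (by omega)

/-- The declaration of a variable starts at position `p`. -/
def DeclAt (w : List (Token L)) (d p : Fin w.length) : Prop :=
  p < d ∧ ∀ k : Fin w.length, (k + 1 : ℕ) = p → w[(k : ℕ)]? = some .endName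

theorem spells_append_left {α : Type} {l₁ l₂ l : List α} {i : ℕ} (h : Spells l₁ i l) :
    Spells (l₁ ++ l₂) i l :=
  h.trans ((List.prefix_append l₁ l₂).drop i)

theorem exists_spells_of_mem {vs : List (List Bool)} {v : List Bool} (hv : v ∈ vs) :
    ∃ p < ((vs.map (encodeName (L := L))).flatten).length,
      Spells ((vs.map encodeName).flatten) p (encodeName (L := L) v) ∧
      ∀ k, k + 1 = p → ((vs.map (encodeName (L := L))).flatten)[k]? = some .endName := by
  obtain ⟨as, bs, rfl⟩ := List.append_of_mem hv
  refine ⟨((as.map (encodeName (L := L))).flatten).length, ?_, ?_, ?_⟩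
  · simp [length_encodeName]
  · rw [Spells, List.map_append, List.flatten_append, List.drop_left, List.map_cons,
      List.flatten_cons]
    exact List.prefix_append _ _
  · intro k hk
    rw [List.map_append, List.flatten_append, List.getElem?_append_left (by omega)]
    exact (exists_names_iff.1 ⟨as, rfl⟩).2 k hk

theorem exists_mem_of_boundary {vs : List (List Bool)} {p : ℕ}
    (hp : p < ((vs.map (encodeName (L := L))).flatten).length)
    (h : ∀ k, k + 1 = p → ((vs.map (encodeName (L := L))).flatten)[k]? = some .endName) :
    ∃ v ∈ vs, Spells ((vs.map encodeName).flatten) p (encodeName (L := L) v) := by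
  induction vs generalizing p with
  | nil => simp at hp
  | cons v vs ih =>
    rw [List.map_cons, List.flatten_cons] at *
    rcases lt_or_ge p (encodeName (L := L) v).length with h1 | h1
    · rcases p with _ | k
      · exact ⟨v, List.mem_cons_self, List.prefix_append _ _⟩
      · have h2 := h k rfl
        rw [length_encodeName] at h1
        rw [List.getElem?_append_left (by rw [length_encodeName]; omega), encodeName,
          List.getElem?_append_left (by rw [List.length_map]; omega), List.getElem?_map] at h2
        obtain ⟨b, -, hb⟩ := Option.map_eq_some_iff.1 h2
        cases hb
    · obtain ⟨q, rfl⟩ := Nat.exists_eq_add_of_le h1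
      rw [List.length_append, Nat.add_lt_add_iff_left] at hp
      obtain ⟨u, hu, h2⟩ := ih hp fun k hk => by
        have := h ((encodeName (L := L) v).length + k) (by omega)
        rwa [List.getElem?_append_right (by omega), Nat.add_sub_cancel_left] at this
      refine ⟨u, List.mem_cons_of_mem _ hu, ?_⟩
      rw [Spells, List.drop_append, List.drop_eq_nil_of_le (by omega), List.nil_append,
        Nat.add_sub_cancel_left]
      exact h2

/-- The names with `l` bits that start at `i` and `j` are equal. -/
def SameName (w : List (Token L)) (i j l : ℕ) : Prop :=
  w[i + l]? = some .endName ∧ w[j + l]? = some .endName ∧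
    ∀ k < l, ∃ b, w[i + k]? = some (.bit b) ∧ w[j + k]? = some (.bit b)

theorem spells_encodeName_iff {i : ℕ} {x : List Bool} : Spells w i (encodeName x) ↔
    (∀ k (h : k < x.length), w[i + k]? = some (.bit x[k])) ∧
      w[i + x.length]? = some .endName := by
  induction x generalizing i with
  | nil => simp [encodeName, spells_cons, spells_nil]
  | cons b x ih =>
    have : encodeName (L := L) (b :: x) = .bit b :: encodeName x := rfl
    have hi : ∀ k, i + 1 + k = i + (k + 1) := fun k => by omega
    simp only [this, spells_cons, ih, hi, ← and_assoc]
    refine and_congr_left' ⟨?_, fun h => ⟨h 0 (Nat.succ_pos _), fun k hk => ?_⟩⟩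
    · rintro ⟨h0, h1⟩ (_ | k) hk
      · exact h0
      · exact h1 k (Nat.lt_of_succ_lt_succ hk)
    · exact h (k + 1) (Nat.succ_lt_succ hk)

theorem sameName_iff {i j l : ℕ} : SameName w i j l ↔
    ∃ x : List Bool, x.length = l ∧ Spells w i (encodeName x) ∧ Spells w j (encodeName x) := by
  simp only [spells_encodeName_iff]
  constructor
  · rintro ⟨h1, h2, h3⟩
    choose b hb hb' using h3
    refine ⟨List.ofFn fun k : Fin l => b k k.2, by simp, ⟨fun k hk => ?_, by simpa using h1⟩,
      fun k hk => ?_, by simpa using h2⟩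
    · rw [List.length_ofFn] at hk
      simpa using hb k hk
    · rw [List.length_ofFn] at hk
      simpa using hb' k hk
  · rintro ⟨x, rfl, h1, h2⟩
    exact ⟨h1.2, h2.2, fun k hk => ⟨x[k], h1.1 k hk, h2.1 k hk⟩⟩

/-- Positions stand for the variables declared there, and all other positions for the first
variable that is declared. So `x` stands for the variable declared at `p`. -/
def Rep (w : List (Token L)) (d x p : Fin w.length) : Prop :=
  DeclAt w d p ∧ ((DeclAt w d x ∧ p = x) ∨ (¬ DeclAt w d x ∧ (p : ℕ) = 0))

/-- A name for the variable that `x` stands for is written between the positions `i` and `e`. -/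
def NameAt (w : List (Token L)) (d : Fin w.length) (i : ℕ) (x : Fin w.length) (e : ℕ) : Prop :=
  ∃ p l : Fin w.length, Rep w d x p ∧ e = i + l ∧ SameName w p i l

/-- The positions `x` and `y` stand for the same variable. -/
def SameVar (w : List (Token L)) (d x y : Fin w.length) : Prop :=
  ∃ p q l : Fin w.length, Rep w d x p ∧ Rep w d y q ∧ SameName w p q l

section

variable {vs : List (List Bool)} {d : Fin w.length} {rest : List (Token L)}

/-- The position `x` stands for the variable `v`. -/
def Denotes (w : List (Token L)) (d : Fin w.length) (x : Fin w.length) (v : {x // x ∈ vs}) : Prop :=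
  ∃ p, Rep w d x p ∧ Spells w p (encodeName v.1)

variable (hw : w = (vs.map encodeName).flatten ++ .endDecl :: rest)
  (hd : (d : ℕ) = ((vs.map (encodeName (L := L))).flatten).length)

include hw hd

theorem getElem?_header {k : ℕ} (hk : k < d) :
    w[k]? = ((vs.map (encodeName (L := L))).flatten)[k]? := by
  conv_lhs => rw [hw]
  rw [List.getElem?_append_left (by omega)]

theorem exists_declAt {v : List Bool} (hv : v ∈ vs) :
    ∃ p, DeclAt w d p ∧ Spells w p (encodeName v) := by
  obtain ⟨p, h1, h2, h3⟩ := exists_spells_of_mem (L := L) hv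
  rw [← hd] at h1
  refine ⟨⟨p, h1.trans d.2⟩, ⟨h1, fun k hk => ?_⟩, ?_⟩
  · simp only at hk
    rw [getElem?_header hw hd (by omega)]
    exact h3 k hk
  · have := spells_append_left (l₂ := .endDecl :: rest) h2
    rwa [← hw] at this

theorem DeclAt.exists_mem {p : Fin w.length} (hp : DeclAt w d p) :
    ∃ v ∈ vs, Spells w p (encodeName v) := by
  have hlt : (p : ℕ) < d := hp.1
  obtain ⟨v, hv, h⟩ := exists_mem_of_boundary (L := L) (vs := vs) (p := p) (by omega) fun k hk => by
    rw [← getElem?_header hw hd (by omega)]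
    exact hp.2 ⟨k, by omega⟩ hk
  have := spells_append_left (l₂ := .endDecl :: rest) h
  rw [← hw] at this
  exact ⟨v, hv, this⟩

omit hw hd in
theorem Rep.unique {x p q : Fin w.length} (h : Rep w d x p) (h' : Rep w d x q) : p = q := by
  rcases h.2 with ⟨h1, h2⟩ | ⟨h1, h2⟩ <;> rcases h'.2 with ⟨h3, h4⟩ | ⟨h3, h4⟩
  · exact h2.trans h4.symm
  · exact absurd h1 h3
  · exact absurd h3 h1
  · exact Fin.ext (h2.trans h4.symm)

omit hw hd in
theorem Denotes.unique {x : Fin w.length} {v v' : {x // x ∈ vs}} (h : Denotes w d x v)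
    (h' : Denotes w d x v') : v = v' := by
  obtain ⟨p, h1, h2⟩ := h
  obtain ⟨q, h3, h4⟩ := h'
  obtain rfl := h1.unique h3
  exact Subtype.ext (h2.name_unique h4)

theorem exists_denotes (v : {x // x ∈ vs}) : ∃ x : Fin w.length, Denotes w d x v := by
  obtain ⟨p, h1, h2⟩ := exists_declAt hw hd v.2
  exact ⟨p, p, ⟨h1, Or.inl ⟨h1, rfl⟩⟩, h2⟩

theorem readsVars_nameAt :
    ReadsVars w Subtype.val (NameAt w d) (Denotes (vs := vs) w d) := by
  refine ⟨exists_denotes hw hd, fun i x e => ⟨?_, ?_⟩⟩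
  · rintro ⟨p, l, h1, rfl, h2⟩
    obtain ⟨u, h3, h4, h5⟩ := sameName_iff.1 h2
    obtain ⟨v, hv, h6⟩ := h1.1.exists_mem hw hd
    obtain rfl := h4.name_unique h6
    refine ⟨⟨u, hv⟩, ⟨p, h1, h4⟩, h5, ?_⟩
    rw [nlen, h3, Nat.add_assoc]
  · rintro ⟨v, ⟨p, h1, h2⟩, h3, h4⟩
    have h5 := h3.length_le (by simp [encodeName])
    rw [length_encodeName] at h5
    rw [nlen] at h4
    exact ⟨p, ⟨v.1.length, by omega⟩, h1, by simp only; omega, sameName_iff.2 ⟨v.1, rfl, h2, h3⟩⟩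

theorem exists_denotes_iff (hpos : 0 < (d : ℕ)) (x : Fin w.length) :
    ∃ v : {x // x ∈ vs}, Denotes w d x v := by
  have key : ∃ p, Rep w d x p := by
    by_cases hx : DeclAt w d x
    · exact ⟨x, hx, Or.inl ⟨hx, rfl⟩⟩
    · exact ⟨⟨0, by omega⟩, ⟨hpos, fun k hk => by simp at hk⟩, Or.inr ⟨hx, rfl⟩⟩
  obtain ⟨p, hp⟩ := key
  obtain ⟨v, hv, h⟩ := hp.1.exists_mem hw hd
  exact ⟨⟨v, hv⟩, p, hp, h⟩

omit hw hd in
theorem sameVar_iff {nm : Fin w.length → {x // x ∈ vs}} (hnm : ∀ x, Denotes w d x (nm x))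
    {x y : Fin w.length} : SameVar w d x y ↔ nm x = nm y := by
  constructor
  · rintro ⟨p, q, l, h1, h2, h3⟩
    obtain ⟨u, -, h4, h5⟩ := sameName_iff.1 h3
    obtain ⟨p', h6, h7⟩ := hnm x
    obtain ⟨q', h8, h9⟩ := hnm y
    obtain rfl := h1.unique h6
    obtain rfl := h2.unique h8
    exact Subtype.ext ((h7.name_unique h4).trans (h5.name_unique h9))
  · intro h
    obtain ⟨p, h1, h2⟩ := hnm x
    obtain ⟨q, h3, h4⟩ := hnm y
    rw [← h] at h4
    have h5 := h2.length_le (by simp [encodeName])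
    rw [length_encodeName] at h5
    exact ⟨p, q, ⟨(nm x).1.length, by omega⟩, h1, h3, sameName_iff.2 ⟨_, rfl, h2, h4⟩⟩

end

/-! ### Coherence of the program that a word describes -/

/-- The transitions between configurations, read off the word. -/
def Step (w : List (Token L)) (d : Fin w.length) (c c' : Config L (Fin w.length)) : Prop :=
  ∃ a, EdgeAt w (NameAt w d) d c.pos a c'.pos ∧ Trans (SameVar w d) c.bad c.S a c'.bad c'.S

/-- The program after position `d` has an execution that is not coherent. -/
def Incoherent (w : List (Token L)) (d : Fin w.length) : Prop :=
  ∃ i : Fin w.length, (i : ℕ) = d + 1 ∧ ∃ S, Relation.ReflTransGen (Step w d)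
    ⟨i, False, Summ.init (SameVar w d)⟩ ⟨d, True, S⟩

theorem Edge.lt_length {V : Type} {name : V → List Bool} {s₀ : Prog L V} {i₀ k₀ i j : ℕ}
    {a : Option (Letter L V)} (hs₀ : Spells w i₀ (s₀.encode name)) (hk : k₀ < w.length)
    (h : Edge name s₀ i₀ k₀ i a j) : j < w.length := by
  cases h with
  | skip h => exact h.next_lt_length hs₀ hk
  | copy h => exact h.next_lt_length hs₀ hk
  | app h => exact h.next_lt_length hs₀ hk
  | assume h => exact h.next_lt_length hs₀ hk
  | seq h => exact h.seq_left.lt_length hs₀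
  | ite_left h => exact h.ite_left.lt_length hs₀
  | ite_right h => exact h.ite_right.lt_length hs₀
  | enter h => exact h.body.lt_length hs₀
  | exit h => exact h.next_lt_length hs₀ hk

theorem coherent_of_isEmpty {V : Type} [DecidableEq V] [IsEmpty V] (s : Prog L V) : s.Coherent := by
  refine fun ρ _ => coherentExecution_iff.2 fun σ a _ ha => ?_
  match a, ha with
  | .app x _ _, _ => exact isEmptyElim x
  | .assume (.eq x _), _ => exact isEmptyElim x

theorem coherent_iff {vs : List (List Bool)} {d : Fin w.length} {s : Prog L {x // x ∈ vs}}
    (hw : w = encodeInstance vs s)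
    (hd : (d : ℕ) = ((vs.map (encodeName (L := L))).flatten).length) :
    s.Coherent ↔ ((d : ℕ) = 0 ∨ ¬ Incoherent w d) := by
  have hw' : w = (vs.map encodeName).flatten ++ .endDecl :: s.encode Subtype.val := hw
  -- without variables there are no assignments and no assumes, hence no violations
  rcases Nat.eq_zero_or_pos (d : ℕ) with h0 | hpos
  · have : IsEmpty {x // x ∈ vs} := by
      constructor
      rintro ⟨v, hv⟩
      obtain ⟨p, hp, -⟩ := exists_spells_of_mem (L := L) hv
      omega
    exact iff_of_true (coherent_of_isEmpty s) (Or.inl h0)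
  have hlen : d + 1 + s.len Subtype.val = w.length := by
    conv_rhs => rw [hw']
    rw [List.length_append, List.length_cons, Prog.len]
    omega
  have hs : Spells w (d + 1) (s.encode Subtype.val) := by
    rw [Spells, drop_succ_of_eq hw' hd]
  have hslen := Prog.len_pos (name := Subtype.val) s
  have hlt : (d + 1 : ℕ) < w.length := by omega
  choose nm hnm using exists_denotes_iff hw' hd hpos
  have hden : ∀ x v, Denotes w d x v ↔ nm x = v := fun x v =>
    ⟨fun h => (hnm x).unique h, fun h => h ▸ hnm x⟩
  have hV : ReadsVars w Subtype.val (NameAt w d) fun x v => nm x = v := by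
    have := readsVars_nameAt hw' hd
    simpa only [ReadsVars, hden] using this
  have hsame : SameVar w d = fun x y => nm x = nm y := by
    funext x y
    exact propext (sameVar_iff hnm)
  have hstep : Step w d = CStep (Edge Subtype.val s (d + 1) d) nm := by
    funext c c'
    simp only [Step, CStep, hsame]
    exact propext (exists_congr fun a =>
      and_congr_left' (hV.edgeAt_iff Subtype.val_injective hs))
  rw [or_iff_right hpos.ne', iff_not_comm, not_coherent_iff (name := Subtype.val) (nm := nm)
    (i := ⟨d + 1, hlt⟩) (j := d) hV.1 (Nat.lt_succ_self _)
    fun p a q h => h.lt_length hs d.2, Incoherent, hstep, hsame]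
  constructor
  · rintro ⟨i, hi, h⟩
    obtain rfl : i = ⟨d + 1, hlt⟩ := Fin.ext hi
    exact h
  · exact fun h => ⟨_, rfl, h⟩

/-- Whether a word describes a coherent program can be expressed by formulas about the word. -/
theorem mem_coherenceProblem_iff : w ∈ coherenceProblem L ↔ ∃ d : Fin w.length, HeaderAt w d ∧
    (∃ i j : Fin w.length, (i : ℕ) = d + 1 ∧ (j + 1 : ℕ) = w.length ∧
      ProgAt w (NameAt w d) i j) ∧ ((d : ℕ) = 0 ∨ ¬ Incoherent w d) := by
  constructor
  · rintro ⟨vs, s, hw, hs⟩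
    have hw' : w = (vs.map encodeName).flatten ++ .endDecl :: s.encode Subtype.val := hw
    have hlt : ((vs.map (encodeName (L := L))).flatten).length < w.length := by
      conv_rhs => rw [hw']
      simp
    have hslen := Prog.len_pos (name := Subtype.val) s
    have hlen : ((vs.map (encodeName (L := L))).flatten).length + 1 + s.len Subtype.val =
        w.length := by
      conv_rhs => rw [hw']
      rw [List.length_append, List.length_cons, Prog.len]
      omega
    have h1 : w.drop (((vs.map (encodeName (L := L))).flatten).length + 1) =
        s.encode Subtype.val := drop_succ_of_eq hw' rfl
    refine ⟨⟨_, hlt⟩, headerAt_iff.2 ⟨vs, by simp only; rw [h1, ← hw'], rfl⟩,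
      ⟨⟨((vs.map (encodeName (L := L))).flatten).length + 1, by omega⟩,
        ⟨w.length - 1, by omega⟩, rfl, by simp only; omega,
      (readsVars_nameAt hw' rfl).progAt_iff.2 ⟨s, ?_, ?_⟩⟩,
      (coherent_iff hw rfl).1 hs⟩
    · rw [Spells, h1]
    · change w.length - 1 + 1 =
        ((vs.map (encodeName (L := L))).flatten).length + 1 + s.len Subtype.val
      omega
  · rintro ⟨d, hd, ⟨i, j, hi, hj, hp⟩, h⟩
    obtain ⟨vs, hw, hd⟩ := headerAt_iff.1 hd
    obtain ⟨s, h1, h2⟩ := (readsVars_nameAt hw hd).progAt_iff.1 hp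
    have h3 : s.encode Subtype.val = w.drop (d + 1) := by
      rw [hi] at h1 h2
      refine h1.eq_of_length ?_
      rw [List.length_drop]
      rw [Prog.len] at h2
      omega
    have hw' : w = encodeInstance vs s := by
      rw [encodeInstance, h3]
      exact hw
    exact ⟨vs, s, hw', (coherent_iff hw' hd).2 h⟩

end

end UninterpretedProgram

namespace UninterpretedProgram

/-! ### Definability of the flow graph -/

section

variable {L : FirstOrder.Language.{0, 0}} {Γ : List (Token L) → Type} [Ctx Γ]
  {d x y i j : ∀ w, Γ w → Fin w.length} {m n l : ∀ w, Γ w → ℕ}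

theorem PS.sameName (hm : PT m) (hn : PT n) (hl : PT l) :
    PS fun w a => SameName w (m w a) (n w a) (l w a) :=
  .and (.letter_eq (hm.add hl) _) (.and (.letter_eq (hn.add hl) _) (.allNum hl (.finite_ex fun _ =>
    .and (.letter_eq (hm.fst.add PT.snd) _) (.letter_eq (hn.fst.add PT.snd) _))))

theorem PS.headerAt (hd : RegOf (τ := fun w => Fin w.length) d) :
    PS fun w a => HeaderAt w (d w a) :=
  .and (.letter_eq hd.num _) (.and
    (.allFin (.imp (.lt RegOf.snd.num hd.fst.num) (.letter RegOf.snd.num _)))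
    (.allFin (.imp (.eq (RegOf.snd.num.add (.const 1)) hd.fst.num) (.letter_eq RegOf.snd.num _))))

theorem PS.declAt (hd : RegOf (τ := fun w => Fin w.length) d)
    (hx : RegOf (τ := fun w => Fin w.length) x) : PS fun w a => DeclAt w (d w a) (x w a) :=
  .and (.lt hx.num hd.num)
    (.allFin (.imp (.eq (RegOf.snd.num.add (.const 1)) hx.fst.num) (.letter_eq RegOf.snd.num _)))

theorem PS.rep (hd : RegOf (τ := fun w => Fin w.length) d)
    (hx : RegOf (τ := fun w => Fin w.length) x) (hy : RegOf (τ := fun w => Fin w.length) y) :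
    PS fun w a => Rep w (d w a) (x w a) (y w a) :=
  .and (.declAt hd hy) (.or (.and (.declAt hd hx) (.eqFin hy hx))
    (.and (.not (.declAt hd hx)) (.eq hy.num (.const 0))))

theorem PS.nameAt (hd : RegOf (τ := fun w => Fin w.length) d) (hm : PT m)
    (hx : RegOf (τ := fun w => Fin w.length) x) (hn : PT n) :
    PS fun w a => NameAt w (d w a) (m w a) (x w a) (n w a) :=
  .exFin (.exFin (.and (.rep hd.fst.fst hx.fst.fst RegOf.snd.fst)
    (.and (.eq hn.fst.fst (hm.fst.fst.add RegOf.snd.num))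
      (.sameName RegOf.snd.fst.num hm.fst.fst RegOf.snd.num))))

theorem PS.sameVar (hd : RegOf (τ := fun w => Fin w.length) d)
    (hx : RegOf (τ := fun w => Fin w.length) x) (hy : RegOf (τ := fun w => Fin w.length) y) :
    PS fun w a => SameVar w (d w a) (x w a) (y w a) :=
  .exFin (.exFin (.exFin (.and (.rep hd.fst.fst.fst hx.fst.fst.fst RegOf.snd.fst.fst)
    (.and (.rep hd.fst.fst.fst hy.fst.fst.fst RegOf.snd.fst)
      (.sameName RegOf.snd.fst.fst.num RegOf.snd.fst.num RegOf.snd.num)))))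

theorem PS.varsAt (hd : RegOf (τ := fun w => Fin w.length) d) {k : ℕ}
    {z : ∀ w, Γ w → Fin k → Fin w.length} (hz : RegOf (τ := fun w => Fin k → Fin w.length) z)
    (hm : PT m) (hn : PT n) :
    PS fun w a => VarsAt (NameAt w (d w a)) k (z w a) (m w a) (n w a) := by
  induction k generalizing Γ with
  | zero => exact .eq hm hn
  | succ k ih =>
    exact .exFin (.and (.nameAt hd.fst (hm.fst.add (.const 1)) (hz.app 0).fst RegOf.snd.num)
      (ih hd.fst (.tuple fun i => (hz.app i.succ).fst) RegOf.snd.num hn.fst))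

theorem PS.condAt (hd : RegOf (τ := fun w => Fin w.length) d) (b : Bool) (hm : PT m)
    (hx : RegOf (τ := fun w => Fin w.length) x) (hy : RegOf (τ := fun w => Fin w.length) y)
    (hn : PT n) : PS fun w a => CondAt w (NameAt w (d w a)) b (m w a) (x w a) (y w a) (n w a) :=
  .and (.letter_eq hm _) (.exFin
    (.and (.nameAt hd.fst (hm.fst.add (.const 1)) hx.fst RegOf.snd.num)
      (.nameAt hd.fst (RegOf.snd.num.add (.const 1)) hy.fst hn.fst)))

theorem PS.progRule [Finite (Σ n, L.Functions n)] (hd : RegOf (τ := fun w => Fin w.length) d)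
    (hi : RegOf (τ := fun w => Fin w.length) i) (hj : RegOf (τ := fun w => Fin w.length) j)
    {S : ∀ w, Γ w → St binary w.length} (hS : RegOf (τ := fun w => St binary w.length) S) :
    PS fun w a => ProgRule w (NameAt w (d w a)) (fun i j => S w a () ![i, j]) (i w a) (j w a) :=
  .or (.and (.letter_eq hi.num _) (.eqFin hj hi)) <|
  .or (.and (.letter_eq hi.num _) (.exFin (.exFin (.exFin (.and
    (.nameAt hd.fst.fst.fst (hi.fst.fst.fst.num.add (.const 1)) RegOf.snd.fst.fst RegOf.snd.num)
    (.nameAt hd.fst.fst.fst (RegOf.snd.num.add (.const 1)) RegOf.snd.fst hj.fst.fst.fst.num)))))) <|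
  .or (.and (.letter_eq hi.num _) (.finite_ex fun f => .exFin (.exTuple (.exFin (.and
    (.nameAt hd.fst.fst.fst (hi.fst.fst.fst.num.add (.const 1)) RegOf.snd.fst.fst RegOf.snd.num)
    (.and (.letter_eq (RegOf.snd.num.add (.const 1)) _)
    (.varsAt hd.fst.fst.fst (RegOf.snd (τ := fun w => Fin f.1 → Fin w.length)).fst
      (RegOf.snd.num.add (.const 1)) hj.fst.fst.fst.num))))))) <|
  .or (.and (.letter_eq hi.num _) (.finite_ex fun b => .exFin (.exFin
    (.condAt hd.fst.fst b (hi.fst.fst.num.add (.const 1)) RegOf.snd.fst RegOf.snd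
      hj.fst.fst.num)))) <|
  .or (.and (.letter_eq hi.num _) (.exFin (.exFin (.exFin (.and
    (.eq RegOf.snd.fst.fst.num (hi.fst.fst.fst.num.add (.const 1)))
    (.and (.rel hS.fst.fst.fst () (RegOf.snd.fst.fst.pair RegOf.snd.fst))
    (.and (.eq RegOf.snd.num (RegOf.snd.fst.num.add (.const 1)))
    (.rel hS.fst.fst.fst () (RegOf.snd.pair hj.fst.fst.fst))))))))) <|
  .or (.and (.letter_eq hi.num _) (.finite_ex fun b => .exFin (.exFin (.exFin (.exFin (.exFin
    (.exFin (.and (.condAt hd.fst.fst.fst.fst.fst.fst b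
      (hi.fst.fst.fst.fst.fst.fst.num.add (.const 1)) RegOf.snd.fst.fst.fst.fst.fst
      RegOf.snd.fst.fst.fst.fst RegOf.snd.fst.fst.fst.num)
    (.and (.eq RegOf.snd.fst.fst.num (RegOf.snd.fst.fst.fst.num.add (.const 1)))
    (.and (.rel hS.fst.fst.fst.fst.fst.fst () (RegOf.snd.fst.fst.pair RegOf.snd.fst))
    (.and (.eq RegOf.snd.num (RegOf.snd.fst.num.add (.const 1)))
    (.rel hS.fst.fst.fst.fst.fst.fst ()
      (RegOf.snd.pair hj.fst.fst.fst.fst.fst.fst)))))))))))))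
  (.and (.letter_eq hi.num _) (.finite_ex fun b => .exFin (.exFin (.exFin (.exFin
    (.and (.condAt hd.fst.fst.fst.fst b (hi.fst.fst.fst.fst.num.add (.const 1))
      RegOf.snd.fst.fst.fst RegOf.snd.fst.fst RegOf.snd.fst.num)
    (.and (.eq RegOf.snd.num (RegOf.snd.fst.num.add (.const 1)))
    (.rel hS.fst.fst.fst.fst () (RegOf.snd.pair hj.fst.fst.fst.fst)))))))))

theorem PS.progAt [Finite (Σ n, L.Functions n)] (hd : RegOf (τ := fun w => Fin w.length) d)
    (hi : RegOf (τ := fun w => Fin w.length) i) (hj : RegOf (τ := fun w => Fin w.length) j) :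
    PS fun w a => ProgAt w (NameAt w (d w a)) (i w a) (j w a) :=
  (PS.lfp (Φ := fun w a X i j => ProgRule w (NameAt w (d w a)) X i j)
    (.progRule hd.fst.fst.fst RegOf.snd.fst RegOf.snd RegOf.snd.fst.fst)).comp
    ((RegMap.id.prod hi).prod hj)

theorem PS.folRule [Finite (Σ n, L.Functions n)] (hd : RegOf (τ := fun w => Fin w.length) d)
    (hi : RegOf (τ := fun w => Fin w.length) i) (hj : RegOf (τ := fun w => Fin w.length) j)
    {S : ∀ w, Γ w → St binary w.length} (hS : RegOf (τ := fun w => St binary w.length) S) :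
    PS fun w a => FolRule w (NameAt w (d w a)) (d w a) (fun i j => S w a () ![i, j])
      (i w a) (j w a) :=
  .or (.and (.eq hi.num (hd.num.add (.const 1))) (.eqFin hj hd)) <|
  .or (.exFin (.exFin (.exFin (.and (.letter_eq RegOf.snd.fst.fst.num _)
    (.and (.rel hS.fst.fst.fst () (RegOf.snd.fst.fst.pair RegOf.snd.fst))
    (.and (.eq hi.fst.fst.fst.num (RegOf.snd.fst.fst.num.add (.const 1)))
    (.and (.progAt hd.fst.fst.fst hi.fst.fst.fst RegOf.snd)
    (.eq hj.fst.fst.fst.num (RegOf.snd.num.add (.const 1)))))))))) <|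
  .or (.exFin (.exFin (.exFin (.and (.letter_eq RegOf.snd.fst.fst.num _)
    (.and (.rel hS.fst.fst.fst () (RegOf.snd.fst.fst.pair hj.fst.fst.fst))
    (.and (.eq RegOf.snd.fst.num (RegOf.snd.fst.fst.num.add (.const 1)))
    (.and (.progAt hd.fst.fst.fst RegOf.snd.fst RegOf.snd)
    (.eq hi.fst.fst.fst.num (RegOf.snd.num.add (.const 1)))))))))) <|
  .or (.exFin (.finite_ex fun b => .exFin (.exFin (.exFin
    (.and (.letter_eq RegOf.snd.fst.fst.fst.num _)
    (.and (.rel hS.fst.fst.fst.fst () (RegOf.snd.fst.fst.fst.pair hj.fst.fst.fst.fst))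
    (.and (.condAt hd.fst.fst.fst.fst b (RegOf.snd.fst.fst.fst.num.add (.const 1))
      RegOf.snd.fst.fst RegOf.snd.fst RegOf.snd.num)
    (.eq hi.fst.fst.fst.fst.num (RegOf.snd.num.add (.const 1)))))))))) <|
  .or (.exFin (.finite_ex fun b => .exFin (.exFin (.exFin (.exFin (.exFin
    (.and (.letter_eq RegOf.snd.fst.fst.fst.fst.fst.num _)
    (.and (.rel hS.fst.fst.fst.fst.fst.fst ()
      (RegOf.snd.fst.fst.fst.fst.fst.pair hj.fst.fst.fst.fst.fst.fst))
    (.and (.condAt hd.fst.fst.fst.fst.fst.fst b (RegOf.snd.fst.fst.fst.fst.fst.num.add (.const 1))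
      RegOf.snd.fst.fst.fst.fst RegOf.snd.fst.fst.fst RegOf.snd.fst.fst.num)
    (.and (.eq RegOf.snd.fst.num (RegOf.snd.fst.fst.num.add (.const 1)))
    (.and (.progAt hd.fst.fst.fst.fst.fst.fst RegOf.snd.fst RegOf.snd)
    (.eq hi.fst.fst.fst.fst.fst.fst.num (RegOf.snd.num.add (.const 1))))))))))))))
  (.exFin (.finite_ex fun b => .exFin (.exFin (.exFin
    (.and (.letter_eq hj.fst.fst.fst.fst.num _)
    (.and (.rel hS.fst.fst.fst.fst () (hj.fst.fst.fst.fst.pair RegOf.snd.fst.fst.fst))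
    (.and (.condAt hd.fst.fst.fst.fst b (hj.fst.fst.fst.fst.num.add (.const 1))
      RegOf.snd.fst.fst RegOf.snd.fst RegOf.snd.num)
    (.eq hi.fst.fst.fst.fst.num (RegOf.snd.num.add (.const 1))))))))))

theorem PS.fol [Finite (Σ n, L.Functions n)] (hd : RegOf (τ := fun w => Fin w.length) d)
    (hi : RegOf (τ := fun w => Fin w.length) i) (hj : RegOf (τ := fun w => Fin w.length) j) :
    PS fun w a => Fol w (NameAt w (d w a)) (d w a) (i w a) (j w a) :=
  (PS.lfp (Φ := fun w a X i j => FolRule w (NameAt w (d w a)) (d w a) X i j)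
    (.folRule hd.fst.fst.fst RegOf.snd.fst RegOf.snd RegOf.snd.fst.fst)).comp
    ((RegMap.id.prod hi).prod hj)

theorem PS.assumeEdgeAt [Finite (Σ n, L.Functions n)] (hd : RegOf (τ := fun w => Fin w.length) d)
    (hi : RegOf (τ := fun w => Fin w.length) i) (b : Bool)
    (hx : RegOf (τ := fun w => Fin w.length) x) (hy : RegOf (τ := fun w => Fin w.length) y)
    (hj : RegOf (τ := fun w => Fin w.length) j) :
    PS fun w a => AssumeEdgeAt w (NameAt w (d w a)) (d w a) (i w a) b (x w a) (y w a) (j w a) :=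
  .or (.and (.letter_eq hi.num _) (.and (.fol hd hi hj) (.exFin
    (.condAt hd.fst b (hi.fst.num.add (.const 1)) hx.fst hy.fst RegOf.snd.num)))) <|
  .or (.and (.or (.letter_eq hi.num _) (.letter_eq hi.num _))
    (.and (.exFin (.fol hd.fst hi.fst RegOf.snd)) (.exFin (.and
      (.condAt hd.fst b (hi.fst.num.add (.const 1)) hx.fst hy.fst RegOf.snd.num)
      (.eq hj.fst.num (RegOf.snd.num.add (.const 1))))))) <|
  .or (.and (.letter_eq hi.num _)
    (.and (.exFin (.fol hd.fst hi.fst RegOf.snd)) (.exFin (.exFin (.exFin (.and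
      (.condAt hd.fst.fst.fst (!b) (hi.fst.fst.fst.num.add (.const 1)) hx.fst.fst.fst
        hy.fst.fst.fst RegOf.snd.fst.fst.num)
      (.and (.eq RegOf.snd.fst.num (RegOf.snd.fst.fst.num.add (.const 1)))
      (.and (.progAt hd.fst.fst.fst RegOf.snd.fst RegOf.snd)
      (.eq hj.fst.fst.fst.num (RegOf.snd.num.add (.const 1)))))))))))
  (.and (.letter_eq hi.num _) (.and (.fol hd hi hj) (.exFin
    (.condAt hd.fst (!b) (hi.fst.num.add (.const 1)) hx.fst hy.fst RegOf.snd.num))))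

theorem PS.edgeAt_none [Finite (Σ n, L.Functions n)] (hd : RegOf (τ := fun w => Fin w.length) d)
    (hi : RegOf (τ := fun w => Fin w.length) i) (hj : RegOf (τ := fun w => Fin w.length) j) :
    PS fun w a => EdgeAt w (NameAt w (d w a)) (d w a) (i w a) none (j w a) :=
  .or (.and (.letter_eq hi.num _) (.fol hd hi hj))
    (.and (.letter_eq hi.num _) (.and (.exFin (.fol hd.fst hi.fst RegOf.snd))
      (.eq hj.num (hi.num.add (.const 1)))))

theorem PS.edgeAt_copy [Finite (Σ n, L.Functions n)] (hd : RegOf (τ := fun w => Fin w.length) d)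
    (hi : RegOf (τ := fun w => Fin w.length) i) (hx : RegOf (τ := fun w => Fin w.length) x)
    (hy : RegOf (τ := fun w => Fin w.length) y) (hj : RegOf (τ := fun w => Fin w.length) j) :
    PS fun w a => EdgeAt w (NameAt w (d w a)) (d w a) (i w a) (some (.copy (x w a) (y w a)))
      (j w a) :=
  .and (.letter_eq hi.num _) (.and (.fol hd hi hj) (.exFin (.exFin (.and
    (.nameAt hd.fst.fst (hi.fst.fst.num.add (.const 1)) hx.fst.fst RegOf.snd.fst.num)
    (.nameAt hd.fst.fst (RegOf.snd.fst.num.add (.const 1)) hy.fst.fst RegOf.snd.num)))))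

theorem PS.edgeAt_app [Finite (Σ n, L.Functions n)] (hd : RegOf (τ := fun w => Fin w.length) d)
    (hi : RegOf (τ := fun w => Fin w.length) i) (hx : RegOf (τ := fun w => Fin w.length) x)
    (f : Σ n, L.Functions n) {z : ∀ w, Γ w → Fin f.1 → Fin w.length}
    (hz : RegOf (τ := fun w => Fin f.1 → Fin w.length) z)
    (hj : RegOf (τ := fun w => Fin w.length) j) :
    PS fun w a => EdgeAt w (NameAt w (d w a)) (d w a) (i w a) (some (.app (x w a) f.2 (z w a)))
      (j w a) :=
  .and (.letter_eq hi.num _) (.and (.fol hd hi hj) (.exFin (.exFin (.and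
    (.nameAt hd.fst.fst (hi.fst.fst.num.add (.const 1)) hx.fst.fst RegOf.snd.fst.num)
    (.and (.letter_eq (RegOf.snd.fst.num.add (.const 1)) _)
    (.varsAt hd.fst.fst hz.fst.fst (RegOf.snd.fst.num.add (.const 1)) RegOf.snd.num))))))

theorem PS.edgeAt_assume [Finite (Σ n, L.Functions n)] (hd : RegOf (τ := fun w => Fin w.length) d)
    (hi : RegOf (τ := fun w => Fin w.length) i) (b : Bool)
    (hx : RegOf (τ := fun w => Fin w.length) x) (hy : RegOf (τ := fun w => Fin w.length) y)
    (hj : RegOf (τ := fun w => Fin w.length) j) :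
    PS fun w a => EdgeAt w (NameAt w (d w a)) (d w a) (i w a)
      (some (.assume (condOf b (x w a) (y w a)))) (j w a) := by
  cases b with
  | false => exact .assumeEdgeAt hd hi false hx hy hj
  | true => exact .assumeEdgeAt hd hi true hx hy hj

end

end UninterpretedProgram

namespace UninterpretedProgram

/-! ### Definability of summaries -/

section

variable {A : Type} {Γ τ : List A → Type} [Ctx Γ] [Reg τ]

/-- Positions that are determined by a definable relation. -/
def DF (g : ∀ w, Γ w → Fin w.length) : Prop :=
  PS fun w (p : Γ w × Fin w.length) => p.2 = g w p.1

theorem RegOf.df {g : ∀ w, Γ w → Fin w.length} (h : RegOf (τ := fun w => Fin w.length) g) : DF g :=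
  .eqFin RegOf.snd h.fst

theorem DF.comp {Δ : List A → Type} [Ctx Δ] {f : ∀ w, Γ w → Δ w} {g : ∀ w, Δ w → Fin w.length}
    (hg : DF g) (hf : RegMap f) : DF fun w a => g w (f w a) :=
  PS.comp hg (hf.fst.prod RegOf.snd)

theorem PS.bindFin {g : ∀ w, Γ w → Fin w.length} (hg : DF g) {R : ∀ w, Γ w → Fin w.length → Prop}
    (h : PS fun w (p : Γ w × Fin w.length) => R w p.1 p.2) : PS fun w a => R w a (g w a) :=
  (PS.exFin (R := fun w a v => v = g w a ∧ R w a v) (.and hg h)).congr fun w a => by simp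

theorem PS.bindTuple {k : ℕ} {g : ∀ w, Γ w → Fin k → Fin w.length}
    (hg : ∀ i, DF fun w a => g w a i) {R : ∀ w, Γ w → (Fin k → Fin w.length) → Prop}
    (h : PS fun w (p : Γ w × (Fin k → Fin w.length)) => R w p.1 p.2) :
    PS fun w a => R w a (g w a) := by
  refine (PS.exTuple (R := fun w a z => (∀ i, z i = g w a i) ∧ R w a z) (.and (.finite_all fun i =>
    (PS.comp (hg i) (RegMap.id.fst.prod
      (RegOf.app (RegOf.snd (τ := fun w => Fin k → Fin w.length)) i)))) h)).congr fun w a => ?_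
  simp [← funext_iff]

end

section

variable {L : FirstOrder.Language.{0, 0}} {Γ : List (Token L) → Type} [Ctx Γ]

/-- Summaries whose components are definable. -/
structure PSumm (S : ∀ w, Γ w → Summ L (Fin w.length)) : Prop where
  defE : PS fun w (p : (Γ w × Fin w.length) × Fin w.length) => (S w p.1.1).E p.1.2 p.2
  defK : ∀ (f : Σ n, L.Functions n) (M : Fin f.1 → Bool), PS fun w
    (p : (((Γ w × (Fin f.1 → Fin w.length)) × (Fin f.1 → Fin w.length)) × Fin w.length) ×
      Fin w.length) => (S w p.1.1.1.1).K f M p.1.1.1.2 p.1.1.2 p.1.2 p.2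
  defC : ∀ f : Σ n, L.Functions n, PS fun w
    (p : Γ w × (Fin f.1 → Fin w.length)) => (S w p.1).C f p.2
  defD : PS fun w (p : Γ w × Fin w.length) => (S w p.1).D p.2

variable {S U : ∀ w, Γ w → Summ L (Fin w.length)}

namespace PSumm

theorem comp {Δ : List (Token L) → Type} [Ctx Δ] {f : ∀ w, Δ w → Γ w} (hS : PSumm S)
    (hf : RegMap f) : PSumm fun w a => S w (f w a) where
  defE := hS.defE.comp ((hf.fst.fst.prod RegOf.snd.fst).prod RegOf.snd)
  defK f M := (hS.defK f M).comp ((((hf.fst.fst.fst.fst.prod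
    (RegOf.snd (τ := fun w => Fin f.1 → Fin w.length)).fst.fst.fst).prod
    (RegOf.snd (τ := fun w => Fin f.1 → Fin w.length)).fst.fst).prod RegOf.snd.fst).prod RegOf.snd)
  defC f := (hS.defC f).comp (hf.fst.prod (RegOf.snd (τ := fun w => Fin f.1 → Fin w.length)))
  defD := hS.defD.comp (hf.fst.prod RegOf.snd)

theorem fst {τ : List (Token L) → Type} [Reg τ] (hS : PSumm S) :
    PSumm fun w (p : Γ w × τ w) => S w p.1 :=
  hS.comp RegMap.id.fst

variable {x y : ∀ w, Γ w → Fin w.length}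

theorem e (hS : PSumm S) (hx : DF x) (hy : DF y) : PS fun w a => (S w a).E (x w a) (y w a) :=
  .bindFin hx (R := fun w a i => (S w a).E i (y w a))
    (.bindFin (hy.comp RegMap.id.fst) (R := fun w p j => (S w p.1).E p.2 j) hS.defE)

theorem k (hS : PSumm S) {f : Σ n, L.Functions n} (M : Fin f.1 → Bool)
    {u v : ∀ w, Γ w → Fin f.1 → Fin w.length} (hu : ∀ i, DF fun w a => u w a i)
    (hv : ∀ i, DF fun w a => v w a i) (hx : DF x) (hy : DF y) :
    PS fun w a => (S w a).K f M (u w a) (v w a) (x w a) (y w a) :=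
  .bindTuple hu (R := fun w a u => (S w a).K f M u (v w a) (x w a) (y w a))
    (.bindTuple (fun i => (hv i).comp RegMap.id.fst)
      (R := fun w p v => (S w p.1).K f M p.2 v (x w p.1) (y w p.1))
      (.bindFin (hx.comp RegMap.id.fst.fst)
        (R := fun w p i => (S w p.1.1).K f M p.1.2 p.2 i (y w p.1.1))
        (.bindFin (hy.comp RegMap.id.fst.fst.fst)
          (R := fun w p j => (S w p.1.1.1).K f M p.1.1.2 p.1.2 p.2 j) (hS.defK f M))))

theorem c (hS : PSumm S) {f : Σ n, L.Functions n} {z : ∀ w, Γ w → Fin f.1 → Fin w.length}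
    (hz : ∀ i, DF fun w a => z w a i) : PS fun w a => (S w a).C f (z w a) :=
  .bindTuple hz (R := fun w a z => (S w a).C f z) (hS.defC f)

theorem d (hS : PSumm S) (hx : DF x) : PS fun w a => (S w a).D (x w a) :=
  .bindFin hx (R := fun w a i => (S w a).D i) hS.defD

theorem holds (hS : PSumm S) {f : Σ n, L.Functions n} {z : ∀ w, Γ w → Fin f.1 → Fin w.length}
    (hz : ∀ i, DF fun w a => z w a i) (hx : DF x) : PS fun w a => (S w a).Holds f (z w a) (x w a) :=
  hS.k _ hz hz hx hx

variable [Finite (Σ n, L.Functions n)]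

theorem child (hS : PSumm S) (hx : DF x) (hy : DF y) :
    PS fun w a => (S w a).Child (x w a) (y w a) :=
  .or (hS.e hx hy) (.finite_ex fun _ => .finite_ex fun i =>
    hS.k (fun j => decide (j = i)) (fun _ => hy) (fun _ => hy) hx hx)

theorem rtcChild (hS : PSumm S) (hx : DF x) (hy : DF y) :
    PS fun w a => Relation.ReflTransGen (S w a).Child (x w a) (y w a) :=
  .bindFin hx (R := fun w a i => Relation.ReflTransGen (S w a).Child i (y w a))
    (.bindFin (hy.comp RegMap.id.fst)
      (R := fun w p j => Relation.ReflTransGen (S w p.1).Child p.2 j)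
      (PS.rtc (r := fun w a => (S w a).Child) (hS.fst.fst.child RegOf.snd.fst.df RegOf.snd.df)))

theorem eqv (hS : PSumm S) (hx : RegOf (τ := fun w => Fin w.length) x)
    (hy : RegOf (τ := fun w => Fin w.length) y) {i j : ∀ w, Γ w → Fin w.length} (hi : DF i)
    (hj : DF j) : PS fun w a => (S w a).eqv (x w a) (y w a) (i w a) (j w a) := by
  refine .bindFin hi (R := fun w a i => (S w a).eqv (x w a) (y w a) i (j w a))
    (.bindFin (hj.comp RegMap.id.fst)
      (R := fun w p j => (S w p.1).eqv (x w p.1) (y w p.1) p.2 j) (PS.lfp (Φ := fun w a X i j =>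
    (S w a).E i j ∨ (i = x w a ∧ j = y w a) ∨ X j i ∨ (∃ k, X i k ∧ X k j) ∨
    ∃ f M, ∃ u v, (S w a).K f M u v i j ∧ ∀ k, M k = true → X (u k) (v k)) ?_))
  refine .or (hS.fst.fst.fst.e RegOf.snd.fst.df RegOf.snd.df) <|
    .or (.and (.eqFin RegOf.snd.fst hx.fst.fst.fst) (.eqFin RegOf.snd hy.fst.fst.fst)) <|
    .or (.rel RegOf.snd.fst.fst () (RegOf.snd.pair RegOf.snd.fst)) <|
    .or (.exFin (.and (.rel RegOf.snd.fst.fst.fst () (RegOf.snd.fst.fst.pair RegOf.snd))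
      (.rel RegOf.snd.fst.fst.fst () (RegOf.snd.pair RegOf.snd.fst)))) <|
    .finite_ex fun f => .finite_ex fun M => .exTuple (.exTuple (.and ?_ (.finite_all fun k =>
      .imp (.const _) (.rel RegOf.snd.fst.fst.fst.fst () (RegOf.pair ?_ ?_)))))
  · exact hS.fst.fst.fst.fst.fst.k M
      (fun i => (RegOf.app (RegOf.snd (τ := fun w => Fin f.1 → Fin w.length)).fst i).df)
      (fun i => (RegOf.app (RegOf.snd (τ := fun w => Fin f.1 → Fin w.length)) i).df)
      RegOf.snd.fst.fst.fst.df RegOf.snd.fst.fst.df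
  · exact RegOf.app (RegOf.snd (τ := fun w => Fin f.1 → Fin w.length)).fst k
  · exact RegOf.app (RegOf.snd (τ := fun w => Fin f.1 → Fin w.length)) k

theorem copy (hS : PSumm S) {s : ∀ w, Γ w → Fin w.length → Fin w.length}
    (hs : DF fun w (p : Γ w × Fin w.length) => s w p.1 p.2) :
    PSumm fun w a => (S w a).copy (s w a) where
  defE := hS.fst.fst.e (hs.comp (RegMap.id.fst.fst.prod RegOf.snd.fst))
    (hs.comp (RegMap.id.fst.fst.prod RegOf.snd))
  defK f M := hS.fst.fst.fst.fst.k M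
    (fun i => hs.comp (RegMap.id.fst.fst.fst.fst.prod
      (RegOf.app (RegOf.snd (τ := fun w => Fin f.1 → Fin w.length)).fst.fst.fst i)))
    (fun i => hs.comp (RegMap.id.fst.fst.fst.fst.prod
      (RegOf.app (RegOf.snd (τ := fun w => Fin f.1 → Fin w.length)).fst.fst i)))
    (hs.comp (RegMap.id.fst.fst.fst.fst.prod RegOf.snd.fst))
    (hs.comp (RegMap.id.fst.fst.fst.fst.prod RegOf.snd))
  defC f := hS.fst.c fun i => hs.comp (RegMap.id.fst.prod
    (RegOf.app (RegOf.snd (τ := fun w => Fin f.1 → Fin w.length)) i))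
  defD := .or (hS.fst.d hs) (.exFin (.and
    (hS.fst.fst.rtcChild RegOf.snd.df (hs.comp (RegMap.id.fst.fst.prod RegOf.snd.fst)))
    (.allFin (.not (hS.fst.fst.fst.e RegOf.snd.fst.df
      (hs.comp (RegMap.id.fst.fst.fst.prod RegOf.snd)))))))

theorem fresh (hS : PSumm S) {X : ∀ w, Γ w → Fin w.length → Prop}
    (hX : PS fun w (p : Γ w × Fin w.length) => X w p.1 p.2) {g : Σ n, L.Functions n}
    {z : ∀ w, Γ w → Fin g.1 → Fin w.length}
    (hz : RegOf (τ := fun w => Fin g.1 → Fin w.length) z) :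
    PSumm fun w a => (S w a).fresh (X w a) g (z w a) where
  defE := .or (.and (hX.comp (RegMap.id.fst.fst.prod RegOf.snd.fst))
      (hX.comp (RegMap.id.fst.fst.prod RegOf.snd)))
    (.and (.not (hX.comp (RegMap.id.fst.fst.prod RegOf.snd.fst)))
      (.and (.not (hX.comp (RegMap.id.fst.fst.prod RegOf.snd)))
        (hS.fst.fst.e RegOf.snd.fst.df RegOf.snd.df)))
  defK f M := by
    have hu : ∀ i : Fin f.1, RegOf (τ := fun w => Fin w.length) fun w (p : (((Γ w ×
        (Fin f.1 → Fin w.length)) × (Fin f.1 → Fin w.length)) × Fin w.length) × Fin w.length) =>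
        p.1.1.1.2 i := fun i =>
      RegOf.app (RegOf.snd (τ := fun w => Fin f.1 → Fin w.length)).fst.fst.fst i
    have hv : ∀ i : Fin f.1, RegOf (τ := fun w => Fin w.length) fun w (p : (((Γ w ×
        (Fin f.1 → Fin w.length)) × (Fin f.1 → Fin w.length)) × Fin w.length) × Fin w.length) =>
        p.1.1.2 i := fun i =>
      RegOf.app (RegOf.snd (τ := fun w => Fin f.1 → Fin w.length)).fst.fst i
    have ha := hX.comp (Γ := fun w => (((Γ w × (Fin f.1 → Fin w.length)) ×
      (Fin f.1 → Fin w.length)) × Fin w.length) × Fin w.length)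
      (RegMap.id.fst.fst.fst.fst.prod RegOf.snd.fst)
    have hb := hX.comp (Γ := fun w => (((Γ w × (Fin f.1 → Fin w.length)) ×
      (Fin f.1 → Fin w.length)) × Fin w.length) × Fin w.length)
      (RegMap.id.fst.fst.fst.fst.prod RegOf.snd)
    have hS' := hS.fst (τ := fun w => Fin f.1 → Fin w.length)
      |>.fst (τ := fun w => Fin f.1 → Fin w.length) |>.fst (τ := fun w => Fin w.length)
      |>.fst (τ := fun w => Fin w.length)
    refine .and (.finite_all fun i => .imp (.const _) (.and
        (.not (hX.comp (RegMap.id.fst.fst.fst.fst.prod (hu i))))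
        (.not (hX.comp (RegMap.id.fst.fst.fst.fst.prod (hv i)))))) (.or (.and ha.not (.and hb.not
      (hS'.k M (fun i => (hu i).df) (fun i => (hv i).df) RegOf.snd.fst.df RegOf.snd.df))) ?_)
    by_cases e : f = g
    · subst e
      have hz' : ∀ i : Fin f.1, RegOf (τ := fun w => Fin w.length) fun w (p : (((Γ w ×
          (Fin f.1 → Fin w.length)) × (Fin f.1 → Fin w.length)) × Fin w.length) × Fin w.length) =>
          z w p.1.1.1.1 i := fun i => RegOf.app hz.fst.fst.fst.fst i
      refine PS.congr (.or (.and ha (.and hb.not (.and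
          (.finite_all fun i => .imp (.const (M i = true)) (hS'.e (hz' i).df (hu i).df))
          (hS'.holds (z := fun w p i => if M i = true then p.1.1.2 i else z w p.1.1.1.1 i) ?_
            RegOf.snd.df))))
        (.or (.and ha.not (.and hb (.and
          (.finite_all fun i => .imp (.const (M i = true)) (hS'.e (hz' i).df (hv i).df))
          (hS'.holds (z := fun w p i => if M i = true then p.1.1.1.2 i else z w p.1.1.1.1 i) ?_
            RegOf.snd.fst.df))))
        (.and ha (.and hb (.finite_all fun i => .imp (.const (M i = true)) (.and
          (hS'.e (hz' i).df (hu i).df) (hS'.e (hz' i).df (hv i).df)))))))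
        fun w p => ⟨fun ⟨_, h⟩ => h, fun h => ⟨rfl, h⟩⟩
      · intro i
        by_cases hi : M i = true
        · simpa only [if_pos hi] using (hv i).df
        · simpa only [if_neg hi] using (hz' i).df
      · intro i
        by_cases hi : M i = true
        · simpa only [if_pos hi] using (hu i).df
        · simpa only [if_neg hi] using (hz' i).df
    · exact (PS.const False).congr fun w p => iff_of_false (fun ⟨h, _⟩ => e h) id
  defC f := by
    refine .and (.finite_all fun i => .not (hX.comp (RegMap.id.fst.prod
      (RegOf.app (RegOf.snd (τ := fun w => Fin f.1 → Fin w.length)) i))))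
      (.or (hS.defC f) ?_)
    by_cases e : f = g
    · subst e
      exact PS.congr (PS.finite_all fun i => hS.fst.e (RegOf.app hz.fst i).df
        (RegOf.app (RegOf.snd (τ := fun w => Fin f.1 → Fin w.length)) i).df)
        fun w p => ⟨fun ⟨_, h⟩ => h, fun h => ⟨rfl, h⟩⟩
    · exact (PS.const False).congr fun w p => iff_of_false (fun ⟨h, _⟩ => e h) id
  defD := .and hX.not (.or hS.defD (.exFin (.and
    (hS.fst.fst.rtcChild RegOf.snd.df RegOf.snd.fst.df)
    (.allFin (.imp (.not (hX.comp (RegMap.id.fst.fst.fst.prod RegOf.snd)))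
      (.not (hS.fst.fst.fst.e RegOf.snd.fst.df RegOf.snd.df)))))))

theorem assume (hS : PSumm S) (hx : RegOf (τ := fun w => Fin w.length) x)
    (hy : RegOf (τ := fun w => Fin w.length) y) :
    PSumm fun w a => (S w a).assume (x w a) (y w a) where
  defE := hS.fst.fst.eqv hx.fst.fst hy.fst.fst RegOf.snd.fst.df RegOf.snd.df
  defK f M := by
    have hS' := hS.fst (τ := fun w => Fin f.1 → Fin w.length)
      |>.fst (τ := fun w => Fin f.1 → Fin w.length) |>.fst (τ := fun w => Fin w.length)
      |>.fst (τ := fun w => Fin w.length) |>.fst (τ := fun w => Fin f.1 → Fin w.length)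
      |>.fst (τ := fun w => Fin f.1 → Fin w.length) |>.fst (τ := fun w => Fin w.length)
      |>.fst (τ := fun w => Fin w.length)
    refine .finite_ex fun M' => .exTuple (.exTuple (.exFin (.exFin (.and (hS'.k M'
      (fun i => (RegOf.app (RegOf.snd (τ := fun w => Fin f.1 → Fin w.length)).fst.fst.fst i).df)
      (fun i => (RegOf.app (RegOf.snd (τ := fun w => Fin f.1 → Fin w.length)).fst.fst i).df)
      RegOf.snd.fst.df RegOf.snd.df) (.and ?_ (.and ?_ ?_))))))
    · exact hS'.eqv hx.fst.fst.fst.fst.fst.fst.fst.fst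
        hy.fst.fst.fst.fst.fst.fst.fst.fst RegOf.snd.fst.fst.fst.fst.fst.df RegOf.snd.fst.df
    · exact hS'.eqv hx.fst.fst.fst.fst.fst.fst.fst.fst
        hy.fst.fst.fst.fst.fst.fst.fst.fst RegOf.snd.fst.fst.fst.fst.df RegOf.snd.df
    · refine .finite_all fun i => .and (.imp (.const _) (.and (.const _) (.and ?_ ?_)))
        (.imp (.const _) (.imp (.const _) ?_))
      · exact hS'.eqv hx.fst.fst.fst.fst.fst.fst.fst.fst
          hy.fst.fst.fst.fst.fst.fst.fst.fst
          (RegOf.app (RegOf.snd (τ := fun w => Fin f.1 → Fin w.length)).fst.fst.fst.fst.fst.fst.fst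
            i).df
          (RegOf.app (RegOf.snd (τ := fun w => Fin f.1 → Fin w.length)).fst.fst.fst i).df
      · exact hS'.eqv hx.fst.fst.fst.fst.fst.fst.fst.fst
          hy.fst.fst.fst.fst.fst.fst.fst.fst
          (RegOf.app (RegOf.snd (τ := fun w => Fin f.1 → Fin w.length)).fst.fst.fst.fst.fst.fst
            i).df
          (RegOf.app (RegOf.snd (τ := fun w => Fin f.1 → Fin w.length)).fst.fst i).df
      · exact hS'.eqv hx.fst.fst.fst.fst.fst.fst.fst.fst
          hy.fst.fst.fst.fst.fst.fst.fst.fst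
          (RegOf.app (RegOf.snd (τ := fun w => Fin f.1 → Fin w.length)).fst.fst.fst i).df
          (RegOf.app (RegOf.snd (τ := fun w => Fin f.1 → Fin w.length)).fst.fst i).df
  defC f := .exTuple (.and
    (hS.fst.fst.c fun i =>
      (RegOf.app (RegOf.snd (τ := fun w => Fin f.1 → Fin w.length)) i).df)
    (.finite_all fun i => hS.fst.fst.eqv hx.fst.fst hy.fst.fst
      (RegOf.app (RegOf.snd (τ := fun w => Fin f.1 → Fin w.length)).fst i).df
      (RegOf.app (RegOf.snd (τ := fun w => Fin f.1 → Fin w.length)) i).df))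
  defD := .exFin (.and (hS.fst.fst.d RegOf.snd.df)
    ((PS.rtc (r := fun w a i j => (S w a).Child i j ∨ (S w a).eqv (x w a) (y w a) i j)
      (.or (hS.fst.fst.child RegOf.snd.fst.df RegOf.snd.df)
        (hS.fst.fst.eqv hx.fst.fst hy.fst.fst RegOf.snd.fst.df RegOf.snd.df))).comp
      ((RegMap.id.fst.fst.prod RegOf.snd).prod RegOf.snd.fst)))

theorem eq (hS : PSumm S) (hU : PSumm U) : PS fun w a => S w a = U w a := by
  have hE : PS fun w a => ∀ i j, (S w a).E i j ↔ (U w a).E i j :=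
    .allFin (.allFin (.iff hS.defE hU.defE))
  have hK : PS fun w a => ∀ f M u v i j, (S w a).K f M u v i j ↔ (U w a).K f M u v i j :=
    .finite_all fun f => .finite_all fun M => .allTuple (.allTuple (.allFin (.allFin
      (.iff (hS.defK f M) (hU.defK f M)))))
  have hC : PS fun w a => ∀ f z, (S w a).C f z ↔ (U w a).C f z :=
    .finite_all fun f => .allTuple (.iff (hS.defC f) (hU.defC f))
  have hD : PS fun w a => ∀ v, (S w a).D v ↔ (U w a).D v := .allFin (.iff hS.defD hU.defD)
  refine (hE.and (hK.and (hC.and hD))).congr fun w a => ?_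
  constructor
  · intro h
    simp only [h, implies_true, and_self]
  · rintro ⟨h1, h2, h3, h4⟩
    ext
    exacts [h1 _ _, h2 _ _ _ _ _ _, h3 _ _, h4 _]

end PSumm

end

end UninterpretedProgram

namespace UninterpretedProgram

/-! ### Definability of coherence -/

section

/-- The relation symbols of the relational structure that represents a configuration. -/
inductive Tag (L : FirstOrder.Language.{0, 0}) : Type
  | pos
  | bad
  | E
  | K (f : Σ n, L.Functions n) (M : Fin f.1 → Bool)
  | C (f : Σ n, L.Functions n)
  | D

variable {L : FirstOrder.Language.{0, 0}}

/-- The arities of these symbols. -/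
def Tag.arity : Tag L → ℕ
  | .pos => 1
  | .bad => 0
  | .E => 2
  | .K f _ => f.1 + f.1 + 2
  | .C f => f.1
  | .D => 1

instance [Finite (Σ n, L.Functions n)] : Finite (Tag L) :=
  Finite.of_surjective
    (α := Fin 4 ⊕ (Σ f : Σ n, L.Functions n, Fin f.1 → Bool) ⊕ Σ n, L.Functions n)
    (fun
      | .inl i => ![.pos, .bad, .E, .D] i
      | .inr (.inl p) => .K p.1 p.2
      | .inr (.inr f) => .C f) fun t => by
    cases t with
    | pos => exact ⟨.inl 0, rfl⟩
    | bad => exact ⟨.inl 1, rfl⟩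
    | E => exact ⟨.inl 2, rfl⟩
    | K f M => exact ⟨.inr (.inl ⟨f, M⟩), rfl⟩
    | C f => exact ⟨.inr (.inr f), rfl⟩
    | D => exact ⟨.inl 3, rfl⟩

instance [Finite (Σ n, L.Functions n)] : Finite (Token L) :=
  Finite.of_surjective (α := Bool ⊕ (Σ n, L.Functions n) ⊕ Fin 10)
    (fun
      | .inl b => .bit b
      | .inr (.inl f) => .fn f
      | .inr (.inr i) => ![.endName, .endDecl, .eq, .ne, .skip, .assign, .assume, .seq, .ite,
          .while] i) fun t => by
    cases t with
    | bit b => exact ⟨.inl b, rfl⟩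
    | fn f => exact ⟨.inr (.inl f), rfl⟩
    | endName => exact ⟨.inr (.inr 0), rfl⟩
    | endDecl => exact ⟨.inr (.inr 1), rfl⟩
    | eq => exact ⟨.inr (.inr 2), rfl⟩
    | ne => exact ⟨.inr (.inr 3), rfl⟩
    | skip => exact ⟨.inr (.inr 4), rfl⟩
    | assign => exact ⟨.inr (.inr 5), rfl⟩
    | assume => exact ⟨.inr (.inr 6), rfl⟩
    | seq => exact ⟨.inr (.inr 7), rfl⟩
    | ite => exact ⟨.inr (.inr 8), rfl⟩
    | _ => exact ⟨.inr (.inr 9), rfl⟩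

/-- Relational structures that represent configurations. -/
abbrev Snapshot (L : FirstOrder.Language.{0, 0}) (n : ℕ) : Type := St (Tag.arity (L := L)) n

variable {n : ℕ}

/-- The position in the represented configuration. -/
def Snapshot.IsPos (s : Snapshot L n) (i : Fin n) : Prop := ∀ z, s .pos z ↔ z (0 : Fin 1) = i

/-- Whether coherence has been violated in the represented configuration. -/
def Snapshot.bad (s : Snapshot L n) : Prop := s .bad (Fin.elim0 : Fin 0 → Fin n)

/-- The summary in the represented configuration. -/
def Snapshot.summ (s : Snapshot L n) : Summ L (Fin n) where
  E i j := s .E (![i, j] : Fin 2 → Fin n)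
  K f M u v a b := s (.K f M) (Fin.append (Fin.append u v) ![a, b] : Fin (f.1 + f.1 + 2) → Fin n)
  C f z := s (.C f) z
  D v := s .D (![v] : Fin 1 → Fin n)

/-- The structure that represents a configuration. -/
def Config.code (c : Config L (Fin n)) : Snapshot L n
  | .pos => fun z : Fin 1 → Fin n => z 0 = c.pos
  | .bad => fun _ => c.bad
  | .E => fun z : Fin 2 → Fin n => c.S.E (z 0) (z 1)
  | .K f M => fun z : Fin (f.1 + f.1 + 2) → Fin n =>
      c.S.K f M (fun i => z (Fin.castAdd 2 (Fin.castAdd f.1 i)))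
        (fun i => z (Fin.castAdd 2 (Fin.natAdd f.1 i))) (z (Fin.natAdd (f.1 + f.1) 0))
        (z (Fin.natAdd (f.1 + f.1) 1))
  | .C f => fun z : Fin f.1 → Fin n => c.S.C f z
  | .D => fun z : Fin 1 → Fin n => c.S.D (z 0)

/-- The structure `s` represents the configuration `c`. -/
def Codes (s : Snapshot L n) (c : Config L (Fin n)) : Prop :=
  s.IsPos c.pos ∧ (s.bad ↔ c.bad) ∧ s.summ = c.S

theorem codes_code (c : Config L (Fin n)) : Codes c.code c := by
  refine ⟨fun z => Iff.rfl, Iff.rfl, ?_⟩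
  ext
  · exact Iff.rfl
  · simp only [Snapshot.summ, Config.code, Fin.append_left, Fin.append_right]
    exact Iff.rfl
  · exact Iff.rfl
  · exact Iff.rfl

theorem Codes.unique {s : Snapshot L n} {c c' : Config L (Fin n)} (h : Codes s c)
    (h' : Codes s c') : c = c' := by
  obtain ⟨i, b, S⟩ := c
  obtain ⟨i', b', S'⟩ := c'
  have h1 : i = i' := (h'.1 (fun _ => i)).1 ((h.1 (fun _ => i)).2 rfl)
  have h2 : b = b' := propext (h.2.1.symm.trans h'.2.1)
  have h3 : S = S' := h.2.2.symm.trans h'.2.2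
  rw [h1, h2, h3]

/-- The relation between structures that represents the relation `R` between configurations. -/
def CodeRel (R : Config L (Fin n) → Config L (Fin n) → Prop) (s s' : Snapshot L n) : Prop :=
  ∃ i j, s.IsPos i ∧ s'.IsPos j ∧ R ⟨i, s.bad, s.summ⟩ ⟨j, s'.bad, s'.summ⟩

theorem codeRel_iff {R : Config L (Fin n) → Config L (Fin n) → Prop} {s s' : Snapshot L n} :
    CodeRel R s s' ↔ ∃ c c', Codes s c ∧ Codes s' c' ∧ R c c' := by
  constructor
  · rintro ⟨i, j, h1, h2, h⟩
    exact ⟨_, _, ⟨h1, Iff.rfl, rfl⟩, ⟨h2, Iff.rfl, rfl⟩, h⟩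
  · rintro ⟨c, c', h1, h2, h⟩
    have e1 := h1.unique (c' := ⟨c.pos, s.bad, s.summ⟩) ⟨h1.1, Iff.rfl, rfl⟩
    have e2 := h2.unique (c' := ⟨c'.pos, s'.bad, s'.summ⟩) ⟨h2.1, Iff.rfl, rfl⟩
    exact ⟨c.pos, c'.pos, h1.1, h2.1, e1 ▸ e2 ▸ h⟩

theorem reaches_iff_code {R : Config L (Fin n) → Config L (Fin n) → Prop} {s : Snapshot L n}
    {c c' : Config L (Fin n)} (hs : Codes s c) : Relation.ReflTransGen R c c' ↔
      ∃ s', Codes s' c' ∧ Relation.ReflTransGen (CodeRel R) s s' := by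
  constructor
  · intro h
    induction h with
    | refl => exact ⟨s, hs, .refl⟩
    | @tail c₁ c₂ _ h ih =>
      obtain ⟨s₁, h1, h2⟩ := ih
      exact ⟨_, codes_code c₂, h2.tail (codeRel_iff.2 ⟨_, _, h1, codes_code c₂, h⟩)⟩
  · rintro ⟨s', hs', h⟩
    induction h generalizing c' with
    | refl => rw [hs.unique hs']
    | tail _ h ih =>
      obtain ⟨c₁, c₂, h1, h2, h⟩ := codeRel_iff.1 h
      rw [← h2.unique hs']
      exact (ih h1).tail h

end

section

variable {L : FirstOrder.Language.{0, 0}}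

theorem exists_letter_iff {I : Type} {P : Option (Letter L I) → Prop} : (∃ a, P a) ↔ P none ∨
    (∃ x y, P (some (.copy x y))) ∨
    (∃ f : Σ n, L.Functions n, ∃ x z, P (some (.app x f.2 z))) ∨
    ∃ b x y, P (some (.assume (condOf b x y))) := by
  constructor
  · rintro ⟨_ | (⟨x, y⟩ | ⟨x, f, z⟩ | c), h⟩
    · exact Or.inl h
    · exact Or.inr (Or.inl ⟨x, y, h⟩)
    · exact Or.inr (Or.inr (Or.inl ⟨⟨_, f⟩, x, z, h⟩))
    · obtain ⟨b, x, y, rfl⟩ := exists_condOf c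
      exact Or.inr (Or.inr (Or.inr ⟨b, x, y, h⟩))
  · rintro (h | ⟨x, y, h⟩ | ⟨f, x, z, h⟩ | ⟨b, x, y, h⟩) <;> exact ⟨_, h⟩

variable {Γ : List (Token L) → Type} [Ctx Γ]

theorem PSumm.init {N : ∀ w, Γ w → Fin w.length → Fin w.length → Prop}
    (hN : PS fun w (p : (Γ w × Fin w.length) × Fin w.length) => N w p.1.1 p.1.2 p.2) :
    PSumm fun w a => Summ.init (L := L) (N w a) where
  defE := hN
  defK _ _ := .const False
  defC _ := .const False
  defD := .const False

variable [Finite (Σ n, L.Functions n)] {s s' : ∀ w, Γ w → Snapshot L w.length}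

theorem PSumm.summ (hs : RegOf (τ := fun w => Snapshot L w.length) s) :
    PSumm fun w a => (s w a).summ where
  defE := .rel hs.fst.fst .E (z := fun w p => (![p.1.2, p.2] : Fin 2 → Fin w.length))
    (RegOf.snd.fst.pair RegOf.snd)
  defK f M := by
    refine .rel hs.fst.fst.fst.fst (.K f M) (z := fun w p =>
      (Fin.append (Fin.append p.1.1.1.2 p.1.1.2) ![p.1.2, p.2] :
        Fin (f.1 + f.1 + 2) → Fin w.length))
      (.tuple fun i => ?_)
    refine Fin.addCases (fun i => ?_) (fun i => ?_) i
    · refine Fin.addCases (fun i => ?_) (fun i => ?_) i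
      · simpa only [Fin.append_left] using
          RegOf.app (RegOf.snd (τ := fun w => Fin f.1 → Fin w.length)).fst.fst.fst i
      · simpa only [Fin.append_left, Fin.append_right] using
          RegOf.app (RegOf.snd (τ := fun w => Fin f.1 → Fin w.length)).fst.fst i
    · simpa only [Fin.append_right] using RegOf.app (RegOf.snd.fst.pair RegOf.snd) i
  defC f := .rel hs.fst (.C f) (RegOf.snd (τ := fun w => Fin f.1 → Fin w.length))
  defD := .rel hs.fst .D (z := fun w p => (![p.2] : Fin 1 → Fin w.length)) (.tuple fun i => by
    obtain rfl : i = 0 := Subsingleton.elim _ _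
    exact RegOf.snd)

theorem PS.isPos (hs : RegOf (τ := fun w => Snapshot L w.length) s) {i : ∀ w, Γ w → Fin w.length}
    (hi : RegOf (τ := fun w => Fin w.length) i) : PS fun w a => (s w a).IsPos (i w a) :=
  .allTuple (n := 1) (R := fun w a z => s w a .pos z ↔ z (0 : Fin 1) = i w a)
    (.iff (.rel hs.fst .pos RegOf.snd) (.eqFin (RegOf.app RegOf.snd 0) hi.fst))

theorem PS.codeBad (hs : RegOf (τ := fun w => Snapshot L w.length) s) : PS fun w a => (s w a).bad :=
  .rel hs .bad (z := fun w _ => (Fin.elim0 : Fin 0 → Fin w.length)) (.tuple fun i => i.elim0)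

variable {S S' : ∀ w, Γ w → Summ L (Fin w.length)} {d x y : ∀ w, Γ w → Fin w.length}

omit [Finite (Σ n, L.Functions n)] in
theorem redirect_df (hd : RegOf (τ := fun w => Fin w.length) d)
    (hx : RegOf (τ := fun w => Fin w.length) x) (hy : RegOf (τ := fun w => Fin w.length) y) :
    DF fun w (p : Γ w × Fin w.length) =>
      redirect (SameVar w (d w p.1)) (x w p.1) (y w p.1) p.2 := by
  refine PS.congr (.or (.and (.sameVar hd.fst.fst RegOf.snd.fst hx.fst.fst)
    (.eqFin RegOf.snd hy.fst.fst)) (.and (.not (.sameVar hd.fst.fst RegOf.snd.fst hx.fst.fst))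
    (.eqFin RegOf.snd RegOf.snd.fst))) fun w p => ?_
  change p.2 = redirect _ _ _ _ ↔ _
  unfold redirect
  split_ifs with h <;> simp [h]

omit [Finite (Σ n, L.Functions n)] in
theorem PS.trans_some {b b' : ∀ w, Γ w → Prop} (hb : PS b) (hb' : PS b')
    {N : ∀ w, Γ w → Fin w.length → Fin w.length → Prop}
    {a : ∀ w, Γ w → Letter L (Fin w.length)} (hbad : PS fun w p => (S w p).Bad (a w p))
    (hnext : PS fun w p => (S w p).Next (N w p) (a w p) (S' w p)) :
    PS fun w p => Trans (N w p) (b w p) (S w p) (some (a w p)) (b' w p) (S' w p) :=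
  .or (.and hb hb') (.and hb.not (.or (.and hbad hb') (.and hbad.not (.and hb'.not hnext))))

omit [Finite (Σ n, L.Functions n)] in
theorem PS.bad_assume (hS : PSumm S) (c : Bool) (hx : DF x) (hy : DF y) :
    PS fun w a => (S w a).Bad (.assume (condOf c (x w a) (y w a))) := by
  cases c with
  | false => exact .const False
  | true => exact .or (hS.d hx) (hS.d hy)

theorem PS.next_copy (hS : PSumm S) (hS' : PSumm S')
    (hd : RegOf (τ := fun w => Fin w.length) d)
    (hx : RegOf (τ := fun w => Fin w.length) x) (hy : RegOf (τ := fun w => Fin w.length) y) :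
    PS fun w a => (S w a).Next (SameVar w (d w a)) (.copy (x w a) (y w a)) (S' w a) :=
  hS'.eq (hS.copy (redirect_df hd hx hy))

theorem PS.next_app (hS : PSumm S) (hS' : PSumm S')
    (hd : RegOf (τ := fun w => Fin w.length) d)
    (hx : RegOf (τ := fun w => Fin w.length) x) (f : Σ n, L.Functions n)
    {z : ∀ w, Γ w → Fin f.1 → Fin w.length}
    (hz : RegOf (τ := fun w => Fin f.1 → Fin w.length) z) :
    PS fun w a => (S w a).Next (SameVar w (d w a)) (.app (x w a) f.2 (z w a)) (S' w a) :=
  .or (.exFin (.and (hS.fst.holds (fun i => (hz.app i).df.comp RegMap.id.fst) RegOf.snd.df)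
      (hS'.fst.eq (hS.fst.copy (redirect_df hd.fst hx.fst RegOf.snd)))))
    (.and (.not (hS.c fun i => (hz.app i).df))
      (hS'.eq (hS.fresh (.sameVar hd.fst RegOf.snd hx.fst) hz)))

theorem PS.next_assume (hS : PSumm S) (hS' : PSumm S') (c : Bool)
    (hx : RegOf (τ := fun w => Fin w.length) x) (hy : RegOf (τ := fun w => Fin w.length) y) :
    PS fun w a => (S w a).Next (SameVar w (d w a)) (.assume (condOf c (x w a) (y w a)))
      (S' w a) := by
  cases c with
  | false => exact hS'.eq hS
  | true => exact hS'.eq (hS.assume hx hy)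

theorem PS.step {b b' : ∀ w, Γ w → Prop} (hb : PS b) (hb' : PS b') (hS : PSumm S)
    (hS' : PSumm S') (hd : RegOf (τ := fun w => Fin w.length) d)
    (hx : RegOf (τ := fun w => Fin w.length) x) (hy : RegOf (τ := fun w => Fin w.length) y) :
    PS fun w a => Step w (d w a) ⟨x w a, b w a, S w a⟩ ⟨y w a, b' w a, S' w a⟩ := by
  refine PS.congr (.or (.and (.edgeAt_none hd hx hy)
      (.or (.and hb hb') (.and hb.not (.and hb'.not (hS'.eq hS))))) <|
    .or (.exFin (.exFin (.and
      (.edgeAt_copy hd.fst.fst hx.fst.fst RegOf.snd.fst RegOf.snd hy.fst.fst)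
      (.trans_some hb.fst.fst hb'.fst.fst (.const False)
        (.next_copy hS.fst.fst hS'.fst.fst hd.fst.fst RegOf.snd.fst RegOf.snd))))) <|
    .or (.finite_ex fun f => .exFin (.exTuple (.and
      (.edgeAt_app hd.fst.fst hx.fst.fst RegOf.snd.fst f
        (RegOf.snd (τ := fun w => Fin f.1 → Fin w.length)) hy.fst.fst)
      (.trans_some hb.fst.fst hb'.fst.fst
        (.and (hS.fst.fst.c fun i =>
            (RegOf.app (RegOf.snd (τ := fun w => Fin f.1 → Fin w.length)) i).df)
          (.allFin (.not (hS.fst.fst.fst.holds (fun i =>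
            (RegOf.app (RegOf.snd (τ := fun w => Fin f.1 → Fin w.length)).fst i).df)
            RegOf.snd.df))))
        (.next_app hS.fst.fst hS'.fst.fst hd.fst.fst RegOf.snd.fst f
          (RegOf.snd (τ := fun w => Fin f.1 → Fin w.length))))))) <|
    .finite_ex fun c => .exFin (.exFin (.and
      (.edgeAt_assume hd.fst.fst hx.fst.fst c RegOf.snd.fst RegOf.snd hy.fst.fst)
      (.trans_some hb.fst.fst hb'.fst.fst
        (.bad_assume hS.fst.fst c RegOf.snd.fst.df RegOf.snd.df)
        (.next_assume (d := fun w p => d w p.1.1) hS.fst.fst hS'.fst.fst c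
          RegOf.snd.fst RegOf.snd))))) fun w a => exists_letter_iff

theorem PS.incoherent (hd : RegOf (τ := fun w => Fin w.length) d) :
    PS fun w a => Incoherent w (d w a) := by
  have hstep : PS fun w (p : (Γ w × Snapshot L w.length) × Snapshot L w.length) =>
      CodeRel (Step w (d w p.1.1)) p.1.2 p.2 :=
    .exFin (.exFin (.and (.isPos RegOf.snd.fst.fst.fst RegOf.snd.fst)
      (.and (.isPos RegOf.snd.fst.fst RegOf.snd)
      (.step (.codeBad RegOf.snd.fst.fst.fst) (.codeBad RegOf.snd.fst.fst)
        (.summ RegOf.snd.fst.fst.fst) (.summ RegOf.snd.fst.fst) hd.fst.fst.fst.fst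
        RegOf.snd.fst RegOf.snd))))
  have hreach := (PS.reachSt (ar := Tag.arity (L := L))
    (R := fun w a => CodeRel (Step w (d w a))) hstep).comp
    (Γ := fun w => ((Γ w × Fin w.length) × Snapshot L w.length) × Snapshot L w.length)
    ((RegMap.id.fst.fst.fst.prod RegOf.snd.fst).prod RegOf.snd)
  have hmain : PS fun w a => ∃ i : Fin w.length, (i : ℕ) = d w a + 1 ∧
      ∃ s s' : Snapshot L w.length,
        (s.IsPos i ∧ ¬ s.bad ∧ s.summ = Summ.init (SameVar w (d w a))) ∧
        (s'.IsPos (d w a) ∧ s'.bad) ∧ Relation.ReflTransGen (CodeRel (Step w (d w a))) s s' :=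
    .exFin (.and (.eq RegOf.snd.num (hd.fst.num.add (.const 1)))
      (.exSt (ar := Tag.arity (L := L)) (.exSt (ar := Tag.arity (L := L))
        (.and (.and (.isPos RegOf.snd.fst RegOf.snd.fst.fst)
          (.and (PS.codeBad RegOf.snd.fst).not ((PSumm.summ RegOf.snd.fst).eq
            (.init (.sameVar hd.fst.fst.fst.fst.fst RegOf.snd.fst RegOf.snd)))))
        (.and (.and (.isPos RegOf.snd hd.fst.fst.fst) (.codeBad RegOf.snd)) hreach)))))
  refine hmain.congr fun w a => ?_
  refine exists_congr fun i => and_congr_right fun _ => ?_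
  constructor
  · rintro ⟨S, h⟩
    have h0 := codes_code (L := L) ⟨i, False, Summ.init (SameVar w (d w a))⟩
    obtain ⟨s', h1, h2⟩ := (reaches_iff_code h0).1 h
    exact ⟨_, s', ⟨h0.1, h0.2.1.1, h0.2.2⟩, ⟨h1.1, h1.2.1.2 trivial⟩, h2⟩
  · rintro ⟨s, s', ⟨h1, h2, h3⟩, ⟨h4, h5⟩, h6⟩
    exact ⟨s'.summ, (reaches_iff_code (s := s) ⟨h1, iff_false_intro h2, h3⟩).2
      ⟨s', ⟨h4, iff_true_intro h5, rfl⟩, h6⟩⟩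

variable (L) in
theorem coherenceProblem_mem_PSPACE : coherenceProblem L ∈ PSPACE (Token L) := by
  refine mem_PSPACE_of_PS (PS.congr (.exFin (.and (.headerAt RegOf.snd) (.and
    (.exFin (.exFin (.and (.eq RegOf.snd.fst.num (RegOf.snd.fst.fst.num.add (.const 1)))
      (.and (.eq (RegOf.snd.num.add (.const 1)) .len)
      (.progAt RegOf.snd.fst.fst RegOf.snd.fst RegOf.snd)))))
    (.or (.eq RegOf.snd.num (.const 0)) (.not (.incoherent RegOf.snd))))))
    fun w _ => mem_coherenceProblem_iff)

end

end UninterpretedProgram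

theorem mainTheorem3 (L : FirstOrder.Language.{0, 0}) [Finite (Σ n, L.Functions n)] :
    UninterpretedProgram.coherenceProblem L ∈
      UninterpretedProgram.PSPACE (UninterpretedProgram.Token L) :=
  UninterpretedProgram.coherenceProblem_mem_PSPACE L
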